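/- Let $\Omega\subset\mathbb R^3$ be a bounded polyhedral domain (a nonempty connected set which is the interior of a finite union of compact convex polytopes), $T>0$, $J=(0,T)$; let $L,\alpha,\beta,b,\xi>0$, let $\Lambda\in C^1(\mathbb R)$ have range in a bounded interval $(H_{\inf},H_{\sup})$, let $g:\mathbb R^2\to\mathbb R$ be arbitrary, $f_0(p)=p(1-p)(p-\tfrac12)$, and $u_{\rm ini},p_{\rm ini}\in C^2(\overline\Omega)$. An *admissible mesh* $\Pi$ of $\Omega$ is a finite family of pairwise disjoint, nonempty, bounded, open convex polyhedra $K\subset\Omega$ (cells) with $\overline{\bigcup_{K} K}=\overline\Omega$, together with a finite family $\mathcal E$ of closed planar sets of positive area (faces) that overlap pairwise in sets of area zero, and with distinct points $x_K\in\overline K$, such that, with $\mathcal E_K=\{\sigma\in\mathcal E:\sigma\subset\partial K\}$: 1. $\partial K=\bigcup_{\sigma\in\mathcal E_K}\sigma$ for all $K$, and each face belongs to some $\mathcal E_K$; 2. for $K\neq L$, either $\overline K\cap\overline L$ has area zero or it is a face, denoted $K|L$; every face not contained in $\partial\Omega$ is of the form $K|L$; 3. if $\sigma=K|L$, the segment $\overline{x_Kx_L}$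 is orthogonal to $\sigma$; 4. if $\sigma\in\mathcal E_K$ and $\sigma\subset\partial\Omega$, then $x_K\notin\sigma$ and there is $y_\sigma\in\sigma$ such that the segment $\overline{x_Ky_\sigma}$ is orthogonal to $\sigma$. The norm $|\Pi|$ is the maximum over the cells $K$ of the infimum of the radii of balls containing $K$. A sequence $(\Pi_n)$ of admissible meshes is *normal* if $|\Pi_n|\to0$. For $w=(w_K)_{K\in\Pi}$ let $\mathcal S_\Pi w$ be the function on $\Omega$ equal to $w_K$ on each cell $K$, and let $F_K(w)=\sum_{\sigma\in\mathcal E_K}F_{K,\sigma}(w)$, where $F_{K,\sigma}(w)=-\frac{m(\sigma)}{|x_K-x_L|}(w_L-w_K)$ if $\sigma=K|L\not\subset\partial\Omega$, and $F_{K,\sigma}(w)=\frac{m(\sigma)}{|x_K-y_\sigma|}\,w_K$ if $\sigma\subset\partial\Omega$; $m$ denotes area or volume. Let $(\Pi_n)$ be a normal sequence of admissible meshes of $\Omega$. For each $n$ let $u_{\Pi_n}=(u_K)$, $p_{\Pi_n}=(p_K)$, $K\in\Pi_n$, be functions of time that are continuous on $[0,T)$, differentiable on $J$, and solve the semi-discrete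 scheme (with homogeneous Dirichlet boundary conditions): for all $K\in\Pi_n$ and $t\in J$, $$m(K)\dot u_K(t)+F_K(u_{\Pi_n}(t))=L\,m(K)\dot p_K(t),$$ $$\alpha\, m(K)\dot p_K(t)+F_K(p_{\Pi_n}(t))=\tfrac1{\xi^2}m(K)f_0(p_K(t))-\tfrac{b\beta}{\xi}m(K)\Lambda\big(g(u_K(t),p_K(t))\big),$$ $$u_K(0)=u_{\rm ini}(x_K),\qquad p_K(0)=p_{\rm ini}(x_K).$$ Then there are a strictly increasing sequence $(k_n)\subset\mathbb N$ and $u,p\in L^2(J;H_0^1(\Omega))$ such that $\mathcal S_{\Pi_{k_n}}u_{\Pi_{k_n}}\to u$ and $\mathcal S_{\Pi_{k_n}}p_{\Pi_{k_n}}\to p$ in $L^2(J;L^2(\Omega))$ and such that, for every $q\in C_0^\infty(\Omega)$, as $n\to\infty$, $$\sum_{K\in\Pi_{k_n}}q(x_K)\,F_K\big(p_{\Pi_{k_n}}(t)\big)\longrightarrow\int_\Omega\nabla p(t,x)\cdot\nabla q(x)\,dx,$$ $$\sum_{K\in\Pi_{k_n}}q(x_K)\,F_K\big(u_{\Pi_{k_n}}(t)\big)\longrightarrow\int_\Omega\nabla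 u(t,x)\cdot\nabla q(x)\,dx$$ in $L^2(J)$. -/

import Mathlib

open MeasureTheory Set Filter Topology

noncomputable section

namespace PhaseFieldFVM

/-- Euclidean three-space. -/
abbrev E3 : Type := EuclideanSpace ℝ (Fin 3)

/-- A bounded polyhedral domain: a nonempty connected set that is the interior of a finite union of
(compact) convex polytopes. Such a set is automatically open and bounded, and it lies on one side of
its boundary: `Ω = interior (closure Ω)`. -/
def IsPolyhedralDomain (Ω : Set E3) : Prop :=
  IsConnected Ω ∧
    ∃ (N : ℕ) (v : Fin N → Finset E3), Ω = interior (⋃ i, convexHull ℝ (v i : Set E3))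

/-- A nonempty, bounded, open, convex polyhedron: a finite intersection of open half-spaces. -/
def IsOpenConvexPolyhedron (K : Set E3) : Prop :=
  K.Nonempty ∧ Bornology.IsBounded K ∧
    ∃ (N : ℕ) (a : Fin N → E3) (c : Fin N → ℝ), K = {x | ∀ i, inner ℝ (a i) x < c i}

/-- The surface area (two-dimensional Lebesgue measure) of a set lying in a plane. The measure
`μHE[2]` is normalized so that it is the usual area on planes. -/
def area (s : Set E3) : ℝ := (Measure.euclideanHausdorffMeasure 2 : Measure E3).real s

/-- An admissible finite volume mesh of `Ω`: finitely many cells (finite volumes) with their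
significant points `center`, and finitely many faces. The faces are closed sets. -/
structure AdmissibleMesh (Ω : Set E3) where
  /-- number of cells -/
  numCells : ℕ
  /-- the cells `K` -/
  cell : Fin numCells → Set E3
  /-- number of faces -/
  numFaces : ℕ
  /-- the faces `σ` -/
  face : Fin numFaces → Set E3
  /-- the significant points `x_K` -/
  center : Fin numCells → E3
  /-- the points `y_σ` (relevant for the faces on the boundary of `Ω` only) -/
  foot : Fin numFaces → E3
  cell_polyhedron : ∀ K, IsOpenConvexPolyhedron (cell K)
  cell_subset : ∀ K, cell K ⊆ Ω
  cell_disjoint : ∀ K L, K ≠ L → Disjoint (cell K) (cell L)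
  closure_cells : closure (⋃ K, cell K) = closure Ω
  /-- faces are planar pieces of positive area -/
  face_closed : ∀ σ, IsClosed (face σ)
  face_planar : ∀ σ, ∃ (a : E3) (c : ℝ), a ≠ 0 ∧ face σ ⊆ {x | inner ℝ a x = c}
  face_pos : ∀ σ, 0 < area (face σ)
  /-- different faces do not overlap -/
  face_overlap : ∀ σ σ', σ ≠ σ' → area (face σ ∩ face σ') = 0
  /-- every face is a face of some cell -/
  face_of_cell : ∀ σ, ∃ K, face σ ⊆ frontier (cell K)
  /-- the boundary of a cell is the union of its faces -/
  frontier_cell : ∀ K, frontier (cell K) = ⋃ σ ∈ {σ | face σ ⊆ frontier (cell K)}, face σ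
  /-- two different cells meet in a set of zero area or in a common face -/
  cell_inter : ∀ K L, K ≠ L → area (closure (cell K) ∩ closure (cell L)) = 0 ∨
    ∃ σ, closure (cell K) ∩ closure (cell L) = face σ
  /-- a face that is not contained in the boundary of `Ω` is of the form `K|L` -/
  face_interior : ∀ σ, ¬ face σ ⊆ frontier Ω →
    ∃ K L, K ≠ L ∧ closure (cell K) ∩ closure (cell L) = face σ
  center_mem : ∀ K, center K ∈ closure (cell K)
  center_injective : Function.Injective center
  /-- the segment joining the significant points of two adjacent cells is orthogonal to their
  common face -/
  center_orthogonal : ∀ K L, K ≠ L → ∀ σ, closure (cell K) ∩ closure (cell L) = face σ →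
    ∀ y ∈ face σ, ∀ z ∈ face σ, inner ℝ (center K - center L) (y - z) = 0
  /-- for a boundary face `σ` of `K`, the point `x_K` is not on `σ`, and `y_σ` is a point of `σ` such
  that the segment from `x_K` to `y_σ` is orthogonal to `σ` -/
  center_boundary : ∀ K σ, face σ ⊆ frontier (cell K) → face σ ⊆ frontier Ω →
    center K ∉ face σ ∧ foot σ ∈ face σ ∧
      ∀ z ∈ face σ, inner ℝ (center K - foot σ) (z - foot σ) = 0

namespace AdmissibleMesh

variable {Ω : Set E3}

/-- Functions on the set of significant points, written as functions of the cell: `w K = w (x_K)`. -/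
abbrev MeshFun (M : AdmissibleMesh Ω) : Type := Fin M.numCells → ℝ

/-- The norm of the mesh: the largest radius, over the cells, of a smallest enclosing ball. -/
def meshNorm (M : AdmissibleMesh Ω) : ℝ :=
  ⨆ K, sInf {r : ℝ | 0 < r ∧ ∃ x₀ : E3, ∀ x ∈ M.cell K, ‖x - x₀‖ < r}

open Classical in
/-- The faces of the cell `K`. -/
def facesOf (M : AdmissibleMesh Ω) (K : Fin M.numCells) : Finset (Fin M.numFaces) :=
  Finset.univ.filter fun σ => M.face σ ⊆ frontier (M.cell K)

open Classical in
/-- The cells `L` with `σ = K|L`. For an interior face `σ` of `K` there is exactly one. -/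
def neighbors (M : AdmissibleMesh Ω) (K : Fin M.numCells) (σ : Fin M.numFaces) :
    Finset (Fin M.numCells) :=
  Finset.univ.filter fun L => L ≠ K ∧ closure (M.cell K) ∩ closure (M.cell L) = M.face σ

open Classical in
/-- The numerical flux `F_{K,σ}(w, w_∂)` through the face `σ` of `K`: it is `-τ_σ (w_L - w_K)` with
`τ_σ = m(σ) / |x_K - x_L|` if `σ = K|L` is interior, and `-τ_σ (w_∂(y_σ) - w_K)` with
`τ_σ = m(σ) / |x_K - y_σ|` if `σ` lies on the boundary of `Ω`. -/
def fluxFace (M : AdmissibleMesh Ω) (w : M.MeshFun) (wb : E3 → ℝ) (K : Fin M.numCells)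
    (σ : Fin M.numFaces) : ℝ :=
  if M.face σ ⊆ frontier Ω then
    -(area (M.face σ) / dist (M.center K) (M.foot σ)) * (wb (M.foot σ) - w K)
  else
    ∑ L ∈ M.neighbors K σ,
      -(area (M.face σ) / dist (M.center K) (M.center L)) * (w L - w K)

/-- The total flux `F_K(w, w_∂)`. -/
def fluxCell (M : AdmissibleMesh Ω) (w : M.MeshFun) (wb : E3 → ℝ) (K : Fin M.numCells) : ℝ :=
  ∑ σ ∈ M.facesOf K, M.fluxFace w wb K σ

/-- The total flux `F_K(w) = F_K(w, 0)` for homogeneous Dirichlet boundary conditions. -/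
def flux (M : AdmissibleMesh Ω) (w : M.MeshFun) (K : Fin M.numCells) : ℝ :=
  M.fluxCell w (fun _ => 0) K

/-- The piecewise constant interpolation `S w`, equal to `w K` on each cell `K`. -/
def interpFun (M : AdmissibleMesh Ω) (w : M.MeshFun) (x : E3) : ℝ :=
  ∑ K, (M.cell K).indicator (fun _ => w K) x

theorem measurableSet_cell (M : AdmissibleMesh Ω) (K : Fin M.numCells) :
    MeasurableSet (M.cell K) := by
  obtain ⟨-, -, N, a, c, h⟩ := M.cell_polyhedron K
  rw [h, ofPred_forall]
  exact MeasurableSet.iInter fun i =>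
    (isOpen_lt (continuous_const.inner continuous_id) continuous_const).measurableSet

theorem memLp_interpFun (M : AdmissibleMesh Ω) (w : M.MeshFun) :
    MemLp (M.interpFun w) 2 (volume.restrict Ω) := by
  refine memLp_finsetSum _ fun K _ => ?_
  refine memLp_indicator_const 2 (M.measurableSet_cell K) (w K) (Or.inr ?_)
  exact ((Measure.restrict_apply_le _ _).trans_lt
    (M.cell_polyhedron K).2.1.measure_lt_top).ne

/-- The piecewise constant interpolation as an element of `L²(Ω)`. -/
def interp (M : AdmissibleMesh Ω) (w : M.MeshFun) : Lp ℝ 2 (volume.restrict Ω) :=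
  (M.memLp_interpFun w).toLp

end AdmissibleMesh

/-- A normal sequence of admissible meshes: the mesh norms tend to zero. -/
def IsNormalSeq {Ω : Set E3} (M : ℕ → AdmissibleMesh Ω) : Prop :=
  Tendsto (fun n => (M n).meshNorm) atTop (𝓝 0)

/-- The function `f₀(p) = p (1 - p) (p - 1/2)`. -/
def f₀ (p : ℝ) : ℝ := p * (1 - p) * (p - 1 / 2)

/-- `(u, p)` is a solution on `(0, T)` of the semi-discrete finite volume scheme on the mesh `M`,
with homogeneous Dirichlet boundary conditions and initial data `uIni`, `pIni`. -/
structure IsSchemeSolution {Ω : Set E3} (M : AdmissibleMesh Ω) (T L α β b ξ : ℝ)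
    (Λ : ℝ → ℝ) (g : ℝ → ℝ → ℝ) (uIni pIni : E3 → ℝ) (u p : ℝ → M.MeshFun) : Prop where
  continuousOn_u : ∀ K, ContinuousOn (fun t => u t K) (Ico 0 T)
  continuousOn_p : ∀ K, ContinuousOn (fun t => p t K) (Ico 0 T)
  differentiable_u : ∀ K, ∀ t ∈ Ioo 0 T, DifferentiableAt ℝ (fun s => u s K) t
  differentiable_p : ∀ K, ∀ t ∈ Ioo 0 T, DifferentiableAt ℝ (fun s => p s K) t
  heat : ∀ K, ∀ t ∈ Ioo 0 T,
    volume.real (M.cell K) * deriv (fun s => u s K) t + M.flux (u t) K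
      = L * volume.real (M.cell K) * deriv (fun s => p s K) t
  phase : ∀ K, ∀ t ∈ Ioo 0 T,
    α * volume.real (M.cell K) * deriv (fun s => p s K) t + M.flux (p t) K
      = 1 / ξ ^ 2 * (volume.real (M.cell K) * f₀ (p t K))
        - b * β / ξ * (volume.real (M.cell K) * Λ (g (u t K) (p t K)))
  init_u : ∀ K, u 0 K = uIni (M.center K)
  init_p : ∀ K, p 0 K = pIni (M.center K)

/-- Test functions: `q ∈ C_0^∞(Ω)`. -/
def IsTestFunction (Ω : Set E3) (q : E3 → ℝ) : Prop :=
  ContDiff ℝ ((⊤ : ℕ∞) : WithTop ℕ∞) q ∧ HasCompactSupport q ∧ tsupport q ⊆ Ω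

/-- The ambient Hilbert space `L²(Ω) × L²(Ω; ℝ³)` of pairs (function, gradient), with norm
`(‖v‖² + ‖G‖²)^{1/2}`. -/
abbrev PairSpace (Ω : Set E3) : Type :=
  WithLp 2 (Lp ℝ 2 (volume.restrict Ω : Measure E3) × Lp E3 2 (volume.restrict Ω : Measure E3))

/-- The Sobolev space `H_0^1(Ω)`, the closure of `C_0^∞(Ω)` in the norm of `H^1(Ω)`. An element is
represented by the pair of the function and its weak gradient. -/
def H10 (Ω : Set E3) : Submodule ℝ (PairSpace Ω) :=
  (Submodule.span ℝ {z : PairSpace Ω | ∃ q : E3 → ℝ, IsTestFunction Ω q ∧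
    z.fst =ᵐ[volume.restrict Ω] q ∧ z.snd =ᵐ[volume.restrict Ω] gradient q}).topologicalClosure

namespace H10

/-- The `L²` function underlying an element of `H_0^1(Ω)`. -/
def val {Ω : Set E3} (v : H10 Ω) : Lp ℝ 2 (volume.restrict Ω : Measure E3) := (v : PairSpace Ω).fst

/-- The weak gradient of an element of `H_0^1(Ω)`. -/
def grad {Ω : Set E3} (v : H10 Ω) : Lp E3 2 (volume.restrict Ω : Measure E3) :=
  (v : PairSpace Ω).snd

end H10

/-- Lebesgue measure on the time interval `J = (0, T)`. -/
abbrev timeMeasure (T : ℝ) : Measure ℝ := volume.restrict (Ioo 0 T)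

/-- Convergence `f n → fLim` in `L²(J; F)`, `J = (0, T)`. It includes that all these functions belong
to this space. -/
def TendstoL2 {F : Type*} [NormedAddCommGroup F] (T : ℝ) (f : ℕ → ℝ → F) (fLim : ℝ → F) : Prop :=
  (∀ n, MemLp (f n) 2 (timeMeasure T)) ∧ MemLp fLim 2 (timeMeasure T) ∧
    Tendsto (fun n => eLpNorm (fun t => f n t - fLim t) 2 (timeMeasure T)) atTop (𝓝 0)

end PhaseFieldFVM

end

open MeasureTheory Set Filter Topology

noncomputable section

namespace PhaseFieldFVM

section

/-! ### Coordinates adapted to one axis, and surface measure on a graph -/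

/-! The proof is compactness by energy estimates. Orthogonality of the meshes is essential, but no
bound on the shape of the cells is used.

Geometry. The divergence theorem holds on each cell in terms of its faces
(`integral_fderiv_eq_sum_faces`), and an interior face belongs to exactly two cells, with opposite
normals. Summation over pairs of a cell and a face thus gives a discrete integration by parts
(`sum_mul_eq_sum_jump`), and the fluxes come from a symmetric nonnegative form in the jumps. By
orthogonality the vector from `x_K` to the point across a face is exactly `d_σ` times the unit
normal. So difference quotients approximate normal derivatives (`flux_consistency`), and the heights
of the centres over the faces satisfy `∑ h_{K,σ} m(σ) = 3 m(K)`.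

A priori bounds. A truncation argument bounds `p` uniformly (`abs_p_le`). Testing the heat equation
with `u - L p` and the phase equation with a multiple of `p` bounds `u` and `p` in `L²(Ω)`,
uniformly in time, and their discrete Dirichlet energies in `L¹(J)` (`energy_estimate`). The
reaction enters only through its size, so `g` plays no role. The equations tested with `q(x_K)` make
the means of `u` and `p` against `q` equicontinuous in time (`equicontinuous_u`,
`equicontinuous_p`).

Strong compactness. An Arzelà–Ascoli argument yields a subsequence that converges weakly in `L²(Ω)`
at every time (`exists_subseq_weak`). In space, the energy and the `L²` norm control the total
variation of `z |z|` (`tv_mul_abs_le`), and hence the `L²` modulus of translation of `z`. On a grid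
of cubes of side `δ`, an `L²` norm is bounded by translations plus finitely many averages; the
averages converge weakly, and `δ → 0` gives a Cauchy sequence in `L²(J; L²(Ω))`
(`tendsto_integral_sub_sq`).

The limit. At almost every time the energies stay bounded along some subsequence, by Fatou's lemma,
and so the limit extended by zero has a square integrable weak gradient on the whole space. That
this implies membership in `H_0^1(Ω)` is where the polyhedral shape matters (`exists_mem_H10`): the
complement of `Ω` is a finite union of convex sets with interior points, and contraction towards
such a point gives a Poincaré inequality near the boundary that controls a cutoff of the mollified
function. A Borel left inverse of the embedding into `L²(Ω)` makes the lift measurable in time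
(`exists_lift_H10`). Finally, consistency turns the flux sums into minus the integral against `Δq`,
which is the gradient pairing after integration by parts (`tendstoL2_sum_mul_flux`,
`integral_inner_grad`). -/

/-- The point with `i`-th coordinate `t` and the remaining coordinates `y`. -/
def ins (i : Fin 3) (t : ℝ) (y : Fin 2 → ℝ) : E3 := WithLp.toLp 2 (i.insertNth (α := fun _ => ℝ) t y)

@[simp] theorem ins_same (i : Fin 3) (t : ℝ) (y : Fin 2 → ℝ) : ins i t y i = t := by
  simp [ins]

@[simp] theorem ins_succAbove (i : Fin 3) (t : ℝ) (y : Fin 2 → ℝ) (j : Fin 2) :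
    ins i t y (i.succAbove j) = y j := by
  simp [ins]

theorem ins_eta (i : Fin 3) (x : E3) : ins i (x i) (fun j => x (i.succAbove j)) = x := by
  ext k
  rcases Fin.eq_self_or_eq_succAbove i k with rfl | ⟨j, rfl⟩ <;> simp

theorem inner_ins (i : Fin 3) (n : E3) (t : ℝ) (y : Fin 2 → ℝ) :
    inner ℝ n (ins i t y) = n i * t + ∑ j, n (i.succAbove j) * y j := by
  simp only [PiLp.inner_apply, RCLike.inner_apply, conj_trivial]
  rw [Fin.sum_univ_succAbove _ i]
  simp [mul_comm]

theorem norm_sq_eq_succAbove (i : Fin 3) (n : E3) :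
    ‖n‖ ^ 2 = n i ^ 2 + ∑ j, n (i.succAbove j) ^ 2 := by
  rw [EuclideanSpace.norm_sq_eq, Fin.sum_univ_succAbove _ i]
  simp

theorem ins_eq_add_smul (i : Fin 3) (t : ℝ) (y : Fin 2 → ℝ) :
    ins i t y = ins i 0 y + t • EuclideanSpace.single i (1 : ℝ) := by
  ext k
  rcases Fin.eq_self_or_eq_succAbove i k with rfl | ⟨j, rfl⟩ <;> simp

theorem continuous_ins (i : Fin 3) : Continuous fun p : ℝ × (Fin 2 → ℝ) => ins i p.1 p.2 := by
  refine (PiLp.continuous_toLp 2 _).comp ?_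
  exact Continuous.finInsertNth i continuous_fst continuous_snd

theorem measurePreserving_ins (i : Fin 3) :
    MeasurePreserving (fun p : ℝ × (Fin 2 → ℝ) => ins i p.1 p.2) := by
  have h1 := (volume_preserving_piFinSuccAbove (fun _ : Fin 3 => ℝ) i).symm
  have h2 := (PiLp.volume_preserving_toLp (Fin 3)).comp h1
  exact h2

theorem measurableEmbedding_ins (i : Fin 3) :
    MeasurableEmbedding (fun p : ℝ × (Fin 2 → ℝ) => ins i p.1 p.2) := by
  have h1 := (MeasurableEquiv.piFinSuccAbove (fun _ : Fin 3 => ℝ) i).symm.measurableEmbedding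
  have h2 := (MeasurableEquiv.toLp 2 (Fin 3 → ℝ)).measurableEmbedding.comp h1
  exact h2

/-- Parametrization of the plane `⟪n, x⟫ = c` by the coordinates other than the `i`-th. -/
def planeGraph (i : Fin 3) (n : E3) (c : ℝ) (y : Fin 2 → ℝ) : E3 :=
  ins i ((c - ∑ j, n (i.succAbove j) * y j) / n i) y

theorem inner_planeGraph {i : Fin 3} {n : E3} (hn : n i ≠ 0) (c : ℝ) (y : Fin 2 → ℝ) :
    inner ℝ n (planeGraph i n c y) = c := by
  rw [planeGraph, inner_ins]; field_simp; ring

theorem ins_eq_planeGraph {i : Fin 3} {n : E3} (hn : n i ≠ 0) {c t : ℝ} {y : Fin 2 → ℝ}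
    (h : inner ℝ n (ins i t y) = c) : ins i t y = planeGraph i n c y := by
  rw [inner_ins] at h
  rw [planeGraph]; congr 1; field_simp; linarith

theorem continuous_planeGraph (i : Fin 3) (n : E3) (c : ℝ) : Continuous (planeGraph i n c) := by
  refine (continuous_ins i).comp (Continuous.prodMk ?_ continuous_id)
  fun_prop

theorem injective_planeGraph (i : Fin 3) (n : E3) (c : ℝ) :
    Function.Injective (planeGraph i n c) := by
  intro y z h
  funext j
  have := congrArg (fun x : E3 => x (i.succAbove j)) h
  simpa [planeGraph] using this

theorem measurableEmbedding_planeGraph (i : Fin 3) (n : E3) (c : ℝ) :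
    MeasurableEmbedding (planeGraph i n c) :=
  (continuous_planeGraph i n c).measurableEmbedding (injective_planeGraph i n c)

/-- The linear part of `planeGraph`. -/
def planeGraphLin (i : Fin 3) (n : E3) : EuclideanSpace ℝ (Fin 2) →ₗ[ℝ] E3 where
  toFun y := planeGraph i n 0 y
  map_add' y z := by
    ext k
    rcases Fin.eq_self_or_eq_succAbove i k with rfl | ⟨j, rfl⟩
    · simp [planeGraph]; ring
    · simp [planeGraph]
  map_smul' a y := by
    ext k
    rcases Fin.eq_self_or_eq_succAbove i k with rfl | ⟨j, rfl⟩
    · simp [planeGraph]; ring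
    · simp [planeGraph]

/-- The columns of the parametrization are `e_j - (n_j / n_i) e_i`. Their Gram determinant is one
plus the sum of the `n_j² / n_i²`, which is `1 / n_i²` because `n` is a unit vector. -/
theorem normDet_planeGraphLin {i : Fin 3} {n : E3} (hn : n i ≠ 0) (h1 : ‖n‖ = 1) :
    (planeGraphLin i n).normDet = |n i|⁻¹ := by
  have h := (planeGraphLin i n).normDet_sq_eq_det_gram (EuclideanSpace.basisFun (Fin 2) ℝ)
  have hsq := norm_sq_eq_succAbove i n
  rw [h1, Fin.sum_univ_two] at hsq
  rw [Matrix.det_fin_two] at h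
  simp only [Matrix.gram, Matrix.of_apply, EuclideanSpace.basisFun_apply, planeGraphLin,
    LinearMap.coe_mk, AddHom.coe_mk] at h
  have key : (planeGraphLin i n).normDet ^ 2 = (|n i|⁻¹) ^ 2 := by
    rw [inv_pow, sq_abs]
    refine Eq.trans h ?_
    simp only [planeGraph, inner_ins]
    simp
    field_simp
    linear_combination (-(n i) ^ 2) * hsq
  exact (sq_eq_sq₀ (LinearMap.normDet_nonneg _) (by positivity)).1 key

theorem planeGraph_eq_add (i : Fin 3) (n : E3) (c : ℝ) (y : EuclideanSpace ℝ (Fin 2)) :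
    planeGraph i n c y = ins i (c / n i) 0 + planeGraphLin i n y := by
  ext k
  rcases Fin.eq_self_or_eq_succAbove i k with rfl | ⟨j, rfl⟩
  · simp [planeGraph, planeGraphLin]; ring
  · simp [planeGraph, planeGraphLin]

theorem surface_image_planeGraph {i : Fin 3} {n : E3} (hn : n i ≠ 0) (h1 : ‖n‖ = 1) (c : ℝ)
    (A : Set (Fin 2 → ℝ)) :
    (Measure.euclideanHausdorffMeasure 2 : Measure E3) (planeGraph i n c '' A)
      = ENNReal.ofReal |n i|⁻¹ * volume A := by
  have himg : planeGraph i n c '' A =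
      (fun x => ins i (c / n i) 0 + x) '' (planeGraphLin i n '' (WithLp.toLp 2 '' A)) := by
    simp only [image_image]
    refine image_congr fun y _ => ?_
    exact planeGraph_eq_add i n c (WithLp.toLp 2 y)
  rw [himg, (isometry_add_left _).euclideanHausdorffMeasure_image]
  have h2 := (planeGraphLin i n).euclideanHausdorffMeasure_image_eq_normDet_mul_volume
    (WithLp.toLp 2 '' A)
  rw [finrank_euclideanSpace_fin] at h2
  rw [h2, normDet_planeGraphLin hn h1]
  congr 1
  have h3 := (PiLp.volume_preserving_toLp (Fin 2)).measure_preimage_emb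
    (MeasurableEquiv.toLp 2 (Fin 2 → ℝ)).measurableEmbedding (WithLp.toLp 2 '' A)
  rw [← h3, preimage_image_eq _ (WithLp.toLp_injective 2)]

theorem surface_restrict_plane {i : Fin 3} {n : E3} (hn : n i ≠ 0) (h1 : ‖n‖ = 1) (c : ℝ) :
    (Measure.euclideanHausdorffMeasure 2 : Measure E3).restrict {x | inner ℝ n x = c}
      = ENNReal.ofReal |n i|⁻¹ • Measure.map (planeGraph i n c) volume := by
  ext s hs
  rw [Measure.restrict_apply hs, Measure.smul_apply,
    (measurableEmbedding_planeGraph i n c).map_apply, smul_eq_mul,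
    ← surface_image_planeGraph hn h1 c]
  congr 1
  ext x
  constructor
  · rintro ⟨hx, hx'⟩
    have := ins_eq_planeGraph hn (c := c) (t := x i) (y := fun j => x (i.succAbove j))
      (by rw [ins_eta]; exact hx')
    rw [ins_eta] at this
    exact ⟨_, by rw [mem_preimage, ← this]; exact hx, this.symm⟩
  · rintro ⟨y, hy, rfl⟩
    exact ⟨hy, inner_planeGraph hn c y⟩

theorem setIntegral_plane {i : Fin 3} {n : E3} (hn : n i ≠ 0) (h1 : ‖n‖ = 1) {c : ℝ}
    {F : Set E3} (hF : MeasurableSet F) (hFc : F ⊆ {x | inner ℝ n x = c}) (φ : E3 → ℝ) :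
    |n i| * ∫ x in F, φ x ∂(Measure.euclideanHausdorffMeasure 2 : Measure E3)
      = ∫ y in planeGraph i n c ⁻¹' F, φ (planeGraph i n c y) := by
  have h : (Measure.euclideanHausdorffMeasure 2 : Measure E3).restrict F
      = (ENNReal.ofReal |n i|⁻¹ • Measure.map (planeGraph i n c) volume).restrict F := by
    rw [← surface_restrict_plane hn h1, Measure.restrict_restrict hF, inter_eq_left.2 hFc]
  rw [h, Measure.restrict_smul, integral_smul_measure,
    (measurableEmbedding_planeGraph i n c).setIntegral_map, ENNReal.toReal_ofReal (by positivity),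
    smul_eq_mul, mul_inv_cancel_left₀ (abs_pos.2 hn).ne']

theorem volume_preimage_planeGraph {i : Fin 3} {n : E3} (hn : n i ≠ 0) (h1 : ‖n‖ = 1) {c : ℝ}
    {F : Set E3} (hFc : F ⊆ {x | inner ℝ n x = c}) :
    volume (planeGraph i n c ⁻¹' F)
      = ENNReal.ofReal |n i| * (Measure.euclideanHausdorffMeasure 2 : Measure E3) F := by
  have := surface_image_planeGraph hn h1 c (planeGraph i n c ⁻¹' F)
  rw [image_preimage_eq_of_subset] at this
  · rw [this, ← mul_assoc, ← ENNReal.ofReal_mul (abs_nonneg _),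
      mul_inv_cancel₀ (abs_pos.2 hn).ne', ENNReal.ofReal_one, one_mul]
  · intro x hx
    refine ⟨fun j => x (i.succAbove j), ?_⟩
    rw [← ins_eq_planeGraph hn (t := x i), ins_eta]
    rw [ins_eta]; exact hFc hx

end

section

/-! ### The divergence theorem on convex bodies with planar boundary pieces -/

/-- Only the closure needs more than connectedness: the open segment from a point of `K` to a point
of `closure K` lies in `K`, so a closure point beyond an end of the fibre would put that end into
`K`. -/
theorem exists_fiber_Ioo {K : Set E3} (hKo : IsOpen K) (hKc : Convex ℝ K)
    (hKb : Bornology.IsBounded K) (i : Fin 3) (y : Fin 2 → ℝ) (hne : ∃ t, ins i t y ∈ K) :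
    ∃ lo hi, lo < hi ∧ (∀ t, ins i t y ∈ K ↔ t ∈ Ioo lo hi) ∧
      (∀ t, ins i t y ∈ closure K ↔ t ∈ Icc lo hi) := by
  set I : Set ℝ := {t | ins i t y ∈ K} with hI
  have hcont : Continuous fun t => ins i t y :=
    (continuous_ins i).comp (continuous_id.prodMk continuous_const)
  have hIo : IsOpen I := hKo.preimage hcont
  have hIc : Convex ℝ I := by
    intro a ha b hb p q hp hq hpq
    have := hKc ha hb hp hq hpq
    have he : p • ins i a y + q • ins i b y = ins i (p • a + q • b) y := by
      ext k
      rcases Fin.eq_self_or_eq_succAbove i k with rfl | ⟨j, rfl⟩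
      · simp
      · simp [← add_mul, hpq]
    rw [he] at this
    exact this
  obtain ⟨C, hC⟩ := hKb.exists_norm_le
  have hIb : ∀ t ∈ I, |t| ≤ C := fun t ht => by
    have h1 := hC _ ht
    have h2 := PiLp.norm_apply_le (ins i t y) i
    simp only [ins_same, Real.norm_eq_abs] at h2
    exact h2.trans h1
  have hba : BddAbove I := ⟨C, fun t ht => (abs_le.1 (hIb t ht)).2⟩
  have hbb : BddBelow I := ⟨-C, fun t ht => (abs_le.1 (hIb t ht)).1⟩
  have hIne : I.Nonempty := hne
  have hIeq : I = Ioo (sInf I) (sSup I) := by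
    apply Subset.antisymm
    · intro t ht
      obtain ⟨ε, hε, hball⟩ := Metric.isOpen_iff.1 hIo t ht
      have h1 : t - ε / 2 ∈ I := hball (by simp [abs_of_pos hε]; linarith)
      have h2 : t + ε / 2 ∈ I := hball (by simp [abs_of_pos hε]; linarith)
      exact ⟨by linarith [csInf_le hbb h1], by linarith [le_csSup hba h2]⟩
    · exact IsConnected.Ioo_csInf_csSup_subset ⟨hIne, hIc.isPreconnected⟩ hbb hba
  have hlt : sInf I < sSup I := by
    obtain ⟨t, ht⟩ := hIne
    rw [hIeq] at ht
    exact ht.1.trans ht.2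
  have hmem : ∀ t, ins i t y ∈ K ↔ t ∈ Ioo (sInf I) (sSup I) := fun t => by rw [← hIeq]; rfl
  refine ⟨sInf I, sSup I, hlt, hmem, fun t => ⟨fun ht => ?_, fun ht => ?_⟩⟩
  · obtain ⟨t₀, ht₀⟩ := hIne
    have ht₀' := (hmem t₀).1 ht₀
    have key : ∀ r : ℝ, r ∈ openSegment ℝ t₀ t → ins i r y ∈ K := by
      rintro r ⟨a, b, ha, hb, hab, rfl⟩
      have h1 := hKc.openSegment_interior_closure_subset_interior (x := ins i t₀ y)
        (y := ins i t y) (by rwa [hKo.interior_eq]) ht ⟨a, b, ha, hb, hab, rfl⟩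
      rw [hKo.interior_eq] at h1
      convert h1 using 1
      ext k
      rcases Fin.eq_self_or_eq_succAbove i k with rfl | ⟨j, rfl⟩
      · simp
      · simp [← add_mul, hab]
    by_contra hcon
    rw [mem_Icc, not_and_or, not_le, not_le] at hcon
    rcases hcon with hcon | hcon
    · have h2 := (hmem _).1 (key (sInf I) (by
        rw [openSegment_symm, openSegment_eq_Ioo (by linarith [ht₀'.1])]
        exact ⟨hcon, ht₀'.1⟩))
      exact lt_irrefl _ h2.1
    · have h2 := (hmem _).1 (key (sSup I) (by
        rw [openSegment_eq_Ioo (by linarith [ht₀'.2])]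
        exact ⟨ht₀'.2, hcon⟩))
      exact lt_irrefl _ h2.2
  · rw [← closure_Ioo hlt.ne] at ht
    exact map_mem_closure (f := fun t => ins i t y) hcont ht fun s hs => (hmem s).2 hs

theorem isOpenMap_dropCoord (i : Fin 3) :
    IsOpenMap (fun (x : E3) (j : Fin 2) => x (i.succAbove j)) := by
  let f : E3 →ₗ[ℝ] (Fin 2 → ℝ) :=
    { toFun := fun x j => x (i.succAbove j)
      map_add' := fun x y => rfl
      map_smul' := fun a x => rfl }
  have hf : Function.Surjective f := fun y => ⟨ins i 0 y, by funext j; exact ins_succAbove i 0 y j⟩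
  exact (LinearMap.toContinuousLinearMap f).isOpenMap hf

/-- A family of planar pieces that cover the boundary of a convex body without overlap. -/
structure IsPlanarBoundary {ι : Type*} (K : Set E3) (S : Finset ι) (F : ι → Set E3) (n : ι → E3)
    (c : ι → ℝ) : Prop where
  closed : ∀ s ∈ S, IsClosed (F s)
  norm_eq : ∀ s ∈ S, ‖n s‖ = 1
  plane : ∀ s ∈ S, F s ⊆ {x | inner ℝ (n s) x = c s}
  side : ∀ s ∈ S, K ⊆ {x | inner ℝ (n s) x < c s}
  cover : frontier K = ⋃ s ∈ S, F s
  overlap : ∀ s ∈ S, ∀ s' ∈ S, s ≠ s' →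
    (Measure.euclideanHausdorffMeasure 2 : Measure E3) (F s ∩ F s') = 0
  finite : ∀ s ∈ S, (Measure.euclideanHausdorffMeasure 2 : Measure E3) (F s) < ⊤

/-- `K` lies strictly on one side of the plane of a face, so a face point at height `t` satisfies
`n_i (t' - t) < 0` for all `t'` in the open fibre. This forces the upper end if `n_i > 0`, the lower
end if `n_i < 0`, and excludes faces parallel to the axis. -/
theorem IsPlanarBoundary.top_face {ι : Type*} {K : Set E3} {S : Finset ι} {F : ι → Set E3}
    {n : ι → E3} {c : ι → ℝ} (h : IsPlanarBoundary K S F n c) (hKo : IsOpen K)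
    {i : Fin 3} {y : Fin 2 → ℝ} {lo hi : ℝ} (hlt : lo < hi)
    (hK : ∀ t, ins i t y ∈ K ↔ t ∈ Ioo lo hi) (hKcl : ∀ t, ins i t y ∈ closure K ↔ t ∈ Icc lo hi) :
    (∀ s ∈ S, ∀ t, ins i t y ∈ F s → (0 < n s i → t = hi) ∧ (n s i < 0 → t = lo) ∧ n s i ≠ 0) ∧
    (∃ s ∈ S, ins i hi y ∈ F s ∧ 0 < n s i) ∧ (∃ s ∈ S, ins i lo y ∈ F s ∧ n s i < 0) := by
  have hsub : ∀ s ∈ S, F s ⊆ frontier K := fun s hs => by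
    rw [h.cover]; exact subset_biUnion_of_mem (u := F) hs
  have hA : ∀ s ∈ S, ∀ t, ins i t y ∈ F s → ∀ t' ∈ Ioo lo hi, n s i * (t' - t) < 0 := by
    intro s hs t ht t' ht'
    have h1 := h.plane s hs ht
    have h2 := h.side s hs ((hK t').2 ht')
    simp only [mem_ofPred_eq, inner_ins] at h1 h2
    linarith
  have hB : ∀ s ∈ S, ∀ t, ins i t y ∈ F s → t ∈ Icc lo hi := fun s hs t ht =>
    (hKcl t).1 (frontier_subset_closure (hsub s hs ht))
  have hC : ∀ s ∈ S, ∀ t, ins i t y ∈ F s →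
      (0 < n s i → t = hi) ∧ (n s i < 0 → t = lo) ∧ n s i ≠ 0 := by
    intro s hs t ht
    have hb := hB s hs t ht
    refine ⟨fun hp => ?_, fun hp => ?_, fun h0 => ?_⟩
    · by_contra hne
      have hlt' : t < hi := lt_of_le_of_ne hb.2 hne
      have := hA s hs t ht ((t + hi) / 2) ⟨by linarith [hb.1], by linarith⟩
      nlinarith
    · by_contra hne
      have hlt' : lo < t := lt_of_le_of_ne hb.1 (Ne.symm hne)
      have := hA s hs t ht ((t + lo) / 2) ⟨by linarith, by linarith [hb.2]⟩
      nlinarith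
    · have := hA s hs t ht ((lo + hi) / 2) ⟨by linarith, by linarith⟩
      rw [h0] at this; linarith
  have hfr : ∀ t ∈ Icc lo hi, t ∉ Ioo lo hi → ∃ s ∈ S, ins i t y ∈ F s := by
    intro t ht ht'
    have : ins i t y ∈ frontier K := by
      rw [hKo.frontier_eq]; exact ⟨(hKcl t).2 ht, fun hc => ht' ((hK t).1 hc)⟩
    rw [h.cover] at this
    simpa using this
  refine ⟨hC, ?_, ?_⟩
  · obtain ⟨s, hs, hx⟩ := hfr hi ⟨hlt.le, le_rfl⟩ (fun h => lt_irrefl _ h.2)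
    refine ⟨s, hs, hx, ?_⟩
    obtain ⟨-, h2, h3⟩ := hC s hs hi hx
    rcases lt_or_gt_of_ne h3 with h4 | h4
    · exact absurd (h2 h4) hlt.ne'
    · exact h4
  · obtain ⟨s, hs, hx⟩ := hfr lo ⟨le_rfl, hlt.le⟩ (fun h => lt_irrefl _ h.1)
    refine ⟨s, hs, hx, ?_⟩
    obtain ⟨h2, -, h3⟩ := hC s hs lo hx
    rcases lt_or_gt_of_ne h3 with h4 | h4
    · exact h4
    · exact absurd (h2 h4) hlt.ne

/-- The contribution of one boundary piece to the fibre integral. -/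
def faceTerm (φ : E3 → ℝ) (i : Fin 3) (n : E3) (c : ℝ) (F : Set E3) (y : Fin 2 → ℝ) : ℝ :=
  SignType.sign (n i) * (planeGraph i n c ⁻¹' F).indicator (fun y => φ (planeGraph i n c y)) y

/-- The sign in `faceTerm` and the Jacobian `|n_i|` combine to the component `n_i` of the normal;
for `n_i = 0` both sides vanish. -/
theorem integral_faceTerm {φ : E3 → ℝ} (i : Fin 3) {n : E3} {c : ℝ} {F : Set E3} (h1 : ‖n‖ = 1)
    (hF : IsClosed F) (hFc : F ⊆ {x | inner ℝ n x = c}) :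
    ∫ y, faceTerm φ i n c F y
      = n i * ∫ x in F, φ x ∂(Measure.euclideanHausdorffMeasure 2 : Measure E3) := by
  simp only [faceTerm]
  rw [integral_const_mul, integral_indicator
    ((continuous_planeGraph i n c).measurable hF.measurableSet)]
  by_cases hn : n i = 0
  · simp [hn]
  · rw [← setIntegral_plane hn h1 hF.measurableSet hFc, ← mul_assoc, sign_mul_abs]

theorem integrable_faceTerm {φ : E3 → ℝ} (hφ : Continuous φ) (i : Fin 3) {n : E3} {c : ℝ}
    {F : Set E3} (h1 : ‖n‖ = 1) (hF : IsCompact F) (hFc : F ⊆ {x | inner ℝ n x = c})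
    (hfin : (Measure.euclideanHausdorffMeasure 2 : Measure E3) F < ⊤) :
    Integrable (faceTerm φ i n c F) := by
  by_cases hn : n i = 0
  · have : faceTerm φ i n c F = 0 := by funext y; simp [faceTerm, hn]
    rw [this]; exact integrable_zero _ _ _
  refine Integrable.const_mul ?_ _
  have hms := (continuous_planeGraph i n c).measurable hF.isClosed.measurableSet
  rw [integrable_indicator_iff hms]
  obtain ⟨C, hC⟩ := hF.exists_bound_of_continuousOn hφ.continuousOn
  refine Measure.integrableOn_of_bounded (M := C) ?_ ?_ ?_
  · rw [volume_preimage_planeGraph hn h1 hFc]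
    exact (ENNReal.mul_lt_top ENNReal.ofReal_lt_top hfin).ne
  · exact (hφ.comp (continuous_planeGraph i n c)).aestronglyMeasurable
  · exact (ae_restrict_mem hms).mono fun y hy => hC _ hy

/-- Only two terms survive: `φ` at the upper end of the fibre with sign plus and at the lower end
with sign minus. The hypothesis `hy` excludes fibres through an overlap of faces, where an end could
be counted twice. -/
theorem sum_faceTerm {ι : Type*} {K : Set E3} {S : Finset ι} {F : ι → Set E3}
    {n : ι → E3} {c : ι → ℝ} (h : IsPlanarBoundary K S F n c) (hKo : IsOpen K)
    {i : Fin 3} {y : Fin 2 → ℝ} {lo hi : ℝ} (hlt : lo < hi)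
    (hK : ∀ t, ins i t y ∈ K ↔ t ∈ Ioo lo hi) (hKcl : ∀ t, ins i t y ∈ closure K ↔ t ∈ Icc lo hi)
    (hy : ∀ s ∈ S, ∀ s' ∈ S, s ≠ s' → n s i ≠ 0 → planeGraph i (n s) (c s) y ∉ F s ∩ F s')
    (φ : E3 → ℝ) :
    ∑ s ∈ S, faceTerm φ i (n s) (c s) (F s) y = φ (ins i hi y) - φ (ins i lo y) := by
  classical
  obtain ⟨hC, ⟨s₁, hs₁, hx₁, hn₁⟩, ⟨s₂, hs₂, hx₂, hn₂⟩⟩ := h.top_face hKo hlt hK hKcl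
  have e₁ := ins_eq_planeGraph hn₁.ne' (h.plane s₁ hs₁ hx₁)
  have e₂ := ins_eq_planeGraph hn₂.ne (h.plane s₂ hs₂ hx₂)
  have hne : s₁ ≠ s₂ := by rintro rfl; linarith
  have hterm : ∀ s ∈ S, faceTerm φ i (n s) (c s) (F s) y
      = (if s = s₁ then φ (ins i hi y) else 0) - (if s = s₂ then φ (ins i lo y) else 0) := by
    intro s hs
    by_cases hs1 : s = s₁
    · subst hs1
      simp only [faceTerm, sign_pos hn₁, if_true, if_neg hne]
      rw [indicator_of_mem (by rw [mem_preimage, ← e₁]; exact hx₁), ← e₁]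
      simp
    by_cases hs2 : s = s₂
    · subst hs2
      simp only [faceTerm, sign_neg hn₂, if_true, if_neg hs1]
      rw [indicator_of_mem (by rw [mem_preimage, ← e₂]; exact hx₂), ← e₂]
      simp
    rw [if_neg hs1, if_neg hs2, sub_zero, faceTerm]
    by_cases hmem : planeGraph i (n s) (c s) y ∈ F s
    · exfalso
      obtain ⟨ha, hb, hc⟩ := hC s hs _ hmem
      rcases lt_or_gt_of_ne hc with h4 | h4
      · have := hb h4
        exact hy s hs s₂ hs₂ hs2 h4.ne ⟨hmem, by rw [planeGraph, this]; exact hx₂⟩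
      · have := ha h4
        exact hy s hs s₁ hs₁ hs1 h4.ne' ⟨hmem, by rw [planeGraph, this]; exact hx₁⟩
    · rw [indicator_of_notMem (s := planeGraph i (n s) (c s) ⁻¹' F s) hmem, mul_zero]
  rw [Finset.sum_congr rfl hterm, Finset.sum_sub_distrib, Finset.sum_ite_eq', Finset.sum_ite_eq',
    if_pos hs₁, if_pos hs₂]

theorem integral_fiber {K : Set E3} {i : Fin 3} {y : Fin 2 → ℝ} {lo hi : ℝ} (hlt : lo < hi)
    (hK : ∀ t, ins i t y ∈ K ↔ t ∈ Ioo lo hi) {φ : E3 → ℝ} (hφ : ContDiff ℝ 1 φ) :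
    ∫ t, K.indicator (fun x => fderiv ℝ φ x (EuclideanSpace.single i 1)) (ins i t y)
      = φ (ins i hi y) - φ (ins i lo y) := by
  have h1 : (fun t => K.indicator (fun x => fderiv ℝ φ x (EuclideanSpace.single i 1)) (ins i t y))
      = (Ioo lo hi).indicator
        (fun t => fderiv ℝ φ (ins i t y) (EuclideanSpace.single i 1)) := by
    funext t
    by_cases ht : t ∈ Ioo lo hi
    · rw [indicator_of_mem ht, indicator_of_mem ((hK t).2 ht)]
    · rw [indicator_of_notMem ht, indicator_of_notMem (fun h => ht ((hK t).1 h))]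
  have hder : ∀ t, HasDerivAt (fun t => ins i t y) (EuclideanSpace.single i (1 : ℝ)) t := by
    intro t
    have h3 : (fun t => ins i t y) = fun t => ins i 0 y + t • EuclideanSpace.single i (1 : ℝ) := by
      funext t; exact ins_eq_add_smul i t y
    rw [h3]
    simpa using ((hasDerivAt_id t).smul_const (EuclideanSpace.single i (1 : ℝ))).const_add (ins i 0 y)
  have hcont : Continuous fun t => ins i t y :=
    (continuous_ins i).comp (continuous_id.prodMk continuous_const)
  have hc : Continuous fun t => fderiv ℝ φ (ins i t y) (EuclideanSpace.single i 1) :=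
    ((hφ.continuous_fderiv one_ne_zero).comp hcont).clm_apply continuous_const
  rw [h1, integral_indicator measurableSet_Ioo, ← integral_Ioc_eq_integral_Ioo,
    ← intervalIntegral.integral_of_le hlt.le]
  refine intervalIntegral.integral_eq_sub_of_hasDerivAt (f := fun t => φ (ins i t y)) ?_
    (hc.intervalIntegrable _ _)
  intro t _
  exact ((hφ.differentiable one_ne_zero).differentiableAt.hasFDerivAt).comp_hasDerivAt t (hder t)

/-- The divergence theorem for a convex body whose boundary consists of planar pieces. -/
theorem integral_fderiv_eq_sum_faces {ι : Type*} {K : Set E3} {S : Finset ι} {F : ι → Set E3}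
    {n : ι → E3} {c : ι → ℝ} (h : IsPlanarBoundary K S F n c) (hKo : IsOpen K)
    (hKc : Convex ℝ K) (hKb : Bornology.IsBounded K) {φ : E3 → ℝ} (hφ : ContDiff ℝ 1 φ)
    (i : Fin 3) :
    ∫ x in K, fderiv ℝ φ x (EuclideanSpace.single i 1)
      = ∑ s ∈ S, n s i * ∫ x in F s, φ x ∂(Measure.euclideanHausdorffMeasure 2 : Measure E3) := by
  have hcompact : ∀ s ∈ S, IsCompact (F s) := fun s hs => by
    refine Metric.isCompact_of_isClosed_isBounded (h.closed s hs) ?_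
    refine hKb.closure.subset ((?_ : F s ⊆ frontier K).trans frontier_subset_closure)
    rw [h.cover]; exact subset_biUnion_of_mem (u := F) hs
  have hR : ∑ s ∈ S, n s i * ∫ x in F s, φ x ∂(Measure.euclideanHausdorffMeasure 2 : Measure E3)
      = ∫ y, ∑ s ∈ S, faceTerm φ i (n s) (c s) (F s) y := by
    rw [integral_finsetSum]
    · exact Finset.sum_congr rfl fun s hs =>
        (integral_faceTerm i (h.norm_eq s hs) (h.closed s hs) (h.plane s hs)).symm
    · exact fun s hs => integrable_faceTerm hφ.continuous i (h.norm_eq s hs) (hcompact s hs)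
        (h.plane s hs) (h.finite s hs)
  have hcd : Continuous fun x => fderiv ℝ φ x (EuclideanSpace.single i 1) :=
    (hφ.continuous_fderiv one_ne_zero).clm_apply continuous_const
  have hint : Integrable (K.indicator fun x => fderiv ℝ φ x (EuclideanSpace.single i 1)) := by
    rw [integrable_indicator_iff hKo.measurableSet]
    exact (hcd.continuousOn.integrableOn_compact hKb.isCompact_closure).mono_set subset_closure
  rw [hR, ← integral_indicator hKo.measurableSet,
    ← (measurePreserving_ins i).integral_comp (measurableEmbedding_ins i)]
  have hint' := ((measurePreserving_ins i).integrable_comp_emb (measurableEmbedding_ins i)).2 hint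
  rw [Measure.volume_eq_prod] at hint' ⊢
  refine (integral_prod_symm _ hint').trans ?_
  refine integral_congr_ae ?_
  -- Overlaps have zero area, and projecting them along an axis with `n_i ≠ 0` keeps them null.
  have hZ1 : ∀ᵐ y : Fin 2 → ℝ, ∀ s ∈ S, ∀ s' ∈ S, s ≠ s' → n s i ≠ 0 →
      planeGraph i (n s) (c s) y ∉ F s ∩ F s' := by
    rw [Finset.eventually_all]
    intro s hs
    rw [Finset.eventually_all]
    intro s' hs'
    by_cases hne : s ≠ s' ∧ n s i ≠ 0
    · have h0 : volume (planeGraph i (n s) (c s) ⁻¹' (F s ∩ F s')) = 0 := by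
        rw [volume_preimage_planeGraph hne.2 (h.norm_eq s hs)
          (inter_subset_left.trans (h.plane s hs)), h.overlap s hs s' hs' hne.1, mul_zero]
      filter_upwards [measure_eq_zero_iff_ae_notMem.1 h0] with y hy _ _ using hy
    · exact Eventually.of_forall fun y h1 h2 => absurd ⟨h1, h2⟩ hne
  let pr : E3 → (Fin 2 → ℝ) := fun x j => x (i.succAbove j)
  have hprc : Continuous pr := by fun_prop
  have hconv : Convex ℝ (pr '' K) := by
    rintro _ ⟨a, ha, rfl⟩ _ ⟨b, hb, rfl⟩ p q hp hq hpq
    exact ⟨p • a + q • b, hKc ha hb hp hq hpq, by funext j; simp [pr]⟩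
  -- A fibre that misses `K` but touches its closure lies over the frontier of the projection, which
  -- is null because the projection is convex.
  have hZ2 : ∀ᵐ y : Fin 2 → ℝ, y ∉ frontier (pr '' K) :=
    measure_eq_zero_iff_ae_notMem.1 (hconv.addHaar_frontier volume)
  filter_upwards [hZ1, hZ2] with y hy1 hy2
  by_cases hne : ∃ t, ins i t y ∈ K
  · obtain ⟨lo, hi, hlt, hK, hKcl⟩ := exists_fiber_Ioo hKo hKc hKb i y hne
    rw [sum_faceTerm h hKo hlt hK hKcl hy1, ← integral_fiber hlt hK hφ]
    rfl
  · push Not at hne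
    have h1 : ∀ t, K.indicator (fun x => fderiv ℝ φ x (EuclideanSpace.single i 1)) (ins i t y) = 0 :=
      fun t => indicator_of_notMem (hne t) _
    simp only [Function.comp_apply, h1, integral_zero]
    symm
    refine Finset.sum_eq_zero fun s hs => ?_
    rw [faceTerm, indicator_of_notMem, mul_zero]
    intro hmem
    have hcl : planeGraph i (n s) (c s) y ∈ closure K := by
      refine frontier_subset_closure ?_
      rw [h.cover]; exact mem_biUnion (t := F) hs hmem
    have hpr : pr (planeGraph i (n s) (c s) y) = y := by funext j; simp [pr, planeGraph]
    refine hy2 ?_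
    rw [(isOpenMap_dropCoord i K hKo).frontier_eq]
    refine ⟨?_, ?_⟩
    · rw [← hpr]; exact image_closure_subset_closure_image hprc ⟨_, hcl, rfl⟩
    · rintro ⟨x, hx, rfl⟩
      exact hne (x i) (by rw [ins_eta]; exact hx)

end

section

/-! ### Planes through sets of positive area -/

theorem area_pos_iff {F : Set E3} : 0 < area F ↔
    (Measure.euclideanHausdorffMeasure 2 : Measure E3) F ≠ 0 ∧
      (Measure.euclideanHausdorffMeasure 2 : Measure E3) F ≠ ⊤ := by
  rw [area, measureReal_def, ENNReal.toReal_pos_iff, pos_iff_ne_zero, lt_top_iff_ne_top]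

theorem nonempty_of_area_pos {F : Set E3} (hF : 0 < area F) : F.Nonempty := by
  rw [nonempty_iff_ne_empty]; rintro rfl; simp [area] at hF

/-- Parametrized over a coordinate plane, `F` has positive Lebesgue measure, and the linear form
induced by `b` is constant on it. A translate of the kernel then has positive measure; proper
subspaces are null, so the form vanishes and `b` is normal to the plane. -/
theorem exists_smul_of_area_pos {F : Set E3} (hF : 0 < area F) {a b : E3} (ha : a ≠ 0)
    (hFa : ∀ y ∈ F, ∀ z ∈ F, inner ℝ a (y - z) = 0)
    (hFb : ∀ y ∈ F, ∀ z ∈ F, inner ℝ b (y - z) = 0) : ∃ r : ℝ, b = r • a := by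
  obtain ⟨y₀, hy₀⟩ := nonempty_of_area_pos hF
  set n : E3 := ‖a‖⁻¹ • a with hn
  have hna : ‖a‖ ≠ 0 := norm_ne_zero_iff.2 ha
  have h1 : ‖n‖ = 1 := by rw [hn, norm_smul, norm_inv, norm_norm, inv_mul_cancel₀ hna]
  obtain ⟨i, hi⟩ : ∃ i, n i ≠ 0 := by
    by_contra! h
    have : n = 0 := by ext k; simpa using h k
    rw [this, norm_zero] at h1; exact zero_ne_one h1
  have hplane : F ⊆ {x | inner ℝ n x = inner ℝ n y₀} := fun y hy => by
    have := hFa y hy y₀ hy₀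
    rw [mem_ofPred_eq, ← sub_eq_zero, ← inner_sub_right, hn, real_inner_smul_left, this, mul_zero]
  have hvol := volume_preimage_planeGraph hi h1 hplane
  have hne : volume (planeGraph i n (inner ℝ n y₀) ⁻¹' F) ≠ 0 := by
    rw [hvol]
    exact mul_ne_zero (by simpa using hi) (area_pos_iff.1 hF).1
  let ℓ : (Fin 2 → ℝ) →ₗ[ℝ] ℝ :=
    { toFun := fun y => inner ℝ b (planeGraphLin i n (WithLp.toLp 2 y))
      map_add' := fun y z => by rw [WithLp.toLp_add, map_add, inner_add_right]
      map_smul' := fun r y => by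
        rw [WithLp.toLp_smul, map_smul, real_inner_smul_right]; rfl }
  have hker : LinearMap.ker ℓ = ⊤ := by
    by_contra hk
    have h0 := Measure.addHaar_submodule (volume : Measure (Fin 2 → ℝ)) (LinearMap.ker ℓ) hk
    obtain ⟨z₀, hz₀⟩ := nonempty_of_measure_ne_zero hne
    refine hne (measure_mono_null (t := (fun y => y - z₀) ⁻¹' (LinearMap.ker ℓ)) ?_ ?_)
    · intro z hz
      have h2 := hFb _ hz _ hz₀
      rw [planeGraph_eq_add i n _ (WithLp.toLp 2 z), planeGraph_eq_add i n _ (WithLp.toLp 2 z₀),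
        add_sub_add_left_eq_sub, ← map_sub] at h2
      exact h2
    · simp only [sub_eq_add_neg]
      rw [measure_preimage_add_right, h0]
  refine ⟨b i / n i * ‖a‖⁻¹, ?_⟩
  have hall : ∀ y, inner ℝ b (planeGraph i n 0 y) = 0 := fun y => by
    have : y ∈ LinearMap.ker ℓ := hker ▸ Submodule.mem_top
    exact this
  rw [mul_smul, ← hn]
  ext k
  rcases Fin.eq_self_or_eq_succAbove i k with rfl | ⟨j, rfl⟩
  · simp [hi]
  · have := hall (Pi.single j 1)
    rw [planeGraph, inner_ins] at this
    simp [Pi.single_apply] at this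
    simp only [PiLp.smul_apply, smul_eq_mul]
    field_simp at this ⊢
    linarith

theorem inner_closure_le {K : Set E3} {n : E3} {c : ℝ} (h : K ⊆ {x | inner ℝ n x < c}) {x : E3}
    (hx : x ∈ closure K) : inner ℝ n x ≤ c := by
  have hcl : IsClosed {x : E3 | inner ℝ n x ≤ c} :=
    isClosed_le (continuous_const.inner continuous_id) continuous_const
  exact closure_minimal (t := {x : E3 | inner ℝ n x ≤ c}) (fun y hy => by
    have := h hy
    rw [mem_ofPred_eq] at this ⊢
    exact this.le) hcl hx

theorem le_inner_closure {K : Set E3} {n : E3} {c : ℝ} (h : K ⊆ {x | c < inner ℝ n x}) {x : E3}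
    (hx : x ∈ closure K) : c ≤ inner ℝ n x := by
  have hcl : IsClosed {x : E3 | c ≤ inner ℝ n x} :=
    isClosed_le continuous_const (continuous_const.inner continuous_id)
  exact closure_minimal (t := {x : E3 | c ≤ inner ℝ n x}) (fun y hy => by
    have := h hy
    rw [mem_ofPred_eq] at this ⊢
    exact this.le) hcl hx

/-- Two disjoint convex sets lie on different sides of a plane on which their closures share a set of
positive area. -/
theorem opposite_side {A B F : Set E3} (hA : IsOpen A) (hAc : Convex ℝ A) (hAne : A.Nonempty)
    (hB : IsOpen B) (hBc : Convex ℝ B) (hd : Disjoint A B) (hF : 0 < area F)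
    (hFA : F ⊆ closure A) (hFB : F ⊆ closure B) {n : E3} {c : ℝ}
    (hFn : F ⊆ {x | inner ℝ n x = c}) (hAn : A ⊆ {x | inner ℝ n x < c}) :
    B ⊆ {x | c < inner ℝ n x} := by
  -- The separating plane contains `F`, which lies in both closures; hence its normal is a multiple
  -- of `n`, and a point of `A` shows that the factor is positive.
  obtain ⟨f, s, hfA, hfB⟩ := geometric_hahn_banach_open_open hAc hA hBc hB hd
  obtain ⟨w, hw⟩ : ∃ w : E3, ∀ x, f x = inner ℝ w x :=
    ⟨(InnerProductSpace.toDual ℝ E3).symm f, fun x => by simp⟩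
  simp only [hw] at hfA hfB
  have hFw : ∀ y ∈ F, inner ℝ w y = s := fun y hy =>
    le_antisymm (inner_closure_le hfA (hFA hy)) (le_inner_closure hfB (hFB hy))
  obtain ⟨y₀, hy₀⟩ := nonempty_of_area_pos hF
  have hn0 : n ≠ 0 := by
    rintro rfl
    obtain ⟨x, hx⟩ := hAne
    have h1 := hAn hx
    have h2 := hFn hy₀
    simp only [mem_ofPred_eq, inner_zero_left] at h1 h2
    linarith
  obtain ⟨r, rfl⟩ := exists_smul_of_area_pos hF hn0
    (fun y hy z hz => by rw [inner_sub_right, hFn hy, hFn hz, sub_self])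
    (fun y hy z hz => by rw [inner_sub_right, hFw y hy, hFw z hz, sub_self])
  have hs : s = r * c := by
    rw [← hFw y₀ hy₀, real_inner_smul_left, hFn hy₀]
  simp only [real_inner_smul_left, hs] at hfA hfB
  obtain ⟨x, hx⟩ := hAne
  have h1 := hfA x hx
  have h2 : inner ℝ n x < c := hAn hx
  have hr : 0 < r := by by_contra hcon; push Not at hcon; nlinarith
  intro z hz
  exact lt_of_mul_lt_mul_left (hfB z hz) hr.le

/-! ### Geometry of an admissible mesh: neighbours, normals and heights. -/

namespace AdmissibleMesh

variable {Ω : Set E3} (M : AdmissibleMesh Ω)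

theorem isOpen_cell (K : Fin M.numCells) : IsOpen (M.cell K) := by
  obtain ⟨-, -, N, a, c, h⟩ := M.cell_polyhedron K
  rw [h, ofPred_forall]
  exact isOpen_iInter_of_finite fun i =>
    isOpen_lt (continuous_const.inner continuous_id) continuous_const

theorem convex_cell (K : Fin M.numCells) : Convex ℝ (M.cell K) := by
  obtain ⟨-, -, N, a, c, h⟩ := M.cell_polyhedron K
  rw [h, ofPred_forall]
  exact convex_iInter fun i => convex_halfSpace_lt ((innerSL ℝ (a i)).isLinear) (c i)

theorem nonempty_cell (K : Fin M.numCells) : (M.cell K).Nonempty := (M.cell_polyhedron K).1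

theorem isBounded_cell (K : Fin M.numCells) : Bornology.IsBounded (M.cell K) :=
  (M.cell_polyhedron K).2.1

theorem mem_facesOf {K : Fin M.numCells} {σ : Fin M.numFaces} :
    σ ∈ M.facesOf K ↔ M.face σ ⊆ frontier (M.cell K) := by
  simp [facesOf]

theorem mem_neighbors {K L : Fin M.numCells} {σ : Fin M.numFaces} :
    L ∈ M.neighbors K σ ↔ L ≠ K ∧ closure (M.cell K) ∩ closure (M.cell L) = M.face σ := by
  simp [neighbors]

theorem mem_neighbors_symm {K L : Fin M.numCells} {σ : Fin M.numFaces}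
    (h : L ∈ M.neighbors K σ) : K ∈ M.neighbors L σ := by
  rw [mem_neighbors] at h ⊢
  exact ⟨h.1.symm, by rw [inter_comm]; exact h.2⟩

theorem mem_facesOf_of_mem_neighbors {K L : Fin M.numCells} {σ : Fin M.numFaces}
    (h : L ∈ M.neighbors K σ) : σ ∈ M.facesOf K := by
  rw [mem_neighbors] at h
  rw [mem_facesOf, ← h.2, (M.isOpen_cell K).frontier_eq]
  rintro x ⟨hx, hx'⟩
  refine ⟨hx, fun hxK => ?_⟩
  obtain ⟨y, hy, hy'⟩ := mem_closure_iff.1 hx' _ (M.isOpen_cell K) hxK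
  exact (M.cell_disjoint K L h.1.symm).le_bot ⟨hy, hy'⟩

/-- The frontier is covered by the finitely many planes of the half-spaces that define the cell, so
one of these planes meets the face in positive area. As the face is planar, it then lies in that
plane entirely. -/
theorem exists_outer_normal {K : Fin M.numCells} {σ : Fin M.numFaces} (h : σ ∈ M.facesOf K) :
    ∃ (n : E3) (c : ℝ), ‖n‖ = 1 ∧ M.face σ ⊆ {x | inner ℝ n x = c} ∧
      M.cell K ⊆ {x | inner ℝ n x < c} := by
  rw [mem_facesOf] at h
  obtain ⟨⟨x₀, hx₀⟩, -, N, a, c, hK⟩ := M.cell_polyhedron K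
  have hcov : M.face σ ⊆ ⋃ i, M.face σ ∩ {x | inner ℝ (a i) x = c i} := by
    intro x hx
    have hfr := h hx
    rw [(M.isOpen_cell K).frontier_eq] at hfr
    have hle : ∀ i, inner ℝ (a i) x ≤ c i := fun i =>
      inner_closure_le (fun y hy => by rw [hK] at hy; exact hy i) hfr.1
    have hnot : ¬ ∀ i, inner ℝ (a i) x < c i := fun hc => hfr.2 (by rw [hK]; exact hc)
    push Not at hnot
    obtain ⟨i, hi⟩ := hnot
    exact mem_iUnion.2 ⟨i, hx, le_antisymm (hle i) hi⟩
  have hpos := area_pos_iff.1 (M.face_pos σ)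
  obtain ⟨i, hi⟩ : ∃ i, (Measure.euclideanHausdorffMeasure 2 : Measure E3)
      (M.face σ ∩ {x | inner ℝ (a i) x = c i}) ≠ 0 := by
    by_contra! hcon
    exact hpos.1 (measure_mono_null hcov (measure_iUnion_null hcon))
  set G := M.face σ ∩ {x | inner ℝ (a i) x = c i} with hG
  have hGpos : 0 < area G := area_pos_iff.2 ⟨hi, ne_top_of_le_ne_top hpos.2
    (measure_mono inter_subset_left)⟩
  obtain ⟨y₀, hy₀, hy₀'⟩ := nonempty_of_area_pos hGpos
  have hx₀' : inner ℝ (a i) x₀ < c i := by rw [hK] at hx₀; exact hx₀ i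
  have hai : a i ≠ 0 := by
    intro h0
    rw [mem_ofPred_eq, h0, inner_zero_left] at hy₀'
    rw [h0, inner_zero_left] at hx₀'
    linarith
  obtain ⟨b, d, hb, hbd⟩ := M.face_planar σ
  obtain ⟨r, hr⟩ := exists_smul_of_area_pos hGpos hai
    (fun y hy z hz => by rw [inner_sub_right, hy.2, hz.2, sub_self])
    (b := b) (fun y hy z hz => by rw [inner_sub_right, hbd hy.1, hbd hz.1, sub_self])
  have hr0 : r ≠ 0 := by rintro rfl; exact hb (by rw [hr, zero_smul])
  have hna : 0 < ‖a i‖ := norm_pos_iff.2 hai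
  refine ⟨‖a i‖⁻¹ • a i, ‖a i‖⁻¹ * c i, ?_, ?_, ?_⟩
  · rw [norm_smul, norm_inv, norm_norm, inv_mul_cancel₀ hna.ne']
  · intro y hy
    rw [mem_ofPred_eq, real_inner_smul_left]
    have h1 : inner ℝ b y = inner ℝ b y₀ := (hbd hy).trans (hbd hy₀).symm
    rw [hr, real_inner_smul_left, real_inner_smul_left] at h1
    rw [mul_left_cancel₀ hr0 h1, hy₀']
  · intro y hy
    rw [mem_ofPred_eq, real_inner_smul_left]
    rw [hK] at hy
    exact mul_lt_mul_of_pos_left (hy i) (inv_pos.2 hna)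

theorem face_subset_closure {K : Fin M.numCells} {σ : Fin M.numFaces} (h : σ ∈ M.facesOf K) :
    M.face σ ⊆ closure (M.cell K) :=
  (M.mem_facesOf.1 h).trans frontier_subset_closure

theorem cell_opposite_side {K L : Fin M.numCells} (hKL : K ≠ L) {σ : Fin M.numFaces}
    (hK : σ ∈ M.facesOf K) (hL : σ ∈ M.facesOf L) {n : E3} {c : ℝ}
    (hn : M.face σ ⊆ {x | inner ℝ n x = c}) (hs : M.cell K ⊆ {x | inner ℝ n x < c}) :
    M.cell L ⊆ {x | c < inner ℝ n x} :=
  opposite_side (M.isOpen_cell K) (M.convex_cell K) (M.nonempty_cell K) (M.isOpen_cell L)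
    (M.convex_cell L) (M.cell_disjoint K L hKL) (M.face_pos σ) (M.face_subset_closure hK)
    (M.face_subset_closure hL) hn hs

/-- A face belongs to at most two cells. -/
theorem eq_or_eq_of_mem_facesOf {A B K : Fin M.numCells} (hAB : A ≠ B) {σ : Fin M.numFaces}
    (hA : σ ∈ M.facesOf A) (hB : σ ∈ M.facesOf B) (hK : σ ∈ M.facesOf K) : K = A ∨ K = B := by
  -- A third cell would lie beyond the face both as seen from `A` and as seen from `B`, that is, on
  -- both sides of one plane.
  by_contra! hcon
  obtain ⟨n, c, -, hn, hs⟩ := M.exists_outer_normal hA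
  have hBs := M.cell_opposite_side hAB hA hB hn hs
  have hKs := M.cell_opposite_side hcon.1.symm hA hK hn hs
  have hKs' := M.cell_opposite_side hcon.2.symm hB hK (n := -n) (c := -c)
    (fun x hx => by rw [mem_ofPred_eq, inner_neg_left, hn hx])
    (fun x hx => by rw [mem_ofPred_eq, inner_neg_left]; exact neg_lt_neg (hBs hx))
  obtain ⟨x, hx⟩ := M.nonempty_cell K
  have h1 : c < inner ℝ n x := hKs hx
  have h2 := hKs' hx
  rw [mem_ofPred_eq, inner_neg_left] at h2
  linarith

/-- Faces on the boundary of `Ω`. -/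
def IsBd (σ : Fin M.numFaces) : Prop := M.face σ ⊆ frontier Ω

open Classical in
/-- The cell on the other side of an interior face, and `K` itself for a boundary face. -/
def flip (K : Fin M.numCells) (σ : Fin M.numFaces) : Fin M.numCells :=
  if h : ¬ M.IsBd σ ∧ (M.neighbors K σ).Nonempty then h.2.choose else K

theorem flip_of_isBd (K : Fin M.numCells) {σ : Fin M.numFaces} (h : M.IsBd σ) :
    M.flip K σ = K := dif_neg fun h' => h'.1 h

/-- An interior face is `A|B` for some cells `A` and `B`, and every cell that has it as a face is
one of these two. -/
theorem flip_mem_neighbors {K : Fin M.numCells} {σ : Fin M.numFaces} (hK : σ ∈ M.facesOf K)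
    (h : ¬ M.IsBd σ) : M.flip K σ ∈ M.neighbors K σ := by
  have hne : (M.neighbors K σ).Nonempty := by
    obtain ⟨A, B, hAB, hσ⟩ := M.face_interior σ h
    have hBA : B ∈ M.neighbors A σ := M.mem_neighbors.2 ⟨hAB.symm, hσ⟩
    have hA := M.mem_facesOf_of_mem_neighbors hBA
    have hB := M.mem_facesOf_of_mem_neighbors (M.mem_neighbors_symm hBA)
    rcases M.eq_or_eq_of_mem_facesOf hAB hA hB hK with rfl | rfl
    · exact ⟨B, hBA⟩
    · exact ⟨A, M.mem_neighbors_symm hBA⟩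
  rw [flip, dif_pos ⟨h, hne⟩]
  exact hne.choose_spec

theorem eq_flip_of_mem_neighbors {K L : Fin M.numCells} {σ : Fin M.numFaces}
    (h : ¬ M.IsBd σ) (hL : L ∈ M.neighbors K σ) : L = M.flip K σ := by
  have hK := M.mem_facesOf_of_mem_neighbors hL
  have h1 := M.flip_mem_neighbors hK h
  have h2 := M.mem_facesOf_of_mem_neighbors (M.mem_neighbors_symm h1)
  have h3 := M.mem_facesOf_of_mem_neighbors (M.mem_neighbors_symm hL)
  rcases M.eq_or_eq_of_mem_facesOf (M.mem_neighbors.1 h1).1 h2 hK h3 with h4 | h4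
  · exact h4
  · exact absurd h4 (M.mem_neighbors.1 hL).1

theorem neighbors_eq_singleton {K : Fin M.numCells} {σ : Fin M.numFaces} (hK : σ ∈ M.facesOf K)
    (h : ¬ M.IsBd σ) : M.neighbors K σ = {M.flip K σ} := by
  ext L
  rw [Finset.mem_singleton]
  exact ⟨M.eq_flip_of_mem_neighbors h, fun hL => hL ▸ M.flip_mem_neighbors hK h⟩

theorem mem_facesOf_flip {K : Fin M.numCells} {σ : Fin M.numFaces} (hK : σ ∈ M.facesOf K) :
    σ ∈ M.facesOf (M.flip K σ) := by
  by_cases h : M.IsBd σ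
  · rwa [M.flip_of_isBd K h]
  · exact M.mem_facesOf_of_mem_neighbors (M.mem_neighbors_symm (M.flip_mem_neighbors hK h))

theorem flip_flip {K : Fin M.numCells} {σ : Fin M.numFaces} (hK : σ ∈ M.facesOf K) :
    M.flip (M.flip K σ) σ = K := by
  by_cases h : M.IsBd σ
  · rw [M.flip_of_isBd K h, M.flip_of_isBd K h]
  · exact (M.eq_flip_of_mem_neighbors h
      (M.mem_neighbors_symm (M.flip_mem_neighbors hK h))).symm

open Classical in
/-- The pairs of a cell and one of its faces. -/
def edges : Finset (Fin M.numCells × Fin M.numFaces) :=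
  Finset.univ.filter fun p => p.2 ∈ M.facesOf p.1

theorem mem_edges {p : Fin M.numCells × Fin M.numFaces} :
    p ∈ M.edges ↔ p.2 ∈ M.facesOf p.1 := by simp [edges]

theorem sum_edges (f : Fin M.numCells → Fin M.numFaces → ℝ) :
    ∑ p ∈ M.edges, f p.1 p.2 = ∑ K, ∑ σ ∈ M.facesOf K, f K σ := by
  classical
  rw [edges, Finset.sum_filter, ← Finset.univ_product_univ, Finset.sum_product]
  refine Finset.sum_congr rfl fun K _ => ?_
  rw [← Finset.sum_filter]
  congr 1
  ext σ
  simp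

/-- Crossing the face is an involution on the pairs of a cell and one of its faces. This reindexing
is the source of all cancellations between neighbouring cells. -/
theorem sum_edges_flip (f : Fin M.numCells → Fin M.numFaces → ℝ) :
    ∑ p ∈ M.edges, f (M.flip p.1 p.2) p.2 = ∑ p ∈ M.edges, f p.1 p.2 := by
  refine Finset.sum_nbij' (fun p => (M.flip p.1 p.2, p.2)) (fun p => (M.flip p.1 p.2, p.2))
    ?_ ?_ ?_ ?_ ?_
  · exact fun p hp => M.mem_edges.2 (M.mem_facesOf_flip (M.mem_edges.1 hp))
  · exact fun p hp => M.mem_edges.2 (M.mem_facesOf_flip (M.mem_edges.1 hp))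
  · exact fun p hp => Prod.ext (M.flip_flip (M.mem_edges.1 hp)) rfl
  · exact fun p hp => Prod.ext (M.flip_flip (M.mem_edges.1 hp)) rfl
  · exact fun p _ => rfl

open Classical in
/-- The point across the face: the significant point of the neighbour, or the foot `y_σ`. -/
def opp (K : Fin M.numCells) (σ : Fin M.numFaces) : E3 :=
  if M.IsBd σ then M.foot σ else M.center (M.flip K σ)

/-- The distance `d_σ` between the points on both sides of a face. -/
def dd (K : Fin M.numCells) (σ : Fin M.numFaces) : ℝ := dist (M.center K) (M.opp K σ)

/-- The outer unit normal of `K` on `σ`. -/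
def nrm (K : Fin M.numCells) (σ : Fin M.numFaces) : E3 :=
  (M.dd K σ)⁻¹ • (M.opp K σ - M.center K)

/-- A point of the face. -/
def facePt (σ : Fin M.numFaces) : E3 := (nonempty_of_area_pos (M.face_pos σ)).some

theorem facePt_mem (σ : Fin M.numFaces) : M.facePt σ ∈ M.face σ :=
  (nonempty_of_area_pos (M.face_pos σ)).some_mem

/-- The distance of `x_K` to the plane of `σ`. -/
def ht (K : Fin M.numCells) (σ : Fin M.numFaces) : ℝ :=
  inner ℝ (M.nrm K σ) (M.facePt σ - M.center K)

theorem dd_pos {K : Fin M.numCells} {σ : Fin M.numFaces} (hK : σ ∈ M.facesOf K) :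
    0 < M.dd K σ := by
  rw [dd, dist_pos, opp]
  split_ifs with h
  · have := M.center_boundary K σ (M.mem_facesOf.1 hK) h
    exact fun h' => this.1 (h' ▸ this.2.1)
  · exact fun h' => (M.mem_neighbors.1 (M.flip_mem_neighbors hK h)).1
      (M.center_injective h').symm

theorem opp_sub_center {K : Fin M.numCells} {σ : Fin M.numFaces} (hK : σ ∈ M.facesOf K) :
    M.opp K σ - M.center K = M.dd K σ • M.nrm K σ := by
  rw [nrm, smul_inv_smul₀ (M.dd_pos hK).ne']

theorem norm_nrm {K : Fin M.numCells} {σ : Fin M.numFaces} (hK : σ ∈ M.facesOf K) :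
    ‖M.nrm K σ‖ = 1 := by
  rw [nrm, norm_smul, ← dist_eq_norm, dist_comm, ← dd, norm_inv, Real.norm_eq_abs,
    abs_of_pos (M.dd_pos hK), inv_mul_cancel₀ (M.dd_pos hK).ne']

/-- `nrm` is the outer normal. -/
theorem nrm_spec {K : Fin M.numCells} {σ : Fin M.numFaces} (hK : σ ∈ M.facesOf K) :
    M.face σ ⊆ {x | inner ℝ (M.nrm K σ) x = inner ℝ (M.nrm K σ) (M.facePt σ)} ∧
      M.cell K ⊆ {x | inner ℝ (M.nrm K σ) x < inner ℝ (M.nrm K σ) (M.facePt σ)} := by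
  obtain ⟨n, c, hn1, hn, hs⟩ := M.exists_outer_normal hK
  have hn0 : n ≠ 0 := by rintro rfl; simp at hn1
  have horth : ∀ y ∈ M.face σ, ∀ z ∈ M.face σ,
      inner ℝ (M.opp K σ - M.center K) (y - z) = 0 := by
    intro y hy z hz
    rw [opp]
    split_ifs with h
    · have h3 := (M.center_boundary K σ (M.mem_facesOf.1 hK) h).2.2
      have h4 : y - z = (y - M.foot σ) - (z - M.foot σ) := by abel
      rw [← neg_sub, inner_neg_left, h4, inner_sub_right, h3 y hy, h3 z hz, sub_self, neg_zero]
    · have h1 := M.mem_neighbors.1 (M.flip_mem_neighbors hK h)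
      rw [← neg_sub, inner_neg_left, M.center_orthogonal K _ h1.1.symm σ h1.2 y hy z hz, neg_zero]
  -- The point across the face is not on the side of `K`: it lies on the face itself or in the
  -- closure of the opposite cell. This fixes the sign of the multiple `r` of `n`.
  have hle : inner ℝ n (M.opp K σ) ≥ c := by
    rw [opp]
    split_ifs with h
    · exact (hn (M.center_boundary K σ (M.mem_facesOf.1 hK) h).2.1).ge
    · have h1 := M.mem_neighbors.1 (M.flip_mem_neighbors hK h)
      exact le_inner_closure (M.cell_opposite_side h1.1.symm hK (M.mem_facesOf_flip hK) hn hs)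
        (M.center_mem _)
  have hge := inner_closure_le hs (M.center_mem K)
  obtain ⟨r, hr⟩ := exists_smul_of_area_pos (M.face_pos σ) hn0
    (fun y hy z hz => by rw [inner_sub_right, hn hy, hn hz, sub_self]) horth
  have hr0 : 0 ≤ r := by
    have h2 : inner ℝ n (M.opp K σ - M.center K) = r := by
      rw [hr, real_inner_smul_right, real_inner_self_eq_norm_sq, hn1]; ring
    rw [inner_sub_right] at h2
    linarith
  have hdd : M.dd K σ = r := by
    have h2 : ‖M.opp K σ - M.center K‖ = r := by
      rw [hr, norm_smul, hn1, mul_one, Real.norm_eq_abs, abs_of_nonneg hr0]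
    rw [dd, dist_comm, dist_eq_norm, h2]
  have hnn : M.nrm K σ = n := by
    have hpos := M.dd_pos hK
    rw [nrm, hr, ← hdd, inv_smul_smul₀ hpos.ne']
  rw [hnn, show inner ℝ n (M.facePt σ) = c from hn (M.facePt_mem σ)]
  exact ⟨hn, hs⟩

theorem inner_nrm_sub_center {K : Fin M.numCells} {σ : Fin M.numFaces} (hK : σ ∈ M.facesOf K)
    {y : E3} (hy : y ∈ M.face σ) : inner ℝ (M.nrm K σ) (y - M.center K) = M.ht K σ := by
  rw [ht, inner_sub_right, inner_sub_right, (M.nrm_spec hK).1 hy]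

theorem ht_nonneg {K : Fin M.numCells} {σ : Fin M.numFaces} (hK : σ ∈ M.facesOf K) :
    0 ≤ M.ht K σ := by
  rw [ht, inner_sub_right, sub_nonneg]
  exact inner_closure_le (M.nrm_spec hK).2 (M.center_mem K)

theorem ht_of_isBd {K : Fin M.numCells} {σ : Fin M.numFaces} (hK : σ ∈ M.facesOf K)
    (h : M.IsBd σ) : M.ht K σ = M.dd K σ := by
  have h1 := M.opp_sub_center hK
  rw [opp, if_pos h] at h1
  rw [← M.inner_nrm_sub_center hK (M.center_boundary K σ (M.mem_facesOf.1 hK) h).2.1, h1,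
    real_inner_smul_right, real_inner_self_eq_norm_sq, M.norm_nrm hK]
  ring

theorem dd_flip {K : Fin M.numCells} {σ : Fin M.numFaces} (hK : σ ∈ M.facesOf K) :
    M.dd (M.flip K σ) σ = M.dd K σ := by
  by_cases h : M.IsBd σ
  · rw [M.flip_of_isBd K h]
  · rw [dd, dd, opp, opp, if_neg h, if_neg h, M.flip_flip hK, dist_comm]

theorem nrm_flip {K : Fin M.numCells} {σ : Fin M.numFaces} (hK : σ ∈ M.facesOf K)
    (h : ¬ M.IsBd σ) : M.nrm (M.flip K σ) σ = -M.nrm K σ := by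
  rw [nrm, nrm, M.dd_flip hK, opp, opp, if_neg h, if_neg h, M.flip_flip hK, ← smul_neg, neg_sub]

/-- The line through the two centres is normal to the face and the normals are opposite, so the
signed heights add up to the distance. A single height may vanish, since a centre may lie on an
interior face; divisions are therefore by `dd` only. -/
theorem ht_add_ht_flip {K : Fin M.numCells} {σ : Fin M.numFaces} (hK : σ ∈ M.facesOf K)
    (h : ¬ M.IsBd σ) : M.ht K σ + M.ht (M.flip K σ) σ = M.dd K σ := by
  have h1 := M.opp_sub_center hK
  rw [opp, if_neg h] at h1
  have h2 : inner ℝ (M.nrm K σ) (M.center (M.flip K σ) - M.center K) = M.dd K σ := by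
    rw [h1, real_inner_smul_right, real_inner_self_eq_norm_sq, M.norm_nrm hK]; ring
  rw [← h2, ht, ht, M.nrm_flip hK h, inner_neg_left, inner_sub_right, inner_sub_right,
    inner_sub_right]
  ring

theorem isPlanarBoundary_cell (K : Fin M.numCells) :
    IsPlanarBoundary (M.cell K) (M.facesOf K) M.face (M.nrm K)
      (fun σ => inner ℝ (M.nrm K σ) (M.facePt σ)) where
  closed σ _ := M.face_closed σ
  norm_eq σ hσ := M.norm_nrm hσ
  plane σ hσ := (M.nrm_spec hσ).1
  side σ hσ := (M.nrm_spec hσ).2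
  cover := by
    rw [M.frontier_cell K]
    ext x
    simp [mem_facesOf]
  overlap σ _ σ' _ hne := by
    -- The real number `area` is also zero for infinite measure; the positive area of a face rules
    -- this out.
    have h := M.face_overlap σ σ' hne
    rw [area, measureReal_def, ENNReal.toReal_eq_zero_iff] at h
    refine h.resolve_right (ne_top_of_le_ne_top (area_pos_iff.1 (M.face_pos σ)).2
      (measure_mono inter_subset_left))
  finite σ _ := (area_pos_iff.1 (M.face_pos σ)).2.lt_top

/-- The divergence theorem on a cell. -/
theorem integral_cell_fderiv (K : Fin M.numCells) {φ : E3 → ℝ} (hφ : ContDiff ℝ 1 φ) (i : Fin 3) :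
    ∫ x in M.cell K, fderiv ℝ φ x (EuclideanSpace.single i 1)
      = ∑ σ ∈ M.facesOf K, M.nrm K σ i *
          ∫ x in M.face σ, φ x ∂(Measure.euclideanHausdorffMeasure 2 : Measure E3) :=
  integral_fderiv_eq_sum_faces (M.isPlanarBoundary_cell K) (M.isOpen_cell K) (M.convex_cell K)
    (M.isBounded_cell K) hφ i

end AdmissibleMesh

end

/-! ### Discrete calculus: integration by parts and the Dirichlet form. -/

section

theorem fderiv_eq_sum_single (φ : E3 → ℝ) (x η : E3) :
    fderiv ℝ φ x η = ∑ i, η i * fderiv ℝ φ x (EuclideanSpace.single i 1) := by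
  conv_lhs => rw [← (EuclideanSpace.basisFun (Fin 3) ℝ).sum_repr η]
  simp [map_sum]

theorem inner_eq_sum (x y : E3) : inner ℝ x y = ∑ i, y i * x i := by
  simp [PiLp.inner_apply]

/-- The Laplacian. -/
def lap (q : E3 → ℝ) (x : E3) : ℝ :=
  ∑ i : Fin 3, fderiv ℝ (fun y => fderiv ℝ q y (EuclideanSpace.single i 1)) x
    (EuclideanSpace.single i 1)

theorem abs_mul_abs_sub_le (a b : ℝ) : abs (a * |a| - b * |b|) ≤ |a - b| * (|a| + |b|) := by
  have h : a * |a| - b * |b| = (a - b) * |a| + b * (|a| - |b|) := by ring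
  rw [h]
  calc abs ((a - b) * |a| + b * (|a| - |b|)) ≤ abs ((a - b) * |a|) + abs (b * (|a| - |b|)) :=
        abs_add_le _ _
    _ = |a - b| * |a| + |b| * abs (|a| - |b|) := by rw [abs_mul, abs_mul, abs_abs]
    _ ≤ |a - b| * |a| + |b| * |a - b| :=
        add_le_add le_rfl
          (mul_le_mul_of_nonneg_left (abs_abs_sub_abs_le_abs_sub a b) (abs_nonneg b))
    _ = _ := by ring

namespace AdmissibleMesh

variable {Ω : Set E3} (M : AdmissibleMesh Ω)

/-- The volume of a cell. -/
def mass (K : Fin M.numCells) : ℝ := volume.real (M.cell K)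

theorem mass_pos (K : Fin M.numCells) : 0 < M.mass K := by
  rw [mass, measureReal_def, ENNReal.toReal_pos_iff]
  exact ⟨(M.isOpen_cell K).measure_pos _ (M.nonempty_cell K), (M.isBounded_cell K).measure_lt_top⟩

theorem sum_mass_le (hΩ : volume Ω ≠ ⊤) : ∑ K, M.mass K ≤ volume.real Ω := by
  have h := measureReal_biUnion_finset (μ := (volume : Measure E3)) (s := Finset.univ) (f := M.cell)
    (fun K _ L _ h => M.cell_disjoint K L h) (fun K _ => M.measurableSet_cell K)
    (fun K _ => (M.isBounded_cell K).measure_lt_top.ne)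
  rw [show ∑ K, M.mass K = ∑ K, volume.real (M.cell K) from rfl, ← h]
  exact measureReal_mono (iUnion₂_subset fun K _ => M.cell_subset K) hΩ

open Classical in
/-- Weight counting every face once. -/
def wt (σ : Fin M.numFaces) : ℝ := if M.IsBd σ then 1 else 1 / 2

open Classical in
/-- The jump of a mesh function across a face, with value `0` outside `Ω`. -/
def jump (w : M.MeshFun) (K : Fin M.numCells) (σ : Fin M.numFaces) : ℝ :=
  if M.IsBd σ then w K else w K - w (M.flip K σ)

theorem wt_nonneg (σ : Fin M.numFaces) : 0 ≤ M.wt σ := by rw [wt]; split_ifs <;> norm_num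

theorem wt_le_one (σ : Fin M.numFaces) : M.wt σ ≤ 1 := by rw [wt]; split_ifs <;> norm_num

theorem jump_flip (w : M.MeshFun) {K : Fin M.numCells} {σ : Fin M.numFaces}
    (hK : σ ∈ M.facesOf K) (h : ¬ M.IsBd σ) : M.jump w (M.flip K σ) σ = -M.jump w K σ := by
  rw [jump, jump, if_neg h, if_neg h, M.flip_flip hK, neg_sub]

theorem flux_eq (w : M.MeshFun) (K : Fin M.numCells) :
    M.flux w K = ∑ σ ∈ M.facesOf K, area (M.face σ) / M.dd K σ * M.jump w K σ := by
  rw [flux, fluxCell]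
  refine Finset.sum_congr rfl fun σ hσ => ?_
  rw [fluxFace, jump, dd, opp]
  by_cases h : M.IsBd σ
  · have h' : M.face σ ⊆ frontier Ω := h
    simp only [if_pos h, if_pos h']; ring
  · have h' : ¬ M.face σ ⊆ frontier Ω := h
    simp only [if_neg h, if_neg h']
    rw [M.neighbors_eq_singleton hσ h, Finset.sum_singleton]; ring

/-- Discrete integration by parts. -/
theorem sum_mul_eq_sum_jump (z : M.MeshFun) (X : Fin M.numCells → Fin M.numFaces → ℝ)
    (hX : ∀ K σ, σ ∈ M.facesOf K → ¬ M.IsBd σ → X (M.flip K σ) σ = -X K σ) :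
    ∑ K, z K * ∑ σ ∈ M.facesOf K, X K σ
      = ∑ p ∈ M.edges, M.wt p.2 * (M.jump z p.1 p.2 * X p.1 p.2) := by
  classical
  simp_rw [Finset.mul_sum]
  rw [← M.sum_edges (fun K σ => z K * X K σ)]
  -- Across an interior face the jump term is `(z_K X_K + z_L X_L) / 2`, which differs from `z_K
  -- X_K` by `f_L - f_K`; these differences sum to zero by the flip.
  let f : Fin M.numCells → Fin M.numFaces → ℝ := fun K σ => if M.IsBd σ then 0 else z K * X K σ / 2
  have h1 := M.sum_edges_flip f
  have h2 : ∑ p ∈ M.edges, M.wt p.2 * (M.jump z p.1 p.2 * X p.1 p.2)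
      = ∑ p ∈ M.edges, (z p.1 * X p.1 p.2 + (f (M.flip p.1 p.2) p.2 - f p.1 p.2)) := by
    refine Finset.sum_congr rfl fun p hp => ?_
    simp only [wt, jump, f]
    by_cases h : M.IsBd p.2
    · simp only [if_pos h]; ring
    · simp only [if_neg h]
      rw [hX p.1 p.2 (M.mem_edges.1 hp) h]; ring
  rw [h2, Finset.sum_add_distrib, Finset.sum_sub_distrib, h1, sub_self, add_zero]

/-- The discrete Dirichlet form. -/
def form (z w : M.MeshFun) : ℝ :=
  ∑ p ∈ M.edges, M.wt p.2 * (M.jump z p.1 p.2 *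
    (area (M.face p.2) / M.dd p.1 p.2 * M.jump w p.1 p.2))

theorem sum_mul_flux (z w : M.MeshFun) : ∑ K, z K * M.flux w K = M.form z w := by
  simp_rw [flux_eq]
  rw [M.sum_mul_eq_sum_jump z (fun K σ => area (M.face σ) / M.dd K σ * M.jump w K σ)]
  · rfl
  · intro K σ hK h
    rw [M.dd_flip hK, M.jump_flip w hK h]; ring

theorem form_comm (z w : M.MeshFun) : M.form z w = M.form w z :=
  Finset.sum_congr rfl fun p _ => by ring

theorem form_self_nonneg (z : M.MeshFun) : 0 ≤ M.form z z := by
  refine Finset.sum_nonneg fun p hp => mul_nonneg (M.wt_nonneg _) ?_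
  have := (M.dd_pos (M.mem_edges.1 hp)).le
  have h2 := (M.face_pos p.2).le
  have h3 : M.jump z p.1 p.2 * (area (M.face p.2) / M.dd p.1 p.2 * M.jump z p.1 p.2)
    = area (M.face p.2) / M.dd p.1 p.2 * M.jump z p.1 p.2 ^ 2 := by ring
  rw [h3]; positivity

theorem form_sq_le (z w : M.MeshFun) : M.form z w ^ 2 ≤ M.form z z * M.form w w := by
  refine Finset.sum_sq_le_sum_mul_sum_of_sq_le_mul _ ?_ ?_ ?_
  · intro p hp
    have := (M.dd_pos (M.mem_edges.1 hp)).le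
    have h2 := (M.face_pos p.2).le
    have h3 := M.wt_nonneg p.2
    have h4 : M.wt p.2 * (M.jump z p.1 p.2 * (area (M.face p.2) / M.dd p.1 p.2 * M.jump z p.1 p.2))
      = M.wt p.2 * (area (M.face p.2) / M.dd p.1 p.2) * M.jump z p.1 p.2 ^ 2 := by ring
    rw [h4]; positivity
  · intro p hp
    have := (M.dd_pos (M.mem_edges.1 hp)).le
    have h2 := (M.face_pos p.2).le
    have h3 := M.wt_nonneg p.2
    have h4 : M.wt p.2 * (M.jump w p.1 p.2 * (area (M.face p.2) / M.dd p.1 p.2 * M.jump w p.1 p.2))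
      = M.wt p.2 * (area (M.face p.2) / M.dd p.1 p.2) * M.jump w p.1 p.2 ^ 2 := by ring
    rw [h4]; positivity
  · intro p _; exact le_of_eq (by ring)

/-! ### Surface integrals over faces, total variation and pyramids. -/

theorem isCompact_face {K : Fin M.numCells} {σ : Fin M.numFaces} (hK : σ ∈ M.facesOf K) :
    IsCompact (M.face σ) :=
  Metric.isCompact_of_isClosed_isBounded (M.face_closed σ)
    ((M.isBounded_cell K).closure.subset (M.face_subset_closure hK))

theorem integrableOn_face {K : Fin M.numCells} {σ : Fin M.numFaces} (hK : σ ∈ M.facesOf K)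
    {φ : E3 → ℝ} (hφ : Continuous φ) :
    IntegrableOn φ (M.face σ) (Measure.euclideanHausdorffMeasure 2) := by
  obtain ⟨C, hC⟩ := (M.isCompact_face hK).exists_bound_of_continuousOn hφ.continuousOn
  exact Measure.integrableOn_of_bounded (area_pos_iff.1 (M.face_pos σ)).2
    hφ.aestronglyMeasurable ((ae_restrict_mem (M.face_closed σ).measurableSet).mono hC)

theorem integrableOn_cell (K : Fin M.numCells) {φ : E3 → ℝ} (hφ : Continuous φ) :
    IntegrableOn φ (M.cell K) :=
  (hφ.continuousOn.integrableOn_compact (M.isBounded_cell K).isCompact_closure).mono_set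
    subset_closure

/-- Surface integral over a face. -/
def faceInt (φ : E3 → ℝ) (σ : Fin M.numFaces) : ℝ :=
  ∫ x in M.face σ, φ x ∂(Measure.euclideanHausdorffMeasure 2 : Measure E3)

theorem faceInt_one (σ : Fin M.numFaces) : M.faceInt (fun _ => 1) σ = area (M.face σ) := by
  simp [faceInt, area]

theorem abs_faceInt_le {φ : E3 → ℝ} {B : ℝ} {σ : Fin M.numFaces}
    (hB : ∀ x ∈ M.face σ, |φ x| ≤ B) : |M.faceInt φ σ| ≤ B * area (M.face σ) := by
  rw [faceInt, area, ← Real.norm_eq_abs]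
  exact norm_setIntegral_le_of_norm_le_const (area_pos_iff.1 (M.face_pos σ)).2.lt_top hB

theorem integral_cell_fderiv_dir (K : Fin M.numCells) {φ : E3 → ℝ} (hφ : ContDiff ℝ 1 φ) (η : E3) :
    ∫ x in M.cell K, fderiv ℝ φ x η
      = ∑ σ ∈ M.facesOf K, inner ℝ (M.nrm K σ) η * M.faceInt φ σ := by
  have hc : ∀ i : Fin 3, Continuous fun x => fderiv ℝ φ x (EuclideanSpace.single i 1) := fun i =>
    (hφ.continuous_fderiv one_ne_zero).clm_apply continuous_const
  simp_rw [fderiv_eq_sum_single φ _ η]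
  rw [integral_finsetSum _ fun i _ => (M.integrableOn_cell K (hc i)).const_mul _]
  simp_rw [integral_const_mul, M.integral_cell_fderiv K hφ, Finset.mul_sum]
  rw [Finset.sum_comm]
  refine Finset.sum_congr rfl fun σ _ => ?_
  rw [inner_eq_sum, Finset.sum_mul]
  exact Finset.sum_congr rfl fun i _ => by rw [faceInt, mul_assoc]

/-- The distributional gradient of the piecewise constant function, extended by zero, is carried by
the faces, with density given up to sign by the jump times the normal. -/
theorem sum_mul_integral_fderiv (z : M.MeshFun) {φ : E3 → ℝ} (hφ : ContDiff ℝ 1 φ) (η : E3) :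
    ∑ K, z K * ∫ x in M.cell K, fderiv ℝ φ x η
      = ∑ p ∈ M.edges, M.wt p.2 * (M.jump z p.1 p.2 *
          (inner ℝ (M.nrm p.1 p.2) η * M.faceInt φ p.2)) := by
  simp_rw [M.integral_cell_fderiv_dir _ hφ η]
  refine M.sum_mul_eq_sum_jump z (fun K σ => inner ℝ (M.nrm K σ) η * M.faceInt φ σ) ?_
  intro K σ hK h
  rw [M.nrm_flip hK h, inner_neg_left, neg_mul]

/-- The total variation of the piecewise constant function, extended by `0`. -/
def tv (g : M.MeshFun) : ℝ :=
  ∑ p ∈ M.edges, M.wt p.2 * (|M.jump g p.1 p.2| * area (M.face p.2))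

theorem abs_sum_mul_integral_fderiv_le (g : M.MeshFun) {φ : E3 → ℝ} (hφ : ContDiff ℝ 1 φ) (η : E3)
    {B : ℝ} (hB : ∀ x, |φ x| ≤ B) :
    |∑ K, g K * ∫ x in M.cell K, fderiv ℝ φ x η| ≤ ‖η‖ * B * M.tv g := by
  rw [M.sum_mul_integral_fderiv g hφ η, tv, Finset.mul_sum]
  refine (Finset.abs_sum_le_sum_abs _ _).trans (Finset.sum_le_sum fun p hp => ?_)
  rw [abs_mul, abs_mul, abs_mul, abs_of_nonneg (M.wt_nonneg _)]
  have h1 : |inner ℝ (M.nrm p.1 p.2) η| ≤ ‖η‖ := by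
    have := abs_real_inner_le_norm (M.nrm p.1 p.2) η
    rwa [M.norm_nrm (M.mem_edges.1 hp), one_mul] at this
  have h2 : |M.faceInt φ p.2| ≤ B * area (M.face p.2) := M.abs_faceInt_le fun x _ => hB x
  have h3 := M.wt_nonneg p.2
  calc M.wt p.2 * (|M.jump g p.1 p.2| * (|inner ℝ (M.nrm p.1 p.2) η| * |M.faceInt φ p.2|))
      ≤ M.wt p.2 * (|M.jump g p.1 p.2| * (‖η‖ * (B * area (M.face p.2)))) := by gcongr
    _ = _ := by ring

/-- For an interior face, `dd` is the sum of the two heights, and each of them is assigned to its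
own cell; on the boundary `dd` is the height. The weight corrects for interior faces occurring in
two pairs. -/
theorem sum_wt_dd (Φ : Fin M.numFaces → ℝ) :
    ∑ p ∈ M.edges, M.wt p.2 * (M.dd p.1 p.2 * Φ p.2) = ∑ p ∈ M.edges, M.ht p.1 p.2 * Φ p.2 := by
  classical
  let f : Fin M.numCells → Fin M.numFaces → ℝ := fun K σ =>
    if M.IsBd σ then 0 else M.ht K σ * Φ σ / 2
  have h1 := M.sum_edges_flip f
  have h2 : ∑ p ∈ M.edges, M.wt p.2 * (M.dd p.1 p.2 * Φ p.2)
      = ∑ p ∈ M.edges, (M.ht p.1 p.2 * Φ p.2 + (f (M.flip p.1 p.2) p.2 - f p.1 p.2)) := by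
    refine Finset.sum_congr rfl fun p hp => ?_
    simp only [wt, f]
    by_cases h : M.IsBd p.2
    · simp only [if_pos h]; rw [M.ht_of_isBd (M.mem_edges.1 hp) h]; ring
    · simp only [if_neg h]; rw [← M.ht_add_ht_flip (M.mem_edges.1 hp) h]; ring
  rw [h2, Finset.sum_add_distrib, Finset.sum_sub_distrib, h1, sub_self, add_zero]

/-- This is the divergence theorem for the field `(x - x_K) φ`, whose normal component on `σ` is the
constant height times `φ`. -/
theorem sum_ht_faceInt (K : Fin M.numCells) {φ : E3 → ℝ} (hφ : ContDiff ℝ 1 φ) :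
    ∑ σ ∈ M.facesOf K, M.ht K σ * M.faceInt φ σ
      = ∫ x in M.cell K, (3 * φ x + fderiv ℝ φ x (x - M.center K)) := by
  have hcoord : ∀ i : Fin 3, ContDiff ℝ 1 fun x : E3 => x i - M.center K i := fun i =>
    (contDiff_piLp_apply 2).sub contDiff_const
  have hψ : ∀ i : Fin 3, ContDiff ℝ 1 fun x : E3 => (x i - M.center K i) * φ x := fun i =>
    (hcoord i).mul hφ
  have hder : ∀ (i : Fin 3) (x : E3),
      fderiv ℝ (fun x : E3 => (x i - M.center K i) * φ x) x (EuclideanSpace.single i 1)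
        = φ x + (x i - M.center K i) * fderiv ℝ φ x (EuclideanSpace.single i 1) := by
    intro i x
    have h1 : HasFDerivAt (fun x : E3 => x i - M.center K i)
        (EuclideanSpace.proj i : E3 →L[ℝ] ℝ) x :=
      ((EuclideanSpace.proj i : E3 →L[ℝ] ℝ).hasFDerivAt).sub_const _
    have h2 := h1.mul ((hφ.differentiable one_ne_zero) x).hasFDerivAt
    rw [HasFDerivAt.fderiv (f := fun x : E3 => (x i - M.center K i) * φ x) h2]
    simp; ring
  have h1 : ∀ σ ∈ M.facesOf K, M.ht K σ * M.faceInt φ σ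
      = ∑ i, M.nrm K σ i * M.faceInt (fun x => (x i - M.center K i) * φ x) σ := by
    intro σ hσ
    simp only [faceInt]
    simp_rw [← integral_const_mul]
    rw [← integral_finsetSum _ fun i _ =>
      (M.integrableOn_face hσ (hψ i).continuous).const_mul _]
    refine setIntegral_congr_fun (M.face_closed σ).measurableSet fun y hy => ?_
    dsimp only
    rw [← M.inner_nrm_sub_center hσ hy, inner_eq_sum, Finset.sum_mul]
    exact Finset.sum_congr rfl fun i _ => by simp; ring
  rw [Finset.sum_congr rfl h1, Finset.sum_comm]
  have h2 : ∀ i : Fin 3, ∑ σ ∈ M.facesOf K,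
      M.nrm K σ i * M.faceInt (fun x => (x i - M.center K i) * φ x) σ
      = ∫ x in M.cell K, (φ x + (x i - M.center K i) * fderiv ℝ φ x (EuclideanSpace.single i 1)) := by
    intro i
    have := M.integral_cell_fderiv K (hψ i) i
    simp_rw [hder i] at this
    exact this.symm
  have hc : ∀ i : Fin 3, Continuous fun x => fderiv ℝ φ x (EuclideanSpace.single i 1) := fun i =>
    (hφ.continuous_fderiv one_ne_zero).clm_apply continuous_const
  have h3 := integral_finsetSum (μ := volume.restrict (M.cell K)) Finset.univ
    (f := fun (i : Fin 3) (x : E3) =>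
      φ x + (x i - M.center K i) * fderiv ℝ φ x (EuclideanSpace.single i 1))
    (fun i _ => M.integrableOn_cell K (hφ.continuous.add ((hcoord i).continuous.mul (hc i))))
  rw [Finset.sum_congr rfl fun i _ => h2 i, ← h3]
  refine integral_congr_ae (Eventually.of_forall fun x => ?_)
  dsimp only
  rw [fderiv_eq_sum_single φ x (x - M.center K), Finset.sum_add_distrib]
  simp

theorem sum_wt_dd_faceInt {φ : E3 → ℝ} (hφ : ContDiff ℝ 1 φ) :
    ∑ p ∈ M.edges, M.wt p.2 * (M.dd p.1 p.2 * M.faceInt φ p.2)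
      = ∑ K, ∫ x in M.cell K, (3 * φ x + fderiv ℝ φ x (x - M.center K)) := by
  rw [M.sum_wt_dd, M.sum_edges (fun K σ => M.ht K σ * M.faceInt φ σ)]
  exact Finset.sum_congr rfl fun K _ => M.sum_ht_faceInt K hφ

/-- The case `φ = 1`: the volume of a cell as the sum of pyramids with apex `x_K`. -/
theorem sum_ht_area (K : Fin M.numCells) :
    ∑ σ ∈ M.facesOf K, M.ht K σ * area (M.face σ) = 3 * M.mass K := by
  have := M.sum_ht_faceInt K (φ := fun _ => 1) contDiff_const
  simp only [faceInt_one] at this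
  rw [this]
  simp [mass, mul_comm]

theorem sum_wt_dd_area_le (hΩ : volume Ω ≠ ⊤) :
    ∑ p ∈ M.edges, M.wt p.2 * (M.dd p.1 p.2 * area (M.face p.2)) ≤ 3 * volume.real Ω := by
  rw [M.sum_wt_dd (fun σ => area (M.face σ)), M.sum_edges (fun K σ => M.ht K σ * area (M.face σ))]
  simp_rw [M.sum_ht_area]
  rw [← Finset.mul_sum]
  gcongr
  exact M.sum_mass_le hΩ

/-! ### Mesh size, and the total variation of `z |z|`. -/

theorem meshNorm_nonneg : 0 ≤ M.meshNorm :=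
  Real.iSup_nonneg fun _ => Real.sInf_nonneg fun _ hr => hr.1.le

theorem dist_le_of_mem_closure {K : Fin M.numCells} {x y : E3} (hx : x ∈ closure (M.cell K))
    (hy : y ∈ closure (M.cell K)) : dist x y ≤ 2 * M.meshNorm := by
  set S : Set ℝ := {r : ℝ | 0 < r ∧ ∃ x₀ : E3, ∀ x ∈ M.cell K, ‖x - x₀‖ < r} with hS
  have h1 : dist x y / 2 ≤ sInf S := by
    refine le_csInf ?_ ?_
    · obtain ⟨C, hC⟩ := (M.isBounded_cell K).exists_norm_le
      refine ⟨|C| + 1, by positivity, 0, fun x hx => ?_⟩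
      rw [sub_zero]
      exact (hC x hx).trans_lt ((le_abs_self C).trans_lt (lt_add_one _))
    · rintro r ⟨hr, x₀, hx₀⟩
      have hsub : closure (M.cell K) ⊆ Metric.closedBall x₀ r :=
        closure_minimal (fun z hz => by
          rw [Metric.mem_closedBall, dist_eq_norm]; exact (hx₀ z hz).le) Metric.isClosed_closedBall
      have h2 := hsub hx
      have h3 := hsub hy
      rw [Metric.mem_closedBall] at h2 h3
      have := dist_triangle_right x y x₀
      linarith
  have h2 : sInf S ≤ M.meshNorm :=
    le_ciSup (f := fun K => sInf {r : ℝ | 0 < r ∧ ∃ x₀ : E3, ∀ x ∈ M.cell K, ‖x - x₀‖ < r})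
      (Set.finite_range _).bddAbove K
  linarith

theorem dist_opp_le {K : Fin M.numCells} {σ : Fin M.numFaces} (hK : σ ∈ M.facesOf K) {y : E3}
    (hy : y ∈ M.face σ) : dist (M.opp K σ) y ≤ 2 * M.meshNorm := by
  rw [opp]
  split_ifs with h
  · exact M.dist_le_of_mem_closure
      (M.face_subset_closure hK (M.center_boundary K σ (M.mem_facesOf.1 hK) h).2.1)
      (M.face_subset_closure hK hy)
  · exact M.dist_le_of_mem_closure (M.center_mem _)
      (M.face_subset_closure (M.mem_facesOf_flip hK) hy)

theorem dist_center_le {K : Fin M.numCells} {σ : Fin M.numFaces} (hK : σ ∈ M.facesOf K) {y : E3}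
    (hy : y ∈ M.face σ) : dist (M.center K) y ≤ 2 * M.meshNorm :=
  M.dist_le_of_mem_closure (M.center_mem _) (M.face_subset_closure hK hy)

theorem dd_le {K : Fin M.numCells} {σ : Fin M.numFaces} (hK : σ ∈ M.facesOf K) :
    M.dd K σ ≤ 4 * M.meshNorm := by
  have h1 := M.dist_opp_le hK (M.facePt_mem σ)
  have h2 := M.dist_center_le hK (M.facePt_mem σ)
  have := dist_triangle_right (M.center K) (M.opp K σ) (M.facePt σ)
  rw [dd]; linarith

/-- The squared `L²` norm of the piecewise constant function. -/
def normSq (z : M.MeshFun) : ℝ := ∑ K, M.mass K * z K ^ 2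

theorem ht_le_dd {K : Fin M.numCells} {σ : Fin M.numFaces} (hK : σ ∈ M.facesOf K) :
    M.ht K σ ≤ M.dd K σ := by
  by_cases h : M.IsBd σ
  · exact (M.ht_of_isBd hK h).le
  · have := M.ht_nonneg (M.mem_facesOf_flip hK)
    linarith [M.ht_add_ht_flip hK h]

/-- The total variation of `z |z|` is controlled by the Dirichlet form and the `L²` norm. -/
theorem tv_mul_abs_le (z : M.MeshFun) :
    M.tv (fun K => z K * |z K|) ≤ (4 * M.meshNorm + 2) * M.form z z + 6 * M.normSq z := by
  classical
  -- Each cell value is weighted with its own height: the sum of `ht * area` over the faces of `K`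
  -- is `3 m(K)`, whereas `dd` involves the neighbour and would call for a regularity assumption on
  -- the mesh.
  let G : Fin M.numCells → Fin M.numFaces → ℝ := fun K σ =>
    M.wt σ * (area (M.face σ) / M.dd K σ * (|M.jump z K σ| * (M.ht K σ * |z K|)))
  have hkey : ∀ p ∈ M.edges, M.wt p.2 * (|M.jump (fun K => z K * |z K|) p.1 p.2| * area (M.face p.2))
      ≤ M.wt p.2 * (area (M.face p.2) * M.jump z p.1 p.2 ^ 2)
        + 2 * (G p.1 p.2 + G (M.flip p.1 p.2) p.2) := by
    intro p hp
    have hK := M.mem_edges.1 hp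
    have hd := M.dd_pos hK
    have ha := (M.face_pos p.2).le
    have hw := M.wt_nonneg p.2
    have hh := M.ht_nonneg hK
    have hh' := M.ht_nonneg (M.mem_facesOf_flip hK)
    have hG0 : ∀ K, p.2 ∈ M.facesOf K → 0 ≤ G K p.2 := fun K hK' => by
      have h1 := M.dd_pos hK'
      have h2 := M.ht_nonneg hK'
      simp only [G]; positivity
    by_cases h : M.IsBd p.2
    · have h1 : |M.jump (fun K => z K * |z K|) p.1 p.2| = M.jump z p.1 p.2 ^ 2 := by
        simp only [jump, if_pos h]; rw [abs_mul, abs_abs, ← sq, sq_abs]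
      rw [h1]
      have := hG0 _ hK
      have := hG0 _ (M.mem_facesOf_flip hK)
      nlinarith
    · set a := z p.1 with hza
      set b := z (M.flip p.1 p.2) with hzb
      have hj : M.jump z p.1 p.2 = a - b := by simp only [jump, if_neg h]; rfl
      have hj' : M.jump z (M.flip p.1 p.2) p.2 = b - a := by
        rw [M.jump_flip z hK h, hj, neg_sub]
      have h1 : |M.jump (fun K => z K * |z K|) p.1 p.2| ≤ |a - b| * (|a| + |b|) := by
        simp only [jump, if_neg h]; exact abs_mul_abs_sub_le a b
      have hsum := M.ht_add_ht_flip hK h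
      have hab : |b| ≤ |a| + |a - b| := by
        have := abs_sub_abs_le_abs_sub b a; rw [abs_sub_comm] at this; linarith
      have hba : |a| ≤ |b| + |a - b| := by
        have := abs_sub_abs_le_abs_sub a b; linarith
      -- Split `dd` into the two heights; where a value carries the height of the other cell,
      -- replace it by the value of that cell plus the jump.
      have h2 : M.dd p.1 p.2 * (|a| + |b|) ≤ M.dd p.1 p.2 * |a - b|
          + 2 * (M.ht p.1 p.2 * |a| + M.ht (M.flip p.1 p.2) p.2 * |b|) := by
        rw [← hsum]
        nlinarith [mul_le_mul_of_nonneg_left hab hh, mul_le_mul_of_nonneg_left hba hh']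
      have h3 : |a| + |b| ≤ |a - b|
          + 2 * (M.ht p.1 p.2 * |a| + M.ht (M.flip p.1 p.2) p.2 * |b|) / M.dd p.1 p.2 := by
        rw [← sub_le_iff_le_add', le_div_iff₀ hd]; linarith
      have h4 : G p.1 p.2 + G (M.flip p.1 p.2) p.2 = M.wt p.2 * (area (M.face p.2) * (|a - b| *
          ((M.ht p.1 p.2 * |a| + M.ht (M.flip p.1 p.2) p.2 * |b|) / M.dd p.1 p.2))) := by
        simp only [G]
        rw [M.dd_flip hK, hj, hj', abs_sub_comm b a]; field_simp; ring
      rw [h4, hj]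
      calc M.wt p.2 * (|M.jump (fun K => z K * |z K|) p.1 p.2| * area (M.face p.2))
          ≤ M.wt p.2 * ((|a - b| * (|a - b|
          + 2 * (M.ht p.1 p.2 * |a| + M.ht (M.flip p.1 p.2) p.2 * |b|) / M.dd p.1 p.2))
            * area (M.face p.2)) := by
            gcongr; exact h1.trans (by gcongr)
        _ = _ := by rw [← sq_abs (a - b)]; ring
  have hflip := M.sum_edges_flip G
  have hA : ∑ p ∈ M.edges, M.wt p.2 * (area (M.face p.2) * M.jump z p.1 p.2 ^ 2)
      ≤ 4 * M.meshNorm * M.form z z := by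
    rw [form, Finset.mul_sum]
    refine Finset.sum_le_sum fun p hp => ?_
    have hK := M.mem_edges.1 hp
    have hd := M.dd_pos hK
    have ha := (M.face_pos p.2).le
    have hw := M.wt_nonneg p.2
    calc M.wt p.2 * (area (M.face p.2) * M.jump z p.1 p.2 ^ 2)
        = M.dd p.1 p.2 * (M.wt p.2 * (area (M.face p.2) / M.dd p.1 p.2) * M.jump z p.1 p.2 ^ 2) := by
          field_simp
      _ ≤ 4 * M.meshNorm *
          (M.wt p.2 * (area (M.face p.2) / M.dd p.1 p.2) * M.jump z p.1 p.2 ^ 2) := by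
          gcongr; exact M.dd_le hK
      _ = _ := by ring
  -- By Young's inequality each term is at most half of `jump²` plus `(ht |z|)²`, with weight `area
  -- / dd`; since `ht ≤ dd`, the second square becomes a volume term.
  have hB : ∑ p ∈ M.edges, G p.1 p.2 ≤ (M.form z z + 3 * M.normSq z) / 2 := by
    have h1 : 3 * M.normSq z
        = ∑ p ∈ M.edges, M.ht p.1 p.2 * area (M.face p.2) * z p.1 ^ 2 := by
      rw [M.sum_edges (fun K σ => M.ht K σ * area (M.face σ) * z K ^ 2), normSq, Finset.mul_sum]
      refine Finset.sum_congr rfl fun K _ => ?_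
      rw [← Finset.sum_mul, M.sum_ht_area]; ring
    rw [h1, form, ← Finset.sum_add_distrib, Finset.sum_div]
    refine Finset.sum_le_sum fun p hp => ?_
    have hK := M.mem_edges.1 hp
    have hd := M.dd_pos hK
    have ha := (M.face_pos p.2).le
    have hw := M.wt_nonneg p.2
    have hw1 := M.wt_le_one p.2
    have hh := M.ht_nonneg hK
    have hle := M.ht_le_dd hK
    have h2 : M.wt p.2 * (area (M.face p.2) / M.dd p.1 p.2) * (M.ht p.1 p.2 * |z p.1|) ^ 2
        ≤ M.ht p.1 p.2 * area (M.face p.2) * z p.1 ^ 2 := by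
      calc M.wt p.2 * (area (M.face p.2) / M.dd p.1 p.2) * (M.ht p.1 p.2 * |z p.1|) ^ 2
          = M.wt p.2 * (M.ht p.1 p.2 / M.dd p.1 p.2) *
            (M.ht p.1 p.2 * area (M.face p.2) * z p.1 ^ 2) := by
            rw [mul_pow, sq_abs]; field_simp
        _ ≤ 1 * 1 * (M.ht p.1 p.2 * area (M.face p.2) * z p.1 ^ 2) := by
            gcongr; rwa [div_le_one hd]
        _ = _ := by ring
    have h3 : M.wt p.2 * (area (M.face p.2) / M.dd p.1 p.2) *
        (2 * |M.jump z p.1 p.2| * (M.ht p.1 p.2 * |z p.1|))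
        ≤ M.wt p.2 * (area (M.face p.2) / M.dd p.1 p.2) *
        (|M.jump z p.1 p.2| ^ 2 + (M.ht p.1 p.2 * |z p.1|) ^ 2) := by
      gcongr; exact two_mul_le_add_sq _ _
    rw [sq_abs] at h3
    simp only [G]
    linarith
  calc M.tv (fun K => z K * |z K|)
      ≤ ∑ p ∈ M.edges, (M.wt p.2 * (area (M.face p.2) * M.jump z p.1 p.2 ^ 2)
        + 2 * (G p.1 p.2 + G (M.flip p.1 p.2) p.2)) := Finset.sum_le_sum hkey
    _ = ∑ p ∈ M.edges, M.wt p.2 * (area (M.face p.2) * M.jump z p.1 p.2 ^ 2)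
        + 4 * ∑ p ∈ M.edges, G p.1 p.2 := by
        rw [Finset.sum_add_distrib, ← Finset.mul_sum, Finset.sum_add_distrib, hflip]; ring
    _ ≤ _ := by linarith

/-- Cauchy–Schwarz for face sums. -/
theorem sum_jump_sq_le (hΩ : volume Ω ≠ ⊤) (z : M.MeshFun)
    (X : Fin M.numCells → Fin M.numFaces → ℝ) {B : ℝ}
    (hX : ∀ K σ, σ ∈ M.facesOf K → |X K σ| ≤ B * area (M.face σ)) :
    (∑ p ∈ M.edges, M.wt p.2 * (M.jump z p.1 p.2 * X p.1 p.2)) ^ 2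
      ≤ M.form z z * (B ^ 2 * (3 * volume.real Ω)) := by
  -- The jumps carry the weight `area / dd` and `X` the inverse weight; the bound on `X` then leaves
  -- the sum of `dd * area`, at most three times the volume of `Ω`.
  have h1 : (∑ p ∈ M.edges, M.wt p.2 * (M.jump z p.1 p.2 * X p.1 p.2)) ^ 2
      ≤ M.form z z * ∑ p ∈ M.edges, M.wt p.2 * (M.dd p.1 p.2 / area (M.face p.2)) *
        X p.1 p.2 ^ 2 := by
    refine Finset.sum_sq_le_sum_mul_sum_of_sq_le_mul _ ?_ ?_ ?_
    · intro p hp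
      have := (M.dd_pos (M.mem_edges.1 hp)).le
      have h2 := (M.face_pos p.2).le
      have h3 := M.wt_nonneg p.2
      have h4 : M.wt p.2 * (M.jump z p.1 p.2 *
          (area (M.face p.2) / M.dd p.1 p.2 * M.jump z p.1 p.2))
        = M.wt p.2 * (area (M.face p.2) / M.dd p.1 p.2) * M.jump z p.1 p.2 ^ 2 := by ring
      rw [h4]; positivity
    · intro p hp
      have := (M.dd_pos (M.mem_edges.1 hp)).le
      have h2 := (M.face_pos p.2).le
      have h3 := M.wt_nonneg p.2
      positivity
    · intro p hp
      have := M.dd_pos (M.mem_edges.1 hp)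
      have h2 := M.face_pos p.2
      refine le_of_eq ?_
      field_simp
  refine h1.trans (mul_le_mul_of_nonneg_left ?_ (M.form_self_nonneg z))
  calc ∑ p ∈ M.edges, M.wt p.2 * (M.dd p.1 p.2 / area (M.face p.2)) * X p.1 p.2 ^ 2
      ≤ ∑ p ∈ M.edges, B ^ 2 * (M.wt p.2 * (M.dd p.1 p.2 * area (M.face p.2))) := by
        refine Finset.sum_le_sum fun p hp => ?_
        have hd := M.dd_pos (M.mem_edges.1 hp)
        have ha := M.face_pos p.2
        have hw := M.wt_nonneg p.2
        have hx := hX p.1 p.2 (M.mem_edges.1 hp)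
        calc M.wt p.2 * (M.dd p.1 p.2 / area (M.face p.2)) * X p.1 p.2 ^ 2
            ≤ M.wt p.2 * (M.dd p.1 p.2 / area (M.face p.2)) * (B * area (M.face p.2)) ^ 2 := by
              gcongr ?_ * ?_
              rw [← sq_abs]; exact pow_le_pow_left₀ (abs_nonneg _) hx 2
          _ = _ := by field_simp
    _ = B ^ 2 * ∑ p ∈ M.edges, M.wt p.2 * (M.dd p.1 p.2 * area (M.face p.2)) := by
        rw [Finset.mul_sum]
    _ ≤ _ := by gcongr; exact M.sum_wt_dd_area_le hΩ

/-! ### Sampled smooth functions and consistency of the fluxes. -/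

/-- For a function vanishing on the boundary, the jump is the difference across the face. -/
theorem jump_comp_center {q : E3 → ℝ} (hq : ∀ x ∈ frontier Ω, q x = 0) {K : Fin M.numCells}
    {σ : Fin M.numFaces} (hK : σ ∈ M.facesOf K) :
    M.jump (fun K => q (M.center K)) K σ = q (M.center K) - q (M.opp K σ) := by
  rw [jump, opp]
  split_ifs with h
  · rw [hq _ (h (M.center_boundary K σ (M.mem_facesOf.1 hK) h).2.1), sub_zero]
  · rfl

/-- Since `q` vanishes on the boundary, every jump is a difference of `q` over the distance `dd`.
The bound does not depend on the mesh, which makes the time equicontinuity uniform. -/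
theorem form_comp_center_le (hΩ : volume Ω ≠ ⊤) {q : E3 → ℝ} (hq : ∀ x ∈ frontier Ω, q x = 0)
    {B : ℝ} (hB : ∀ x y, |q x - q y| ≤ B * dist x y) :
    M.form (fun K => q (M.center K)) (fun K => q (M.center K)) ≤ B ^ 2 * (3 * volume.real Ω) := by
  refine le_trans ?_ (mul_le_mul_of_nonneg_left (M.sum_wt_dd_area_le hΩ) (sq_nonneg B))
  rw [form, Finset.mul_sum]
  refine Finset.sum_le_sum fun p hp => ?_
  have hK := M.mem_edges.1 hp
  have hd := M.dd_pos hK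
  have ha := M.face_pos p.2
  have hw := M.wt_nonneg p.2
  rw [M.jump_comp_center hq hK]
  have h1 : |q (M.center p.1) - q (M.opp p.1 p.2)| ≤ B * M.dd p.1 p.2 := hB _ _
  calc M.wt p.2 * ((q (M.center p.1) - q (M.opp p.1 p.2)) * (area (M.face p.2) / M.dd p.1 p.2 *
        (q (M.center p.1) - q (M.opp p.1 p.2))))
      = M.wt p.2 * (area (M.face p.2) / M.dd p.1 p.2) *
        |q (M.center p.1) - q (M.opp p.1 p.2)| ^ 2 := by rw [sq_abs]; ring
    _ ≤ M.wt p.2 * (area (M.face p.2) / M.dd p.1 p.2) * (B * M.dd p.1 p.2) ^ 2 := by gcongr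
    _ = _ := by field_simp

/-- Consistency of the numerical fluxes. -/
theorem flux_consistency (hΩ : volume Ω ≠ ⊤) {q : E3 → ℝ} (hqs : ContDiff ℝ 2 q)
    (hq : ∀ x ∈ frontier Ω, q x = 0) {B : ℝ} (hB0 : 0 ≤ B)
    (hB : ∀ x y, ‖fderiv ℝ q x - fderiv ℝ q y‖ ≤ B * dist x y) (z : M.MeshFun) :
    (∑ K, q (M.center K) * M.flux z K + ∑ K, z K * ∫ x in M.cell K, lap q x) ^ 2
      ≤ M.form z z * ((2 * B * M.meshNorm) ^ 2 * (3 * volume.real Ω)) := by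
  have hqd := hqs.differentiable two_ne_zero
  have hc1 : ∀ i : Fin 3, ContDiff ℝ 1 fun y => fderiv ℝ q y (EuclideanSpace.single i 1) := fun i =>
    (hqs.fderiv_right (m := 1) (by norm_num)).clm_apply contDiff_const
  have hlap : ∀ K, ∫ x in M.cell K, lap q x
      = ∑ σ ∈ M.facesOf K, M.faceInt (fun y => fderiv ℝ q y (M.nrm K σ)) σ := by
    intro K
    simp only [lap]
    rw [integral_finsetSum _ fun i _ => M.integrableOn_cell K
      (((hc1 i).continuous_fderiv one_ne_zero).clm_apply continuous_const)]
    simp_rw [M.integral_cell_fderiv K (hc1 _)]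
    rw [Finset.sum_comm]
    refine Finset.sum_congr rfl fun σ hσ => ?_
    simp_rw [fderiv_eq_sum_single q _ (M.nrm K σ), faceInt]
    rw [integral_finsetSum _ fun i _ => (M.integrableOn_face hσ (hc1 i).continuous).const_mul _]
    simp_rw [integral_const_mul]
  have e1 : ∑ K, q (M.center K) * M.flux z K = M.form z (fun K => q (M.center K)) := by
    rw [M.sum_mul_flux (fun K => q (M.center K)) z, form_comm]
  have e2 : ∑ K, z K * ∫ x in M.cell K, lap q x = ∑ p ∈ M.edges, M.wt p.2 * (M.jump z p.1 p.2 *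
      M.faceInt (fun y => fderiv ℝ q y (M.nrm p.1 p.2)) p.2) := by
    simp_rw [hlap]
    refine M.sum_mul_eq_sum_jump z (fun K σ => M.faceInt (fun y => fderiv ℝ q y (M.nrm K σ)) σ) ?_
    intro K σ hK h
    simp only [faceInt, M.nrm_flip hK h, map_neg, integral_neg]
  rw [e1, e2, form, ← Finset.sum_add_distrib]
  simp_rw [← mul_add]
  refine M.sum_jump_sq_le hΩ z (fun K σ => area (M.face σ) / M.dd K σ *
    M.jump (fun K => q (M.center K)) K σ + M.faceInt (fun y => fderiv ℝ q y (M.nrm K σ)) σ) ?_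
  intro K σ hK
  have hd := M.dd_pos hK
  rw [M.jump_comp_center hq hK]
  -- By orthogonality the two points differ by `dd` times the normal, so `-D` is a difference
  -- quotient of `q` in the normal direction.
  set D := (q (M.center K) - q (M.opp K σ)) / M.dd K σ with hD
  have hcn : Continuous fun y => fderiv ℝ q y (M.nrm K σ) :=
    (hqs.continuous_fderiv two_ne_zero).clm_apply continuous_const
  have e3 : area (M.face σ) / M.dd K σ * (q (M.center K) - q (M.opp K σ)) +
      M.faceInt (fun y => fderiv ℝ q y (M.nrm K σ)) σ
      = M.faceInt (fun y => D + fderiv ℝ q y (M.nrm K σ)) σ := by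
    rw [faceInt, faceInt, integral_add (M.integrableOn_face hK continuous_const)
      (M.integrableOn_face hK hcn), setIntegral_const, smul_eq_mul, hD]
    rw [area]; ring
  rw [e3]
  refine M.abs_faceInt_le fun y hy => ?_
  -- Both points lie within twice the mesh norm of the face point `y`; this is the origin of the
  -- constant `2 * B * meshNorm`.
  have hmv := (convex_closedBall y (2 * M.meshNorm)).norm_image_sub_le_of_norm_hasFDerivWithin_le'
    (f := q) (f' := fderiv ℝ q) (φ := fderiv ℝ q y) (C := B * (2 * M.meshNorm))
    (x := M.center K) (y := M.opp K σ)
    (fun x _ => (hqd x).hasFDerivAt.hasFDerivWithinAt)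
    (fun x hx => (hB x y).trans (mul_le_mul_of_nonneg_left hx hB0))
    (M.dist_center_le hK hy) (M.dist_opp_le hK hy)
  rw [M.opp_sub_center hK, map_smul, smul_eq_mul, norm_smul, M.norm_nrm hK, mul_one,
    Real.norm_eq_abs, Real.norm_eq_abs, abs_of_pos hd] at hmv
  have e4 : D + fderiv ℝ q y (M.nrm K σ) = -((q (M.opp K σ) - q (M.center K) -
      M.dd K σ * fderiv ℝ q y (M.nrm K σ)) / M.dd K σ) := by
    rw [hD]; field_simp; ring
  rw [e4, abs_neg, abs_div, abs_of_pos hd, div_le_iff₀ hd]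
  linarith

end AdmissibleMesh

end

section

open scoped Convolution ContDiff

/-! ### Estimating an `L¹` norm by testing with smooth functions -/

/-- A sequence of bump functions with supports shrinking to a point. -/
def bumpSeq (n : ℕ) : ContDiffBump (0 : E3) where
  rIn := 1 / (2 * ((n : ℝ) + 1))
  rOut := 1 / ((n : ℝ) + 1)
  rIn_pos := by positivity
  rIn_lt_rOut := by
    apply one_div_lt_one_div_of_lt <;> nlinarith [(Nat.cast_nonneg n : (0 : ℝ) ≤ n)]

theorem bumpSeq_tendsto : Tendsto (fun n => (bumpSeq n).rOut) atTop (𝓝 0) :=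
  tendsto_one_div_add_atTop_nhds_zero_nat

/-- The test functions are mollifications of the sign of `h`: they are bounded by one and converge
to the sign almost everywhere, so dominated convergence applies. -/
theorem integral_abs_le_of_test {h : E3 → ℝ} (hm : Measurable h) (hi : Integrable h) {A : ℝ}
    (H : ∀ φ : E3 → ℝ, ContDiff ℝ ∞ φ → (∀ x, |φ x| ≤ 1) → ∫ x, h x * φ x ≤ A) :
    ∫ x, |h x| ≤ A := by
  let s : E3 → ℝ := fun x => (SignType.sign (h x) : ℝ)
  have hs : ∀ x, |s x| ≤ 1 := fun x => by
    rcases lt_trichotomy (h x) 0 with hx | hx | hx <;> simp [s, hx]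
  have hsm : Measurable s := by
    have : s = fun x => if h x < 0 then -1 else if h x = 0 then 0 else (1 : ℝ) := by
      funext x
      rcases lt_trichotomy (h x) 0 with hx | hx | hx
      · simp [s, hx]
      · simp [s, hx]
      · simp [s, hx, hx.ne', hx.le]
    rw [this]
    refine Measurable.ite (measurableSet_lt hm measurable_const) measurable_const ?_
    exact Measurable.ite (hm (measurableSet_singleton 0)) measurable_const measurable_const
  have hsl : LocallyIntegrable s := by
    refine (locallyIntegrable_const (1 : ℝ)).mono hsm.aestronglyMeasurable ?_
    exact Eventually.of_forall fun x => by simpa using hs x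
  let φ : ℕ → E3 → ℝ := fun n => (bumpSeq n).normed volume ⋆[ContinuousLinearMap.lsmul ℝ ℝ, volume] s
  have hφ1 : ∀ n x, |φ n x| ≤ 1 := by
    intro n x
    have h1 : ∫ t, ‖(bumpSeq n).normed volume t • s (x - t)‖ ≤ ∫ t, (bumpSeq n).normed volume t := by
      refine integral_mono_of_nonneg (Eventually.of_forall fun t => norm_nonneg _)
        (bumpSeq n).integrable_normed (Eventually.of_forall fun t => ?_)
      dsimp only
      rw [norm_smul, Real.norm_eq_abs, abs_of_nonneg ((bumpSeq n).nonneg_normed t)]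
      exact mul_le_of_le_one_right ((bumpSeq n).nonneg_normed t) (hs _)
    rw [(bumpSeq n).integral_normed] at h1
    exact (norm_integral_le_integral_norm _).trans h1
  have hφs : ∀ n, ContDiff ℝ ∞ (φ n) := fun n =>
    ((bumpSeq n).hasCompactSupport_normed).contDiff_convolution_left _
      (bumpSeq n).contDiff_normed hsl
  have hae : ∀ᵐ x : E3, Tendsto (fun n => φ n x) atTop (𝓝 (s x)) :=
    ContDiffBump.ae_convolution_tendsto_right_of_locallyIntegrable (K := 2) bumpSeq_tendsto
      (Eventually.of_forall fun n => by
        change 1 / ((n : ℝ) + 1) ≤ 2 * (1 / (2 * ((n : ℝ) + 1)))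
        have : (0 : ℝ) < n + 1 := by positivity
        apply le_of_eq; field_simp) hsl
  have hlim : Tendsto (fun n => ∫ x, h x * φ n x) atTop (𝓝 (∫ x, h x * s x)) := by
    refine tendsto_integral_of_dominated_convergence (fun x => |h x|)
      (fun n => hm.aestronglyMeasurable.mul (hφs n).continuous.aestronglyMeasurable) hi.abs ?_ ?_
    · exact fun n => Eventually.of_forall fun x => by
        rw [Real.norm_eq_abs, abs_mul]
        exact mul_le_of_le_one_right (abs_nonneg _) (hφ1 n x)
    · filter_upwards [hae] with x hx using hx.const_mul _
  have hfin := le_of_tendsto hlim (Eventually.of_forall fun n => H (φ n) (hφs n) (hφ1 n))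
  have he : ∀ x, h x * s x = |h x| := fun x => by simp [s]
  simpa only [he] using hfin

/-! ### Piecewise constant functions -/

namespace AdmissibleMesh

variable {Ω : Set E3} (M : AdmissibleMesh Ω)

theorem interpFun_of_mem (z : M.MeshFun) {K : Fin M.numCells} {x : E3} (hx : x ∈ M.cell K) :
    M.interpFun z x = z K := by
  rw [interpFun, Finset.sum_eq_single K, indicator_of_mem hx]
  · intro L _ hL
    exact indicator_of_notMem (fun h => (M.cell_disjoint L K hL).le_bot ⟨h, hx⟩) _
  · simp

theorem interpFun_of_notMem (z : M.MeshFun) {x : E3} (hx : ∀ K, x ∉ M.cell K) :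
    M.interpFun z x = 0 :=
  Finset.sum_eq_zero fun K _ => indicator_of_notMem (hx K) _

theorem interpFun_eq_zero (z : M.MeshFun) {x : E3} (hx : x ∉ Ω) : M.interpFun z x = 0 :=
  M.interpFun_of_notMem z fun K h => hx (M.cell_subset K h)

theorem interpFun_comp (z : M.MeshFun) {F : ℝ → ℝ} (hF : F 0 = 0) (x : E3) :
    M.interpFun (fun K => F (z K)) x = F (M.interpFun z x) := by
  by_cases h : ∃ K, x ∈ M.cell K
  · obtain ⟨K, hK⟩ := h
    rw [M.interpFun_of_mem _ hK, M.interpFun_of_mem _ hK]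
  · push Not at h
    rw [M.interpFun_of_notMem _ h, M.interpFun_of_notMem _ h, hF]

theorem measurable_interpFun (z : M.MeshFun) : Measurable (M.interpFun z) :=
  Finset.measurable_fun_sum _ fun K _ => measurable_const.indicator (M.measurableSet_cell K)

theorem abs_interpFun_le (z : M.MeshFun) (x : E3) : |M.interpFun z x| ≤ ∑ K, |z K| := by
  refine (Finset.abs_sum_le_sum_abs _ _).trans (Finset.sum_le_sum fun K _ => ?_)
  by_cases h : x ∈ M.cell K
  · rw [indicator_of_mem h]
  · rw [indicator_of_notMem h, abs_zero]; exact abs_nonneg _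

theorem integrable_interpFun (z : M.MeshFun) : Integrable (M.interpFun z) := by
  refine integrable_finsetSum _ fun K _ => ?_
  rw [integrable_indicator_iff (M.measurableSet_cell K)]
  exact integrableOn_const (M.isBounded_cell K).measure_lt_top.ne

theorem integrable_interpFun_mul (z : M.MeshFun) {ψ : E3 → ℝ} (hψ : ∀ K, IntegrableOn ψ (M.cell K)) :
    Integrable fun x => M.interpFun z x * ψ x := by
  have h : (fun x => M.interpFun z x * ψ x)
      = fun x => ∑ K, z K * (M.cell K).indicator ψ x := by
    funext x
    rw [interpFun, Finset.sum_mul]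
    refine Finset.sum_congr rfl fun K _ => ?_
    by_cases hx : x ∈ M.cell K <;> simp [hx]
  rw [h]
  exact integrable_finsetSum _ fun K _ =>
    ((integrable_indicator_iff (M.measurableSet_cell K)).2 (hψ K)).const_mul _

theorem integral_interpFun_mul (z : M.MeshFun) {ψ : E3 → ℝ} (hψ : ∀ K, IntegrableOn ψ (M.cell K)) :
    ∫ x, M.interpFun z x * ψ x = ∑ K, z K * ∫ x in M.cell K, ψ x := by
  have h : (fun x => M.interpFun z x * ψ x)
      = fun x => ∑ K, z K * (M.cell K).indicator ψ x := by
    funext x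
    rw [interpFun, Finset.sum_mul]
    refine Finset.sum_congr rfl fun K _ => ?_
    by_cases hx : x ∈ M.cell K <;> simp [hx]
  rw [h, integral_finsetSum _ fun K _ =>
    ((integrable_indicator_iff (M.measurableSet_cell K)).2 (hψ K)).const_mul _]
  refine Finset.sum_congr rfl fun K _ => ?_
  rw [integral_const_mul, integral_indicator (M.measurableSet_cell K)]

theorem integral_sq_interpFun (z : M.MeshFun) : ∫ x, M.interpFun z x ^ 2 = M.normSq z := by
  have h : ∀ x, M.interpFun z x ^ 2 = M.interpFun (fun K => z K ^ 2) x * 1 := fun x => by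
    rw [mul_one, M.interpFun_comp z (F := fun r => r ^ 2) (by norm_num)]
  simp_rw [h]
  rw [M.integral_interpFun_mul _ fun K => integrableOn_const (M.isBounded_cell K).measure_lt_top.ne]
  exact Finset.sum_congr rfl fun K _ => by simp [mass, mul_comm]

theorem tv_nonneg (g : M.MeshFun) : 0 ≤ M.tv g :=
  Finset.sum_nonneg fun _ _ => mul_nonneg (M.wt_nonneg _)
    (mul_nonneg (abs_nonneg _) (M.face_pos _).le)

/-- By duality the translation moves to the test function; `φ (x - η) - φ x` is an integral of
directional derivatives along the segment, and the total variation bounds the pairing for each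
parameter. -/
theorem integral_abs_translate_le (g : M.MeshFun) (η : E3) :
    ∫ x, |M.interpFun g (x + η) - M.interpFun g x| ≤ ‖η‖ * M.tv g := by
  have hm := M.measurable_interpFun g
  have hi := M.integrable_interpFun g
  have hi' : Integrable fun x => M.interpFun g (x + η) := hi.comp_add_right η
  refine integral_abs_le_of_test ((hm.comp (measurable_add_const η)).sub hm) (hi'.sub hi) ?_
  intro φ hφ hφ1
  have hφ1' : ContDiff ℝ 1 φ := hφ.of_le (by norm_cast)
  have hic : ∀ {ψ : E3 → ℝ}, Continuous ψ → ∀ K, IntegrableOn ψ (M.cell K) := fun hψ K =>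
    M.integrableOn_cell K hψ
  have hcφ := hφ.continuous
  have hcφ' : Continuous fun x => φ (x - η) := hcφ.comp (continuous_sub_right η)
  have e1 : ∫ x, (M.interpFun g (x + η) - M.interpFun g x) * φ x
      = ∑ K, g K * ∫ x in M.cell K, (φ (x - η) - φ x) := by
    have h1 : ∫ x, M.interpFun g (x + η) * φ x = ∫ x, M.interpFun g x * φ (x - η) := by
      rw [← integral_add_right_eq_self (fun x => M.interpFun g x * φ (x - η)) η]
      simp
    have h2 : Integrable fun x => M.interpFun g (x + η) * φ x := by
      have := (M.integrable_interpFun_mul g (hic hcφ')).comp_add_right η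
      simpa using this
    simp_rw [sub_mul]
    rw [integral_sub h2 (M.integrable_interpFun_mul g (hic hcφ)), h1,
      ← integral_sub (M.integrable_interpFun_mul g (hic hcφ'))
        (M.integrable_interpFun_mul g (hic hcφ)), ← M.integral_interpFun_mul g
        (ψ := fun x => φ (x - η) - φ x) (hic (hcφ'.sub hcφ))]
    simp_rw [mul_sub]
  let ψ : ℝ → E3 → ℝ := fun s x => φ (x - s • η)
  have hψ : ∀ s, ContDiff ℝ 1 (ψ s) := fun s => hφ1'.comp (contDiff_id.sub contDiff_const)
  have hder : ∀ s x, fderiv ℝ (ψ s) x = fderiv ℝ φ (x - s • η) := fun s x =>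
    fderiv_comp_sub (s • η)
  have hcd : Continuous fun p : ℝ × E3 => fderiv ℝ φ (p.2 - p.1 • η) η :=
    ((hφ1'.continuous_fderiv one_ne_zero).comp (by fun_prop)).clm_apply continuous_const
  have e2 : ∀ K, ∫ x in M.cell K, (φ (x - η) - φ x)
      = -∫ s in (0 : ℝ)..1, ∫ x in M.cell K, fderiv ℝ (ψ s) x η := by
    intro K
    simp_rw [hder]
    rw [intervalIntegral_integral_swap, ← integral_neg]
    · refine integral_congr_ae (Eventually.of_forall fun x => ?_)
      dsimp only
      have h3 : ∀ s ∈ uIcc (0 : ℝ) 1, HasDerivAt (fun s => φ (x - s • η))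
          (-(fderiv ℝ φ (x - s • η) η)) s := by
        intro s _
        have h4 : HasDerivAt (fun s : ℝ => x - s • η) (-η) s := by
          simpa using ((hasDerivAt_id s).smul_const η).const_sub x
        have h5 := ((hφ1'.differentiable one_ne_zero) (x - s • η)).hasFDerivAt.comp_hasDerivAt s h4
        exact h5.congr_deriv (by simp)
      have h6 := intervalIntegral.integral_eq_sub_of_hasDerivAt h3
        ((hcd.comp (continuous_id.prodMk continuous_const)).neg.intervalIntegrable _ _)
      rw [intervalIntegral.integral_neg] at h6
      rw [h6]; simp
    · refine Integrable.mono_measure (ν := (volume.prod volume).restrict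
        (uIcc (0 : ℝ) 1 ×ˢ closure (M.cell K))) ?_ ?_
      · exact (hcd.continuousOn.integrableOn_compact
          (isCompact_uIcc.prod (M.isBounded_cell K).isCompact_closure))
      · rw [Measure.prod_restrict]
        exact Measure.restrict_mono (Set.prod_mono uIoc_subset_uIcc subset_closure) le_rfl
  have e3 : ∑ K, g K * ∫ x in M.cell K, (φ (x - η) - φ x)
      = -∫ s in (0 : ℝ)..1, ∑ K, g K * ∫ x in M.cell K, fderiv ℝ (ψ s) x η := by
    rw [intervalIntegral.integral_finsetSum, ← Finset.sum_neg_distrib]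
    · refine Finset.sum_congr rfl fun K _ => ?_
      rw [e2 K, intervalIntegral.integral_const_mul]; ring
    · intro K _
      refine (Continuous.intervalIntegrable ?_ _ _).const_mul _
      simp_rw [hder]
      have h7 := continuous_parametric_integral_of_continuous (μ := volume)
        (f := fun (s : ℝ) (x : E3) => fderiv ℝ φ (x - s • η) η) hcd
        (M.isBounded_cell K).isCompact_closure
      -- The frontier of a convex set is null, so the cell can be replaced by its compact closure,
      -- over which parametric integrals are continuous.
      have h8 : ∀ s : ℝ, ∫ x in M.cell K, fderiv ℝ φ (x - s • η) η
          = ∫ x in closure (M.cell K), fderiv ℝ φ (x - s • η) η := by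
        intro s
        exact setIntegral_congr_set (closure_ae_eq_of_null_frontier
          ((M.convex_cell K).addHaar_frontier volume)).symm
      simp_rw [h8]
      exact h7
  change ∫ x, (M.interpFun g (x + η) - M.interpFun g x) * φ x ≤ _
  rw [e1, e3]
  refine (neg_le_abs _).trans ?_
  have h9 := intervalIntegral.norm_integral_le_of_norm_le_const (a := (0 : ℝ)) (b := 1)
    (C := ‖η‖ * 1 * M.tv g)
    (f := fun s => ∑ K, g K * ∫ x in M.cell K, fderiv ℝ (ψ s) x η)
    (fun s _ => M.abs_sum_mul_integral_fderiv_le g (hψ s) η fun x => hφ1 _)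
  simpa using h9

/-- The elementary inequality `hkey` reduces the `L²` modulus of `z` to the `L¹` modulus of `z |z|`.
This is the reason for estimating the total variation of `z |z|` rather than that of `z`. -/
theorem integral_sq_translate_le (z : M.MeshFun) (η : E3) :
    ∫ x, (M.interpFun z (x + η) - M.interpFun z x) ^ 2
      ≤ 2 * (‖η‖ * M.tv (fun K => z K * |z K|)) := by
  have hkey : ∀ a b : ℝ, (a - b) ^ 2 ≤ 2 * abs (a * |a| - b * |b|) := by
    intro a b
    rcases le_total 0 a with ha | ha <;> rcases le_total 0 b with hb | hb
    · rw [abs_of_nonneg ha, abs_of_nonneg hb]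
      rcases le_total a b with h | h
      · rw [abs_of_nonpos (by nlinarith)]; nlinarith
      · rw [abs_of_nonneg (by nlinarith)]; nlinarith
    · rw [abs_of_nonneg ha, abs_of_nonpos hb, abs_of_nonneg (by nlinarith)]
      nlinarith [sq_nonneg (a + b)]
    · rw [abs_of_nonpos ha, abs_of_nonneg hb, abs_of_nonpos (by nlinarith)]
      nlinarith [sq_nonneg (a + b)]
    · rw [abs_of_nonpos ha, abs_of_nonpos hb]
      rcases le_total a b with h | h
      · rw [abs_of_nonpos (by nlinarith)]; nlinarith
      · rw [abs_of_nonneg (by nlinarith)]; nlinarith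
  have h1 := M.integral_abs_translate_le (fun K => z K * |z K|) η
  have hi := M.integrable_interpFun (fun K => z K * |z K|)
  have h2 : ∫ x, (M.interpFun z (x + η) - M.interpFun z x) ^ 2
      ≤ ∫ x, 2 * |M.interpFun (fun K => z K * |z K|) (x + η)
        - M.interpFun (fun K => z K * |z K|) x| := by
    refine integral_mono_of_nonneg (Eventually.of_forall fun x => sq_nonneg _)
      (((hi.comp_add_right η).sub hi).abs.const_mul 2) (Eventually.of_forall fun x => ?_)
    dsimp only
    rw [M.interpFun_comp z (F := fun r => r * |r|) (by norm_num),
      M.interpFun_comp z (F := fun r => r * |r|) (by norm_num)]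
    exact hkey _ _
  rw [integral_const_mul] at h2
  linarith

end AdmissibleMesh

end

section

open scoped ENNReal

/-! ### A Poincaré inequality on a grid of cubes -/

/-- The half-open cube of side `δ` with index `k`. -/
def cube (δ : ℝ) (k : Fin 3 → ℤ) : Set E3 :=
  {x | ∀ i, x i ∈ Ico ((k i : ℝ) * δ) (((k i : ℝ) + 1) * δ)}

theorem measurableSet_cube (δ : ℝ) (k : Fin 3 → ℤ) : MeasurableSet (cube δ k) := by
  have : cube δ k = ⋂ i, (fun x : E3 => x i) ⁻¹' Ico ((k i : ℝ) * δ) (((k i : ℝ) + 1) * δ) := by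
    ext x; simp [cube]
  rw [this]
  refine MeasurableSet.iInter fun i => measurableSet_Ico.preimage ?_
  exact (EuclideanSpace.proj i : E3 →L[ℝ] ℝ).continuous.measurable

theorem volume_cube {δ : ℝ} (hδ : 0 < δ) (k : Fin 3 → ℤ) :
    volume (cube δ k) = ENNReal.ofReal (δ ^ 3) := by
  rw [← (PiLp.volume_preserving_toLp (Fin 3)).measure_preimage_emb
    (MeasurableEquiv.toLp 2 (Fin 3 → ℝ)).measurableEmbedding]
  have : (WithLp.toLp 2) ⁻¹' cube δ k
      = Set.pi univ fun i : Fin 3 => Ico ((k i : ℝ) * δ) (((k i : ℝ) + 1) * δ) := by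
    ext x; simp [cube]
  rw [this, Real.volume_pi_Ico]
  have h : ∀ i, ((k i : ℝ) + 1) * δ - (k i : ℝ) * δ = δ := fun i => by ring
  simp only [h, Finset.prod_const, Finset.card_univ, Fintype.card_fin]
  rw [ENNReal.ofReal_pow hδ.le]

theorem floor_eq_of_mem_cube {δ : ℝ} (hδ : 0 < δ) {k : Fin 3 → ℤ} {x : E3} (hx : x ∈ cube δ k) :
    k = fun i => ⌊x i / δ⌋ := by
  funext i
  symm
  rw [Int.floor_eq_iff, le_div_iff₀ hδ, div_lt_iff₀ hδ]
  exact hx i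

theorem mem_cube_floor {δ : ℝ} (hδ : 0 < δ) (x : E3) : x ∈ cube δ fun i => ⌊x i / δ⌋ := by
  intro i
  exact ⟨(le_div_iff₀ hδ).1 (Int.floor_le _), (div_lt_iff₀ hδ).1 (Int.lt_floor_add_one _)⟩

theorem disjoint_cube {δ : ℝ} (hδ : 0 < δ) {k l : Fin 3 → ℤ} (h : k ≠ l) :
    Disjoint (cube δ k) (cube δ l) :=
  Set.disjoint_left.2 fun _ hx hx' =>
    h ((floor_eq_of_mem_cube hδ hx).trans (floor_eq_of_mem_cube hδ hx').symm)

theorem norm_sub_le_of_mem_cube {δ : ℝ} (hδ : 0 < δ) {k : Fin 3 → ℤ} {x y : E3}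
    (hx : x ∈ cube δ k) (hy : y ∈ cube δ k) : ‖y - x‖ ≤ 2 * δ := by
  rw [EuclideanSpace.norm_eq]
  refine Real.sqrt_le_iff.2 ⟨by positivity, ?_⟩
  have h : ∀ i : Fin 3, ‖(y - x) i‖ ^ 2 ≤ δ ^ 2 := fun i => by
    rw [Real.norm_eq_abs, sq_abs]
    refine sq_le_sq' ?_ ?_ <;> simp only [PiLp.sub_apply] <;>
      linarith [(hx i).1, (hx i).2, (hy i).1, (hy i).2]
  calc ∑ i, ‖(y - x) i‖ ^ 2 ≤ ∑ _i : Fin 3, δ ^ 2 := Finset.sum_le_sum fun i _ => h i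
    _ ≤ (2 * δ) ^ 2 := by simp; nlinarith

/-- The indices of the cubes that may meet the ball of radius `R`. -/
def cubeIndex (R δ : ℝ) : Finset (Fin 3 → ℤ) :=
  Fintype.piFinset fun _ => Finset.Icc (-(⌈R / δ⌉ + 1)) (⌈R / δ⌉ + 1)

theorem floor_mem_cubeIndex {R δ : ℝ} (hδ : 0 < δ) {x : E3} (hx : ‖x‖ ≤ R) :
    (fun i => ⌊x i / δ⌋) ∈ cubeIndex R δ := by
  rw [cubeIndex, Fintype.mem_piFinset]
  intro i
  have h1 : |x i| ≤ R := (PiLp.norm_apply_le x i).trans hx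
  have h2 : |x i / δ| ≤ R / δ := by rw [abs_div, abs_of_pos hδ]; gcongr
  have h3 := Int.le_ceil (R / δ)
  have h4 := abs_le.1 h2
  rw [Finset.mem_Icc]
  constructor
  · rw [Int.le_floor]; push_cast; linarith
  · rw [← Int.lt_add_one_iff, Int.floor_lt]; push_cast; linarith

/-- Expanding the square shows that the double oscillation is the second moment minus the squared
mean. It is the Poincaré inequality on one cube in the form of an identity. -/
theorem integral_integral_sq_sub {Q : Set E3} (hQ : volume Q ≠ ⊤) {f : E3 → ℝ} (hf : Measurable f)
    {B : ℝ} (hB : ∀ x, |f x| ≤ B) :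
    ∫ x in Q, ∫ y in Q, (f x - f y) ^ 2
      = 2 * (volume.real Q * ∫ x in Q, f x ^ 2) - 2 * (∫ x in Q, f x) ^ 2 := by
  have hB0 : 0 ≤ B := (abs_nonneg _).trans (hB 0)
  have h1 : Integrable f (volume.restrict Q) := Measure.integrableOn_of_bounded hQ hf.aestronglyMeasurable
    (Eventually.of_forall hB)
  have h2 : Integrable (fun x => f x ^ 2) (volume.restrict Q) :=
    Measure.integrableOn_of_bounded (M := B ^ 2) hQ (hf.pow_const 2).aestronglyMeasurable
      (Eventually.of_forall fun x => by
        rw [norm_pow]; exact pow_le_pow_left₀ (norm_nonneg _) (hB x) 2)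
  have hc : ∀ c : ℝ, Integrable (fun _ : E3 => c) (volume.restrict Q) :=
    fun c => integrableOn_const hQ
  have e1 : ∀ x, ∫ y in Q, (f x - f y) ^ 2
      = volume.real Q * f x ^ 2 - 2 * (∫ y in Q, f y) * f x + ∫ y in Q, f y ^ 2 := by
    intro x
    have : ∀ y, (f x - f y) ^ 2 = (f x ^ 2 - 2 * f x * f y) + f y ^ 2 := fun y => by ring
    simp_rw [this]
    have i1 := integral_add (μ := volume.restrict Q) (f := fun y => f x ^ 2 - 2 * f x * f y) (g := fun y => f y ^ 2)
      ((hc (f x ^ 2)).sub (h1.const_mul (2 * f x))) h2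
    have i2 := integral_sub (μ := volume.restrict Q) (f := fun _ => f x ^ 2) (g := fun y => 2 * f x * f y)
      (hc (f x ^ 2)) (h1.const_mul (2 * f x))
    rw [i1, i2, integral_const_mul, setIntegral_const, smul_eq_mul]
    ring
  simp_rw [e1]
  have i1 := integral_add (μ := volume.restrict Q)
    (f := fun x => volume.real Q * f x ^ 2 - 2 * (∫ y in Q, f y) * f x)
    (g := fun _ => ∫ y in Q, f y ^ 2)
    ((h2.const_mul (volume.real Q)).sub (h1.const_mul (2 * ∫ y in Q, f y))) (hc _)
  have i2 := integral_sub (μ := volume.restrict Q) (f := fun x => volume.real Q * f x ^ 2)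
    (g := fun x => 2 * (∫ y in Q, f y) * f x)
    (h2.const_mul (volume.real Q)) (h1.const_mul (2 * ∫ y in Q, f y))
  rw [i1, i2, integral_const_mul, integral_const_mul, setIntegral_const, smul_eq_mul]
  ring

theorem integrable_of_bdd_of_support {f : E3 → ℝ} (hf : Measurable f) {B R : ℝ}
    (hB : ∀ x, |f x| ≤ B) (hR : ∀ x, R < ‖x‖ → f x = 0) : Integrable f := by
  have h1 : IntegrableOn f (Metric.closedBall 0 R) :=
    Measure.integrableOn_of_bounded (isCompact_closedBall _ _).measure_lt_top.ne
      hf.aestronglyMeasurable (Eventually.of_forall hB)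
  refine (integrableOn_iff_integrable_of_support_subset fun x hx => ?_).1 h1
  rw [mem_closedBall_zero_iff]
  by_contra hcon
  exact hx (hR x (not_le.1 hcon))

theorem ofReal_integral_integral_sq_sub {Q : Set E3} (hQ : volume Q ≠ ⊤) {f : E3 → ℝ}
    (hf : Measurable f) {B : ℝ} (hB : ∀ x, |f x| ≤ B) :
    ENNReal.ofReal (∫ x in Q, ∫ y in Q, (f x - f y) ^ 2)
      = ∫⁻ x in Q, ∫⁻ y in Q, ENNReal.ofReal ((f x - f y) ^ 2) := by
  have hD : ∀ x y, ‖(f x - f y) ^ 2‖ ≤ (2 * B) ^ 2 := fun x y => by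
    have h1 := abs_le.1 (hB x)
    have h2 := abs_le.1 (hB y)
    rw [Real.norm_eq_abs, abs_of_nonneg (sq_nonneg _)]
    exact sq_le_sq' (by linarith) (by linarith)
  have hin : ∀ x, IntegrableOn (fun y => (f x - f y) ^ 2) Q := fun x =>
    Measure.integrableOn_of_bounded (M := (2 * B) ^ 2) hQ
      ((measurable_const.sub hf).pow_const 2).aestronglyMeasurable (Eventually.of_forall (hD x))
  have hsm : StronglyMeasurable fun x => ∫ y in Q, (f x - f y) ^ 2 := by
    refine StronglyMeasurable.integral_prod_right (f := fun x y => (f x - f y) ^ 2) ?_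
    exact (((hf.comp measurable_fst).sub (hf.comp measurable_snd)).pow_const 2).stronglyMeasurable
  rw [ofReal_integral_eq_lintegral_ofReal]
  · refine lintegral_congr fun x => ?_
    rw [ofReal_integral_eq_lintegral_ofReal (hin x) (Eventually.of_forall fun y => sq_nonneg _)]
  · exact Measure.integrableOn_of_bounded (M := (2 * B) ^ 2 * volume.real Q) hQ
      hsm.aestronglyMeasurable (Eventually.of_forall fun x =>
        norm_setIntegral_le_of_norm_le_const hQ.lt_top fun y _ => hD x y)
  · exact Eventually.of_forall fun x => integral_nonneg fun y => sq_nonneg _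

/-- Two points of a cube differ by some `η` of length at most `2 δ`. Enlarging the domain of `η` to
a ball makes it independent of the cube. -/
theorem lintegral_cube_le {δ : ℝ} (hδ : 0 < δ) (D : E3 → E3 → ℝ≥0∞) (k : Fin 3 → ℤ) :
    ∫⁻ x in cube δ k, ∫⁻ y in cube δ k, D x y
      ≤ ∫⁻ x in cube δ k, ∫⁻ η in Metric.closedBall 0 (2 * δ), D x (x + η) := by
  refine setLIntegral_mono' (measurableSet_cube δ k) fun x hx => ?_
  have h1 : ∫⁻ y in cube δ k, D x y ≤ ∫⁻ y in Metric.closedBall x (2 * δ), D x y :=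
    lintegral_mono_set fun y hy => by
      rw [Metric.mem_closedBall, dist_eq_norm]; exact norm_sub_le_of_mem_cube hδ hx hy
  refine h1.trans (le_of_eq ?_)
  rw [← lintegral_indicator Metric.isClosed_closedBall.measurableSet,
    ← lintegral_indicator Metric.isClosed_closedBall.measurableSet,
    ← lintegral_add_left_eq_self _ x]
  refine lintegral_congr fun η => ?_
  by_cases hη : η ∈ Metric.closedBall (0 : E3) (2 * δ)
  · rw [indicator_of_mem hη, indicator_of_mem (by simpa using hη)]
  · rw [indicator_of_notMem hη, indicator_of_notMem (by simpa using hη)]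

theorem integrable_sq_sub_translate {f : E3 → ℝ} (hf : Integrable f) {B : ℝ}
    (hB : ∀ x, |f x| ≤ B) (η : E3) : Integrable fun x => (f (x + η) - f x) ^ 2 := by
  have hg : Integrable fun x => f (x + η) - f x := (hf.comp_add_right η).sub hf
  have := hg.bdd_mul (c := 2 * B) hg.aestronglyMeasurable (Eventually.of_forall fun x => by
    have h1 := abs_le.1 (hB x)
    have h2 := abs_le.1 (hB (x + η))
    exact abs_le.2 ⟨by linarith, by linarith⟩)
  simpa [sq] using this

theorem lintegral_translate_le {f : E3 → ℝ} (hf : Integrable f) (hfm : Measurable f) {B : ℝ}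
    (hB : ∀ x, |f x| ≤ B) {r A : ℝ}
    (hA : ∀ η : E3, ‖η‖ ≤ r → ∫ x, (f (x + η) - f x) ^ 2 ≤ A) :
    ∫⁻ x, ∫⁻ η in Metric.closedBall (0 : E3) r, ENNReal.ofReal ((f x - f (x + η)) ^ 2)
      ≤ volume (Metric.closedBall (0 : E3) r) * ENNReal.ofReal A := by
  have hm : Measurable (Function.uncurry fun x η : E3 =>
      ENNReal.ofReal ((f x - f (x + η)) ^ 2)) :=
    ENNReal.measurable_ofReal.comp (((hfm.comp measurable_fst).sub
      (hfm.comp (measurable_fst.add measurable_snd))).pow_const 2)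
  rw [lintegral_lintegral_swap hm.aemeasurable, mul_comm, ← setLIntegral_const]
  refine setLIntegral_mono' Metric.isClosed_closedBall.measurableSet fun η hη => ?_
  have h3 : ∫⁻ x, ENNReal.ofReal ((f x - f (x + η)) ^ 2)
      = ENNReal.ofReal (∫ x, (f (x + η) - f x) ^ 2) := by
    rw [ofReal_integral_eq_lintegral_ofReal (integrable_sq_sub_translate hf hB η)
      (Eventually.of_forall fun x => sq_nonneg _)]
    refine lintegral_congr fun x => ?_
    congr 1; ring
  rw [h3]
  exact ENNReal.ofReal_le_ofReal (hA η (by simpa using hη))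

/-- The cubes are disjoint, so their contributions add up to at most one integral over the whole
space; Fubini's theorem then leaves the translation bound, integrated over the ball of shifts. -/
theorem sum_cube_integral_le {f : E3 → ℝ} (hf : Measurable f) {B R : ℝ} (hB : ∀ x, |f x| ≤ B)
    (hR : ∀ x, R < ‖x‖ → f x = 0) {δ A : ℝ} (hδ : 0 < δ)
    (hA : ∀ η : E3, ‖η‖ ≤ 2 * δ → ∫ x, (f (x + η) - f x) ^ 2 ≤ A) :
    ∑ k ∈ cubeIndex R δ, ∫ x in cube δ k, ∫ y in cube δ k, (f x - f y) ^ 2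
      ≤ volume.real (Metric.closedBall (0 : E3) (2 * δ)) * A := by
  have hA0 : 0 ≤ A := by
    have := hA 0 (by simpa using hδ.le)
    simpa using this
  have hvol : ∀ k, volume (cube δ k) ≠ ⊤ := fun k => by
    rw [volume_cube hδ]; exact ENNReal.ofReal_ne_top
  have hnn : ∀ k, 0 ≤ ∫ x in cube δ k, ∫ y in cube δ k, (f x - f y) ^ 2 := fun k =>
    integral_nonneg fun x => integral_nonneg fun y => sq_nonneg _
  have hBf : volume (Metric.closedBall (0 : E3) (2 * δ)) ≠ ⊤ :=
    (isCompact_closedBall _ _).measure_lt_top.ne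
  rw [← ENNReal.ofReal_le_ofReal_iff (mul_nonneg measureReal_nonneg hA0),
    ENNReal.ofReal_sum_of_nonneg fun k _ => hnn k,
    ENNReal.ofReal_mul measureReal_nonneg, ofReal_measureReal hBf]
  refine le_trans ?_ (lintegral_translate_le (integrable_of_bdd_of_support hf hB hR) hf hB hA)
  refine (Finset.sum_le_sum fun k _ => ?_).trans ((lintegral_biUnion_finset
    (s := cubeIndex R δ) (t := cube δ) (fun k _ l _ hkl => disjoint_cube hδ hkl)
    (fun k _ => measurableSet_cube δ k) _).symm.trans_le (setLIntegral_le_lintegral _ _))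
  rw [ofReal_integral_integral_sq_sub (hvol k) hf hB]
  exact lintegral_cube_le hδ _ k

/-- An `L²` norm is controlled by translations and finitely many averages. -/
theorem integral_sq_le_cubes {f : E3 → ℝ} (hf : Measurable f) {B R : ℝ} (hB : ∀ x, |f x| ≤ B)
    (hR : ∀ x, R < ‖x‖ → f x = 0) {δ A : ℝ} (hδ : 0 < δ)
    (hA : ∀ η : E3, ‖η‖ ≤ 2 * δ → ∫ x, (f (x + η) - f x) ^ 2 ≤ A) :
    ∫ x, f x ^ 2 ≤ volume.real (Metric.closedBall (0 : E3) 2) * A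
      + (δ ^ 3)⁻¹ * ∑ k ∈ cubeIndex R δ, (∫ x in cube δ k, f x) ^ 2 := by
  have hA0 : 0 ≤ A := by
    have := hA 0 (by simpa using hδ.le)
    simpa using this
  have hvol : ∀ k, volume (cube δ k) ≠ ⊤ := fun k => by
    rw [volume_cube hδ]; exact ENNReal.ofReal_ne_top
  have hvr : ∀ k, volume.real (cube δ k) = δ ^ 3 := fun k => by
    rw [measureReal_def, volume_cube hδ, ENNReal.toReal_ofReal (by positivity)]
  have h1 := sum_cube_integral_le hf hB hR hδ hA
  simp_rw [fun k => integral_integral_sq_sub (hvol k) hf hB, hvr] at h1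
  -- The ball of shifts scales like the volume `δ ^ 3` of a cube, so the factor of `A` does not
  -- depend on `δ`.
  have hball : volume.real (Metric.closedBall (0 : E3) (2 * δ))
      = δ ^ 3 * volume.real (Metric.closedBall (0 : E3) 2) := by
    rw [measureReal_def, measureReal_def, mul_comm 2 δ,
      Measure.addHaar_closedBall_mul _ _ hδ.le (by norm_num),
      ENNReal.toReal_mul, ENNReal.toReal_ofReal (by positivity), finrank_euclideanSpace_fin]
  have h2 : ∫ x, f x ^ 2 = ∑ k ∈ cubeIndex R δ, ∫ x in cube δ k, f x ^ 2 := by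
    have hf2 : ∀ k ∈ cubeIndex R δ, IntegrableOn (fun x => f x ^ 2) (cube δ k) := fun k _ =>
      Measure.integrableOn_of_bounded (M := B ^ 2) (hvol k) (hf.pow_const 2).aestronglyMeasurable
        (Eventually.of_forall fun x => by
          rw [norm_pow]; exact pow_le_pow_left₀ (norm_nonneg _) (hB x) 2)
    rw [← integral_biUnion_finset _ (fun k _ => measurableSet_cube δ k)
      (fun k _ l _ hkl => disjoint_cube hδ hkl) hf2]
    refine (setIntegral_eq_integral_of_forall_compl_eq_zero fun x hx => ?_).symm
    have : R < ‖x‖ := by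
      by_contra hcon
      exact hx (mem_biUnion (floor_mem_cubeIndex hδ (not_lt.1 hcon)) (mem_cube_floor hδ x))
    rw [hR x this]; norm_num
  have hd3 : 0 < δ ^ 3 := by positivity
  rw [Finset.sum_sub_distrib, ← Finset.mul_sum, ← Finset.mul_sum, ← Finset.mul_sum, ← h2, hball] at h1
  have hA' : 0 ≤ volume.real (Metric.closedBall (0 : E3) 2) * A := by positivity
  have h3 : δ ^ 3 * ∫ x, f x ^ 2 ≤ δ ^ 3 * (volume.real (Metric.closedBall (0 : E3) 2) * A
      + (δ ^ 3)⁻¹ * ∑ k ∈ cubeIndex R δ, (∫ x in cube δ k, f x) ^ 2) := by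
    rw [mul_add, mul_inv_cancel_left₀ hd3.ne']
    nlinarith
  exact le_of_mul_le_mul_left h3 hd3

/-- Compactness estimate for differences of piecewise constant functions. -/
theorem integral_sq_interpFun_sub_le {Ω : Set E3} {R : ℝ} (hΩ : ∀ x ∈ Ω, ‖x‖ ≤ R)
    (M M' : AdmissibleMesh Ω) (z : M.MeshFun) (w : M'.MeshFun) {δ : ℝ} (hδ : 0 < δ) :
    ∫ x, (M.interpFun z x - M'.interpFun w x) ^ 2
      ≤ volume.real (Metric.closedBall (0 : E3) 2) *
          (8 * δ * (M.tv (fun K => z K * |z K|) + M'.tv (fun K => w K * |w K|)))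
        + (δ ^ 3)⁻¹ * ∑ k ∈ cubeIndex R δ,
          (∫ x in cube δ k, (M.interpFun z x - M'.interpFun w x)) ^ 2 := by
  have hm := M.measurable_interpFun z
  have hm' := M'.measurable_interpFun w
  refine integral_sq_le_cubes (B := ∑ K, |z K| + ∑ K, |w K|) (hm.sub hm') (fun x => ?_)
    (fun x hx => ?_) hδ ?_
  · refine (abs_sub _ _).trans (add_le_add (M.abs_interpFun_le z x) (M'.abs_interpFun_le w x))
  · have : x ∉ Ω := fun h => absurd (hΩ x h) (not_le.2 hx)
    rw [Pi.sub_apply, M.interpFun_eq_zero z this, M'.interpFun_eq_zero w this, sub_self]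
  -- The factor `8 * δ` is `2 * 2 * ‖η‖` with `‖η‖ ≤ 2 * δ`: one `2` comes from the square of a
  -- difference, the other from `integral_sq_translate_le`.
  · intro η hη
    have h1 := M.integral_sq_translate_le z η
    have h2 := M'.integral_sq_translate_le w η
    have hsq : ∀ (N : AdmissibleMesh Ω) (v : N.MeshFun),
        Integrable fun x => (N.interpFun v (x + η) - N.interpFun v x) ^ 2 := fun N v =>
      integrable_sq_sub_translate (N.integrable_interpFun v) (N.abs_interpFun_le v) η
    have h3 : ∫ x, ((M.interpFun z - M'.interpFun w) (x + η) - (M.interpFun z - M'.interpFun w) x) ^ 2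
        ≤ ∫ x, (2 * (M.interpFun z (x + η) - M.interpFun z x) ^ 2
          + 2 * (M'.interpFun w (x + η) - M'.interpFun w x) ^ 2) := by
      refine integral_mono_of_nonneg (Eventually.of_forall fun x => sq_nonneg _)
        (((hsq M z).const_mul 2).add ((hsq M' w).const_mul 2)) (Eventually.of_forall fun x => ?_)
      simp only [Pi.sub_apply]
      nlinarith [sq_nonneg ((M.interpFun z (x + η) - M.interpFun z x)
        + (M'.interpFun w (x + η) - M'.interpFun w x))]
    rw [integral_add ((hsq M z).const_mul 2) ((hsq M' w).const_mul 2), integral_const_mul,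
      integral_const_mul] at h3
    have h4 := M.tv_nonneg (fun K => z K * |z K|)
    have h5 := M'.tv_nonneg (fun K => w K * |w K|)
    nlinarith [mul_le_mul_of_nonneg_right hη h4, mul_le_mul_of_nonneg_right hη h5]

end

section

open scoped Convolution ContDiff

/-! ### Mollification -/

/-- The convolution of real-valued functions. -/
def conv (f κ : E3 → ℝ) (x : E3) : ℝ := ∫ y, f y * κ (x - y)

theorem contDiff_fderiv_apply {φ : E3 → ℝ} (hφ : ContDiff ℝ ∞ φ) (η : E3) :
    ContDiff ℝ ∞ fun x => fderiv ℝ φ x η :=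
  (hφ.fderiv_right (m := ∞) le_rfl).clm_apply contDiff_const

theorem hasCompactSupport_sq {ψ : E3 → ℝ} (hψ : HasCompactSupport ψ) :
    HasCompactSupport fun x => ψ x ^ 2 := by
  refine hψ.mono fun x hx => ?_
  rw [Function.mem_support] at hx ⊢
  exact fun h => hx (by rw [h]; norm_num)

theorem integrable_sq_of_hasCompactSupport {ψ : E3 → ℝ} (hψ : HasCompactSupport ψ)
    (hc : Continuous ψ) : Integrable fun x => ψ x ^ 2 :=
  (hc.pow 2).integrable_of_hasCompactSupport (hasCompactSupport_sq hψ)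

theorem conv_eq (f κ : E3 → ℝ) : conv f κ = f ⋆[ContinuousLinearMap.mul ℝ ℝ, volume] κ := by
  funext x
  rw [convolution_def]
  rfl

theorem hasCompactSupport_conv {f κ : E3 → ℝ} (hf : HasCompactSupport f)
    (hκ : HasCompactSupport κ) : HasCompactSupport (conv f κ) := by
  rw [conv_eq]
  exact hf.convolution _ hκ

theorem contDiff_conv {f κ : E3 → ℝ} (hf : Integrable f) (hκ : ContDiff ℝ ∞ κ)
    (hκc : HasCompactSupport κ) : ContDiff ℝ ∞ (conv f κ) := by
  rw [conv_eq]
  exact hκc.contDiff_convolution_right _ hf.locallyIntegrable hκ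

theorem fderiv_conv {f κ : E3 → ℝ} (hf : Integrable f) (hκ : ContDiff ℝ ∞ κ)
    (hκc : HasCompactSupport κ) (x η : E3) :
    fderiv ℝ (conv f κ) x η = conv f (fun y => fderiv ℝ κ y η) x := by
  have h1 : ContDiff ℝ 1 κ := hκ.of_le (by exact_mod_cast le_top)
  rw [conv_eq, conv_eq, (hκc.hasFDerivAt_convolution_right (ContinuousLinearMap.mul ℝ ℝ)
    hf.locallyIntegrable h1 x).fderiv,
    convolution_precompR_apply _ hf.locallyIntegrable (hκc.fderiv ℝ)
      (h1.continuous_fderiv one_ne_zero)]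

theorem integrable_conv {f κ : E3 → ℝ} (hf : Integrable f) (hκ : Integrable κ) :
    Integrable (conv f κ) := by
  rw [conv_eq]
  exact hf.integrable_convolution _ hκ

theorem integral_conv {f κ : E3 → ℝ} (hf : Integrable f) (hκ : Integrable κ) :
    ∫ x, conv f κ x = (∫ x, f x) * ∫ x, κ x := by
  rw [conv_eq, integral_convolution _ hf hκ]
  rfl

/-- By Fubini's theorem, the adjoint of a convolution is the convolution with the reflected kernel.
-/
theorem integral_conv_mul {f κ ψ : E3 → ℝ} (hf : Integrable f) (hκ : Continuous κ) {B : ℝ}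
    (hB : ∀ x, |κ x| ≤ B) (hψ : Integrable ψ) :
    ∫ x, conv f κ x * ψ x = ∫ y, f y * conv ψ (fun z => κ (-z)) y := by
  have h1 : Integrable (Function.uncurry fun x y : E3 => f y * κ (x - y) * ψ x)
      (volume.prod volume) := by
    have h2 : Integrable (fun z : E3 × E3 => ψ z.1 * f z.2) (volume.prod volume) := hψ.mul_prod hf
    have h3 := h2.bdd_mul (f := fun z : E3 × E3 => κ (z.1 - z.2)) (c := B)
      (hκ.comp (continuous_fst.sub continuous_snd)).aestronglyMeasurable
      (Eventually.of_forall fun z => hB _)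
    refine h3.congr (Eventually.of_forall fun z => ?_)
    simp only [Function.uncurry]
    ring
  calc ∫ x, conv f κ x * ψ x = ∫ x, ∫ y, f y * κ (x - y) * ψ x := by
        refine integral_congr_ae (Eventually.of_forall fun x => ?_)
        simp only [conv]
        rw [integral_mul_const]
    _ = ∫ y, ∫ x, f y * κ (x - y) * ψ x := integral_integral_swap h1
    _ = _ := by
        refine integral_congr_ae (Eventually.of_forall fun y => ?_)
        simp only [conv]
        rw [← integral_const_mul]
        refine integral_congr_ae (Eventually.of_forall fun x => ?_)
        simp only [neg_sub]
        ring

/-- Young's inequality for the convolution with a probability density. -/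
theorem integral_conv_sq_le {f κ : E3 → ℝ} (hf : Integrable f) (hf2 : Integrable fun x => f x ^ 2)
    (hκ : Continuous κ) (hκc : HasCompactSupport κ) (hκ0 : ∀ x, 0 ≤ κ x) (hκ1 : ∫ x, κ x = 1) :
    Integrable (fun x => conv f κ x ^ 2) ∧ ∫ x, conv f κ x ^ 2 ≤ ∫ x, f x ^ 2 := by
  have hκi : Integrable κ := hκ.integrable_of_hasCompactSupport hκc
  obtain ⟨B, hB⟩ := hκc.exists_bound_of_continuous hκ
  have h1 : ∀ x, conv f κ x ^ 2 ≤ conv (fun y => f y ^ 2) κ x := by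
    intro x
    have i0 : Integrable fun y => κ (x - y) := hκi.comp_sub_left x
    have hc : Continuous fun y => κ (x - y) := hκ.comp (continuous_const.sub continuous_id)
    have i1 : Integrable fun y => f y * κ (x - y) :=
      hf.mul_bdd (c := B) hc.aestronglyMeasurable (Eventually.of_forall fun y => hB _)
    have i2 : Integrable fun y => f y ^ 2 * κ (x - y) :=
      hf2.mul_bdd (c := B) hc.aestronglyMeasurable (Eventually.of_forall fun y => hB _)
    have e0 : ∫ y, κ (x - y) = 1 := by rw [integral_sub_left_eq_self κ volume x, hκ1]
    set m := conv f κ x with hm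
    -- Jensen's inequality for the probability density `κ (x - ·)`, obtained from the nonnegativity
    -- of a variance.
    have h2 : 0 ≤ ∫ y, (f y - m) ^ 2 * κ (x - y) :=
      integral_nonneg fun y => mul_nonneg (sq_nonneg _) (hκ0 _)
    have h3 : ∫ y, (f y - m) ^ 2 * κ (x - y)
        = ∫ y, (f y ^ 2 * κ (x - y) - 2 * m * (f y * κ (x - y)) + m ^ 2 * κ (x - y)) := by
      refine integral_congr_ae (Eventually.of_forall fun y => ?_)
      ring
    have i3 := integral_add
      (f := fun y => f y ^ 2 * κ (x - y) - 2 * m * (f y * κ (x - y)))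
      (g := fun y => m ^ 2 * κ (x - y)) (i2.sub (i1.const_mul (2 * m))) (i0.const_mul (m ^ 2))
    have i4 := integral_sub i2 (i1.const_mul (2 * m))
    rw [h3, i3, i4, integral_const_mul, integral_const_mul, e0] at h2
    have h5 : ∫ y, f y * κ (x - y) = m := rfl
    have h6 : ∫ y, f y ^ 2 * κ (x - y) = conv (fun y => f y ^ 2) κ x := rfl
    rw [h5, h6] at h2
    nlinarith
  have h2 := integrable_conv hf2 hκi
  have h3 : Integrable fun x => conv f κ x ^ 2 := by
    refine h2.mono ((integrable_conv hf hκi).aestronglyMeasurable.pow 2)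
      (Eventually.of_forall fun x => ?_)
    rw [Real.norm_eq_abs, abs_of_nonneg (sq_nonneg _)]
    exact (h1 x).trans (le_abs_self _)
  refine ⟨h3, (integral_mono h3 h2 h1).trans_eq ?_⟩
  rw [integral_conv hf2 hκi, hκ1, mul_one]

/-- The bump function of unit radius used for mollification. -/
def unitBump : ContDiffBump (0 : E3) where
  rIn := 1 / 2
  rOut := 1
  rIn_pos := by norm_num
  rIn_lt_rOut := by norm_num

/-- The rescaled mollifier. -/
def mollifier (ε : ℝ) (x : E3) : ℝ := (ε ^ 3)⁻¹ * unitBump.normed volume (ε⁻¹ • x)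

theorem contDiff_mollifier (ε : ℝ) : ContDiff ℝ ∞ (mollifier ε) :=
  contDiff_const.mul (unitBump.contDiff_normed.comp (contDiff_const_smul _))

theorem mollifier_nonneg {ε : ℝ} (hε : 0 < ε) (x : E3) : 0 ≤ mollifier ε x :=
  mul_nonneg (by positivity) (unitBump.nonneg_normed _)

theorem mollifier_neg (ε : ℝ) (x : E3) : mollifier ε (-x) = mollifier ε x := by
  rw [mollifier, mollifier, smul_neg, unitBump.normed_neg]

theorem mollifier_eq_zero {ε : ℝ} (hε : 0 < ε) {x : E3} (hx : ε ≤ ‖x‖) : mollifier ε x = 0 := by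
  have : ε⁻¹ • x ∉ Function.support (unitBump.normed volume) := by
    rw [unitBump.support_normed_eq, mem_ball_zero_iff, norm_smul, Real.norm_eq_abs,
      abs_of_pos (inv_pos.2 hε), not_lt, ← div_eq_inv_mul]
    exact (one_le_div hε).2 hx
  rw [mollifier, Function.notMem_support.1 this, mul_zero]

theorem hasCompactSupport_mollifier {ε : ℝ} (hε : 0 < ε) : HasCompactSupport (mollifier ε) := by
  refine HasCompactSupport.intro (isCompact_closedBall (0 : E3) ε) fun x hx => ?_
  rw [mem_closedBall_zero_iff, not_le] at hx
  exact mollifier_eq_zero hε hx.le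

theorem integral_mollifier {ε : ℝ} (hε : 0 < ε) : ∫ x, mollifier ε x = 1 := by
  simp only [mollifier]
  rw [integral_const_mul, Measure.integral_comp_inv_smul, unitBump.integral_normed,
    finrank_euclideanSpace_fin, abs_of_pos (by positivity)]
  simp [hε.ne']

theorem fderiv_mollifier (ε : ℝ) (x : E3) :
    fderiv ℝ (mollifier ε) x
      = (ε ^ 3)⁻¹ • ε⁻¹ • fderiv ℝ (unitBump.normed (volume : Measure E3)) (ε⁻¹ • x) := by
  have h : DifferentiableAt ℝ (fun x : E3 => unitBump.normed (volume : Measure E3) (ε⁻¹ • x)) x :=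
    ((unitBump.contDiff_normed (n := ⊤)).comp (contDiff_const_smul ε⁻¹)).contDiffAt.differentiableAt
      (by simp)
  have : mollifier ε = fun x => (ε ^ 3)⁻¹ * unitBump.normed (volume : Measure E3) (ε⁻¹ • x) := rfl
  rw [this, fderiv_const_mul h, fderiv_comp_smul]

theorem fderiv_mollifier_neg (ε : ℝ) (x η : E3) :
    fderiv ℝ (mollifier ε) (-x) η = -fderiv ℝ (mollifier ε) x η := by
  have h : mollifier ε = fun x => mollifier ε ((-1 : ℝ) • x) := by
    funext x
    rw [neg_one_smul, mollifier_neg]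
  conv_rhs => rw [h]
  rw [fderiv_comp_smul]
  simp

/-- The size of the gradient of the unit mollifier. -/
def mollConst : ℝ := ∫ x : E3, ‖fderiv ℝ (unitBump.normed (volume : Measure E3)) x‖

theorem mollConst_nonneg : 0 ≤ mollConst := integral_nonneg fun _ => norm_nonneg _

theorem integral_norm_fderiv_mollifier {ε : ℝ} (hε : 0 < ε) :
    ∫ x, ‖fderiv ℝ (mollifier ε) x‖ = mollConst / ε := by
  simp_rw [fderiv_mollifier, norm_smul, integral_const_mul]
  rw [Measure.integral_comp_inv_smul volume
    (fun x : E3 => ‖fderiv ℝ (unitBump.normed (volume : Measure E3)) x‖),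
    finrank_euclideanSpace_fin, mollConst, smul_eq_mul]
  simp only [norm_inv, norm_pow, Real.norm_eq_abs, abs_of_pos hε, abs_pow]
  field_simp

theorem conv_mollifier_eq_zero {f : E3 → ℝ} {ε : ℝ} (hε : 0 < ε) {x : E3}
    (h : ∀ y, ‖y - x‖ < ε → f y = 0) : conv f (mollifier ε) x = 0 := by
  rw [conv]
  refine integral_eq_zero_of_ae (Eventually.of_forall fun y => ?_)
  by_cases hy : ‖y - x‖ < ε
  · simp [h y hy]
  · simp only [Pi.zero_apply]
    rw [mollifier_eq_zero hε (by rw [norm_sub_rev]; exact not_lt.1 hy), mul_zero]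

theorem conv_mollifier_eq_one {f : E3 → ℝ} {ε : ℝ} (hε : 0 < ε) {x : E3}
    (h : ∀ y, ‖y - x‖ < ε → f y = 1) : conv f (mollifier ε) x = 1 := by
  rw [conv, ← integral_mollifier hε, ← integral_sub_left_eq_self (mollifier ε) volume x]
  refine integral_congr_ae (Eventually.of_forall fun y => ?_)
  by_cases hy : ‖y - x‖ < ε
  · simp [h y hy]
  · dsimp only
    rw [mollifier_eq_zero hε (by rw [norm_sub_rev]; exact not_lt.1 hy), mul_zero]

theorem abs_conv_mollifier_sub_le {f : E3 → ℝ} (hf : Integrable f) {ε : ℝ} (hε : 0 < ε) {B : ℝ}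
    (hB : ∀ x y, |f x - f y| ≤ B * ‖x - y‖) (hB0 : 0 ≤ B) (x : E3) :
    |conv f (mollifier ε) x - f x| ≤ B * ε := by
  have hm := (contDiff_mollifier ε).continuous
  have hmi : Integrable fun y => mollifier ε (x - y) :=
    (hm.integrable_of_hasCompactSupport (hasCompactSupport_mollifier hε)).comp_sub_left x
  obtain ⟨C, hC⟩ := (hasCompactSupport_mollifier hε).exists_bound_of_continuous hm
  have i1 : Integrable fun y => f y * mollifier ε (x - y) :=
    hf.mul_bdd (c := C) (hm.comp (continuous_const.sub continuous_id)).aestronglyMeasurable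
      (Eventually.of_forall fun y => hC _)
  have e0 : ∫ y, mollifier ε (x - y) = 1 := by
    rw [integral_sub_left_eq_self (mollifier ε) volume x, integral_mollifier hε]
  have e1 : conv f (mollifier ε) x - f x = ∫ y, (f y - f x) * mollifier ε (x - y) := by
    have := integral_sub i1 (hmi.const_mul (f x))
    rw [integral_const_mul, e0, mul_one] at this
    rw [conv, ← this]
    refine integral_congr_ae (Eventually.of_forall fun y => ?_)
    ring
  rw [e1, ← Real.norm_eq_abs]
  refine (norm_integral_le_integral_norm _).trans ?_
  have : ∫ y, ‖(f y - f x) * mollifier ε (x - y)‖ ≤ ∫ y, B * ε * mollifier ε (x - y) := by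
    refine integral_mono_of_nonneg (Eventually.of_forall fun _ => norm_nonneg _)
      (hmi.const_mul _) (Eventually.of_forall fun y => ?_)
    dsimp only
    rw [norm_mul, Real.norm_eq_abs, Real.norm_eq_abs, abs_of_nonneg (mollifier_nonneg hε _)]
    rcases lt_or_ge ‖x - y‖ ε with h | h
    · refine mul_le_mul_of_nonneg_right ((hB y x).trans ?_) (mollifier_nonneg hε _)
      rw [norm_sub_rev]
      exact mul_le_mul_of_nonneg_left h.le hB0
    · rw [mollifier_eq_zero hε h]; simp
  rwa [integral_const_mul, e0, mul_one] at this

theorem norm_fderiv_conv_mollifier_le {f : E3 → ℝ} (hf : Integrable f) {ε : ℝ} (hε : 0 < ε)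
    (hf1 : ∀ x, |f x| ≤ 1) (x : E3) :
    ‖fderiv ℝ (conv f (mollifier ε)) x‖ ≤ mollConst / ε := by
  refine ContinuousLinearMap.opNorm_le_bound _ (div_nonneg mollConst_nonneg hε.le) fun η => ?_
  have hc : Continuous fun y => fderiv ℝ (mollifier ε) y :=
    (contDiff_mollifier ε).continuous_fderiv (by simp)
  have hi : Integrable fun y => ‖fderiv ℝ (mollifier ε) (x - y)‖ :=
    ((hc.integrable_of_hasCompactSupport
      ((hasCompactSupport_mollifier hε).fderiv ℝ)).norm).comp_sub_left x
  rw [fderiv_conv hf (contDiff_mollifier ε) (hasCompactSupport_mollifier hε), conv]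
  refine (norm_integral_le_integral_norm _).trans ?_
  have h1 : ∫ y, ‖f y * fderiv ℝ (mollifier ε) (x - y) η‖
      ≤ ∫ y, ‖fderiv ℝ (mollifier ε) (x - y)‖ * ‖η‖ := by
    refine integral_mono_of_nonneg (Eventually.of_forall fun _ => norm_nonneg _)
      (hi.mul_const _) (Eventually.of_forall fun y => ?_)
    dsimp only
    rw [norm_mul]
    calc ‖f y‖ * ‖fderiv ℝ (mollifier ε) (x - y) η‖ ≤ 1 * (‖fderiv ℝ (mollifier ε) (x - y)‖ * ‖η‖) :=
          mul_le_mul (hf1 y) (ContinuousLinearMap.le_opNorm _ _) (norm_nonneg _) zero_le_one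
      _ = _ := one_mul _
  rw [integral_mul_const, integral_sub_left_eq_self
    (fun y => ‖fderiv ℝ (mollifier ε) y‖) volume x, integral_norm_fderiv_mollifier hε] at h1
  exact h1

/-- A weak derivative bound is preserved by mollification. -/
theorem integral_fderiv_conv_sq_le {f : E3 → ℝ} (hf : Integrable f) (hfc : HasCompactSupport f)
    {η : E3} {A : ℝ} (hA0 : 0 ≤ A)
    (hA : ∀ φ : E3 → ℝ, ContDiff ℝ ∞ φ → HasCompactSupport φ →
      (∫ x, f x * fderiv ℝ φ x η) ^ 2 ≤ A * ∫ x, φ x ^ 2) {ε : ℝ} (hε : 0 < ε) :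
    ∫ x, (fderiv ℝ (conv f (mollifier ε)) x η) ^ 2 ≤ A := by
  have hms := contDiff_mollifier ε
  have hmc := hasCompactSupport_mollifier hε
  set ψ : E3 → ℝ := fun x => fderiv ℝ (conv f (mollifier ε)) x η with hψ
  have hψs : ContDiff ℝ ∞ ψ := contDiff_fderiv_apply (contDiff_conv hf hms hmc) η
  have hψc : HasCompactSupport ψ := (hasCompactSupport_conv hfc hmc).fderiv_apply ℝ η
  have hψi : Integrable ψ := hψs.continuous.integrable_of_hasCompactSupport hψc
  have hψ2 : Integrable fun x => ψ x ^ 2 := integrable_sq_of_hasCompactSupport hψc hψs.continuous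
  have hκs : Continuous fun y => fderiv ℝ (mollifier ε) y η := (contDiff_fderiv_apply hms η).continuous
  have hκc : HasCompactSupport fun y => fderiv ℝ (mollifier ε) y η := hmc.fderiv_apply ℝ η
  obtain ⟨B, hB⟩ := hκc.exists_bound_of_continuous hκs
  -- The right test function is the mollification of `ψ` itself: the derivative of the mollifier is
  -- odd, so the pairing gives `∫ ψ ^ 2` up to sign. Young's inequality bounds the norm of the test
  -- function by that of `ψ`, and one factor `∫ ψ ^ 2` cancels.
  have e1 : ∫ x, ψ x ^ 2 = -∫ y, f y * fderiv ℝ (conv ψ (mollifier ε)) y η := by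
    have h1 : ∀ x, ψ x ^ 2 = conv f (fun y => fderiv ℝ (mollifier ε) y η) x * ψ x := fun x => by
      rw [sq, ← fderiv_conv hf hms hmc]
    simp_rw [h1]
    rw [integral_conv_mul hf hκs hB hψi, ← integral_neg]
    refine integral_congr_ae (Eventually.of_forall fun y => ?_)
    dsimp only
    rw [fderiv_conv hψi hms hmc]
    simp_rw [fderiv_mollifier_neg, conv, mul_neg, integral_neg]
    rw [mul_neg]
  have h2 := hA (conv ψ (mollifier ε)) (contDiff_conv hψi hms hmc)
    (hasCompactSupport_conv hψc hmc)
  have h3 := (integral_conv_sq_le hψi hψ2 hms.continuous hmc (mollifier_nonneg hε)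
    (integral_mollifier hε)).2
  have h4 : 0 ≤ ∫ x, ψ x ^ 2 := integral_nonneg fun x => sq_nonneg _
  have h5 : (∫ x, ψ x ^ 2) ^ 2 ≤ A * ∫ x, conv ψ (mollifier ε) x ^ 2 := by
    rw [e1, neg_sq]; exact h2
  rcases h4.eq_or_lt with h6 | h6
  · rw [← h6]; exact hA0
  · nlinarith

end

section

open scoped Convolution ContDiff ENNReal

/-! ### The complement of a polyhedral domain -/

/-- Moving a point of the closed polyhedron slightly towards a point that satisfies all strict
inequalities makes every inequality strict. -/
theorem closure_halfspaces {N : ℕ} (a : Fin N → E3) (c : Fin N → ℝ)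
    (hne : {x : E3 | ∀ i, inner ℝ (a i) x < c i}.Nonempty) :
    closure {x : E3 | ∀ i, inner ℝ (a i) x < c i} = {x | ∀ i, inner ℝ (a i) x ≤ c i} := by
  obtain ⟨x₀, hx₀⟩ := hne
  rw [mem_ofPred_eq] at hx₀
  refine Subset.antisymm (closure_minimal (fun x hx i => (hx i).le) ?_) fun x hx => ?_
  · rw [ofPred_forall]
    exact isClosed_iInter fun i =>
      isClosed_le (continuous_const.inner continuous_id) continuous_const
  · rw [mem_ofPred_eq] at hx
    have h1 : Tendsto (fun s : ℝ => x + s • (x₀ - x)) (𝓝[>] 0) (𝓝 x) := by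
      have : Continuous fun s : ℝ => x + s • (x₀ - x) := by fun_prop
      have h2 := this.tendsto 0
      simp only [zero_smul, add_zero] at h2
      exact h2.mono_left nhdsWithin_le_nhds
    refine mem_closure_of_tendsto h1 ?_
    filter_upwards [Ioo_mem_nhdsGT (zero_lt_one (α := ℝ))] with s hs
    intro i
    rw [inner_add_right, inner_smul_right, inner_sub_right]
    have h3 := hx i
    have h4 := hx₀ i
    nlinarith [mul_nonneg (sub_nonneg.2 hs.2.le) (sub_nonneg.2 h3),
      mul_pos hs.1 (sub_pos.2 h4)]

theorem IsPolyhedralDomain.isOpen {Ω : Set E3} (hΩ : IsPolyhedralDomain Ω) : IsOpen Ω := by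
  obtain ⟨-, N, v, h⟩ := hΩ
  rw [h]; exact isOpen_interior

theorem isCompact_polytopes {N : ℕ} (v : Fin N → Finset E3) :
    IsCompact (⋃ i, convexHull ℝ (v i : Set E3)) :=
  isCompact_iUnion fun i => (v i).finite_toSet.isCompact_convexHull ℝ

theorem IsPolyhedralDomain.isBounded {Ω : Set E3} (hΩ : IsPolyhedralDomain Ω) :
    Bornology.IsBounded Ω := by
  obtain ⟨-, N, v, h⟩ := hΩ
  rw [h]
  exact (isCompact_polytopes v).isBounded.subset interior_subset

/-- The union of the polytopes is closed, hence contains `closure Ω`, and its interior is `Ω`. Slits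
are excluded in this way. -/
theorem IsPolyhedralDomain.interior_closure {Ω : Set E3} (hΩ : IsPolyhedralDomain Ω) :
    interior (closure Ω) = Ω := by
  refine Subset.antisymm ?_ (interior_maximal subset_closure hΩ.isOpen)
  obtain ⟨-, N, v, h⟩ := hΩ
  conv_rhs => rw [h]
  refine interior_mono ?_
  rw [h]
  exact closure_minimal interior_subset (isCompact_polytopes v).isClosed

/-- The complement of a polyhedral domain that has an admissible mesh is a finite union of convex
sets with interior points. -/
theorem exists_convex_cover_compl {Ω : Set E3} (hΩ : IsPolyhedralDomain Ω) (M : AdmissibleMesh Ω) :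
    ∃ (ι : Type) (_ : Fintype ι) (D : ι → Set E3) (c : ι → E3) (r : ℝ), 0 < r ∧
      (∀ i, Convex ℝ (D i)) ∧ (∀ i, IsClosed (D i)) ∧
      (∀ i, Metric.ball (c i) r ⊆ D i) ∧ Ωᶜ = ⋃ i, D i := by
  choose hne _ N a b hcell using M.cell_polyhedron
  -- A point outside all closed cells violates at least one inequality of every cell, and `s`
  -- selects one for each. Every `U s` is a finite intersection of open half-spaces, hence convex.
  let U : (∀ K, Fin (N K)) → Set E3 := fun s => ⋂ K, {x | b K (s K) < inner ℝ (a K (s K)) x}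
  have hUo : ∀ s, IsOpen (U s) := fun s => isOpen_iInter_of_finite fun K =>
    isOpen_lt continuous_const (continuous_const.inner continuous_id)
  have hUc : ∀ s, Convex ℝ (U s) := fun s => convex_iInter fun K =>
    convex_halfSpace_gt (innerSL ℝ (a K (s K))).toLinearMap.isLinear _
  have h1 : closure Ω = ⋃ K, {x | ∀ i, inner ℝ (a K i) x ≤ b K i} := by
    rw [← M.closure_cells, closure_iUnion_of_finite]
    refine iUnion_congr fun K => ?_
    have := hne K
    rw [hcell K] at this ⊢
    exact closure_halfspaces _ _ this
  have h2 : (closure Ω)ᶜ = ⋃ s, U s := by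
    rw [h1]
    ext x
    simp only [mem_compl_iff, mem_iUnion, mem_ofPred_eq, not_exists, not_forall, not_le, U,
      mem_iInter]
    exact ⟨fun h => by choose s hs using h; exact ⟨s, hs⟩, fun ⟨s, hs⟩ K => ⟨s K, hs K⟩⟩
  -- Taking closures recovers all of the complement, boundary points included, because `Ω` is the
  -- interior of its closure.
  have h3 : Ωᶜ = ⋃ s, closure (U s) := by
    rw [← closure_iUnion_of_finite, ← h2, closure_compl, hΩ.interior_closure]
  -- Without the empty selections every piece contains a ball, and as there are finitely many
  -- pieces, a common radius exists.
  let ι := {s // (U s).Nonempty}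
  have hb : ∀ i : ι, ∃ c r, 0 < r ∧ Metric.ball c r ⊆ U i.1 := fun i => by
    obtain ⟨c, hc⟩ := i.2
    obtain ⟨r, hr, h⟩ := Metric.isOpen_iff.1 (hUo i.1) c hc
    exact ⟨c, r, hr, h⟩
  choose c r hr hball using hb
  classical
  have : Fintype ι := Fintype.ofFinite ι
  obtain ⟨r₀, h4, h5⟩ : ∃ r₀ : ℝ, (∀ i : ι, r₀ < r i) ∧ 0 < r₀ := by
    have h6 : ∀ᶠ r₀ : ℝ in 𝓝[>] 0, ∀ i, r₀ < r i := eventually_all.2 fun i =>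
      by filter_upwards [Ioo_mem_nhdsGT (hr i)] with x hx using hx.2
    exact (h6.and self_mem_nhdsWithin).exists
  refine ⟨ι, inferInstance, fun i => closure (U i.1), c, r₀, h5, fun i => (hUc i.1).closure,
    fun i => isClosed_closure,
    fun i => (Metric.ball_subset_ball (h4 i).le).trans ((hball i).trans subset_closure), ?_⟩
  rw [h3]
  ext x
  simp only [mem_iUnion]
  constructor
  · rintro ⟨s, hs⟩
    have : (U s).Nonempty := closure_nonempty_iff.1 ⟨x, hs⟩
    exact ⟨⟨s, this⟩, hs⟩
  · rintro ⟨i, hi⟩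
    exact ⟨i.1, hi⟩

/-- Contracting towards an interior point pushes a neighbourhood of a convex set into it. -/
theorem mem_of_contract {D : Set E3} (hD : Convex ℝ D) {c : E3} {r : ℝ} (hr : 0 < r)
    (hball : Metric.ball c r ⊆ D) {ε : ℝ} (hε : 0 < ε) (hεr : 8 * ε ≤ r) {x y z : E3}
    (hy : y ∈ D) (hxy : ‖x - y‖ ≤ 3 * ε) (hz : ‖z - (c + (1 - 4 * ε / r) • (x - c))‖ < ε) :
    z ∈ D := by
  set t := 4 * ε / r with ht
  have ht0 : 0 < t := by positivity
  have ht1 : t ≤ 1 := by rw [ht, div_le_one hr]; linarith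
  have htr : t * r = 4 * ε := by rw [ht]; field_simp
  -- `z` equals `(1 - t) • y + t • w`. The displacement that `w` has to absorb is less than `3 ε + ε
  -- = t * r`, so `w` is in the ball around `c`.
  set w := c + t⁻¹ • ((1 - t) • (x - y) + (z - (c + (1 - t) • (x - c)))) with hw
  have hwD : w ∈ D := by
    refine hball ?_
    rw [mem_ball_iff_norm, hw, add_sub_cancel_left, norm_smul, norm_inv, Real.norm_eq_abs,
      abs_of_pos ht0, inv_mul_lt_iff₀ ht0, htr]
    refine (norm_add_le _ _).trans_lt ?_
    rw [norm_smul, Real.norm_eq_abs, abs_of_nonneg (by linarith)]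
    nlinarith [norm_nonneg (x - y)]
  have := hD hy hwD (sub_nonneg.2 ht1) ht0.le (by ring)
  convert this using 1
  rw [hw, smul_add, smul_smul, mul_inv_cancel₀ ht0.ne']
  module

/-! ### A Poincaré inequality on a thin strip -/

theorem sq_intervalIntegral_le {g : ℝ → ℝ} (hg : Continuous g) {a b : ℝ} (hab : a ≤ b) :
    (∫ t in a..b, g t) ^ 2 ≤ (b - a) * ∫ t in a..b, g t ^ 2 := by
  set I := ∫ t in a..b, g t with hI
  rcases hab.eq_or_lt with rfl | h
  · simp [hI]
  have h1 : 0 ≤ ∫ t in a..b, ((b - a) * g t - I) ^ 2 :=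
    intervalIntegral.integral_nonneg hab fun t _ => sq_nonneg _
  have e : ∫ t in a..b, ((b - a) * g t - I) ^ 2
      = ∫ t in a..b, ((b - a) ^ 2 * g t ^ 2 - 2 * (b - a) * I * g t + I ^ 2) := by
    congr 1; funext t; ring
  rw [e, intervalIntegral.integral_add, intervalIntegral.integral_sub,
    intervalIntegral.integral_const_mul, intervalIntegral.integral_const_mul,
    intervalIntegral.integral_const, ← hI, smul_eq_mul] at h1
  · have h2 : 0 ≤ (b - a) * ((b - a) * (∫ t in a..b, g t ^ 2) - I ^ 2) := by nlinarith
    have := nonneg_of_mul_nonneg_right h2 (sub_pos.2 h)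
    linarith
  all_goals exact Continuous.intervalIntegrable (by fun_prop) _ _

theorem integral_comp_dilation (c : E3) {t : ℝ} (ht : 0 < t) (f : E3 → ℝ) :
    ∫ x, f (c + t • (x - c)) = (t ^ 3)⁻¹ * ∫ x, f x := by
  rw [integral_sub_right_eq_self (fun x => f (c + t • x)) c,
    Measure.integral_comp_smul volume (fun x => f (c + x)), integral_add_left_eq_self f c,
    finrank_euclideanSpace_fin, abs_of_pos (by positivity), smul_eq_mul]

/-- `F` vanishes at the contracted point, so `F x` is the integral of the radial derivative over
`[μ, 1]`. After Cauchy–Schwarz and Fubini's theorem each dilation costs a Jacobian `t⁻³ ≤ 8`, as `t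
> 1/2`. The factor `(1 - μ)²` will compensate the gradient of the cutoff. -/
theorem integral_strip_sq_le {F : E3 → ℝ} (hF : ContDiff ℝ ∞ F) (hFc : HasCompactSupport F)
    {S : Set E3} (hS : MeasurableSet S) {c : E3} {μ R : ℝ} (hμ : 1 / 2 ≤ μ) (hμ1 : μ ≤ 1)
    (hR : ∀ x ∈ S, ‖x - c‖ ≤ R) (hz : ∀ x ∈ S, F (c + μ • (x - c)) = 0) :
    ∫ x in S, F x ^ 2 ≤ 8 * (1 - μ) ^ 2 * R ^ 2 * ∫ x, ‖fderiv ℝ F x‖ ^ 2 := by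
  have hc' : Continuous fun x => fderiv ℝ F x := hF.continuous_fderiv (by simp)
  have hG : Continuous fun x => ‖fderiv ℝ F x‖ ^ 2 := hc'.norm.pow 2
  have hGi : Integrable fun x => ‖fderiv ℝ F x‖ ^ 2 := hG.integrable_of_hasCompactSupport (by
    refine (hFc.fderiv ℝ).mono fun x hx => ?_
    rw [Function.mem_support] at hx ⊢
    exact fun h => hx (by rw [h]; simp))
  have hI0 : 0 ≤ ∫ x, ‖fderiv ℝ F x‖ ^ 2 := integral_nonneg fun x => sq_nonneg _
  have hpt : ∀ x ∈ S, F x ^ 2 ≤ ∫ t in μ..1, (1 - μ) * R ^ 2 * ‖fderiv ℝ F (c + t • (x - c))‖ ^ 2 := by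
    intro x hx
    have hd : ∀ t : ℝ, HasDerivAt (fun t : ℝ => F (c + t • (x - c)))
        (fderiv ℝ F (c + t • (x - c)) (x - c)) t := by
      intro t
      have h1 : HasDerivAt (fun t : ℝ => c + t • (x - c)) (x - c) t := by
        simpa using ((hasDerivAt_id t).smul_const (x - c)).const_add c
      exact ((hF.differentiable (by simp)) _).hasFDerivAt.comp_hasDerivAt t h1
    have hcont : Continuous fun t : ℝ => fderiv ℝ F (c + t • (x - c)) (x - c) :=
      (hc'.comp (by fun_prop)).clm_apply continuous_const
    have h2 : F x = ∫ t in μ..1, fderiv ℝ F (c + t • (x - c)) (x - c) := by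
      rw [intervalIntegral.integral_eq_sub_of_hasDerivAt (fun t _ => hd t)
        (hcont.intervalIntegrable _ _), hz x hx]
      simp
    rw [h2]
    refine (sq_intervalIntegral_le hcont hμ1).trans ?_
    rw [← intervalIntegral.integral_const_mul]
    refine intervalIntegral.integral_mono_on hμ1
      ((continuous_const.mul (hcont.pow 2)).intervalIntegrable _ _)
      ((continuous_const.mul ((hc'.comp (by fun_prop)).norm.pow 2)).intervalIntegrable _ _)
      fun t _ => ?_
    rw [mul_assoc]
    refine mul_le_mul_of_nonneg_left ?_ (by linarith)
    rw [← sq_abs, mul_comm, ← mul_pow]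
    refine pow_le_pow_left₀ (abs_nonneg _) ?_ 2
    exact ((fderiv ℝ F _).le_opNorm _).trans (mul_le_mul_of_nonneg_left (hR x hx) (norm_nonneg _))
  have hmeas : Measurable (Function.uncurry fun (x : E3) (t : ℝ) =>
      ENNReal.ofReal ((1 - μ) * R ^ 2 * ‖fderiv ℝ F (c + t • (x - c))‖ ^ 2)) := by
    refine ENNReal.measurable_ofReal.comp (Continuous.measurable ?_)
    exact continuous_const.mul ((hc'.comp (by fun_prop)).norm.pow 2)
  have hpt' : ∀ x ∈ S, ENNReal.ofReal (F x ^ 2) ≤ ∫⁻ t in Ioc μ 1,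
      ENNReal.ofReal ((1 - μ) * R ^ 2 * ‖fderiv ℝ F (c + t • (x - c))‖ ^ 2) := by
    intro x hx
    refine (ENNReal.ofReal_le_ofReal (hpt x hx)).trans_eq ?_
    rw [intervalIntegral.integral_of_le hμ1, ofReal_integral_eq_lintegral_ofReal]
    · refine (Continuous.integrableOn_Icc ?_).mono_set Ioc_subset_Icc_self
      exact continuous_const.mul ((hc'.comp (by fun_prop)).norm.pow 2)
    · exact Eventually.of_forall fun t => mul_nonneg (mul_nonneg (by linarith) (sq_nonneg _))
        (sq_nonneg _)
  have hin : ∀ t ∈ Ioc μ 1, ∫⁻ x, ENNReal.ofReal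
      ((1 - μ) * R ^ 2 * ‖fderiv ℝ F (c + t • (x - c))‖ ^ 2)
      ≤ ENNReal.ofReal (8 * ((1 - μ) * R ^ 2 * ∫ x, ‖fderiv ℝ F x‖ ^ 2)) := by
    intro t ht
    have ht0 : 0 < t := by linarith [ht.1]
    have hi : Integrable fun x => ‖fderiv ℝ F (c + t • (x - c))‖ ^ 2 :=
      ((hGi.comp_add_left c).comp_smul ht0.ne').comp_sub_right c
    rw [← ofReal_integral_eq_lintegral_ofReal (hi.const_mul _)
      (Eventually.of_forall fun t => mul_nonneg (mul_nonneg (by linarith) (sq_nonneg _))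
        (sq_nonneg _)), integral_const_mul,
      integral_comp_dilation c ht0 fun x => ‖fderiv ℝ F x‖ ^ 2]
    refine ENNReal.ofReal_le_ofReal ?_
    have h8 : (t ^ 3)⁻¹ ≤ 8 := by
      rw [inv_le_comm₀ (by positivity) (by norm_num)]
      have : (1 / 2 : ℝ) ^ 3 ≤ t ^ 3 := pow_le_pow_left₀ (by norm_num) (by linarith [ht.1]) 3
      linarith
    have hk : 0 ≤ (1 - μ) * R ^ 2 * ∫ x, ‖fderiv ℝ F x‖ ^ 2 :=
      mul_nonneg (mul_nonneg (by linarith) (sq_nonneg _)) hI0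
    nlinarith [mul_le_mul_of_nonneg_right h8 hk]
  have hk : 0 ≤ (1 - μ) * R ^ 2 * ∫ x, ‖fderiv ℝ F x‖ ^ 2 :=
      mul_nonneg (mul_nonneg (by linarith) (sq_nonneg _)) hI0
  have hfin : 8 * (1 - μ) ^ 2 * R ^ 2 * ∫ x, ‖fderiv ℝ F x‖ ^ 2
      = 8 * ((1 - μ) * R ^ 2 * ∫ x, ‖fderiv ℝ F x‖ ^ 2) * (1 - μ) := by ring
  rw [hfin, ← ENNReal.ofReal_le_ofReal_iff (mul_nonneg (by linarith) (by linarith)),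
    ofReal_integral_eq_lintegral_ofReal
      (integrable_sq_of_hasCompactSupport hFc hF.continuous).integrableOn
      (Eventually.of_forall fun x => sq_nonneg _)]
  calc ∫⁻ x in S, ENNReal.ofReal (F x ^ 2)
      ≤ ∫⁻ x in S, ∫⁻ t in Ioc μ 1,
        ENNReal.ofReal ((1 - μ) * R ^ 2 * ‖fderiv ℝ F (c + t • (x - c))‖ ^ 2) :=
        setLIntegral_mono' hS hpt'
    _ ≤ ∫⁻ x, ∫⁻ t in Ioc μ 1,
        ENNReal.ofReal ((1 - μ) * R ^ 2 * ‖fderiv ℝ F (c + t • (x - c))‖ ^ 2) :=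
        setLIntegral_le_lintegral _ _
    _ = ∫⁻ t in Ioc μ 1, ∫⁻ x,
        ENNReal.ofReal ((1 - μ) * R ^ 2 * ‖fderiv ℝ F (c + t • (x - c))‖ ^ 2) :=
        lintegral_lintegral_swap hmeas.aemeasurable
    _ ≤ ∫⁻ _t in Ioc μ 1, ENNReal.ofReal (8 * ((1 - μ) * R ^ 2 * ∫ x, ‖fderiv ℝ F x‖ ^ 2)) :=
        setLIntegral_mono' measurableSet_Ioc hin
    _ = _ := by
        rw [setLIntegral_const, Real.volume_Ioc, ← ENNReal.ofReal_mul (by linarith)]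

end

section

open scoped ContDiff

/-! ### Cutoff functions and approximation by test functions -/

/-- A smooth cutoff function, equal to one outside the `3 ε`-neighbourhood of the complement of
`Ω`. -/
def cutoff (Ω : Set E3) (ε : ℝ) : E3 → ℝ :=
  conv ({x | 2 * ε ≤ Metric.infDist x Ωᶜ}.indicator fun _ => 1) (mollifier ε)

section cutoff

variable {Ω : Set E3} {ε : ℝ}

theorem infDist_compl_pos_subset (Ω : Set E3) {δ : ℝ} (hδ : 0 < δ) :
    {x | δ ≤ Metric.infDist x Ωᶜ} ⊆ Ω := by
  intro x hx
  by_contra h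
  have : Metric.infDist x Ωᶜ = 0 := Metric.infDist_zero_of_mem h
  rw [mem_ofPred_eq, this] at hx
  linarith

theorem isClosed_le_infDist (s : Set E3) (δ : ℝ) : IsClosed {x | δ ≤ Metric.infDist x s} :=
  isClosed_le continuous_const (Metric.continuous_infDist_pt s)

theorem integrable_cutoffSet (hΩ : Bornology.IsBounded Ω) (hε : 0 < ε) :
    Integrable ({x : E3 | 2 * ε ≤ Metric.infDist x Ωᶜ}.indicator fun _ => (1 : ℝ)) := by
  rw [integrable_indicator_iff (isClosed_le_infDist _ _).measurableSet]
  exact integrableOn_const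
    (hΩ.subset (infDist_compl_pos_subset Ω (by positivity))).measure_lt_top.ne

theorem contDiff_cutoff (hΩ : Bornology.IsBounded Ω) (hε : 0 < ε) : ContDiff ℝ ∞ (cutoff Ω ε) :=
  contDiff_conv (integrable_cutoffSet hΩ hε) (contDiff_mollifier ε)
    (hasCompactSupport_mollifier hε)

theorem abs_indicator_one_le (s : Set E3) (x : E3) : |s.indicator (fun _ => (1 : ℝ)) x| ≤ 1 := by
  by_cases h : x ∈ s <;> simp [h]

theorem norm_fderiv_cutoff_le (hΩ : Bornology.IsBounded Ω) (hε : 0 < ε) (x : E3) :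
    ‖fderiv ℝ (cutoff Ω ε) x‖ ≤ mollConst / ε :=
  norm_fderiv_conv_mollifier_le (integrable_cutoffSet hΩ hε) hε (abs_indicator_one_le _) x

theorem abs_cutoff_le (hε : 0 < ε) (x : E3) : |cutoff Ω ε x| ≤ 1 := by
  have hmi : Integrable fun y => mollifier ε (x - y) :=
    ((contDiff_mollifier ε).continuous.integrable_of_hasCompactSupport
      (hasCompactSupport_mollifier hε)).comp_sub_left x
  rw [cutoff, conv, ← Real.norm_eq_abs]
  refine (norm_integral_le_integral_norm _).trans ?_
  have e : ∫ y, mollifier ε (x - y) = 1 :=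
    (integral_sub_left_eq_self (mollifier ε) volume x).trans (integral_mollifier hε)
  refine le_of_le_of_eq ?_ e
  refine integral_mono_of_nonneg (Eventually.of_forall fun _ => norm_nonneg _) hmi
    (Eventually.of_forall fun y => ?_)
  dsimp only
  rw [norm_mul, Real.norm_eq_abs, Real.norm_eq_abs, abs_of_nonneg (mollifier_nonneg hε _)]
  exact mul_le_of_le_one_left (mollifier_nonneg hε _) (abs_indicator_one_le _ _)

theorem cutoff_eq_one (hε : 0 < ε) {x : E3} (hx : 3 * ε ≤ Metric.infDist x Ωᶜ) :
    cutoff Ω ε x = 1 := by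
  refine conv_mollifier_eq_one hε fun y hy => indicator_of_mem ?_ _
  have h := Metric.infDist_le_infDist_add_dist (s := Ωᶜ) (x := x) (y := y)
  rw [dist_eq_norm, norm_sub_rev] at h
  rw [mem_ofPred_eq]
  linarith

theorem cutoff_eq_zero (hε : 0 < ε) {x : E3} (hx : Metric.infDist x Ωᶜ ≤ ε) :
    cutoff Ω ε x = 0 := by
  refine conv_mollifier_eq_zero hε fun y hy => indicator_of_notMem ?_ _
  have h := Metric.infDist_le_infDist_add_dist (s := Ωᶜ) (x := y) (y := x)
  rw [dist_eq_norm] at h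
  rw [mem_ofPred_eq]
  linarith

theorem fderiv_cutoff_eq_zero (hε : 0 < ε) {x : E3} (hx : 3 * ε < Metric.infDist x Ωᶜ) :
    fderiv ℝ (cutoff Ω ε) x = 0 := by
  have : cutoff Ω ε =ᶠ[𝓝 x] fun _ => 1 := by
    filter_upwards [(isOpen_lt continuous_const (Metric.continuous_infDist_pt Ωᶜ)).mem_nhds hx]
      with y hy
    exact cutoff_eq_one hε (le_of_lt hy)
  rw [this.fderiv_eq, fderiv_fun_const]
  rfl

theorem tsupport_cutoff_subset (hε : 0 < ε) : tsupport (cutoff Ω ε) ⊆ Ω := by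
  refine Subset.trans ?_ (infDist_compl_pos_subset Ω hε)
  refine closure_minimal (fun x hx => ?_) (isClosed_le_infDist _ _)
  rw [mem_ofPred_eq]
  by_contra h
  exact hx (cutoff_eq_zero hε (not_le.1 h).le)

theorem hasCompactSupport_cutoff (hΩ : Bornology.IsBounded Ω) (hε : 0 < ε) :
    HasCompactSupport (cutoff Ω ε) :=
  Metric.isCompact_of_isClosed_isBounded (isClosed_tsupport _)
    (hΩ.subset (tsupport_cutoff_subset hε))

theorem isTestFunction_cutoff_mul (hΩ : Bornology.IsBounded Ω) (hε : 0 < ε) {F : E3 → ℝ}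
    (hF : ContDiff ℝ ∞ F) : IsTestFunction Ω fun x => cutoff Ω ε x * F x :=
  ⟨(contDiff_cutoff hΩ hε).mul hF, (hasCompactSupport_cutoff hΩ hε).mul_right,
    (tsupport_mul_subset_left).trans (tsupport_cutoff_subset hε)⟩

end cutoff

theorem norm_sq_eq_sum_clm (ℓ : E3 →L[ℝ] ℝ) :
    ‖ℓ‖ ^ 2 = ∑ i : Fin 3, (ℓ (EuclideanSpace.single i 1)) ^ 2 := by
  rw [← (InnerProductSpace.toDual ℝ E3).symm.norm_map ℓ, EuclideanSpace.norm_sq_eq]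
  refine Finset.sum_congr rfl fun i _ => ?_
  rw [Real.norm_eq_abs, sq_abs, ← InnerProductSpace.toDual_symm_apply (x := EuclideanSpace.single i 1),
    real_inner_comm, EuclideanSpace.inner_single_left]
  simp

theorem norm_gradient (f : E3 → ℝ) (x : E3) : ‖gradient f x‖ = ‖fderiv ℝ f x‖ := by
  rw [gradient, LinearIsometryEquiv.norm_map]

/-- Uniform bounds for the approximation, by test functions, of a function that vanishes outside
`Ω` and has a square integrable weak gradient on the whole space. -/
theorem integral_norm_fderiv_cutoff_mul_le {Ω : Set E3} {R₀ : ℝ} (hΩ : ∀ x ∈ Ω, ‖x‖ ≤ R₀)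
    (hΩo : IsOpen Ω) (hΩn : Ωᶜ.Nonempty) {ι : Type} [Fintype ι] {D : ι → Set E3} {c : ι → E3}
    {r : ℝ} (hr : 0 < r)
    (hDc : ∀ i, Convex ℝ (D i)) (hDcl : ∀ i, IsClosed (D i))
    (hball : ∀ i, Metric.ball (c i) r ⊆ D i) (hD : Ωᶜ = ⋃ i, D i)
    {R : ℝ} (hR : ∀ i, R₀ + 1 + ‖c i‖ ≤ R)
    {f : E3 → ℝ} (hf : Integrable f) (hf0 : ∀ x, x ∉ Ω → f x = 0) {A : ℝ} (hA0 : 0 ≤ A)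
    (hA : ∀ (i : Fin 3) (φ : E3 → ℝ), ContDiff ℝ ∞ φ → HasCompactSupport φ →
      (∫ x, f x * fderiv ℝ φ x (EuclideanSpace.single i 1)) ^ 2 ≤ A * ∫ x, φ x ^ 2)
    {ε : ℝ} (hε : 0 < ε) (hε1 : ε ≤ 1) (hεr : 8 * ε ≤ r) :
    ∫ x, ‖fderiv ℝ (fun x => cutoff Ω ε x * conv f (mollifier ε) x) x‖ ^ 2
      ≤ (6 + 768 * Fintype.card ι * (mollConst ^ 2 * R ^ 2 / r ^ 2)) * A := by
  have hΩb : Bornology.IsBounded Ω :=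
    (Metric.isBounded_closedBall (x := (0 : E3)) (r := R₀)).subset fun x hx =>
      mem_closedBall_zero_iff.2 (hΩ x hx)
  have hfc : HasCompactSupport f := by
    refine HasCompactSupport.intro (isCompact_closedBall (0 : E3) R₀) fun x hx => hf0 x fun h => ?_
    exact hx (mem_closedBall_zero_iff.2 (hΩ x h))
  have hms := contDiff_mollifier ε
  have hmc := hasCompactSupport_mollifier hε
  set F := conv f (mollifier ε) with hFdef
  have hFs : ContDiff ℝ ∞ F := contDiff_conv hf hms hmc
  have hFc : HasCompactSupport F := hasCompactSupport_conv hfc hmc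
  have hηs := contDiff_cutoff hΩb hε
  have hF' : Continuous fun x => fderiv ℝ F x := hFs.continuous_fderiv (by simp)
  have hpart : ∀ i : Fin 3,
      Integrable fun x => (fderiv ℝ F x (EuclideanSpace.single i 1)) ^ 2 := fun i =>
    integrable_sq_of_hasCompactSupport (hFc.fderiv_apply ℝ _)
      (contDiff_fderiv_apply hFs _).continuous
  have hGi : Integrable fun x => ‖fderiv ℝ F x‖ ^ 2 := by
    simp_rw [norm_sq_eq_sum_clm]
    exact integrable_finsetSum _ fun i _ => hpart i
  have hG : ∫ x, ‖fderiv ℝ F x‖ ^ 2 ≤ 3 * A := by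
    simp_rw [norm_sq_eq_sum_clm]
    rw [integral_finsetSum _ fun i _ => hpart i]
    refine (Finset.sum_le_sum fun i _ =>
      integral_fderiv_conv_sq_le hf hfc hA0 (hA i) hε).trans_eq ?_
    simp
  have hG0 : 0 ≤ ∫ x, ‖fderiv ℝ F x‖ ^ 2 := integral_nonneg fun x => sq_nonneg _
  have hF2 : Integrable fun x => F x ^ 2 := integrable_sq_of_hasCompactSupport hFc hFs.continuous
  -- This is where the gradient of the cutoff and `F` may both be nonzero. The ball of radius `R₀ +
  -- 1` suffices because `ε ≤ 1`.
  let S : ι → Set E3 := fun i => Metric.closedBall 0 (R₀ + 1) ∩ Metric.cthickening (3 * ε) (D i)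
  have hSm : ∀ i, MeasurableSet (S i) := fun i =>
    (Metric.isClosed_closedBall.inter Metric.isClosed_cthickening).measurableSet
  -- Take `μ = 1 - 4 ε / r`: the `ε`-ball around the contracted point lies in `D i`, where `f` is
  -- zero, so `F` vanishes there; `8 ε ≤ r` gives `μ ≥ 1/2`. The resulting `ε²` balances the `ε⁻²`
  -- of the squared gradient of the cutoff.
  have hS : ∀ i, ∫ x in S i, F x ^ 2 ≤ 8 * (4 * ε / r) ^ 2 * R ^ 2 * (3 * A) := by
    intro i
    have h1 : 4 * ε / r ≤ 1 / 2 := by rw [div_le_iff₀ hr]; linarith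
    have h2 : 0 < 4 * ε / r := by positivity
    have h3 := integral_strip_sq_le hFs hFc (hSm i) (c := c i) (μ := 1 - 4 * ε / r) (R := R)
      (by linarith) (by linarith) (fun x hx => ?_) (fun x hx => ?_)
    · rw [sub_sub_cancel] at h3
      exact h3.trans (mul_le_mul_of_nonneg_left hG (by positivity))
    · have := mem_closedBall_zero_iff.1 hx.1
      exact (norm_sub_le _ _).trans ((add_le_add_left this _).trans (hR i))
    · refine conv_mollifier_eq_zero hε fun z hz => hf0 z ?_
      have h4 := hx.2
      rw [(hDcl i).cthickening_eq_biUnion_closedBall (by positivity), mem_iUnion₂] at h4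
      obtain ⟨y, hy, hxy⟩ := h4
      rw [mem_closedBall_iff_norm] at hxy
      have h5 := mem_of_contract (hDc i) hr (hball i) hε hεr hy hxy hz
      have h6 : z ∈ Ωᶜ := hD ▸ mem_iUnion_of_mem i h5
      exact h6
  have hpt : ∀ x, ‖fderiv ℝ (fun x => cutoff Ω ε x * F x) x‖ ^ 2
      ≤ 2 * ‖fderiv ℝ F x‖ ^ 2
        + ∑ i, 2 * (mollConst / ε) ^ 2 * (S i).indicator (fun x => F x ^ 2) x := by
    intro x
    have h1 : fderiv ℝ (fun x => cutoff Ω ε x * F x) x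
        = cutoff Ω ε x • fderiv ℝ F x + F x • fderiv ℝ (cutoff Ω ε) x :=
      fderiv_fun_mul (hηs.differentiable (by simp) x) (hFs.differentiable (by simp) x)
    have h2 : ‖fderiv ℝ (fun x => cutoff Ω ε x * F x) x‖
        ≤ ‖fderiv ℝ F x‖ + |F x| * ‖fderiv ℝ (cutoff Ω ε) x‖ := by
      rw [h1]
      refine (norm_add_le _ _).trans ?_
      rw [norm_smul, norm_smul, Real.norm_eq_abs, Real.norm_eq_abs]
      gcongr
      exact mul_le_of_le_one_left (norm_nonneg _) (abs_cutoff_le hε x)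
    have h3 : |F x| ^ 2 * ‖fderiv ℝ (cutoff Ω ε) x‖ ^ 2
        ≤ ∑ i, (mollConst / ε) ^ 2 * (S i).indicator (fun x => F x ^ 2) x := by
      have hnn : ∀ i, 0 ≤ (mollConst / ε) ^ 2 * (S i).indicator (fun x => F x ^ 2) x := fun i =>
        mul_nonneg (sq_nonneg _) (indicator_nonneg (fun _ _ => sq_nonneg _) _)
      by_cases h4 : F x = 0 ∨ 3 * ε < Metric.infDist x Ωᶜ
      · refine le_trans (le_of_eq ?_) (Finset.sum_nonneg fun i _ => hnn i)
        rcases h4 with h4 | h4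
        · rw [h4]; simp
        · rw [fderiv_cutoff_eq_zero hε h4]; simp
      · rw [not_or, not_lt] at h4
        obtain ⟨h4, h5⟩ := h4
        -- The nearest point of the complement is at distance at most `3 ε` and belongs to one of
        -- the convex pieces.
        obtain ⟨y, hy, hxy⟩ := hΩo.isClosed_compl.exists_infDist_eq_dist hΩn x
        rw [hD, mem_iUnion] at hy
        obtain ⟨i, hi⟩ := hy
        have h6 : x ∈ S i := by
          refine ⟨?_, ?_⟩
          · rw [mem_closedBall_zero_iff]
            by_contra hcon
            rw [not_le] at hcon
            refine h4 (conv_mollifier_eq_zero hε fun z hz => hf0 z fun hzΩ => ?_)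
            have h7 := hΩ z hzΩ
            have h8 := norm_sub_norm_le x z
            rw [norm_sub_rev] at h8
            linarith
          · rw [(hDcl i).cthickening_eq_biUnion_closedBall (by positivity), mem_iUnion₂]
            exact ⟨y, hi, by rw [Metric.mem_closedBall, ← hxy]; exact h5⟩
        refine le_trans ?_ (Finset.single_le_sum (fun i _ => hnn i) (Finset.mem_univ i))
        rw [indicator_of_mem h6, sq_abs, mul_comm]
        exact mul_le_mul_of_nonneg_right
          (pow_le_pow_left₀ (norm_nonneg _) (norm_fderiv_cutoff_le hΩb hε x) 2) (sq_nonneg _)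
    have h4 : ‖fderiv ℝ (fun x => cutoff Ω ε x * F x) x‖ ^ 2
        ≤ 2 * ‖fderiv ℝ F x‖ ^ 2 + 2 * (|F x| ^ 2 * ‖fderiv ℝ (cutoff Ω ε) x‖ ^ 2) := by
      refine (pow_le_pow_left₀ (norm_nonneg _) h2 2).trans ?_
      nlinarith [sq_nonneg (‖fderiv ℝ F x‖ - |F x| * ‖fderiv ℝ (cutoff Ω ε) x‖)]
    refine h4.trans (add_le_add le_rfl ?_)
    simp_rw [mul_assoc, ← Finset.mul_sum]
    rw [← Finset.mul_sum] at h3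
    exact mul_le_mul_of_nonneg_left h3 (by norm_num)
  have hSi : ∀ i ∈ Finset.univ, Integrable fun x =>
      2 * (mollConst / ε) ^ 2 * (S i).indicator (fun x => F x ^ 2) x := fun i _ =>
    (hF2.indicator (hSm i)).const_mul _
  have h1 : ∫ x, ‖fderiv ℝ (fun x => cutoff Ω ε x * F x) x‖ ^ 2
      ≤ ∫ x, (2 * ‖fderiv ℝ F x‖ ^ 2
        + ∑ i, 2 * (mollConst / ε) ^ 2 * (S i).indicator (fun x => F x ^ 2) x) :=
    integral_mono_of_nonneg (Eventually.of_forall fun x => sq_nonneg _)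
      ((hGi.const_mul 2).add (integrable_finsetSum _ hSi)) (Eventually.of_forall hpt)
  have h2 := integral_add (hGi.const_mul 2) (integrable_finsetSum _ hSi)
  have h3 := integral_finsetSum Finset.univ hSi
  rw [h2, h3, integral_const_mul] at h1
  -- The powers of `ε` cancel, and `768 = 2 * 8 * 4 ^ 2 * 3`.
  have h4 : ∀ i, ∫ x, 2 * (mollConst / ε) ^ 2 * (S i).indicator (fun x => F x ^ 2) x
      ≤ 768 * (mollConst ^ 2 * R ^ 2 / r ^ 2) * A := by
    intro i
    rw [integral_const_mul, integral_indicator (hSm i)]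
    refine (mul_le_mul_of_nonneg_left (hS i) (by positivity)).trans_eq ?_
    field_simp
    ring
  refine h1.trans ((add_le_add (mul_le_mul_of_nonneg_left hG (by norm_num))
    (Finset.sum_le_sum fun i _ => h4 i)).trans_eq ?_)
  rw [Finset.sum_const, Finset.card_univ, nsmul_eq_mul]
  ring

end

section

open scoped ContDiff

/-! ### Weak limits in a Hilbert space -/

/-- Banach–Alaoglu along a free ultrafilter on `ℕ`, which spares the choice of a subsequence: every
convergent sequence of scalar products has the same limit along the ultrafilter. A closed subspace
is its own double orthogonal complement, hence weakly closed. -/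
theorem exists_weak_limit {H : Type*} [NormedAddCommGroup H] [InnerProductSpace ℝ H]
    [CompleteSpace H] (S : Submodule ℝ H) (hS : IsClosed (S : Set H)) {B : ℝ} {w : ℕ → H}
    (hwS : ∀ n, w n ∈ S) (hwB : ∀ n, ‖w n‖ ≤ B) :
    ∃ v ∈ S, ‖v‖ ≤ B ∧ ∀ (z : H) (l : ℝ), Tendsto (fun n => inner ℝ (w n) z) atTop (𝓝 l) →
      inner ℝ v z = l := by
  let Φ : ℕ → WeakDual ℝ H := fun n =>
    StrongDual.toWeakDual (InnerProductSpace.toDual ℝ H (w n))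
  obtain ⟨ψ, hψ, hlim⟩ := (WeakDual.isCompact_closedBall (𝕜 := ℝ) (E := H) 0 B).ultrafilter_le_nhds
    ((hyperfilter ℕ).map Φ) (by
      rw [Ultrafilter.coe_map, le_principal_iff, mem_map]
      refine Filter.univ_mem' fun n => ?_
      change InnerProductSpace.toDual ℝ H (w n) ∈ Metric.closedBall 0 B
      rw [mem_closedBall_zero_iff, LinearIsometryEquiv.norm_map]
      exact hwB n)
  set v := (InnerProductSpace.toDual ℝ H).symm (WeakDual.toStrongDual ψ) with hv
  have hvz : ∀ z, inner ℝ v z = ψ z := fun z => InnerProductSpace.toDual_symm_apply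
  have ht : ∀ z, Tendsto (fun n => inner ℝ (w n) z) (hyperfilter ℕ) (𝓝 (inner ℝ v z)) := by
    intro z
    have h1 : Tendsto Φ (hyperfilter ℕ) (𝓝 ψ) := hlim
    rw [hvz]
    exact ((WeakDual.eval_continuous z).tendsto ψ).comp h1
  have hle : (hyperfilter ℕ : Filter ℕ) ≤ atTop := Nat.hyperfilter_le_atTop
  refine ⟨v, ?_, ?_, fun z l hl => tendsto_nhds_unique (ht z) (hl.mono_left hle)⟩
  · have : v ∈ Sᗮᗮ := by
      rw [Submodule.mem_orthogonal']
      intro z hz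
      refine tendsto_nhds_unique (ht z) ?_
      refine tendsto_const_nhds.congr fun n => ?_
      exact ((Submodule.mem_orthogonal S z).1 hz (w n) (hwS n)).symm
    rwa [Submodule.orthogonal_orthogonal_eq_closure, hS.submodule_topologicalClosure_eq] at this
  · rw [hv, LinearIsometryEquiv.norm_map]
    exact mem_closedBall_zero_iff.1 hψ

/-! ### Test functions as elements of `H_0^1(Ω)` -/

theorem continuous_gradient {q : E3 → ℝ} (hq : ContDiff ℝ ∞ q) : Continuous (gradient q) :=
  (InnerProductSpace.toDual ℝ E3).symm.continuous.comp (hq.continuous_fderiv (by simp))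

theorem hasCompactSupport_gradient {q : E3 → ℝ} (hq : HasCompactSupport q) :
    HasCompactSupport (gradient q) :=
  (hq.fderiv ℝ).comp_left (map_zero _)

theorem gradient_apply (q : E3 → ℝ) (x : E3) (i : Fin 3) :
    gradient q x i = fderiv ℝ q x (EuclideanSpace.single i 1) := by
  rw [gradient, ← InnerProductSpace.toDual_symm_apply (x := EuclideanSpace.single i 1),
    real_inner_comm, EuclideanSpace.inner_single_left]
  simp

/-- The pair of a function and a vector field as an element of the ambient Hilbert space. -/
def mkPair (Ω : Set E3) {a : E3 → ℝ} {G : E3 → E3} (ha : MemLp a 2 (volume.restrict Ω))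
    (hG : MemLp G 2 (volume.restrict Ω)) : PairSpace Ω :=
  WithLp.toLp 2 (ha.toLp, hG.toLp)

theorem inner_mkPair {Ω : Set E3} {a : E3 → ℝ} {G : E3 → E3} (ha : MemLp a 2 (volume.restrict Ω))
    (hG : MemLp G 2 (volume.restrict Ω)) (z : PairSpace Ω) :
    inner ℝ z (mkPair Ω ha hG)
      = (∫ x in Ω, z.fst x * a x) + ∫ x in Ω, inner ℝ (z.snd x) (G x) := by
  rw [WithLp.prod_inner_apply, L2.inner_def, L2.inner_def]
  congr 1
  · refine integral_congr_ae ?_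
    filter_upwards [ha.coeFn_toLp] with x hx
    change inner ℝ (z.fst x) ((ha.toLp a) x) = _
    rw [hx]
    simp [mul_comm]
  · refine integral_congr_ae ?_
    filter_upwards [hG.coeFn_toLp] with x hx
    change inner ℝ (z.snd x) ((hG.toLp G) x) = _
    rw [hx]

theorem inner_mkPair_mkPair {Ω : Set E3} {a b : E3 → ℝ} {G G' : E3 → E3}
    (ha : MemLp a 2 (volume.restrict Ω)) (hG : MemLp G 2 (volume.restrict Ω))
    (hb : MemLp b 2 (volume.restrict Ω)) (hG' : MemLp G' 2 (volume.restrict Ω)) :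
    inner ℝ (mkPair Ω hb hG') (mkPair Ω ha hG)
      = (∫ x in Ω, b x * a x) + ∫ x in Ω, inner ℝ (G' x) (G x) := by
  rw [inner_mkPair]
  congr 1
  · refine integral_congr_ae ?_
    filter_upwards [hb.coeFn_toLp] with x hx
    change (hb.toLp b) x * _ = _
    rw [hx]
  · refine integral_congr_ae ?_
    filter_upwards [hG'.coeFn_toLp] with x hx
    change inner ℝ ((hG'.toLp G') x) _ = _
    rw [hx]

theorem IsTestFunction.memLp {Ω : Set E3} {q : E3 → ℝ} (hq : IsTestFunction Ω q) :
    MemLp q 2 (volume.restrict Ω) :=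
  (hq.1.continuous.memLp_of_hasCompactSupport hq.2.1).restrict Ω

theorem IsTestFunction.memLp_gradient {Ω : Set E3} {q : E3 → ℝ} (hq : IsTestFunction Ω q) :
    MemLp (gradient q) 2 (volume.restrict Ω) :=
  ((continuous_gradient hq.1).memLp_of_hasCompactSupport (hasCompactSupport_gradient hq.2.1)).restrict Ω

theorem IsTestFunction.mkPair_mem {Ω : Set E3} {q : E3 → ℝ} (hq : IsTestFunction Ω q) :
    mkPair Ω hq.memLp hq.memLp_gradient ∈ H10 Ω :=
  subset_closure (Submodule.subset_span ⟨q, hq, hq.memLp.coeFn_toLp, hq.memLp_gradient.coeFn_toLp⟩)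

theorem IsTestFunction.eq_zero {Ω : Set E3} {q : E3 → ℝ} (hq : IsTestFunction Ω q) {x : E3}
    (hx : x ∉ Ω) : q x = 0 :=
  image_eq_zero_of_notMem_tsupport fun h => hx (hq.2.2 h)

theorem IsTestFunction.gradient_eq_zero {Ω : Set E3} {q : E3 → ℝ} (hq : IsTestFunction Ω q) {x : E3}
    (hx : x ∉ Ω) : gradient q x = 0 := by
  rw [gradient, image_eq_zero_of_notMem_tsupport fun h => hx (hq.2.2 (tsupport_fderiv_subset ℝ h)),
    map_zero]

/-- Integration by parts defines the weak gradient of an element of `H_0^1(Ω)`. -/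
theorem integral_grad_mul {Ω : Set E3} (v : H10 Ω) {ψ : E3 → ℝ} (hψ : ContDiff ℝ ∞ ψ)
    (hψc : HasCompactSupport ψ) (i : Fin 3) :
    ∫ x in Ω, H10.grad v x i * ψ x
      = -∫ x in Ω, H10.val v x * fderiv ℝ ψ x (EuclideanSpace.single i 1) := by
  have hd : MemLp (fun x => fderiv ℝ ψ x (EuclideanSpace.single i 1)) 2 (volume.restrict Ω) :=
    ((contDiff_fderiv_apply hψ _).continuous.memLp_of_hasCompactSupport
      (hψc.fderiv_apply ℝ _)).restrict Ω
  have hg : MemLp (fun x => ψ x • (EuclideanSpace.single i 1 : E3)) 2 (volume.restrict Ω) :=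
    ((hψ.continuous.smul continuous_const).memLp_of_hasCompactSupport
      (hψc.smul_right)).restrict Ω
  set z₀ := mkPair Ω hd hg with hz₀
  have hin : ∀ z : PairSpace Ω, inner ℝ z z₀
      = (∫ x in Ω, z.fst x * fderiv ℝ ψ x (EuclideanSpace.single i 1))
        + ∫ x in Ω, z.snd x i * ψ x := by
    intro z
    rw [hz₀, inner_mkPair]
    congr 1
    refine integral_congr_ae (Eventually.of_forall fun x => ?_)
    dsimp only
    rw [inner_smul_right, real_inner_comm, EuclideanSpace.inner_single_left]
    simp [mul_comm]
  -- The identity says that a continuous linear functional vanishes. It does so on test functions,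
  -- by classical integration by parts, and hence on their closed span.
  have hzero : ∀ z ∈ H10 Ω, inner ℝ z z₀ = 0 := by
    have hsub : H10 Ω ≤ LinearMap.ker (innerSL ℝ z₀).toLinearMap := by
      refine Submodule.topologicalClosure_minimal _ (Submodule.span_le.2 ?_)
        (innerSL ℝ z₀).isClosed_ker
      rintro z ⟨q, hq, h1, h2⟩
      change inner ℝ z₀ z = 0
      rw [real_inner_comm, hin]
      have e1 : ∫ x in Ω, z.fst x * fderiv ℝ ψ x (EuclideanSpace.single i 1)
          = ∫ x, q x * fderiv ℝ ψ x (EuclideanSpace.single i 1) := by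
        refine Eq.trans (integral_congr_ae ?_) (setIntegral_eq_integral_of_forall_compl_eq_zero
          (s := Ω) fun x hx => by rw [hq.eq_zero hx, zero_mul])
        filter_upwards [h1] with x hx
        rw [hx]
      have e2 : ∫ x in Ω, z.snd x i * ψ x
          = ∫ x, fderiv ℝ q x (EuclideanSpace.single i 1) * ψ x := by
        refine Eq.trans (integral_congr_ae ?_) (setIntegral_eq_integral_of_forall_compl_eq_zero
          (s := Ω) fun x hx => by rw [← gradient_apply, hq.gradient_eq_zero hx]; simp)
        filter_upwards [h2] with x hx
        rw [hx, gradient_apply]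
      have hqd := (contDiff_fderiv_apply hq.1 (EuclideanSpace.single i 1)).continuous
      have hψd := (contDiff_fderiv_apply hψ (EuclideanSpace.single i 1)).continuous
      have hqc := hq.2.1
      rw [e1, e2, integral_mul_fderiv_eq_neg_fderiv_mul_of_integrable]
      · ring
      · exact (hqd.mul hψ.continuous).integrable_of_hasCompactSupport (hψc.mul_left)
      · exact (hq.1.continuous.mul hψd).integrable_of_hasCompactSupport (hqc.mul_right)
      · exact (hq.1.continuous.mul hψ.continuous).integrable_of_hasCompactSupport (hqc.mul_right)
      · exact fun x _ => hq.1.differentiable (by simp) x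
      · exact fun x _ => hψ.differentiable (by simp) x
    intro z hz
    have := hsub hz
    rw [real_inner_comm]
    exact this
  have := hzero v v.2
  rw [hin] at this
  exact eq_neg_of_add_eq_zero_right this

theorem integrable_coord_mul {Ω : Set E3} (G : Lp E3 2 (volume.restrict Ω : Measure E3))
    {ψ : E3 → ℝ} (hψ : Continuous ψ) (hψc : HasCompactSupport ψ) (i : Fin 3) :
    IntegrableOn (fun x => G x i * ψ x) Ω := by
  have h1 : MemLp (fun x => G x i) 2 (volume.restrict Ω) :=
    (EuclideanSpace.proj (𝕜 := ℝ) i : E3 →L[ℝ] ℝ).comp_memLp' (Lp.memLp G)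
  have h2 : MemLp ψ 2 (volume.restrict Ω) := (hψ.memLp_of_hasCompactSupport hψc).restrict Ω
  exact h1.integrable_mul h2

theorem integrable_mul_of_hasCompactSupport {Ω : Set E3}
    (f : Lp ℝ 2 (volume.restrict Ω : Measure E3)) {ψ : E3 → ℝ} (hψ : Continuous ψ)
    (hψc : HasCompactSupport ψ) : IntegrableOn (fun x => f x * ψ x) Ω :=
  have h2 : MemLp ψ 2 (volume.restrict Ω) := (hψ.memLp_of_hasCompactSupport hψc).restrict Ω
  (Lp.memLp f).integrable_mul h2

/-- Two functions in `L²(Ω)` are equal if they have the same integrals against test functions. -/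
theorem ae_eq_of_integral_mul_eq {Ω : Set E3} (hΩ : IsOpen Ω) {f g : E3 → ℝ}
    (hf : MemLp f 2 (volume.restrict Ω)) (hg : MemLp g 2 (volume.restrict Ω))
    (h : ∀ q, IsTestFunction Ω q → ∫ x in Ω, f x * q x = ∫ x in Ω, g x * q x) :
    f =ᵐ[volume.restrict Ω] g := by
  have hfg : MemLp (fun x => f x - g x) 2 (volume.restrict Ω) := hf.sub hg
  have hl : LocallyIntegrableOn (fun x => f x - g x) Ω := by
    rw [locallyIntegrableOn_iff hΩ.isLocallyClosed]
    intro K hK hKc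
    have : MemLp (fun x => f x - g x) 2 (volume.restrict K) := hfg.mono_measure
      (Measure.restrict_mono hK le_rfl)
    have h2 : IsFiniteMeasure (volume.restrict K : Measure E3) := ⟨by
      rw [Measure.restrict_apply_univ]; exact hKc.measure_lt_top⟩
    exact this.integrable one_le_two
  have h0 := hΩ.ae_eq_zero_of_integral_contDiff_smul_eq_zero hl (fun q hq hqc hqs => by
    have hqt : IsTestFunction Ω q := ⟨hq, hqc, hqs⟩
    rw [← setIntegral_eq_integral_of_forall_compl_eq_zero (s := Ω) fun x hx => by
      rw [hqt.eq_zero hx, zero_smul]]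
    have h1 := integral_sub (hf.integrable_mul hqt.memLp) (hg.integrable_mul hqt.memLp)
    have h2 : ∫ x in Ω, q x • (f x - g x) = ∫ x in Ω, ((f * q) x - (g * q) x) := by
      refine integral_congr_ae (Eventually.of_forall fun x => ?_)
      simp only [smul_eq_mul, Pi.mul_apply]
      ring
    rw [h2, h1]
    exact sub_eq_zero.2 (h q hqt))
  filter_upwards [ae_restrict_of_ae h0, ae_restrict_mem hΩ.measurableSet] with x hx hxΩ
  exact sub_eq_zero.1 (hx hxΩ)

/-- Integration by parts determines the gradient component from the function. Injectivity is what
allows a limit known only in `L²(Ω)` to be lifted measurably to `H_0^1(Ω)`. -/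
theorem val_injective {Ω : Set E3} (hΩ : IsOpen Ω) :
    Function.Injective (H10.val : H10 Ω → Lp ℝ 2 (volume.restrict Ω : Measure E3)) := by
  intro v w hvw
  have hg : H10.grad v = H10.grad w := by
    refine Lp.ext ?_
    have h1 : ∀ i : Fin 3, ∀ᵐ x ∂volume.restrict Ω, H10.grad v x i = H10.grad w x i := by
      intro i
      refine ae_eq_of_integral_mul_eq hΩ
        ((EuclideanSpace.proj (𝕜 := ℝ) i : E3 →L[ℝ] ℝ).comp_memLp' (Lp.memLp (H10.grad v)))
        ((EuclideanSpace.proj (𝕜 := ℝ) i : E3 →L[ℝ] ℝ).comp_memLp' (Lp.memLp (H10.grad w)))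
        fun q hq => ?_
      change ∫ x in Ω, H10.grad v x i * q x = ∫ x in Ω, H10.grad w x i * q x
      rw [integral_grad_mul v hq.1 hq.2.1, integral_grad_mul w hq.1 hq.2.1, hvw]
    filter_upwards [ae_all_iff.2 h1] with x hx
    exact PiLp.ext hx
  refine Subtype.ext ?_
  have h1 : (v : PairSpace Ω).fst = (w : PairSpace Ω).fst := hvw
  have h2 : (v : PairSpace Ω).snd = (w : PairSpace Ω).snd := hg
  exact (WithLp.ofLp_injective 2) (Prod.ext h1 h2)

theorem continuous_val {Ω : Set E3} :
    Continuous (H10.val : H10 Ω → Lp ℝ 2 (volume.restrict Ω : Measure E3)) :=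
  (WithLp.fstL 2 ℝ _ _).continuous.comp continuous_subtype_val

/-- The components of the gradient of `q` are smooth with compact support, so the weak gradient can
be tested with each of them. This gives the flux limits their final form. -/
theorem integral_inner_grad {Ω : Set E3} (v : H10 Ω) {q : E3 → ℝ} (hq : ContDiff ℝ ∞ q)
    (hqc : HasCompactSupport q) :
    ∫ x in Ω, inner ℝ (H10.grad v x) (gradient q x) = -∫ x in Ω, H10.val v x * lap q x := by
  let d : Fin 3 → E3 → ℝ := fun i x => fderiv ℝ q x (EuclideanSpace.single i 1)
  have hds : ∀ i, ContDiff ℝ ∞ (d i) := fun i => contDiff_fderiv_apply hq _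
  have hdc : ∀ i, HasCompactSupport (d i) := fun i => hqc.fderiv_apply ℝ _
  have e1 : ∀ x, inner ℝ (H10.grad v x) (gradient q x) = ∑ i, H10.grad v x i * d i x := fun x => by
    rw [PiLp.inner_apply]
    refine Finset.sum_congr rfl fun i _ => ?_
    rw [gradient_apply]
    simp [d, mul_comm]
  have e2 : ∀ x, H10.val v x * lap q x
      = ∑ i, H10.val v x * fderiv ℝ (d i) x (EuclideanSpace.single i 1) := fun x => by
    rw [lap, Finset.mul_sum]
  simp_rw [e1, e2]
  rw [integral_finsetSum _ fun i _ => integrable_coord_mul _ (hds i).continuous (hdc i) i,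
    integral_finsetSum _ fun i _ => integrable_mul_of_hasCompactSupport _
      (contDiff_fderiv_apply (hds i) _).continuous ((hdc i).fderiv_apply ℝ _),
    ← Finset.sum_neg_distrib]
  exact Finset.sum_congr rfl fun i _ => integral_grad_mul v (hds i) (hdc i) i

end

section

open scoped ContDiff

/-! ### The weak gradient of piecewise constant functions -/

theorem sq_integral_le {X : Type*} [MeasurableSpace X] {μ : Measure X} [IsFiniteMeasure μ]
    {f : X → ℝ} (hf : Integrable f μ) (hf2 : Integrable (fun x => f x ^ 2) μ) :
    (∫ x, f x ∂μ) ^ 2 ≤ μ.real univ * ∫ x, f x ^ 2 ∂μ := by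
  set I := ∫ x, f x ∂μ with hI
  set m := μ.real univ with hm
  have hm0 : 0 ≤ m := measureReal_nonneg
  have hc : Integrable (fun _ : X => I ^ 2) μ := integrable_const _
  have h1 : 0 ≤ ∫ x, (m * f x - I) ^ 2 ∂μ := integral_nonneg fun x => sq_nonneg _
  have e : ∫ x, (m * f x - I) ^ 2 ∂μ
      = ∫ x, (m ^ 2 * f x ^ 2 - 2 * m * I * f x + I ^ 2) ∂μ := by
    congr 1; funext x; ring
  have i1 := integral_add (f := fun x => m ^ 2 * f x ^ 2 - 2 * m * I * f x) (g := fun _ => I ^ 2)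
    ((hf2.const_mul (m ^ 2)).sub (hf.const_mul (2 * m * I))) hc
  have i2 := integral_sub (hf2.const_mul (m ^ 2)) (hf.const_mul (2 * m * I))
  rw [e, i1, i2, integral_const_mul, integral_const_mul, integral_const, ← hI, smul_eq_mul,
    ← hm] at h1
  rcases hm0.eq_or_lt with h0 | h0
  · have : μ = 0 := by
      rw [← Measure.measure_univ_eq_zero, ← measureReal_eq_zero_iff, ← hm, ← h0]
    rw [hI, this]; simp
  · have h2 : 0 ≤ m * (m * (∫ x, f x ^ 2 ∂μ) - I ^ 2) := by nlinarith
    have := nonneg_of_mul_nonneg_right h2 h0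
    linarith

namespace AdmissibleMesh

variable {Ω : Set E3} (M : AdmissibleMesh Ω)

theorem faceInt_sq_le {K : Fin M.numCells} {σ : Fin M.numFaces} (hK : σ ∈ M.facesOf K)
    {φ : E3 → ℝ} (hφ : Continuous φ) :
    M.faceInt φ σ ^ 2 ≤ area (M.face σ) * M.faceInt (fun x => φ x ^ 2) σ := by
  have hfin : IsFiniteMeasure ((Measure.euclideanHausdorffMeasure 2 : Measure E3).restrict
      (M.face σ)) := ⟨by
    rw [Measure.restrict_apply_univ]; exact (area_pos_iff.1 (M.face_pos σ)).2.lt_top⟩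
  have := sq_integral_le (M.integrableOn_face hK hφ) (M.integrableOn_face hK (hφ.pow 2))
  rwa [measureReal_restrict_apply_univ] at this

/-- This is the pyramid identity with density `φ`. Points of a cell are within twice the mesh norm
of the centre, so the gradient term disappears as the mesh is refined. -/
theorem sum_wt_dd_faceInt_le {φ : E3 → ℝ} (hφ : ContDiff ℝ 1 φ) (hφc : HasCompactSupport φ)
    (hφ0 : ∀ x, 0 ≤ φ x) :
    ∑ p ∈ M.edges, M.wt p.2 * (M.dd p.1 p.2 * M.faceInt φ p.2)
      ≤ 3 * (∫ x, φ x) + 2 * M.meshNorm * ∫ x, ‖fderiv ℝ φ x‖ := by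
  have hc := hφ.continuous_fderiv one_ne_zero
  have i1 : Integrable φ := hφ.continuous.integrable_of_hasCompactSupport hφc
  have i2 : Integrable fun x => ‖fderiv ℝ φ x‖ :=
    (hc.integrable_of_hasCompactSupport (hφc.fderiv ℝ)).norm
  have hi : Integrable fun x => 3 * φ x + 2 * M.meshNorm * ‖fderiv ℝ φ x‖ :=
    (i1.const_mul _).add (i2.const_mul _)
  have hm := M.meshNorm_nonneg
  rw [M.sum_wt_dd_faceInt hφ]
  calc ∑ K, ∫ x in M.cell K, (3 * φ x + fderiv ℝ φ x (x - M.center K))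
      ≤ ∑ K, ∫ x in M.cell K, (3 * φ x + 2 * M.meshNorm * ‖fderiv ℝ φ x‖) := by
        refine Finset.sum_le_sum fun K _ => setIntegral_mono_on (M.integrableOn_cell K ?_)
          hi.integrableOn (M.measurableSet_cell K) fun x hx => ?_
        · exact (continuous_const.mul hφ.continuous).add
            (hc.clm_apply (continuous_id.sub continuous_const))
        · have h1 : ‖x - M.center K‖ ≤ 2 * M.meshNorm := by
            rw [← dist_eq_norm]
            exact M.dist_le_of_mem_closure (subset_closure hx) (M.center_mem K)
          have h2 := (le_abs_self _).trans ((fderiv ℝ φ x).le_opNorm (x - M.center K))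
          nlinarith [mul_le_mul_of_nonneg_left h1 (norm_nonneg (fderiv ℝ φ x))]
    _ = ∫ x in ⋃ K, M.cell K, (3 * φ x + 2 * M.meshNorm * ‖fderiv ℝ φ x‖) :=
        (integral_iUnion_fintype M.measurableSet_cell (fun K L h => M.cell_disjoint K L h)
          fun K => hi.integrableOn).symm
    _ ≤ ∫ x, (3 * φ x + 2 * M.meshNorm * ‖fderiv ℝ φ x‖) :=
        setIntegral_le_integral hi (Eventually.of_forall fun x =>
          add_nonneg (mul_nonneg (by norm_num) (hφ0 x)) (by positivity))
    _ = _ := by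
        have := integral_add (i1.const_mul 3) (i2.const_mul (2 * M.meshNorm))
        rw [this, integral_const_mul, integral_const_mul]

/-- The weak gradient of a piecewise constant function, tested with a smooth function. -/
theorem sq_integral_interpFun_fderiv_le (z : M.MeshFun) {φ : E3 → ℝ} (hφ : ContDiff ℝ 1 φ)
    (hφc : HasCompactSupport φ) (η : E3) :
    (∫ x, M.interpFun z x * fderiv ℝ φ x η) ^ 2
      ≤ M.form z z * (‖η‖ ^ 2 * (3 * (∫ x, φ x ^ 2)
          + 2 * M.meshNorm * ∫ x, ‖fderiv ℝ (fun x => φ x ^ 2) x‖)) := by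
  have hc : Continuous fun x => fderiv ℝ φ x η :=
    (hφ.continuous_fderiv one_ne_zero).clm_apply continuous_const
  have h1 := M.sum_wt_dd_faceInt_le (hφ.pow 2) (hasCompactSupport_sq hφc) fun x => sq_nonneg _
  rw [M.integral_interpFun_mul z fun K => M.integrableOn_cell K hc, M.sum_mul_integral_fderiv z hφ]
  refine le_trans ?_ (mul_le_mul_of_nonneg_left (mul_le_mul_of_nonneg_left h1 (sq_nonneg ‖η‖))
    (M.form_self_nonneg z))
  -- Cauchy–Schwarz over the faces: the jumps carry `area / dd`, and the face integrals, after a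
  -- second Cauchy–Schwarz on each face, carry `dd` times the face integral of `φ ^ 2`.
  rw [form, Finset.mul_sum]
  refine Finset.sum_sq_le_sum_mul_sum_of_sq_le_mul _ ?_ ?_ ?_
  · intro p hp
    have := (M.dd_pos (M.mem_edges.1 hp)).le
    have h2 := (M.face_pos p.2).le
    have h3 := M.wt_nonneg p.2
    have h4 : M.wt p.2 * (M.jump z p.1 p.2 * (area (M.face p.2) / M.dd p.1 p.2 * M.jump z p.1 p.2))
      = M.wt p.2 * (area (M.face p.2) / M.dd p.1 p.2) * M.jump z p.1 p.2 ^ 2 := by ring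
    rw [h4]; positivity
  · intro p hp
    have := (M.dd_pos (M.mem_edges.1 hp)).le
    have h3 := M.wt_nonneg p.2
    have h5 : 0 ≤ M.faceInt (fun x => φ x ^ 2) p.2 := integral_nonneg fun x => sq_nonneg _
    positivity
  · intro p hp
    have hK := M.mem_edges.1 hp
    have hd := M.dd_pos hK
    have h2 := (M.face_pos p.2).le
    have h3 := M.wt_nonneg p.2
    have h5 := M.faceInt_sq_le hK hφ.continuous
    have h6 : (inner ℝ (M.nrm p.1 p.2) η) ^ 2 ≤ ‖η‖ ^ 2 := by
      rw [← sq_abs]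
      refine pow_le_pow_left₀ (abs_nonneg _) ?_ 2
      have := abs_real_inner_le_norm (M.nrm p.1 p.2) η
      rwa [M.norm_nrm hK, one_mul] at this
    have h7 : (inner ℝ (M.nrm p.1 p.2) η) ^ 2 * M.faceInt φ p.2 ^ 2
        ≤ ‖η‖ ^ 2 * (area (M.face p.2) * M.faceInt (fun x => φ x ^ 2) p.2) :=
      mul_le_mul h6 h5 (sq_nonneg _) (sq_nonneg _)
    calc (M.wt p.2 * (M.jump z p.1 p.2 * (inner ℝ (M.nrm p.1 p.2) η * M.faceInt φ p.2))) ^ 2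
        = M.wt p.2 ^ 2 * M.jump z p.1 p.2 ^ 2 *
          ((inner ℝ (M.nrm p.1 p.2) η) ^ 2 * M.faceInt φ p.2 ^ 2) := by ring
      _ ≤ M.wt p.2 ^ 2 * M.jump z p.1 p.2 ^ 2 *
          (‖η‖ ^ 2 * (area (M.face p.2) * M.faceInt (fun x => φ x ^ 2) p.2)) := by gcongr
      _ = _ := by field_simp

end AdmissibleMesh

/-! ### Membership in `H_0^1(Ω)` -/

/-- A function on a polyhedral domain that, extended by zero, has a square integrable weak gradient
on the whole space, belongs to `H_0^1(Ω)`. -/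
theorem exists_mem_H10 {Ω : Set E3} (hΩ : IsPolyhedralDomain Ω) (M : AdmissibleMesh Ω) :
    ∃ C : ℝ, 0 ≤ C ∧ ∀ f : E3 → ℝ, MemLp f 2 volume → (∀ x, x ∉ Ω → f x = 0) →
      ∀ A : ℝ, 0 ≤ A →
      (∀ (i : Fin 3) (φ : E3 → ℝ), ContDiff ℝ ∞ φ → HasCompactSupport φ →
        (∫ x, f x * fderiv ℝ φ x (EuclideanSpace.single i 1)) ^ 2 ≤ A * ∫ x, φ x ^ 2) →
      ∃ v : H10 Ω, H10.val v =ᵐ[volume.restrict Ω] f ∧ ‖v‖ ^ 2 ≤ (∫ x, f x ^ 2) + C * A := by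
  obtain ⟨ι, _, D, c, r, hr, hDc, hDcl, hball, hD⟩ := exists_convex_cover_compl hΩ M
  obtain ⟨R₀, hR₀⟩ := hΩ.isBounded.exists_norm_le
  have hΩn : Ωᶜ.Nonempty := by
    rw [nonempty_compl]
    intro h
    have := hΩ.isBounded
    rw [h] at this
    exact NoncompactSpace.noncompact_univ (X := E3)
      (by simpa using Metric.isCompact_of_isClosed_isBounded isClosed_univ this)
  set R := R₀ + 1 + ∑ i, ‖c i‖ with hRdef
  have hR : ∀ i, R₀ + 1 + ‖c i‖ ≤ R := fun i =>
    add_le_add_right (Finset.single_le_sum (fun i _ => norm_nonneg (c i)) (Finset.mem_univ i)) _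
  set C := 6 + 768 * Fintype.card ι * (mollConst ^ 2 * R ^ 2 / r ^ 2) with hC
  have hC0 : 0 ≤ C := by positivity
  refine ⟨C, hC0, fun f hf hf0 A hA0 hA => ?_⟩
  have hf2 : Integrable fun x => f x ^ 2 := hf.integrable_sq
  have hfi : Integrable f := by
    have hfin : IsFiniteMeasure (volume.restrict Ω : Measure E3) := ⟨by
      rw [Measure.restrict_apply_univ]; exact hΩ.isBounded.measure_lt_top⟩
    have h1 : IntegrableOn f Ω := (hf.restrict Ω).integrable one_le_two
    exact (integrableOn_iff_integrable_of_support_subset fun x hx => by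
      by_contra h; exact hx (hf0 x h)).1 h1
  -- The scales tend to zero and stay below `1` and `r / 8`, as the gradient bound for the cut-off
  -- function requires.
  let ε : ℕ → ℝ := fun n => min 1 (r / 8) * (1 / ((n : ℝ) + 1))
  have hmin : 0 < min 1 (r / 8) := lt_min one_pos (by positivity)
  have hε : ∀ n, 0 < ε n := fun n => by positivity
  have hεle : ∀ n, ε n ≤ min 1 (r / 8) := fun n =>
    mul_le_of_le_one_right hmin.le (by
      rw [div_le_one (by positivity)]; linarith [(Nat.cast_nonneg n : (0 : ℝ) ≤ n)])
  have hε1 : ∀ n, ε n ≤ 1 := fun n => (hεle n).trans (min_le_left _ _)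
  have hεr : ∀ n, 8 * ε n ≤ r := fun n => by
    have := (hεle n).trans (min_le_right _ _)
    linarith
  have hε0 : Tendsto ε atTop (𝓝 0) := by
    simpa [ε] using tendsto_one_div_add_atTop_nhds_zero_nat.const_mul (min 1 (r / 8))
  let F : ℕ → E3 → ℝ := fun n => conv f (mollifier (ε n))
  have hFs : ∀ n, ContDiff ℝ ∞ (F n) := fun n =>
    contDiff_conv hfi (contDiff_mollifier _) (hasCompactSupport_mollifier (hε n))
  let g : ℕ → E3 → ℝ := fun n x => cutoff Ω (ε n) x * F n x
  have hg : ∀ n, IsTestFunction Ω (g n) := fun n =>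
    isTestFunction_cutoff_mul hΩ.isBounded (hε n) (hFs n)
  have hgrad : ∀ n, ∫ x, ‖fderiv ℝ (g n) x‖ ^ 2 ≤ C * A := fun n =>
    integral_norm_fderiv_cutoff_mul_le hR₀ hΩ.isOpen hΩn hr hDc hDcl hball hD hR hfi hf0 hA0 hA
      (hε n) (hε1 n) (hεr n)
  have hval : ∀ n, ∫ x, g n x ^ 2 ≤ ∫ x, f x ^ 2 := by
    intro n
    have h1 := integral_conv_sq_le hfi hf2 (contDiff_mollifier (ε n)).continuous
      (hasCompactSupport_mollifier (hε n)) (mollifier_nonneg (hε n)) (integral_mollifier (hε n))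
    refine le_trans ?_ h1.2
    refine integral_mono_of_nonneg (Eventually.of_forall fun x => sq_nonneg _) h1.1
      (Eventually.of_forall fun x => ?_)
    simp only [g, mul_pow]
    refine mul_le_of_le_one_left (sq_nonneg _) ?_
    rw [← sq_abs]
    exact pow_le_one₀ (abs_nonneg _) (abs_cutoff_le (hε n) x)
  have hB : ∀ n, ‖mkPair Ω (hg n).memLp (hg n).memLp_gradient‖
      ≤ Real.sqrt ((∫ x, f x ^ 2) + C * A) := by
    intro n
    refine Real.le_sqrt_of_sq_le ?_
    rw [← real_inner_self_eq_norm_sq, inner_mkPair_mkPair]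
    refine add_le_add ?_ ?_
    · rw [setIntegral_eq_integral_of_forall_compl_eq_zero fun x hx => by
        rw [(hg n).eq_zero hx, mul_zero]]
      simpa only [sq] using hval n
    · rw [setIntegral_eq_integral_of_forall_compl_eq_zero fun x hx => by
        rw [(hg n).gradient_eq_zero hx, inner_zero_right]]
      simpa only [real_inner_self_eq_norm_sq, norm_gradient] using hgrad n
  -- The approximations are test functions bounded in the norm of `H^1(Ω)`. Weak convergence is
  -- enough: the closed subspace keeps the limit, and its first component is identified by testing.
  obtain ⟨v, hvS, hvB, hv⟩ := exists_weak_limit (H10 Ω)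
    (Submodule.isClosed_topologicalClosure _) (fun n => (hg n).mkPair_mem) hB
  refine ⟨⟨v, hvS⟩, ?_, ?_⟩
  · refine ae_eq_of_integral_mul_eq hΩ.isOpen (Lp.memLp _) (hf.restrict Ω) fun q hq => ?_
    have hz : MemLp (fun _ : E3 => (0 : E3)) 2 (volume.restrict Ω) := MemLp.zero'
    have h1 := hv (mkPair Ω hq.memLp hz) (∫ x in Ω, f x * q x) ?_
    · rw [inner_mkPair] at h1
      simp only [inner_zero_right, integral_zero, add_zero] at h1
      exact h1
    · have e1 : ∀ n, inner ℝ (mkPair Ω (hg n).memLp (hg n).memLp_gradient) (mkPair Ω hq.memLp hz)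
          = ∫ x, g n x * q x := fun n => by
        rw [inner_mkPair_mkPair, setIntegral_eq_integral_of_forall_compl_eq_zero fun x hx => by
          rw [hq.eq_zero hx, mul_zero]]
        simp
      simp_rw [e1]
      rw [setIntegral_eq_integral_of_forall_compl_eq_zero fun x hx => by
          rw [hq.eq_zero hx, mul_zero]]
      -- The support of `q` has a positive distance `d` to the complement of `Ω`, so the cutoff is
      -- one on it as soon as `3 * ε n < d`. The mollifier can then be moved onto `q`.
      obtain ⟨d, hd0, hd⟩ : ∃ d > 0, ∀ x ∈ tsupport q, d ≤ Metric.infDist x Ωᶜ := by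
        rcases (tsupport q).eq_empty_or_nonempty with h | h
        · exact ⟨1, one_pos, fun x hx => by rw [h] at hx; exact absurd hx (notMem_empty x)⟩
        · have hcont : ContinuousOn (fun x => Metric.infDist x Ωᶜ) (tsupport q) :=
            (Metric.continuous_infDist_pt Ωᶜ).continuousOn
          obtain ⟨x₀, hx₀, hmin⟩ := (hq.2.1 : IsCompact (tsupport q)).exists_isMinOn h hcont
          refine ⟨Metric.infDist x₀ Ωᶜ, ?_, fun x hx => hmin hx⟩
          exact (hΩ.isOpen.isClosed_compl.notMem_iff_infDist_pos hΩn).1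
            fun h => h (hq.2.2 hx₀)
      have hqi : Integrable q := hq.1.continuous.integrable_of_hasCompactSupport hq.2.1
      obtain ⟨B, hB⟩ := (hq.2.1.fderiv ℝ).exists_bound_of_continuous
        (hq.1.continuous_fderiv (by simp))
      have hB0 : 0 ≤ B := (norm_nonneg _).trans (hB 0)
      have hLip : ∀ x y, |q x - q y| ≤ B * ‖x - y‖ := fun x y =>
        convex_univ.norm_image_sub_le_of_norm_fderiv_le
          (fun x _ => hq.1.differentiable (by simp) x) (fun x _ => hB x) (mem_univ y) (mem_univ x)
      obtain ⟨Bq, hBq⟩ := hq.2.1.exists_bound_of_continuous hq.1.continuous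
      have hev : ∀ᶠ n in atTop, |(∫ x, g n x * q x) - ∫ x, f x * q x| ≤ B * ε n * ∫ x, ‖f x‖ := by
        have h3 : Tendsto (fun n => 3 * ε n) atTop (𝓝 0) := by simpa using hε0.const_mul 3
        filter_upwards [h3.eventually_lt_const hd0] with n hn
        have e2 : ∫ x, g n x * q x = ∫ x, f x * conv q (mollifier (ε n)) x := by
          have h4 : ∫ x, g n x * q x = ∫ x, F n x * q x := by
            refine integral_congr_ae (Eventually.of_forall fun x => ?_)
            simp only [g]
            by_cases hx : x ∈ tsupport q
            · rw [cutoff_eq_one (hε n) (hn.le.trans (hd x hx)), one_mul]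
            · rw [image_eq_zero_of_notMem_tsupport hx]; simp
          obtain ⟨C', hC'⟩ := (hasCompactSupport_mollifier (hε n)).exists_bound_of_continuous
            (contDiff_mollifier (ε n)).continuous
          rw [h4, integral_conv_mul hfi (contDiff_mollifier (ε n)).continuous hC' hqi]
          simp_rw [mollifier_neg]
        have hcd : ∀ x, |conv q (mollifier (ε n)) x - q x| ≤ B * ε n :=
          abs_conv_mollifier_sub_le hqi (hε n) hLip hB0
        have hcc : Continuous (conv q (mollifier (ε n))) :=
          (contDiff_conv hqi (contDiff_mollifier _) (hasCompactSupport_mollifier (hε n))).continuous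
        have i1 : Integrable fun x => f x * (conv q (mollifier (ε n)) x - q x) :=
          hfi.mul_bdd (c := B * ε n) (hcc.sub hq.1.continuous).aestronglyMeasurable
            (Eventually.of_forall hcd)
        have i2 : Integrable fun x => f x * q x :=
          hfi.mul_bdd (c := Bq) hq.1.continuous.aestronglyMeasurable (Eventually.of_forall hBq)
        have e3 : (∫ x, f x * conv q (mollifier (ε n)) x) - ∫ x, f x * q x
            = ∫ x, f x * (conv q (mollifier (ε n)) x - q x) := by
          have := integral_add i1 i2
          rw [sub_eq_iff_eq_add, ← this]
          congr 1; funext x; ring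
        rw [e2, e3, ← Real.norm_eq_abs, ← integral_const_mul]
        refine (norm_integral_le_integral_norm _).trans
          (integral_mono i1.norm (hfi.norm.const_mul _) fun x => ?_)
        dsimp only
        rw [norm_mul, mul_comm]
        exact mul_le_mul_of_nonneg_right (hcd x) (norm_nonneg _)
      rw [tendsto_iff_norm_sub_tendsto_zero]
      refine squeeze_zero' (Eventually.of_forall fun n => norm_nonneg _) hev ?_
      simpa using (hε0.const_mul B).mul_const (∫ x, ‖f x‖)
  · have h0 : 0 ≤ (∫ x, f x ^ 2) + C * A :=
      add_nonneg (integral_nonneg fun x => sq_nonneg _) (mul_nonneg hC0 hA0)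
    have := pow_le_pow_left₀ (norm_nonneg v) hvB 2
    rwa [Real.sq_sqrt h0] at this

end

section

open scoped ContDiff

/-! ### Limits of piecewise constant functions -/

theorem inner_toLp {Ω : Set E3} (f : Lp ℝ 2 (volume.restrict Ω : Measure E3)) {ψ : E3 → ℝ}
    (hψ : MemLp ψ 2 (volume.restrict Ω)) : inner ℝ f (hψ.toLp ψ) = ∫ x in Ω, f x * ψ x := by
  rw [L2.inner_def]
  refine integral_congr_ae ?_
  filter_upwards [hψ.coeFn_toLp] with x hx
  rw [hx]
  simp [mul_comm]

namespace AdmissibleMesh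

variable {Ω : Set E3} (M : AdmissibleMesh Ω)

theorem inner_interp (z : M.MeshFun) {ψ : E3 → ℝ} (hψ : MemLp ψ 2 (volume.restrict Ω)) :
    inner ℝ (M.interp z) (hψ.toLp ψ) = ∫ x, M.interpFun z x * ψ x := by
  rw [inner_toLp]
  refine Eq.trans (integral_congr_ae ?_) (setIntegral_eq_integral_of_forall_compl_eq_zero
    (s := Ω) fun x hx => by rw [M.interpFun_eq_zero z hx, zero_mul])
  filter_upwards [(M.memLp_interpFun z).coeFn_toLp] with x hx
  rw [interp, hx]

theorem norm_interp_sq (z : M.MeshFun) : ‖M.interp z‖ ^ 2 = M.normSq z := by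
  rw [← real_inner_self_eq_norm_sq, ← M.integral_sq_interpFun]
  change inner ℝ (M.interp z) ((M.memLp_interpFun z).toLp _) = _
  rw [M.inner_interp]
  simp_rw [sq]

end AdmissibleMesh

theorem norm_sq_eq_integral {Ω : Set E3} (f : Lp ℝ 2 (volume.restrict Ω : Measure E3)) :
    ‖f‖ ^ 2 = ∫ x in Ω, f x ^ 2 := by
  rw [← real_inner_self_eq_norm_sq, L2.inner_def]
  refine integral_congr_ae (Eventually.of_forall fun x => ?_)
  simp [sq]

/-- In the limit the term with the mesh norm drops out of the weak gradient bound, which leaves `3 *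
A * ∫ φ ^ 2`. Bounded energies for infinitely many `n` suffice; at a fixed time, Fatou's lemma
provides no more than that. -/
theorem exists_mem_H10_of_tendsto {Ω : Set E3} (hΩ : IsPolyhedralDomain Ω)
    (M : ℕ → AdmissibleMesh Ω) (hM : IsNormalSeq M) :
    ∃ C : ℝ, 0 ≤ C ∧ ∀ (k : ℕ → ℕ), Tendsto k atTop atTop → ∀ (z : ∀ n, (M (k n)).MeshFun)
      (f : Lp ℝ 2 (volume.restrict Ω : Measure E3)),
      Tendsto (fun n => (M (k n)).interp (z n)) atTop (𝓝 f) →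
      ∀ A : ℝ, 0 ≤ A → (∃ᶠ n in atTop, (M (k n)).form (z n) (z n) ≤ A) →
      ∃ v : H10 Ω, H10.val v = f ∧ ‖v‖ ^ 2 ≤ ‖f‖ ^ 2 + C * A := by
  obtain ⟨C, hC0, hC⟩ := exists_mem_H10 hΩ (M 0)
  refine ⟨3 * C, by positivity, fun k hk z f hf A hA0 hA => ?_⟩
  obtain ⟨l, hl, hlA⟩ := extraction_of_frequently_atTop hA
  have hΩm := hΩ.isOpen.measurableSet
  have hf1 : MemLp (Ω.indicator f) 2 volume := (memLp_indicator_iff_restrict hΩm).2 (Lp.memLp f)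
  have hfΩ : Ω.indicator f =ᵐ[volume.restrict Ω] f := by
    filter_upwards [ae_restrict_mem hΩm] with x hx
    rw [indicator_of_mem hx]
  have hw : ∀ (i : Fin 3) (φ : E3 → ℝ), ContDiff ℝ ∞ φ → HasCompactSupport φ →
      (∫ x, Ω.indicator f x * fderiv ℝ φ x (EuclideanSpace.single i 1)) ^ 2
        ≤ 3 * A * ∫ x, φ x ^ 2 := by
    intro i φ hφ hφc
    set ψ : E3 → ℝ := fun x => fderiv ℝ φ x (EuclideanSpace.single i 1) with hψ
    have hψm : MemLp ψ 2 (volume.restrict Ω) :=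
      ((contDiff_fderiv_apply hφ _).continuous.memLp_of_hasCompactSupport
        (hφc.fderiv_apply ℝ _)).restrict Ω
    have e1 : ∫ x, Ω.indicator f x * ψ x = inner ℝ f (hψm.toLp ψ) := by
      rw [inner_toLp, ← integral_indicator hΩm]
      refine integral_congr_ae (Eventually.of_forall fun x => ?_)
      by_cases hx : x ∈ Ω <;> simp [hx]
    rw [e1]
    have h1 : Tendsto (fun n => (inner ℝ ((M (k (l n))).interp (z (l n))) (hψm.toLp ψ)) ^ 2) atTop
        (𝓝 ((inner ℝ f (hψm.toLp ψ)) ^ 2)) :=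
      ((hf.comp hl.tendsto_atTop).inner tendsto_const_nhds).pow 2
    have hm : Tendsto (fun n => (M (k (l n))).meshNorm) atTop (𝓝 0) :=
      hM.comp (hk.comp hl.tendsto_atTop)
    set I := ∫ x, ‖fderiv ℝ (fun x => φ x ^ 2) x‖
    have h2 : Tendsto (fun n => A * (‖(EuclideanSpace.single i 1 : E3)‖ ^ 2 *
        (3 * (∫ x, φ x ^ 2) + 2 * (M (k (l n))).meshNorm * I))) atTop
        (𝓝 (A * (‖(EuclideanSpace.single i 1 : E3)‖ ^ 2 *
          (3 * (∫ x, φ x ^ 2) + 2 * 0 * I)))) :=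
      ((((hm.const_mul 2).mul_const I).const_add _).const_mul _).const_mul _
    have hI : 0 ≤ I := integral_nonneg fun x => norm_nonneg _
    have hφ2 : 0 ≤ ∫ x, φ x ^ 2 := integral_nonneg fun x => sq_nonneg _
    have h3 := le_of_tendsto_of_tendsto' h1 h2 fun n => by
      rw [AdmissibleMesh.inner_interp]
      refine ((M (k (l n))).sq_integral_interpFun_fderiv_le (z (l n))
        (hφ.of_le (by exact_mod_cast le_top)) hφc (EuclideanSpace.single i 1)).trans ?_
      have := (M (k (l n))).meshNorm_nonneg
      exact mul_le_mul_of_nonneg_right (hlA n) (by positivity)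
    refine h3.trans_eq ?_
    simp
    ring
  obtain ⟨v, hv1, hv2⟩ := hC (Ω.indicator f) hf1 (fun x hx => indicator_of_notMem hx _) (3 * A)
    (by positivity) hw
  refine ⟨v, Lp.ext (hv1.trans hfΩ), hv2.trans_eq ?_⟩
  rw [norm_sq_eq_integral]
  have : ∫ x, Ω.indicator f x ^ 2 = ∫ x in Ω, f x ^ 2 := by
    rw [← integral_indicator hΩm]
    refine integral_congr_ae (Eventually.of_forall fun x => ?_)
    by_cases hx : x ∈ Ω <;> simp [hx]
  rw [this]; ring

end

section

open scoped ContDiff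

/-! ### Extraction of a subsequence that converges weakly at every time -/

section Hilbert

variable {H : Type*} [NormedAddCommGroup H] [InnerProductSpace ℝ H]

/-- For a bounded sequence, the vectors whose scalar products with it are Cauchy form a closed
subspace. -/
theorem cauchySeq_inner_of_dense {w : ℕ → H} {B : ℝ} (hB : ∀ n, ‖w n‖ ≤ B) {S : Set H}
    (hS : (Submodule.span ℝ S).topologicalClosure = ⊤)
    (h : ∀ ψ ∈ S, CauchySeq fun n => inner ℝ (w n) ψ) (ψ : H) :
    CauchySeq fun n => inner ℝ (w n) ψ := by
  have hB0 : 0 ≤ B := (norm_nonneg _).trans (hB 0)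
  have hspan : ∀ φ ∈ Submodule.span ℝ S, CauchySeq fun n => inner ℝ (w n) φ := by
    intro φ hφ
    induction hφ using Submodule.span_induction with
    | mem x hx => exact h x hx
    | zero => simpa using cauchySeq_const (0 : ℝ)
    | add x y _ _ hx hy =>
      simp_rw [inner_add_right]
      exact hx.add hy
    | smul a x _ hx =>
      obtain ⟨l, hl⟩ := cauchySeq_tendsto_of_complete hx
      simpa [inner_smul_right] using (hl.const_mul a).cauchySeq
  have hψ : ψ ∈ closure (Submodule.span ℝ S : Set H) := by
    rw [← Submodule.topologicalClosure_coe, hS]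
    exact mem_univ _
  rw [Metric.cauchySeq_iff]
  intro ε hε
  obtain ⟨φ, hφ, hd⟩ := Metric.mem_closure_iff.1 hψ (ε / (3 * (B + 1))) (by positivity)
  obtain ⟨N, hN⟩ := Metric.cauchySeq_iff.1 (hspan φ hφ) (ε / 3) (by positivity)
  refine ⟨N, fun m hm n hn => ?_⟩
  have h1 := hN m hm n hn
  have h2 : ∀ j, |inner ℝ (w j) ψ - inner ℝ (w j) φ| ≤ ε / 3 := fun j => by
    rw [← inner_sub_right]
    refine (abs_real_inner_le_norm _ _).trans ?_
    rw [← dist_eq_norm]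
    calc ‖w j‖ * dist ψ φ ≤ (B + 1) * (ε / (3 * (B + 1))) :=
          mul_le_mul ((hB j).trans (by linarith)) hd.le dist_nonneg (by linarith)
      _ = ε / 3 := by field_simp
  rw [Real.dist_eq] at h1 ⊢
  have h3 := abs_le.1 (h2 m)
  have h4 := abs_le.1 (h2 n)
  have h5 := abs_lt.1 h1
  exact abs_lt.2 ⟨by linarith, by linarith⟩

/-- A weak form of the Arzelà–Ascoli theorem. The scalar products at countably many dense times with
countably many dense vectors of `S` lie in a product of compact intervals, which yields the
subsequence; equicontinuity extends the Cauchy property to all times, and density to all vectors.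
Equicontinuity for large `n` is enough, which leaves room for an error depending on the mesh. -/
theorem exists_subseq_cauchySeq_inner [SecondCountableTopology H] {T : ℝ} (hT : 0 < T)
    {W : ℕ → ℝ → H} {B : ℝ} (hB : ∀ n, ∀ t ∈ Ioo 0 T, ‖W n t‖ ≤ B) {S : Set H} (hSn : S.Nonempty)
    (hS : (Submodule.span ℝ S).topologicalClosure = ⊤)
    (hequi : ∀ ψ ∈ S, ∀ ε > 0, ∃ δ > 0, ∀ᶠ n in atTop, ∀ s ∈ Ioo 0 T, ∀ t ∈ Ioo 0 T,
      |t - s| < δ → |inner ℝ (W n t) ψ - inner ℝ (W n s) ψ| ≤ ε) :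
    ∃ k : ℕ → ℕ, StrictMono k ∧ ∀ t ∈ Ioo 0 T, ∀ ψ : H,
      CauchySeq fun n => inner ℝ (W (k n) t) ψ := by
  have : Nonempty S := hSn.to_subtype
  have : Nonempty (Ioo 0 T) := (nonempty_Ioo.2 hT).to_subtype
  let ψ : ℕ → H := fun j => (TopologicalSpace.denseSeq S j : H)
  let τ : ℕ → ℝ := fun i => (TopologicalSpace.denseSeq (Ioo 0 T) i : ℝ)
  have hτ : ∀ i, τ i ∈ Ioo 0 T := fun i => (TopologicalSpace.denseSeq (Ioo 0 T) i).2
  have hψS : ∀ j, ψ j ∈ S := fun j => (TopologicalSpace.denseSeq S j).2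
  have hdense : (Submodule.span ℝ (range ψ)).topologicalClosure = ⊤ := by
    rw [eq_top_iff, ← hS]
    refine Submodule.topologicalClosure_minimal _ (Submodule.span_le.2 fun φ hφ => ?_)
      (Submodule.isClosed_topologicalClosure _)
    rw [Submodule.topologicalClosure_coe]
    refine closure_mono Submodule.subset_span (Metric.mem_closure_iff.2 fun ε hε => ?_)
    obtain ⟨y, ⟨j, rfl⟩, hy⟩ := Metric.mem_closure_iff.1
      (TopologicalSpace.denseRange_denseSeq S ⟨φ, hφ⟩) ε hε
    exact ⟨ψ j, mem_range_self j, hy⟩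
  let X : ℕ → ℕ × ℕ → ℝ := fun n p => inner ℝ (W n (τ p.1)) (ψ p.2)
  have hX : ∀ n, X n ∈ Set.pi univ fun p : ℕ × ℕ => Icc (-(B * ‖ψ p.2‖)) (B * ‖ψ p.2‖) := by
    intro n p _
    refine abs_le.1 ((abs_real_inner_le_norm _ _).trans ?_)
    exact mul_le_mul_of_nonneg_right (hB n _ (hτ _)) (norm_nonneg _)
  obtain ⟨a, -, k, hk, hlim⟩ := (isCompact_univ_pi fun p : ℕ × ℕ =>
    isCompact_Icc (a := -(B * ‖ψ p.2‖)) (b := B * ‖ψ p.2‖)).tendsto_subseq hX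
  have hlim' : ∀ i j, CauchySeq fun n => inner ℝ (W (k n) (τ i)) (ψ j) := fun i j =>
    ((tendsto_pi_nhds.1 hlim) (i, j)).cauchySeq
  refine ⟨k, hk, fun t ht => ?_⟩
  refine cauchySeq_inner_of_dense (B := B) (fun n => hB _ t ht) hdense ?_
  rintro _ ⟨j, rfl⟩
  rw [Metric.cauchySeq_iff]
  intro ε hε
  obtain ⟨δ, hδ, hev⟩ := hequi (ψ j) (hψS j) (ε / 4) (by positivity)
  obtain ⟨y, ⟨i, rfl⟩, hy⟩ := Metric.mem_closure_iff.1
    (TopologicalSpace.denseRange_denseSeq (Ioo 0 T) ⟨t, ht⟩) δ hδ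
  have hy' : |t - τ i| < δ := hy
  obtain ⟨N₁, hN₁⟩ := eventually_atTop.1 (hk.tendsto_atTop.eventually hev)
  obtain ⟨N₂, hN₂⟩ := Metric.cauchySeq_iff.1 (hlim' i j) (ε / 4) (by positivity)
  refine ⟨max N₁ N₂, fun m hm n hn => ?_⟩
  have h1 := hN₁ m ((le_max_left _ _).trans hm) (τ i) (hτ i) t ht hy'
  have h2 := hN₁ n ((le_max_left _ _).trans hn) (τ i) (hτ i) t ht hy'
  have h3 := hN₂ m ((le_max_right _ _).trans hm) n ((le_max_right _ _).trans hn)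
  rw [Real.dist_eq] at h3 ⊢
  have h1' := abs_le.1 h1
  have h2' := abs_le.1 h2
  have h3' := abs_lt.1 h3
  exact abs_lt.2 ⟨by linarith, by linarith⟩

end Hilbert

/-- The test functions as elements of `L²(Ω)`. -/
def testSet (Ω : Set E3) : Set (Lp ℝ 2 (volume.restrict Ω : Measure E3)) :=
  {f | ∃ (q : E3 → ℝ) (hq : IsTestFunction Ω q), f = hq.memLp.toLp q}

theorem isTestFunction_zero (Ω : Set E3) : IsTestFunction Ω fun _ => 0 :=
  ⟨contDiff_const, HasCompactSupport.zero, by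
    have : tsupport (fun _ : E3 => (0 : ℝ)) = ∅ := tsupport_eq_empty_iff.2 rfl
    rw [this]; exact empty_subset _⟩

theorem nonempty_testSet (Ω : Set E3) : (testSet Ω).Nonempty := ⟨_, _, isTestFunction_zero Ω, rfl⟩

/-- A function in `L²(Ω)` that is orthogonal to all test functions vanishes almost everywhere. -/
theorem topologicalClosure_span_testSet {Ω : Set E3} (hΩ : IsOpen Ω) :
    (Submodule.span ℝ (testSet Ω)).topologicalClosure = ⊤ := by
  rw [Submodule.topologicalClosure_eq_top_iff, eq_bot_iff]
  intro f hf
  rw [Submodule.mem_bot]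
  refine Lp.ext ((ae_eq_of_integral_mul_eq hΩ (Lp.memLp f) (MemLp.zero' (ε := ℝ)) fun q hq => ?_).trans
    (Lp.coeFn_zero ℝ 2 _).symm)
  have h := (Submodule.mem_orthogonal' _ _).1 hf _
    (Submodule.subset_span (⟨q, hq, rfl⟩ : hq.memLp.toLp q ∈ testSet Ω))
  rw [inner_toLp] at h
  rw [h]
  simp

namespace AdmissibleMesh

variable {Ω : Set E3} (M : AdmissibleMesh Ω)

/-- On a cell, `q` differs from its value at the centre by at most `2 B` times the mesh norm; `|z| ≤
1 + z²` then brings in the volume and the `L²` norm. -/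
theorem abs_sum_center_sub_integral_le (hΩ : volume Ω ≠ ⊤) (z : M.MeshFun) {q : E3 → ℝ}
    (hq : Continuous q) {B : ℝ} (hB : ∀ x y, |q x - q y| ≤ B * dist x y) :
    |(∑ K, M.mass K * z K * q (M.center K)) - ∫ x, M.interpFun z x * q x|
      ≤ 2 * B * M.meshNorm * (volume.real Ω + M.normSq z) := by
  have hm := M.meshNorm_nonneg
  have hB0 : 0 ≤ B := by
    have := (abs_nonneg _).trans (hB 0 (EuclideanSpace.single 0 1))
    have hd : 0 < dist (0 : E3) (EuclideanSpace.single 0 1) := by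
      rw [dist_pos]
      intro h
      have := congrArg (fun x : E3 => x 0) h
      simp at this
    exact nonneg_of_mul_nonneg_left this hd
  rw [M.integral_interpFun_mul z fun K => M.integrableOn_cell K hq, ← Finset.sum_sub_distrib]
  have hK : ∀ K, |M.mass K * z K * q (M.center K) - z K * ∫ x in M.cell K, q x|
      ≤ 2 * B * M.meshNorm * (M.mass K + M.mass K * z K ^ 2) := by
    intro K
    have h1 : |∫ x in M.cell K, (q (M.center K) - q x)| ≤ B * (2 * M.meshNorm) * M.mass K := by
      rw [← Real.norm_eq_abs]
      refine norm_setIntegral_le_of_norm_le_const (M.isBounded_cell K).measure_lt_top fun x hx => ?_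
      exact (hB _ _).trans (mul_le_mul_of_nonneg_left
        (M.dist_le_of_mem_closure (M.center_mem K) (subset_closure hx)) hB0)
    have h2 : M.mass K * z K * q (M.center K) - z K * ∫ x in M.cell K, q x
        = z K * ∫ x in M.cell K, (q (M.center K) - q x) := by
      have h3 : Integrable (fun _ : E3 => q (M.center K)) (volume.restrict (M.cell K)) :=
        integrableOn_const (M.isBounded_cell K).measure_lt_top.ne
      rw [integral_sub h3 (M.integrableOn_cell K hq), setIntegral_const, smul_eq_mul, mass]
      ring
    rw [h2, abs_mul]
    have hmass := (M.mass_pos K).le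
    have h3 : |z K| ≤ 1 + z K ^ 2 := by rw [← sq_abs]; nlinarith [sq_nonneg (|z K| - 1), abs_nonneg (z K)]
    calc |z K| * |∫ x in M.cell K, (q (M.center K) - q x)|
        ≤ (1 + z K ^ 2) * (B * (2 * M.meshNorm) * M.mass K) := by gcongr
      _ = _ := by ring
  refine (Finset.abs_sum_le_sum_abs _ _).trans ((Finset.sum_le_sum fun K _ => hK K).trans ?_)
  rw [← Finset.mul_sum, Finset.sum_add_distrib]
  have := M.sum_mass_le hΩ
  rw [normSq]
  gcongr

end AdmissibleMesh

theorem IsTestFunction.exists_lipschitz {Ω : Set E3} {q : E3 → ℝ} (hq : IsTestFunction Ω q) :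
    ∃ B : ℝ, 0 ≤ B ∧ ∀ x y, |q x - q y| ≤ B * dist x y := by
  obtain ⟨B, hB⟩ := (hq.2.1.fderiv ℝ).exists_bound_of_continuous
    (hq.1.continuous_fderiv (by simp))
  refine ⟨B, (norm_nonneg _).trans (hB 0), fun x y => ?_⟩
  rw [dist_eq_norm]
  exact convex_univ.norm_image_sub_le_of_norm_fderiv_le
    (fun x _ => hq.1.differentiable (by simp) x) (fun x _ => hB x) (mem_univ y) (mem_univ x)

/-- Weak compactness, at every time, of a bounded and equicontinuous family of piecewise constant
functions. -/
theorem exists_subseq_weak {Ω : Set E3} (hΩ : IsPolyhedralDomain Ω) {T : ℝ} (hT : 0 < T)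
    (M : ℕ → AdmissibleMesh Ω) (hM : IsNormalSeq M) (z : ∀ n, ℝ → (M n).MeshFun) {C : ℝ}
    (hC : ∀ n, ∀ t ∈ Ioo 0 T, (M n).normSq (z n t) ≤ C)
    (hequi : ∀ q, IsTestFunction Ω q → ∀ ε > 0, ∃ δ > 0, ∀ n, ∀ s ∈ Ioo 0 T, ∀ t ∈ Ioo 0 T,
      |t - s| < δ → |(∑ K, (M n).mass K * z n t K * q ((M n).center K))
        - ∑ K, (M n).mass K * z n s K * q ((M n).center K)| ≤ ε) :
    ∃ k : ℕ → ℕ, StrictMono k ∧ ∀ t ∈ Ioo 0 T, ∀ ψ : Lp ℝ 2 (volume.restrict Ω : Measure E3),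
      CauchySeq fun n => inner ℝ ((M (k n)).interp (z (k n) t)) ψ := by
  have : Fact ((2 : ENNReal) ≠ ⊤) := ⟨by norm_num⟩
  have hvol : volume Ω ≠ ⊤ := hΩ.isBounded.measure_lt_top.ne
  refine exists_subseq_cauchySeq_inner hT (W := fun n t => (M n).interp (z n t))
    (B := Real.sqrt C) (fun n t ht => ?_) (nonempty_testSet Ω)
    (topologicalClosure_span_testSet hΩ.isOpen) ?_
  · refine Real.le_sqrt_of_sq_le ?_
    rw [AdmissibleMesh.norm_interp_sq]
    exact hC n t ht
  · rintro _ ⟨q, hq, rfl⟩ ε hε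
    obtain ⟨B, hB0, hB⟩ := hq.exists_lipschitz
    obtain ⟨δ, hδ, hδ'⟩ := hequi q hq (ε / 2) (by positivity)
    refine ⟨δ, hδ, ?_⟩
    -- Replacing the centre sums by `L²` scalar products costs a quadrature error that is below `ε /
    -- 4` on fine meshes, uniformly in time. It is paid at both times, which leaves `ε / 2` for the
    -- equicontinuity.
    have h0 : Tendsto (fun n => 2 * B * (M n).meshNorm * (volume.real Ω + C)) atTop (𝓝 0) := by
      have h1 := (hM.const_mul (2 * B)).mul_const (volume.real Ω + C)
      simpa using h1
    filter_upwards [h0.eventually_lt_const (show 0 < ε / 4 by positivity)] with n hn s hs t ht hst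
    have h2 : ∀ r ∈ Ioo 0 T, |(∑ K, (M n).mass K * z n r K * q ((M n).center K))
        - inner ℝ ((M n).interp (z n r)) (hq.memLp.toLp q)| ≤ ε / 4 := by
      intro r hr
      rw [AdmissibleMesh.inner_interp]
      refine ((M n).abs_sum_center_sub_integral_le hvol (z n r) hq.1.continuous hB).trans ?_
      refine le_trans ?_ hn.le
      have := (M n).meshNorm_nonneg
      have := hC n r hr
      gcongr
    have h3 := abs_le.1 (h2 s hs)
    have h4 := abs_le.1 (h2 t ht)
    have h5 := abs_le.1 (hδ' n s hs t ht hst)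
    exact abs_le.2 ⟨by linarith, by linarith⟩

end

section

/-! ### Strong convergence -/

theorem tendsto_eLpNorm_two {X ι E : Type*} [MeasurableSpace X] {μ : Measure X}
    [NormedAddCommGroup E] {l : Filter ι} {f : ι → X → E} (hf : ∀ i, MemLp (f i) 2 μ)
    (h : Tendsto (fun i => ∫ x, ‖f i x‖ ^ 2 ∂μ) l (𝓝 0)) :
    Tendsto (fun i => eLpNorm (f i) 2 μ) l (𝓝 0) := by
  have e : ∀ i, eLpNorm (f i) 2 μ = ENNReal.ofReal (Real.sqrt (∫ x, ‖f i x‖ ^ 2 ∂μ)) := fun i => by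
    rw [(hf i).eLpNorm_eq_integral_rpow_norm two_ne_zero ENNReal.ofNat_ne_top, Real.sqrt_eq_rpow]
    simp
  simp_rw [e]
  have := (ENNReal.continuous_ofReal.comp Real.continuous_sqrt).tendsto 0
  simp only [Function.comp_apply, Real.sqrt_zero, ENNReal.ofReal_zero] at this
  exact this.comp h

theorem memLp_of_continuousOn_Ioo {E : Type*} [NormedAddCommGroup E]
    {T : ℝ} {f : ℝ → E} (hf : ContinuousOn f (Ioo 0 T)) {B : ℝ} (hB : ∀ t ∈ Ioo 0 T, ‖f t‖ ≤ B) :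
    MemLp f 2 (timeMeasure T) := by
  have : IsFiniteMeasure (timeMeasure T) := ⟨by simp⟩
  exact MemLp.of_bound (hf.aestronglyMeasurable measurableSet_Ioo) B
    ((ae_restrict_mem measurableSet_Ioo).mono hB)

theorem integrableOn_Ioo_of_bdd {T : ℝ} {f : ℝ → ℝ} (hf : ContinuousOn f (Ioo 0 T)) {B : ℝ}
    (hB : ∀ t ∈ Ioo 0 T, |f t| ≤ B) : Integrable f (timeMeasure T) := by
  have : IsFiniteMeasure (timeMeasure T) := ⟨by simp⟩
  exact (memLp_of_continuousOn_Ioo hf hB).integrable one_le_two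

namespace AdmissibleMesh

variable {Ω : Set E3} (M : AdmissibleMesh Ω)

/-- The piecewise constant interpolation as a linear map. -/
def interpLin : M.MeshFun →ₗ[ℝ] Lp ℝ 2 (volume.restrict Ω : Measure E3) where
  toFun := M.interp
  map_add' z w := by
    refine Lp.ext ?_
    filter_upwards [(M.memLp_interpFun z).coeFn_toLp, (M.memLp_interpFun w).coeFn_toLp,
      (M.memLp_interpFun (z + w)).coeFn_toLp, Lp.coeFn_add (M.interp z) (M.interp w)]
      with x h1 h2 h3 h4
    rw [h4, Pi.add_apply, interp, interp, interp, h1, h2, h3]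
    simp only [interpFun, ← Finset.sum_add_distrib]
    refine Finset.sum_congr rfl fun K _ => ?_
    by_cases h : x ∈ M.cell K <;> simp [h]
  map_smul' c z := by
    refine Lp.ext ?_
    filter_upwards [(M.memLp_interpFun z).coeFn_toLp, (M.memLp_interpFun (c • z)).coeFn_toLp,
      Lp.coeFn_smul c (M.interp z)] with x h1 h2 h3
    rw [RingHom.id_apply, h3, Pi.smul_apply, interp, interp, h1, h2]
    simp only [interpFun, Finset.smul_sum]
    refine Finset.sum_congr rfl fun K _ => ?_
    by_cases h : x ∈ M.cell K <;> simp [h]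

theorem continuous_interp : Continuous M.interp :=
  M.interpLin.continuous_of_finiteDimensional

theorem continuousOn_interp {z : ℝ → M.MeshFun} {s : Set ℝ}
    (hz : ∀ K, ContinuousOn (fun t => z t K) s) : ContinuousOn (fun t => M.interp (z t)) s :=
  M.continuous_interp.comp_continuousOn (continuousOn_pi.2 hz)

theorem norm_interp_le {z : M.MeshFun} {C : ℝ} (h : M.normSq z ≤ C) :
    ‖M.interp z‖ ≤ Real.sqrt C :=
  Real.le_sqrt_of_sq_le ((M.norm_interp_sq z).trans_le h)

theorem memLp_interp {T C : ℝ} {z : ℝ → M.MeshFun}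
    (hz : ∀ K, ContinuousOn (fun t => z t K) (Ioo 0 T))
    (hC : ∀ t ∈ Ioo 0 T, M.normSq (z t) ≤ C) :
    MemLp (fun t => M.interp (z t)) 2 (timeMeasure T) :=
  memLp_of_continuousOn_Ioo (M.continuousOn_interp hz) fun t ht => M.norm_interp_le (hC t ht)

theorem integral_sub_interpFun_eq (M' : AdmissibleMesh Ω) (z : M.MeshFun) (w : M'.MeshFun) :
    ‖M.interp z - M'.interp w‖ ^ 2 = ∫ x, (M.interpFun z x - M'.interpFun w x) ^ 2 := by
  rw [norm_sq_eq_integral]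
  refine Eq.trans (integral_congr_ae ?_) (setIntegral_eq_integral_of_forall_compl_eq_zero
    (s := Ω) fun x hx => by
      rw [M.interpFun_eq_zero z hx, M'.interpFun_eq_zero w hx]; norm_num)
  filter_upwards [(M.memLp_interpFun z).coeFn_toLp, (M'.memLp_interpFun w).coeFn_toLp,
    Lp.coeFn_sub (M.interp z) (M'.interp w)] with x h1 h2 h3
  rw [h3, Pi.sub_apply, interp, interp, h1, h2]

end AdmissibleMesh

/-- The characteristic function of a cube in `L²(Ω)`. -/
def cubeFun (Ω : Set E3) {δ : ℝ} (hδ : 0 < δ) (k : Fin 3 → ℤ) :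
    Lp ℝ 2 (volume.restrict Ω : Measure E3) :=
  (((memLp_indicator_const 2 (measurableSet_cube δ k) (1 : ℝ)
    (Or.inr (by rw [volume_cube hδ]; exact ENNReal.ofReal_ne_top))).restrict Ω :
    MemLp _ 2 (volume.restrict Ω))).toLp ((cube δ k).indicator fun _ => (1 : ℝ))

theorem inner_cubeFun {Ω : Set E3} (M : AdmissibleMesh Ω) (z : M.MeshFun) {δ : ℝ} (hδ : 0 < δ)
    (k : Fin 3 → ℤ) :
    inner ℝ (M.interp z) (cubeFun Ω hδ k) = ∫ x in cube δ k, M.interpFun z x := by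
  rw [cubeFun, AdmissibleMesh.inner_interp, ← integral_indicator (measurableSet_cube δ k)]
  refine integral_congr_ae (Eventually.of_forall fun x => ?_)
  by_cases h : x ∈ cube δ k <;> simp [h]

/-- A family of mesh functions that is bounded in the discrete energy space and converges weakly at
every time is a Cauchy sequence in `L²(J; L²(Ω))`. -/
theorem tendsto_integral_sub_sq {Ω : Set E3} {R : ℝ} (hΩ : ∀ x ∈ Ω, ‖x‖ ≤ R) {T : ℝ}
    (hT : 0 < T) (M : ℕ → AdmissibleMesh Ω) {h : ℝ} (hh : ∀ n, (M n).meshNorm ≤ h)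
    (z : ∀ n, ℝ → (M n).MeshFun)
    (hz : ∀ n K, ContinuousOn (fun t => z n t K) (Ioo 0 T)) {C : ℝ}
    (hC : ∀ n, ∀ t ∈ Ioo 0 T, (M n).normSq (z n t) ≤ C)
    (hform : ∀ n, Integrable (fun t => (M n).form (z n t) (z n t)) (timeMeasure T))
    (hformC : ∀ n, ∫ t, (M n).form (z n t) (z n t) ∂timeMeasure T ≤ C)
    (hweak : ∀ t ∈ Ioo 0 T, ∀ ψ : Lp ℝ 2 (volume.restrict Ω : Measure E3),
      CauchySeq fun n => inner ℝ ((M n).interp (z n t)) ψ) :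
    Tendsto (fun p : ℕ × ℕ => ∫ t, ‖(M p.1).interp (z p.1 t) - (M p.2).interp (z p.2 t)‖ ^ 2
      ∂timeMeasure T) atTop (𝓝 0) := by
  have : IsFiniteMeasure (timeMeasure T) := ⟨by simp⟩
  have hC0 : 0 ≤ C := by
    refine le_trans ?_ (hC 0 (T / 2) ⟨by positivity, by linarith⟩)
    rw [← AdmissibleMesh.norm_interp_sq]; positivity
  have hh0 : 0 ≤ h := (M 0).meshNorm_nonneg.trans (hh 0)
  let W : ℕ → ℝ → Lp ℝ 2 (volume.restrict Ω : Measure E3) := fun n t => (M n).interp (z n t)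
  have hWc : ∀ n, ContinuousOn (W n) (Ioo 0 T) := fun n => (M n).continuousOn_interp (hz n)
  have hWB : ∀ n, ∀ t ∈ Ioo 0 T, ‖W n t‖ ≤ Real.sqrt C := fun n t ht =>
    (M n).norm_interp_le (hC n t ht)
  set V := volume.real (Metric.closedBall (0 : E3) 2) with hV
  have hV0 : 0 ≤ V := measureReal_nonneg
  -- These collect the constants of the translation term: `8 * V` from the cube estimate, `4 * h +
  -- 2` and `6 * C` from `tv_mul_abs_le`, and `96 = 8 * (6 + 6)`.
  set a := 8 * V * (4 * h + 2) with ha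
  set b := 96 * V * C with hb
  have ha0 : 0 ≤ a := by positivity
  have hb0 : 0 ≤ b := by positivity
  let E : ℝ → ℕ × ℕ → ℝ → ℝ := fun δ p t => if hδ : 0 < δ then
    (δ ^ 3)⁻¹ * ∑ k ∈ cubeIndex R δ, (inner ℝ (W p.1 t - W p.2 t) (cubeFun Ω hδ k)) ^ 2 else 0
  -- For fixed `δ` finitely many cubes occur, so weak convergence at each time and dominated
  -- convergence in time suffice.
  have hE : ∀ δ, 0 < δ → Tendsto (fun p => ∫ t, E δ p t ∂timeMeasure T) atTop (𝓝 0) := by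
    intro δ hδ
    have hEeq : ∀ p t, E δ p t = (δ ^ 3)⁻¹ * ∑ k ∈ cubeIndex R δ,
        (inner ℝ (W p.1 t - W p.2 t) (cubeFun Ω hδ k)) ^ 2 := fun p t => dif_pos hδ
    have key := tendsto_integral_filter_of_dominated_convergence (μ := timeMeasure T)
      (l := (atTop : Filter (ℕ × ℕ))) (F := fun p t => E δ p t) (f := fun _ => (0 : ℝ))
      (fun _ => (δ ^ 3)⁻¹ * ∑ k ∈ cubeIndex R δ, (2 * Real.sqrt C * ‖cubeFun Ω hδ k‖) ^ 2)
      (Eventually.of_forall fun p => ?_) (Eventually.of_forall fun p => ?_) (integrable_const _) ?_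
    · simpa using key
    · simp_rw [hEeq]
      refine ContinuousOn.aestronglyMeasurable ?_ measurableSet_Ioo
      refine continuousOn_const.mul (continuousOn_finsetSum _ fun k _ => ContinuousOn.pow ?_ 2)
      exact ((hWc p.1).sub (hWc p.2)).inner continuousOn_const
    · filter_upwards [ae_restrict_mem measurableSet_Ioo] with t ht
      rw [hEeq, Real.norm_eq_abs, abs_of_nonneg (mul_nonneg (by positivity)
        (Finset.sum_nonneg fun k _ => sq_nonneg _))]
      refine mul_le_mul_of_nonneg_left (Finset.sum_le_sum fun k _ => ?_) (by positivity)
      rw [← sq_abs]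
      refine pow_le_pow_left₀ (abs_nonneg _) ((abs_real_inner_le_norm _ _).trans ?_) 2
      refine mul_le_mul_of_nonneg_right ?_ (norm_nonneg _)
      linarith [norm_sub_le (W p.1 t) (W p.2 t), hWB p.1 t ht, hWB p.2 t ht]
    · filter_upwards [ae_restrict_mem measurableSet_Ioo] with t ht
      simp_rw [hEeq]
      have : Tendsto (fun p : ℕ × ℕ => (δ ^ 3)⁻¹ * ∑ k ∈ cubeIndex R δ,
          (inner ℝ (W p.1 t - W p.2 t) (cubeFun Ω hδ k)) ^ 2) atTop
          (𝓝 ((δ ^ 3)⁻¹ * ∑ k ∈ cubeIndex R δ, (0 : ℝ) ^ 2)) := by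
        refine Tendsto.const_mul _ (tendsto_finsetSum _ fun k _ => Tendsto.pow ?_ 2)
        obtain ⟨l, hl⟩ := cauchySeq_tendsto_of_complete (hweak t ht (cubeFun Ω hδ k))
        rw [← prod_atTop_atTop_eq]
        have := (hl.comp tendsto_fst).sub (hl.comp (tendsto_snd (f := (atTop : Filter ℕ))))
        rw [sub_self] at this
        refine this.congr fun p => ?_
        rw [inner_sub_left]
        rfl
      simpa using this
  have hEi : ∀ δ p, Integrable (E δ p) (timeMeasure T) := by
    intro δ p
    by_cases hδ : 0 < δ
    · have hEeq : E δ p = fun t => (δ ^ 3)⁻¹ * ∑ k ∈ cubeIndex R δ,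
          (inner ℝ (W p.1 t - W p.2 t) (cubeFun Ω hδ k)) ^ 2 := funext fun t => dif_pos hδ
      rw [hEeq]
      refine Integrable.const_mul (integrable_finsetSum _ fun k _ => ?_) _
      refine integrableOn_Ioo_of_bdd (B := (2 * Real.sqrt C * ‖cubeFun Ω hδ k‖) ^ 2)
        (ContinuousOn.pow (((hWc p.1).sub (hWc p.2)).inner continuousOn_const) 2) fun t ht => ?_
      rw [abs_of_nonneg (sq_nonneg _), ← sq_abs]
      refine pow_le_pow_left₀ (abs_nonneg _) ((abs_real_inner_le_norm _ _).trans ?_) 2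
      refine mul_le_mul_of_nonneg_right ?_ (norm_nonneg _)
      linarith [norm_sub_le (W p.1 t) (W p.2 t), hWB p.1 t ht, hWB p.2 t ht]
    · have hEeq : E δ p = fun t => 0 := funext fun t => dif_neg hδ
      rw [hEeq]
      exact integrable_zero _ _ _
  have htv : ∀ n, ∀ t ∈ Ioo 0 T, (M n).tv (fun K => z n t K * |z n t K|)
      ≤ (4 * h + 2) * (M n).form (z n t) (z n t) + 6 * C := by
    intro n t ht
    refine ((M n).tv_mul_abs_le (z n t)).trans ?_
    have h1 := (M n).form_self_nonneg (z n t)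
    have h2 := hh n
    have h3 := hC n t ht
    gcongr
  have hpt : ∀ δ, 0 < δ → ∀ p : ℕ × ℕ, ∀ t ∈ Ioo 0 T, ‖W p.1 t - W p.2 t‖ ^ 2
      ≤ δ * a * ((M p.1).form (z p.1 t) (z p.1 t) + (M p.2).form (z p.2 t) (z p.2 t)) + δ * b
        + E δ p t := by
    intro δ hδ p t ht
    rw [AdmissibleMesh.integral_sub_interpFun_eq]
    refine (integral_sq_interpFun_sub_le hΩ (M p.1) (M p.2) (z p.1 t) (z p.2 t) hδ).trans ?_
    have h1 := htv p.1 t ht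
    have h2 := htv p.2 t ht
    refine add_le_add ?_ (le_of_eq ?_)
    · calc V * (8 * δ * ((M p.1).tv (fun K => z p.1 t K * |z p.1 t K|)
            + (M p.2).tv (fun K => z p.2 t K * |z p.2 t K|)))
          ≤ V * (8 * δ * (((4 * h + 2) * (M p.1).form (z p.1 t) (z p.1 t) + 6 * C)
            + ((4 * h + 2) * (M p.2).form (z p.2 t) (z p.2 t) + 6 * C))) := by gcongr
        _ = _ := by rw [ha, hb]; ring
    · rw [show E δ p t = _ from dif_pos hδ]
      congr 1
      refine Finset.sum_congr rfl fun k _ => ?_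
      rw [inner_sub_left, inner_cubeFun, inner_cubeFun, integral_sub
        ((M p.1).integrable_interpFun _).integrableOn ((M p.2).integrable_interpFun _).integrableOn]
  -- The translation part is `δ` times a constant that does not depend on the pair of indices; hence
  -- `δ` can be fixed first and the indices sent to infinity afterwards.
  have hint : ∀ δ, 0 < δ → ∀ p : ℕ × ℕ, ∫ t, ‖W p.1 t - W p.2 t‖ ^ 2 ∂timeMeasure T
      ≤ δ * (2 * a * C + b * T) + ∫ t, E δ p t ∂timeMeasure T := by
    intro δ hδ p
    have i1 : Integrable (fun t => δ * a * ((M p.1).form (z p.1 t) (z p.1 t)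
        + (M p.2).form (z p.2 t) (z p.2 t))) (timeMeasure T) :=
      ((hform p.1).add (hform p.2)).const_mul _
    have i2 : Integrable (fun t : ℝ => δ * b) (timeMeasure T) := integrable_const _
    have h1 := integral_mono_of_nonneg (μ := timeMeasure T)
      (f := fun t => ‖W p.1 t - W p.2 t‖ ^ 2)
      (Eventually.of_forall fun t => sq_nonneg _) ((i1.add i2).add (hEi δ p))
      ((ae_restrict_mem measurableSet_Ioo).mono (hpt δ hδ p))
    refine h1.trans ?_
    have e1 := integral_add (i1.add i2) (hEi δ p)
    have e2 := integral_add i1 i2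
    have e3 := integral_add (hform p.1) (hform p.2)
    have e4 : ∫ _t : ℝ, δ * b ∂timeMeasure T = T * (δ * b) := by
      rw [integral_const, measureReal_restrict_apply_univ, Real.volume_real_Ioo_of_le hT.le]
      simp
    refine (e1.trans (congrArg (· + _) e2)).trans_le ?_
    rw [integral_const_mul, e3, e4]
    have h2 := hformC p.1
    have h3 := hformC p.2
    have : δ * a * ((∫ t, (M p.1).form (z p.1 t) (z p.1 t) ∂timeMeasure T)
        + ∫ t, (M p.2).form (z p.2 t) (z p.2 t) ∂timeMeasure T) ≤ δ * a * (C + C) := by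
      gcongr
    linarith
  rw [Metric.tendsto_nhds]
  intro ε hε
  set κ := 2 * a * C + b * T with hκ
  have hκ0 : 0 ≤ κ := by positivity
  have hδ : 0 < ε / (2 * (κ + 1)) := by positivity
  filter_upwards [(hE _ hδ).eventually_lt_const (show 0 < ε / 2 by positivity)] with p hp
  rw [Real.dist_eq, sub_zero, abs_of_nonneg (integral_nonneg fun t => sq_nonneg _)]
  have h1 := hint _ hδ p
  have h2 : ε / (2 * (κ + 1)) * κ ≤ ε / 2 := by
    rw [div_mul_eq_mul_div, div_le_div_iff₀ (by positivity) (by norm_num)]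
    nlinarith
  change ∫ t, ‖W p.1 t - W p.2 t‖ ^ 2 ∂timeMeasure T < ε
  linarith

end

section

open scoped ContDiff

/-! ### The limit of a family of mesh functions -/

/-- By the Lusin–Souslin theorem the continuous injection of the Polish space `H_0^1(Ω)` into
`L²(Ω)` is a measurable embedding, so it has a Borel left inverse. -/
theorem exists_measurable_inverse_val {Ω : Set E3} (hΩ : IsOpen Ω) :
    ∃ g : Lp ℝ 2 (volume.restrict Ω : Measure E3) → H10 Ω,
      (∀ {X : Type} [MeasurableSpace X] {μ : Measure X} {P : X → Lp ℝ 2 (volume.restrict Ω : Measure E3)},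
        AEStronglyMeasurable P μ → AEStronglyMeasurable (fun x => g (P x)) μ) ∧
      ∀ v, g (H10.val v) = v := by
  have : Fact ((2 : ENNReal) ≠ ⊤) := ⟨by norm_num⟩
  have i1 : SecondCountableTopology (Lp ℝ 2 (volume.restrict Ω : Measure E3)) := inferInstance
  have i2 : SecondCountableTopology (Lp E3 2 (volume.restrict Ω : Measure E3)) := inferInstance
  have i3 : SecondCountableTopology (PairSpace Ω) := WithLp.secondCountableTopology 2 _ _
  have i4 : SecondCountableTopology (H10 Ω) :=
    TopologicalSpace.Subtype.secondCountableTopology (H10 Ω : Set (PairSpace Ω))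
  have i5 : CompleteSpace (H10 Ω) :=
    (Submodule.isClosed_topologicalClosure _).completeSpace_coe
  have i6 : PolishSpace (H10 Ω) := inferInstance
  let _ : MeasurableSpace (H10 Ω) := borel _
  have : BorelSpace (H10 Ω) := ⟨rfl⟩
  let _ : MeasurableSpace (Lp ℝ 2 (volume.restrict Ω : Measure E3)) := borel _
  have : BorelSpace (Lp ℝ 2 (volume.restrict Ω : Measure E3)) := ⟨rfl⟩
  have hemb : MeasurableEmbedding (H10.val : H10 Ω → Lp ℝ 2 (volume.restrict Ω : Measure E3)) :=
    continuous_val.measurableEmbedding (val_injective hΩ)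
  obtain ⟨g, hg, hgv⟩ := hemb.exists_measurable_extend measurable_id fun _ => ⟨0⟩
  refine ⟨g, fun hP => (hg.comp_aemeasurable hP.aemeasurable).aestronglyMeasurable, fun v => ?_⟩
  exact congrFun hgv v

theorem eLpNorm_two_sub_sq {X E : Type*} [MeasurableSpace X] {μ : Measure X}
    [NormedAddCommGroup E] {f : X → E} (hf : MemLp f 2 μ) :
    ∫ x, ‖f x‖ ^ 2 ∂μ = (eLpNorm f 2 μ).toReal ^ 2 := by
  have h0 : 0 ≤ ∫ x, ‖f x‖ ^ 2 ∂μ := integral_nonneg fun x => sq_nonneg _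
  have e : eLpNorm f 2 μ = ENNReal.ofReal (Real.sqrt (∫ x, ‖f x‖ ^ 2 ∂μ)) := by
    rw [hf.eLpNorm_eq_integral_rpow_norm two_ne_zero ENNReal.ofNat_ne_top, Real.sqrt_eq_rpow]
    simp
  rw [e, ENNReal.toReal_ofReal (Real.sqrt_nonneg _), Real.sq_sqrt h0]

theorem exists_strong_limit {Ω : Set E3} (hΩ : IsPolyhedralDomain Ω) {T : ℝ} (hT : 0 < T)
    (M : ℕ → AdmissibleMesh Ω) (hM : IsNormalSeq M) (z : ∀ n, ℝ → (M n).MeshFun)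
    (hz : ∀ n K, ContinuousOn (fun t => z n t K) (Ioo 0 T)) {C : ℝ}
    (hC : ∀ n, ∀ t ∈ Ioo 0 T, (M n).normSq (z n t) ≤ C)
    (hform : ∀ n, Integrable (fun t => (M n).form (z n t) (z n t)) (timeMeasure T))
    (hformC : ∀ n, ∫ t, (M n).form (z n t) (z n t) ∂timeMeasure T ≤ C)
    (hequi : ∀ q, IsTestFunction Ω q → ∀ ε > 0, ∃ δ > 0, ∀ n, ∀ s ∈ Ioo 0 T, ∀ t ∈ Ioo 0 T,
      |t - s| < δ → |(∑ K, (M n).mass K * z n t K * q ((M n).center K))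
        - ∑ K, (M n).mass K * z n s K * q ((M n).center K)| ≤ ε) :
    ∃ k : ℕ → ℕ, StrictMono k ∧ ∃ P : ℝ → Lp ℝ 2 (volume.restrict Ω : Measure E3),
      TendstoL2 T (fun n t => (M (k n)).interp (z (k n) t)) P := by
  obtain ⟨k, hk, hweak⟩ := exists_subseq_weak hΩ hT M hM z hC hequi
  obtain ⟨R, hR⟩ := hΩ.isBounded.exists_norm_le
  obtain ⟨h, hh⟩ := hM.bddAbove_range
  have hmem : ∀ n, MemLp (fun t => (M (k n)).interp (z (k n) t)) 2 (timeMeasure T) := fun n =>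
    (M (k n)).memLp_interp (hz (k n)) (hC (k n))
  have hc := tendsto_eLpNorm_two (fun p : ℕ × ℕ => (hmem p.1).sub (hmem p.2))
    (tendsto_integral_sub_sq hR hT (fun n => M (k n)) (fun n => hh (mem_range_self (k n)))
      (fun n => z (k n)) (fun n => hz (k n)) (fun n => hC (k n)) (fun n => hform (k n))
      (fun n => hformC (k n)) hweak)
  have hcau : CauchySeq fun n => (hmem n).toLp := by
    rw [Lp.cauchySeq_Lp_iff_cauchySeq_eLpNorm]
    refine hc.congr fun p => eLpNorm_congr_ae ?_
    exact ((hmem p.1).coeFn_toLp.sub (hmem p.2).coeFn_toLp).symm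
  obtain ⟨P, hP⟩ := cauchySeq_tendsto_of_complete hcau
  refine ⟨k, hk, P, hmem, Lp.memLp P, ?_⟩
  rw [Lp.tendsto_Lp_iff_tendsto_eLpNorm'] at hP
  refine hP.congr fun n => eLpNorm_congr_ae ?_
  exact (hmem n).coeFn_toLp.sub (EventuallyEq.refl _ _)

theorem memLp_two_of_norm_sq_le {X E F : Type*} [MeasurableSpace X] {μ : Measure X}
    [IsFiniteMeasure μ] [NormedAddCommGroup E] [NormedAddCommGroup F] {u : X → E} {P : X → F}
    (hu : AEStronglyMeasurable u μ) (hP : MemLp P 2 μ) {A : X → ENNReal} (hA : ∫⁻ x, A x ∂μ < ⊤)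
    (hAfin : ∀ᵐ x ∂μ, A x < ⊤) {C : ℝ} (hC : 0 ≤ C)
    (h : ∀ᵐ x ∂μ, ‖u x‖ ^ 2 ≤ ‖P x‖ ^ 2 + C * ((A x).toReal + 1)) : MemLp u 2 μ := by
  have e : ∀ {E : Type _} [NormedAddCommGroup E] (x : E),
      ‖x‖ₑ ^ (2 : ENNReal).toReal = ENNReal.ofReal (‖x‖ ^ 2) := fun x => by
    rw [ENNReal.toReal_ofNat, ENNReal.rpow_ofNat, ENNReal.ofReal_pow (norm_nonneg _),
      ofReal_norm]
  have e' : ∀ x : F, ‖x‖ₑ ^ (2 : ENNReal).toReal = ENNReal.ofReal (‖x‖ ^ 2) := fun x => by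
    rw [ENNReal.toReal_ofNat, ENNReal.rpow_ofNat, ENNReal.ofReal_pow (norm_nonneg _),
      ofReal_norm]
  refine ⟨hu, ?_⟩
  rw [eLpNorm_lt_top_iff_lintegral_rpow_enorm_lt_top two_ne_zero ENNReal.ofNat_ne_top]
  have hPfin := (eLpNorm_lt_top_iff_lintegral_rpow_enorm_lt_top (μ := μ)
    two_ne_zero ENNReal.ofNat_ne_top).1 hP.eLpNorm_lt_top
  have hle : ∫⁻ x, ‖u x‖ₑ ^ (2 : ENNReal).toReal ∂μ
      ≤ ∫⁻ x, (‖P x‖ₑ ^ (2 : ENNReal).toReal + ENNReal.ofReal C * (A x + 1)) ∂μ := by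
    refine lintegral_mono_ae ?_
    filter_upwards [h, hAfin] with t ht hLt
    rw [e, e']
    refine (ENNReal.ofReal_le_ofReal ht).trans_eq ?_
    rw [ENNReal.ofReal_add (by positivity) (by positivity), ENNReal.ofReal_mul hC,
      ENNReal.ofReal_add ENNReal.toReal_nonneg zero_le_one, ENNReal.ofReal_toReal hLt.ne,
      ENNReal.ofReal_one]
  refine hle.trans_lt ?_
  -- No measurability of `A` is assumed, so each sum is split along its other, measurable summand.
  rw [lintegral_add_left' ((hP.aestronglyMeasurable.enorm).pow_const _),
    lintegral_const_mul' _ _ ENNReal.ofReal_ne_top, lintegral_add_right _ measurable_const]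
  refine ENNReal.add_lt_top.2 ⟨hPfin, ENNReal.mul_lt_top ENNReal.ofReal_lt_top
    (ENNReal.add_lt_top.2 ⟨hA, ?_⟩)⟩
  rw [lintegral_const, one_mul]
  exact measure_lt_top _ _

theorem lintegral_liminf_ofReal_le {X : Type*} [MeasurableSpace X] {μ : Measure X}
    {f : ℕ → X → ℝ} (hf : ∀ n, Integrable (f n) μ) (hf0 : ∀ n x, 0 ≤ f n x) {C : ℝ}
    (hC : ∀ n, ∫ x, f n x ∂μ ≤ C) :
    ∫⁻ x, liminf (fun n => ENNReal.ofReal (f n x)) atTop ∂μ ≤ ENNReal.ofReal C := by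
  refine (lintegral_liminf_le' fun n =>
    (hf n).aestronglyMeasurable.aemeasurable.ennreal_ofReal).trans ?_
  refine liminf_le_of_frequently_le' (Eventually.of_forall fun n => ?_).frequently
  rw [← ofReal_integral_eq_lintegral_ofReal (hf n) (Eventually.of_forall (hf0 n))]
  exact ENNReal.ofReal_le_ofReal (hC n)

theorem ae_liminf_ofReal_lt_top {X : Type*} [MeasurableSpace X] {μ : Measure X}
    {f : ℕ → X → ℝ} (hf : ∀ n, Integrable (f n) μ) (hf0 : ∀ n x, 0 ≤ f n x) {C : ℝ}
    (hC : ∀ n, ∫ x, f n x ∂μ ≤ C) :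
    ∀ᵐ x ∂μ, liminf (fun n => ENNReal.ofReal (f n x)) atTop < ⊤ := by
  have hm : ∀ n, AEMeasurable (fun x => ENNReal.ofReal (f n x)) μ := fun n =>
    (hf n).aestronglyMeasurable.aemeasurable.ennreal_ofReal
  have hm2 : AEMeasurable (fun x => liminf (fun n => ENNReal.ofReal (f n x)) atTop) μ := by
    refine ⟨_, Measurable.liminf fun n => (hm n).measurable_mk, ?_⟩
    filter_upwards [ae_all_iff.2 fun n => (hm n).ae_eq_mk] with t ht
    simp only [ht]
  exact ae_lt_top' hm2 ((lintegral_liminf_ofReal_le hf hf0 hC).trans_lt ENNReal.ofReal_lt_top).ne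

/-- The added `1` makes the comparison with the lower limit strict, and a strict inequality gives
infinitely many indices. -/
theorem frequently_le_of_liminf_lt_top {f : ℕ → ℝ}
    (h : liminf (fun n => ENNReal.ofReal (f n)) atTop < ⊤) :
    ∃ᶠ n in atTop, f n ≤ (liminf (fun n => ENNReal.ofReal (f n)) atTop).toReal + 1 := by
  have h1 : liminf (fun n => ENNReal.ofReal (f n)) atTop
      < ENNReal.ofReal ((liminf (fun n => ENNReal.ofReal (f n)) atTop).toReal + 1) := by
    rw [ENNReal.ofReal_add ENNReal.toReal_nonneg zero_le_one, ENNReal.ofReal_toReal h.ne]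
    exact ENNReal.lt_add_right h.ne (by simp)
  refine (frequently_lt_of_liminf_lt (by isBoundedDefault) h1).mono fun n hn => ?_
  exact (ENNReal.ofReal_le_ofReal_iff (by positivity)).1 hn.le

theorem TendstoL2.exists_seq_tendsto_ae {F : Type*} [NormedAddCommGroup F] {T : ℝ}
    {f : ℕ → ℝ → F} {P : ℝ → F} (hP : TendstoL2 T f P) :
    ∃ ns : ℕ → ℕ, StrictMono ns ∧
      ∀ᵐ t ∂timeMeasure T, Tendsto (fun n => f (ns n) t) atTop (𝓝 (P t)) :=
  (tendstoInMeasure_of_tendsto_eLpNorm two_ne_zero (fun n => (hP.1 n).aestronglyMeasurable)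
    hP.2.1.aestronglyMeasurable hP.2.2).exists_seq_tendsto_ae

-- After a subsequence converging at almost every time, Fatou's lemma makes the lower limit of the
-- energies integrable in time. Where it is finite, `P t` lies in `H_0^1(Ω)` with a corresponding
-- bound. The further subsequence depends on `t`, which is harmless because only a property of `P t`
-- is concluded; the Borel left inverse provides measurability.
set_option maxHeartbeats 3000000 in
theorem exists_lift_H10 {Ω : Set E3} (hΩ : IsPolyhedralDomain Ω) {T : ℝ}
    (M : ℕ → AdmissibleMesh Ω) (hM : IsNormalSeq M) (z : ∀ n, ℝ → (M n).MeshFun) {C : ℝ}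
    (hform : ∀ n, Integrable (fun t => (M n).form (z n t) (z n t)) (timeMeasure T))
    (hformC : ∀ n, ∫ t, (M n).form (z n t) (z n t) ∂timeMeasure T ≤ C)
    {P : ℝ → Lp ℝ 2 (volume.restrict Ω : Measure E3)}
    (hP : TendstoL2 T (fun n t => (M n).interp (z n t)) P) :
    ∃ v : Lp (H10 Ω) 2 (timeMeasure T), ∀ᵐ t ∂timeMeasure T, H10.val (v t) = P t := by
  have : IsFiniteMeasure (timeMeasure T) := ⟨by simp⟩
  have hPm := hP.2.1
  obtain ⟨ns, hns, hae⟩ := hP.exists_seq_tendsto_ae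
  obtain ⟨C', hC'0, hC'⟩ := exists_mem_H10_of_tendsto hΩ M hM
  have hf0 : ∀ n t, 0 ≤ (M (ns n)).form (z (ns n) t) (z (ns n) t) := fun n t =>
    (M _).form_self_nonneg _
  have hLf := lintegral_liminf_ofReal_le (fun n => hform (ns n)) hf0 (fun n => hformC (ns n))
  have hLfin := ae_liminf_ofReal_lt_top (fun n => hform (ns n)) hf0 (fun n => hformC (ns n))
  obtain ⟨g, hgm, hgv⟩ := exists_measurable_inverse_val hΩ.isOpen
  have hpt : ∀ᵐ t ∂timeMeasure T, ∃ v : H10 Ω, H10.val v = P t ∧ ‖v‖ ^ 2 ≤ ‖P t‖ ^ 2 + C' *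
      ((liminf (fun n => ENNReal.ofReal ((M (ns n)).form (z (ns n) t) (z (ns n) t)))
        atTop).toReal + 1) :=
    (hae.and hLfin).mono fun t ht => hC' ns hns.tendsto_atTop (fun n => z (ns n) t) (P t) ht.1
      _ (add_nonneg ENNReal.toReal_nonneg zero_le_one) (frequently_le_of_liminf_lt_top ht.2)
  have hu : ∀ᵐ t ∂timeMeasure T, H10.val (g (P t)) = P t ∧ ‖g (P t)‖ ^ 2 ≤ ‖P t‖ ^ 2 + C' *
      ((liminf (fun n => ENNReal.ofReal ((M (ns n)).form (z (ns n) t) (z (ns n) t)))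
        atTop).toReal + 1) := by
    refine hpt.mono fun t ht => ?_
    obtain ⟨v, hv, hvn⟩ := ht
    have e : g (P t) = v := by rw [← hv, hgv]
    rw [e]
    exact ⟨hv, hvn⟩
  have humem : MemLp (fun t => g (P t)) 2 (timeMeasure T) :=
    memLp_two_of_norm_sq_le (hgm hPm.aestronglyMeasurable) hPm
      (hLf.trans_lt ENNReal.ofReal_lt_top) hLfin hC'0 (hu.mono fun t ht => ht.2)
  refine ⟨humem.toLp, ?_⟩
  filter_upwards [humem.coeFn_toLp, hu] with t h1 h2
  rw [h1, h2.1]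

end

section

open scoped ContDiff

/-! ### Convergence of the flux terms -/

theorem contDiff_lap {q : E3 → ℝ} (hq : ContDiff ℝ ∞ q) : ContDiff ℝ ∞ (lap q) :=
  ContDiff.sum fun _ _ => contDiff_fderiv_apply (contDiff_fderiv_apply hq _) _

theorem lap_eq_zero_of_notMem_tsupport {q : E3 → ℝ} {x : E3} (hx : x ∉ tsupport q) :
    lap q x = 0 := by
  refine Finset.sum_eq_zero fun i _ => ?_
  have h : fderiv ℝ (fun y => fderiv ℝ q y (EuclideanSpace.single i 1)) x = 0 :=
    image_eq_zero_of_notMem_tsupport fun h =>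
      hx (tsupport_fderiv_apply_subset ℝ _ (tsupport_fderiv_subset ℝ h))
  rw [h, zero_apply]

theorem IsTestFunction.memLp_lap {Ω : Set E3} {q : E3 → ℝ} (hq : IsTestFunction Ω q) :
    MemLp (lap q) 2 (volume.restrict Ω) :=
  ((contDiff_lap hq.1).continuous.memLp_of_hasCompactSupport
    (HasCompactSupport.intro hq.2.1 fun _ hx => lap_eq_zero_of_notMem_tsupport hx)).restrict Ω

theorem exists_lipschitz_of_hasCompactSupport {E F : Type*} [NormedAddCommGroup E]
    [NormedSpace ℝ E] [NormedAddCommGroup F] [NormedSpace ℝ F] {f : E → F} (hf : ContDiff ℝ 1 f)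
    (hfc : HasCompactSupport f) : ∃ B : ℝ, 0 ≤ B ∧ ∀ x y, ‖f x - f y‖ ≤ B * dist x y := by
  obtain ⟨B, hB⟩ := hf.lipschitzWith_of_hasCompactSupport hfc one_ne_zero
  exact ⟨B, B.2, fun x y => by rw [← dist_eq_norm]; exact hB.dist_le_mul x y⟩

theorem IsTestFunction.exists_lipschitz_fderiv {Ω : Set E3} {q : E3 → ℝ} (hq : IsTestFunction Ω q) :
    ∃ B : ℝ, 0 ≤ B ∧ ∀ x y, ‖fderiv ℝ q x - fderiv ℝ q y‖ ≤ B * dist x y :=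
  exists_lipschitz_of_hasCompactSupport ((contDiff_infty.1 hq.1 2).fderiv_right (by norm_num)) (hq.2.1.fderiv ℝ)

namespace AdmissibleMesh

variable {Ω : Set E3} (M : AdmissibleMesh Ω)

theorem continuousOn_flux {z : ℝ → M.MeshFun} {s : Set ℝ}
    (hz : ∀ K, ContinuousOn (fun t => z t K) s) (K : Fin M.numCells) :
    ContinuousOn (fun t => M.flux (z t) K) s := by
  simp_rw [flux_eq]
  refine continuousOn_finsetSum _ fun σ _ => continuousOn_const.mul ?_
  simp only [jump]
  split_ifs
  · exact hz K
  · exact (hz K).sub (hz _)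

/-- The Cauchy–Schwarz inequality for the form bounds the square of the flux sum by a constant times
the energy, which is integrable in time. -/
theorem memLp_sum_mul_flux {T : ℝ} {z : ℝ → M.MeshFun}
    (hz : ∀ K, ContinuousOn (fun t => z t K) (Ioo 0 T))
    (hform : Integrable (fun t => M.form (z t) (z t)) (timeMeasure T)) (w : M.MeshFun) :
    MemLp (fun t => ∑ K, w K * M.flux (z t) K) 2 (timeMeasure T) := by
  have hm : AEStronglyMeasurable (fun t => ∑ K, w K * M.flux (z t) K) (timeMeasure T) :=
    (continuousOn_finsetSum _ fun K _ => continuousOn_const.mul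
      (M.continuousOn_flux hz K)).aestronglyMeasurable measurableSet_Ioo
  rw [memLp_two_iff_integrable_sq hm]
  refine (hform.const_mul (M.form w w)).mono' (hm.pow 2) (Eventually.of_forall fun t => ?_)
  rw [Real.norm_eq_abs, abs_of_nonneg (sq_nonneg _), M.sum_mul_flux]
  exact M.form_sq_le _ _

/-- Two errors are added: consistency replaces the flux sum by the pairing of the interpolation with
the Laplacian, and Cauchy–Schwarz replaces the interpolation by `f`. -/
theorem sum_mul_flux_add_inner_sq_le (hΩ : volume Ω ≠ ⊤) {q : E3 → ℝ} (hq : IsTestFunction Ω q)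
    (hqb : ∀ x ∈ frontier Ω, q x = 0) {B : ℝ} (hB0 : 0 ≤ B)
    (hB : ∀ x y, ‖fderiv ℝ q x - fderiv ℝ q y‖ ≤ B * dist x y) (z : M.MeshFun)
    (f : Lp ℝ 2 (volume.restrict Ω : Measure E3)) :
    (∑ K, q (M.center K) * M.flux z K + inner ℝ f (hq.memLp_lap.toLp (lap q))) ^ 2
      ≤ 2 * ((2 * B * M.meshNorm) ^ 2 * (3 * volume.real Ω)) * M.form z z
        + 2 * ‖hq.memLp_lap.toLp (lap q)‖ ^ 2 * ‖M.interp z - f‖ ^ 2 := by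
  have h1 := M.flux_consistency hΩ (contDiff_infty.1 hq.1 2) hqb hB0 hB z
  have h2 : inner ℝ (M.interp z) (hq.memLp_lap.toLp (lap q)) = ∑ K, z K * ∫ x in M.cell K, lap q x := by
    rw [inner_interp, M.integral_interpFun_mul z fun K =>
      M.integrableOn_cell K (contDiff_lap hq.1).continuous]
  rw [← h2] at h1
  have h3 := abs_real_inner_le_norm (M.interp z - f) (hq.memLp_lap.toLp (lap q))
  have h4 := pow_le_pow_left₀ (abs_nonneg _) h3 2
  rw [sq_abs, mul_pow, inner_sub_left] at h4
  have h5 : ∀ a b c : ℝ, (a + b) ^ 2 ≤ 2 * (a + c) ^ 2 + 2 * (c - b) ^ 2 := fun a b c => by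
    nlinarith [sq_nonneg ((a + c) + (c - b))]
  refine (h5 _ _ (inner ℝ (M.interp z) (hq.memLp_lap.toLp (lap q)))).trans ?_
  linarith

end AdmissibleMesh

/-- Integrated in time, the first error is the squared mesh norm times the bounded energy, and the
second is controlled by the strong convergence in `L²(J; L²(Ω))`. -/
theorem tendstoL2_sum_mul_flux {Ω : Set E3} (hΩ : IsPolyhedralDomain Ω) {T : ℝ}
    (M : ℕ → AdmissibleMesh Ω) (hM : IsNormalSeq M) (z : ∀ n, ℝ → (M n).MeshFun) {C : ℝ}
    (hz : ∀ n K, ContinuousOn (fun t => z n t K) (Ioo 0 T))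
    (hform : ∀ n, Integrable (fun t => (M n).form (z n t) (z n t)) (timeMeasure T))
    (hformC : ∀ n, ∫ t, (M n).form (z n t) (z n t) ∂timeMeasure T ≤ C)
    {P : ℝ → Lp ℝ 2 (volume.restrict Ω : Measure E3)}
    (hP : TendstoL2 T (fun n t => (M n).interp (z n t)) P) {q : E3 → ℝ}
    (hq : IsTestFunction Ω q) :
    TendstoL2 T (fun n t => ∑ K, q ((M n).center K) * (M n).flux (z n t) K)
      (fun t => -inner ℝ (P t) (hq.memLp_lap.toLp (lap q))) := by
  have hvol : volume Ω ≠ ⊤ := hΩ.isBounded.measure_lt_top.ne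
  have hqb : ∀ x ∈ frontier Ω, q x = 0 := fun x hx =>
    hq.eq_zero (by rw [hΩ.isOpen.frontier_eq] at hx; exact hx.2)
  obtain ⟨B, hB0, hB⟩ := hq.exists_lipschitz_fderiv
  have h1 : ∀ n, MemLp (fun t => ∑ K, q ((M n).center K) * (M n).flux (z n t) K) 2
      (timeMeasure T) := fun n => (M n).memLp_sum_mul_flux (hz n) (hform n) _
  have h2 : MemLp (fun t => -inner ℝ (P t) (hq.memLp_lap.toLp (lap q))) 2 (timeMeasure T) :=
    (hP.2.1.inner_const _).neg
  have h3 := fun n => (h1 n).sub h2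
  refine ⟨h1, h2, tendsto_eLpNorm_two h3 ?_⟩
  have h4 := fun n => (hP.1 n).sub hP.2.1
  have hlim : Tendsto (fun n => 2 * ((2 * B * (M n).meshNorm) ^ 2 * (3 * volume.real Ω)) * C
      + 2 * ‖hq.memLp_lap.toLp (lap q)‖ ^ 2
        * (eLpNorm (fun t => (M n).interp (z n t) - P t) 2 (timeMeasure T)).toReal ^ 2)
      atTop (𝓝 0) := by
    have e1 := ((((hM.const_mul (2 * B)).pow 2).mul_const (3 * volume.real Ω)).const_mul
      2).mul_const C
    have e2 := (((ENNReal.tendsto_toReal ENNReal.zero_ne_top).comp hP.2.2).pow 2).const_mul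
      (2 * ‖hq.memLp_lap.toLp (lap q)‖ ^ 2)
    simpa using e1.add e2
  refine squeeze_zero (fun n => integral_nonneg fun t => sq_nonneg _) (fun n => ?_) hlim
  have i1 := (hform n).const_mul (2 * ((2 * B * (M n).meshNorm) ^ 2 * (3 * volume.real Ω)))
  have i2 := (h4 n).norm.integrable_sq.const_mul (2 * ‖hq.memLp_lap.toLp (lap q)‖ ^ 2)
  have h5 := integral_mono_of_nonneg (μ := timeMeasure T)
    (Eventually.of_forall fun t => sq_nonneg
      (‖(∑ K, q ((M n).center K) * (M n).flux (z n t) K)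
        - -inner ℝ (P t) (hq.memLp_lap.toLp (lap q))‖)) (i1.add i2)
    (Eventually.of_forall fun t => by
      change ‖(∑ K, q ((M n).center K) * (M n).flux (z n t) K)
        - -inner ℝ (P t) (hq.memLp_lap.toLp (lap q))‖ ^ 2 ≤ _
      rw [Real.norm_eq_abs, sq_abs, sub_neg_eq_add]
      exact (M n).sum_mul_flux_add_inner_sq_le hvol hq hqb hB0 hB (z n t) (P t))
  refine h5.trans ((integral_add i1 i2).trans_le ?_)
  rw [integral_const_mul, integral_const_mul]
  refine add_le_add (mul_le_mul_of_nonneg_left (hformC n) (by positivity)) (le_of_eq ?_)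
  congr 1
  exact eLpNorm_two_sub_sq (h4 n)

theorem TendstoL2.comp_strictMono {F : Type*} [NormedAddCommGroup F] {T : ℝ} {f : ℕ → ℝ → F}
    {P : ℝ → F} (h : TendstoL2 T f P) {k : ℕ → ℕ} (hk : StrictMono k) :
    TendstoL2 T (fun n => f (k n)) P :=
  ⟨fun n => h.1 (k n), h.2.1, h.2.2.comp hk.tendsto_atTop⟩

theorem TendstoL2.congr_right {F : Type*} [NormedAddCommGroup F] {T : ℝ} {f : ℕ → ℝ → F}
    {P Q : ℝ → F} (h : TendstoL2 T f P) (hPQ : P =ᵐ[timeMeasure T] Q) : TendstoL2 T f Q := by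
  refine ⟨h.1, h.2.1.ae_eq hPQ, h.2.2.congr fun n => eLpNorm_congr_ae ?_⟩
  exact (EventuallyEq.refl _ _).sub hPQ

theorem IsNormalSeq.comp_strictMono {Ω : Set E3} {M : ℕ → AdmissibleMesh Ω} (hM : IsNormalSeq M)
    {k : ℕ → ℕ} (hk : StrictMono k) : IsNormalSeq fun n => M (k n) :=
  Tendsto.comp (g := fun n => (M n).meshNorm) hM hk.tendsto_atTop

set_option maxHeartbeats 3000000 in
/-- Compactness of a family of mesh functions that is bounded in the discrete energy norms and
weakly equicontinuous in time. -/
theorem exists_subseq_tendstoL2 {Ω : Set E3} (hΩ : IsPolyhedralDomain Ω) {T : ℝ} (hT : 0 < T)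
    (M : ℕ → AdmissibleMesh Ω) (hM : IsNormalSeq M) (z : ∀ n, ℝ → (M n).MeshFun)
    (hz : ∀ n K, ContinuousOn (fun t => z n t K) (Ioo 0 T)) {C : ℝ}
    (hC : ∀ n, ∀ t ∈ Ioo 0 T, (M n).normSq (z n t) ≤ C)
    (hform : ∀ n, Integrable (fun t => (M n).form (z n t) (z n t)) (timeMeasure T))
    (hformC : ∀ n, ∫ t, (M n).form (z n t) (z n t) ∂timeMeasure T ≤ C)
    (hequi : ∀ q, IsTestFunction Ω q → ∀ ε > 0, ∃ δ > 0, ∀ n, ∀ s ∈ Ioo 0 T, ∀ t ∈ Ioo 0 T,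
      |t - s| < δ → |(∑ K, (M n).mass K * z n t K * q ((M n).center K))
        - ∑ K, (M n).mass K * z n s K * q ((M n).center K)| ≤ ε) :
    ∃ k : ℕ → ℕ, StrictMono k ∧ ∃ v : Lp (H10 Ω) 2 (timeMeasure T),
      TendstoL2 T (fun n t => (M (k n)).interp (z (k n) t)) (fun t => H10.val (v t)) ∧
      ∀ q : E3 → ℝ, IsTestFunction Ω q →
        TendstoL2 T (fun n t => ∑ K, q ((M (k n)).center K) * (M (k n)).flux (z (k n) t) K)
          (fun t => ∫ x in Ω, inner ℝ (H10.grad (v t) x) (gradient q x)) := by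
  obtain ⟨k, hk, P, hP⟩ := exists_strong_limit hΩ hT M hM z hz hC hform hformC hequi
  obtain ⟨v, hv⟩ := exists_lift_H10 hΩ (fun n => M (k n)) (hM.comp_strictMono hk)
    (fun n => z (k n)) (fun n => hform (k n)) (fun n => hformC (k n)) hP
  refine ⟨k, hk, v, hP.congr_right (hv.mono fun t ht => ht.symm), fun q hq => ?_⟩
  refine (tendstoL2_sum_mul_flux hΩ (fun n => M (k n)) (hM.comp_strictMono hk)
    (fun n => z (k n)) (fun n => hz (k n)) (fun n => hform (k n)) (fun n => hformC (k n)) hP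
    hq).congr_right (hv.mono fun t ht => ?_)
  change -inner ℝ (P t) (hq.memLp_lap.toLp (lap q)) = _
  rw [inner_toLp, ← ht]
  exact (integral_inner_grad (v t) hq.1 hq.2.1).symm

end

section

/-! ### Differential inequalities -/

theorem antitoneOn_of_hasDerivAt_nonpos {D : Set ℝ} (hD : Convex ℝ D) {f f' : ℝ → ℝ}
    (hf : ContinuousOn f D) (hf' : ∀ x ∈ interior D, HasDerivAt f (f' x) x)
    (h : ∀ x ∈ interior D, f' x ≤ 0) : AntitoneOn f D :=
  antitoneOn_of_deriv_nonpos hD hf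
    (fun x hx => (hf' x hx).differentiableAt.differentiableWithinAt)
    fun x hx => (hf' x hx).deriv.trans_le (h x hx)

theorem intervalIntegrable_of_continuousOn_Ico {T : ℝ} {a : ℝ → ℝ} (ha : ContinuousOn a (Ico 0 T))
    {t : ℝ} (ht : t ∈ Ico 0 T) : IntervalIntegrable a volume 0 t := by
  refine (ha.mono ?_).intervalIntegrable
  rw [uIcc_of_le ht.1]
  exact Icc_subset_Ico_right ht.2

theorem hasDerivAt_primitive {T : ℝ} {a : ℝ → ℝ} (ha : ContinuousOn a (Ico 0 T)) {t : ℝ}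
    (ht : t ∈ Ioo 0 T) : HasDerivAt (fun t => ∫ s in (0 : ℝ)..t, a s) (a t) t :=
  intervalIntegral.integral_hasDerivAt_right
    (intervalIntegrable_of_continuousOn_Ico ha ⟨ht.1.le, ht.2⟩)
    ((ha.mono Ioo_subset_Ico_self).stronglyMeasurableAtFilter isOpen_Ioo t ht)
    ((ha.mono Ioo_subset_Ico_self).continuousAt (isOpen_Ioo.mem_nhds ht))

theorem continuousOn_primitive_Icc {T : ℝ} {a : ℝ → ℝ} (ha : ContinuousOn a (Ico 0 T)) {t : ℝ}
    (ht : t ∈ Ico 0 T) : ContinuousOn (fun t => ∫ s in (0 : ℝ)..t, a s) (Icc 0 t) := by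
  have h := intervalIntegral.continuousOn_primitive_interval (μ := volume) (f := a) (a := 0) (b := t)
    ((ha.mono (by rw [uIcc_of_le ht.1]; exact Icc_subset_Ico_right ht.2)).integrableOn_compact
      isCompact_uIcc)
  rwa [uIcc_of_le ht.1] at h

/-- `Z + ∫ a - c t` is nonincreasing. Staying on `[0, t]` with `t < T` makes the behaviour at `T`
irrelevant. -/
theorem add_integral_le_of_deriv_le {T c : ℝ} (hc : 0 ≤ c) {a Z Z' : ℝ → ℝ}
    (ha : ContinuousOn a (Ico 0 T)) (hZ : ContinuousOn Z (Ico 0 T))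
    (hd : ∀ t ∈ Ioo 0 T, HasDerivAt Z (Z' t) t) (hle : ∀ t ∈ Ioo 0 T, Z' t ≤ c - a t)
    {t : ℝ} (ht : t ∈ Ico 0 T) : Z t + ∫ s in (0 : ℝ)..t, a s ≤ Z 0 + c * T := by
  have hsub : Icc 0 t ⊆ Ico 0 T := Icc_subset_Ico_right ht.2
  have hsub' : interior (Icc 0 t) ⊆ Ioo 0 T := by
    rw [interior_Icc]
    exact Ioo_subset_Ioo_right ht.2.le
  have h := antitoneOn_of_hasDerivAt_nonpos (convex_Icc 0 t)
    (f := fun s => Z s + (∫ r in (0 : ℝ)..s, a r) - c * s) (f' := fun s => Z' s + a s - c * 1)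
    (((hZ.mono hsub).add (continuousOn_primitive_Icc ha ht)).sub (by fun_prop))
    (fun s hs => ((hd s (hsub' hs)).add (hasDerivAt_primitive ha (hsub' hs))).sub
      ((hasDerivAt_id s).const_mul c))
    (fun s hs => by linarith [hle s (hsub' hs)])
  have h1 := h (left_mem_Icc.2 ht.1) (right_mem_Icc.2 ht.1) ht.1
  simp only [intervalIntegral.integral_same] at h1
  have := mul_le_mul_of_nonneg_left ht.2.le hc
  linarith

/-- The function is continuous on `[0, T)` only and may be unbounded near `T`; exhaustion by
intervals `(0, b n]` with `b n → T` carries the uniform bound over to integrability. -/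
theorem integrable_of_integral_le {T B : ℝ} (hT : 0 < T) {a : ℝ → ℝ}
    (ha : ContinuousOn a (Ico 0 T)) (ha0 : ∀ t, 0 ≤ a t)
    (hB : ∀ t ∈ Ico 0 T, ∫ s in (0 : ℝ)..t, a s ≤ B) :
    Integrable a (timeMeasure T) ∧ ∫ t, a t ∂timeMeasure T ≤ B := by
  let b : ℕ → ℝ := fun n => T - T / ((n : ℝ) + 1)
  have hb : ∀ n, b n ∈ Ico 0 T := fun n => by
    have h1 : 0 < T / ((n : ℝ) + 1) := by positivity
    have h2 : T / ((n : ℝ) + 1) ≤ T := div_le_self hT.le (by linarith [n.cast_nonneg (α := ℝ)])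
    exact ⟨by simp only [b]; linarith, by simp only [b]; linarith⟩
  have hlim : Tendsto b atTop (𝓝 T) := by
    have h := (tendsto_one_div_add_atTop_nhds_zero_nat (𝕜 := ℝ)).const_mul T
    have h' := h.const_sub T
    rw [mul_zero, sub_zero] at h'
    refine h'.congr fun n => ?_
    simp only [b]
    rw [mul_one_div]
  have hcov : AECover (timeMeasure T) atTop fun n => Ioc 0 (b n) :=
    aecover_Ioo_of_Ioc tendsto_const_nhds hlim
  have hle : ∀ n, ∫ x in Ioc 0 (b n), a x ∂timeMeasure T ≤ B := fun n => by
    rw [timeMeasure, Measure.restrict_restrict measurableSet_Ioc, inter_eq_left.2,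
      ← intervalIntegral.integral_of_le (hb n).1]
    · exact hB _ (hb n)
    · exact fun x hx => ⟨hx.1, hx.2.trans_lt (hb n).2⟩
  have hint : ∀ n, IntegrableOn a (Ioc 0 (b n)) (timeMeasure T) := fun n => by
    have h := (intervalIntegrable_of_continuousOn_Ico ha (hb n)).1
    rw [IntegrableOn, timeMeasure, Measure.restrict_restrict measurableSet_Ioc]
    exact IntegrableOn.mono_set h inter_subset_left
  have hi := hcov.integrable_of_integral_bounded_of_nonneg_ae B hint
    (Eventually.of_forall ha0) (Eventually.of_forall hle)
  exact ⟨hi, le_of_tendsto (hcov.integral_tendsto_of_countably_generated hi)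
    (Eventually.of_forall hle)⟩

/-- `A - κ ∫ a - e t` is nonincreasing. The part `κ * B` does not become small with `t - s`, so
smallness has to come from `κ`. -/
theorem sub_le_of_deriv_le_primitive {T κ e B : ℝ} (hκ : 0 ≤ κ) {a A A' : ℝ → ℝ}
    (ha : ContinuousOn a (Ico 0 T)) (ha0 : ∀ t, 0 ≤ a t)
    (hB : ∀ t ∈ Ico 0 T, ∫ s in (0 : ℝ)..t, a s ≤ B)
    (hd : ∀ t ∈ Ioo 0 T, HasDerivAt A (A' t) t) (hle : ∀ t ∈ Ioo 0 T, A' t ≤ κ * a t + e)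
    {s t : ℝ} (hs : s ∈ Ioo 0 T) (ht : t ∈ Ioo 0 T) (hst : s ≤ t) :
    A t - A s ≤ κ * B + e * (t - s) := by
  have h := antitoneOn_of_hasDerivAt_nonpos (convex_Ioo 0 T)
    (f := fun s => A s - κ * (∫ r in (0 : ℝ)..s, a r) - e * s)
    (f' := fun s => A' s - κ * a s - e * 1)
    (fun r hr => (((hd r hr).continuousAt.sub
      (continuousAt_const.mul (hasDerivAt_primitive ha hr).continuousAt)).sub
        (by fun_prop)).continuousWithinAt)
    (fun r hr => by
      rw [isOpen_Ioo.interior_eq] at hr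
      exact ((hd r hr).sub ((hasDerivAt_primitive ha hr).const_mul κ)).sub
        ((hasDerivAt_id r).const_mul e))
    (fun r hr => by
      rw [isOpen_Ioo.interior_eq] at hr
      linarith [hle r hr])
  have h1 := h hs ht hst
  have h2 := hB t ⟨ht.1.le, ht.2⟩
  have h3 : 0 ≤ ∫ r in (0 : ℝ)..s, a r := intervalIntegral.integral_nonneg hs.1.le fun r _ => ha0 r
  simp only at h1
  have h4 := mul_le_mul_of_nonneg_left h2 hκ
  have h5 := mul_nonneg hκ h3
  linarith

theorem abs_sub_le_of_abs_deriv_le_primitive {T κ e B : ℝ} (hκ : 0 ≤ κ)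
    {a A A' : ℝ → ℝ} (ha : ContinuousOn a (Ico 0 T)) (ha0 : ∀ t, 0 ≤ a t)
    (hB : ∀ t ∈ Ico 0 T, ∫ s in (0 : ℝ)..t, a s ≤ B)
    (hd : ∀ t ∈ Ioo 0 T, HasDerivAt A (A' t) t) (hle : ∀ t ∈ Ioo 0 T, |A' t| ≤ κ * a t + e)
    {s t : ℝ} (hs : s ∈ Ioo 0 T) (ht : t ∈ Ioo 0 T) : |A t - A s| ≤ κ * B + e * |t - s| := by
  have key : ∀ {s t : ℝ}, s ∈ Ioo 0 T → t ∈ Ioo 0 T → s ≤ t →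
      |A t - A s| ≤ κ * B + e * (t - s) := fun {s t} hs ht hst => by
    have h1 := sub_le_of_deriv_le_primitive hκ ha ha0 hB hd
      (fun r hr => (le_abs_self _).trans (hle r hr)) hs ht hst
    have h2 := sub_le_of_deriv_le_primitive (A := fun r => -A r) hκ ha ha0 hB
      (fun r hr => (hd r hr).neg) (fun r hr => (neg_le_abs _).trans (hle r hr)) hs ht hst
    exact abs_le.2 ⟨by linarith, h1⟩
  rcases le_total s t with h | h
  · rw [abs_of_nonneg (sub_nonneg.2 h)]
    exact key hs ht h
  · rw [abs_sub_comm, abs_sub_comm t, abs_of_nonneg (sub_nonneg.2 h)]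
    exact key ht hs h

/-! ### Truncation -/

/-- The signed excess of `x` over the interval `[-R, R]`. -/
def excess (R x : ℝ) : ℝ := max (x - R) 0 - max (-x - R) 0

theorem hasDerivAt_max_sq (x : ℝ) : HasDerivAt (fun y : ℝ => max y 0 ^ 2) (2 * max x 0) x := by
  rcases lt_trichotomy x 0 with h | rfl | h
  · rw [max_eq_right h.le, mul_zero]
    refine (hasDerivAt_const x (0 : ℝ)).congr_of_eventuallyEq ?_
    filter_upwards [gt_mem_nhds h] with y hy
    rw [max_eq_right hy.le]; norm_num
  · rw [max_self, mul_zero, hasDerivAt_iff_isLittleO]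
    simp only [max_self, sub_zero, smul_zero]
    have h1 : (fun y : ℝ => max y 0 ^ 2 - 0 ^ 2) =O[𝓝 0] fun y : ℝ => y ^ 2 := by
      refine Asymptotics.IsBigO.of_bound 1 (Eventually.of_forall fun y => ?_)
      rw [one_mul, Real.norm_eq_abs, Real.norm_eq_abs, zero_pow two_ne_zero, sub_zero,
        abs_of_nonneg (sq_nonneg _), abs_of_nonneg (sq_nonneg _)]
      rcases le_total y 0 with h | h
      · rw [max_eq_right h]; nlinarith
      · rw [max_eq_left h]
    exact h1.trans_isLittleO (Asymptotics.isLittleO_pow_id one_lt_two)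
  · rw [max_eq_left h.le]
    refine ((hasDerivAt_pow 2 x).congr_of_eventuallyEq ?_).congr_deriv (by simp)
    filter_upwards [lt_mem_nhds h] with y hy
    rw [max_eq_left hy.le]

/-- The two positive parts are never nonzero together, so the square of their difference is the sum
of their squares, and the square of a positive part is differentiable. -/
theorem hasDerivAt_excess_sq {R : ℝ} (hR : 0 ≤ R) (x : ℝ) :
    HasDerivAt (fun y => excess R y ^ 2) (2 * excess R x) x := by
  have e : (fun y => excess R y ^ 2) = fun y => max (y - R) 0 ^ 2 + max (-y - R) 0 ^ 2 := by
    funext y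
    have : max (y - R) 0 * max (-y - R) 0 = 0 := by
      rcases le_total y R with h | h
      · rw [max_eq_right (sub_nonpos.2 h), zero_mul]
      · rw [max_eq_right (by linarith : -y - R ≤ 0), mul_zero]
    rw [excess]
    linear_combination -2 * this
  rw [e]
  have h1 := (hasDerivAt_max_sq (x - R)).comp x ((hasDerivAt_id x).sub_const R)
  have h2 := (hasDerivAt_max_sq (-x - R)).comp x ((hasDerivAt_id x).neg.sub_const R)
  refine (h1.add h2).congr_deriv ?_
  rw [excess]; ring

theorem monotone_excess (R : ℝ) : Monotone (excess R) := fun x y h =>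
  sub_le_sub (max_le_max_right 0 (by linarith)) (max_le_max_right 0 (by linarith))

theorem excess_eq_zero {R x : ℝ} (h : |x| ≤ R) : excess R x = 0 := by
  have := abs_le.1 h
  rw [excess, max_eq_right (by linarith), max_eq_right (by linarith), sub_zero]

theorem abs_le_of_excess_eq_zero {R x : ℝ} (hR : 0 ≤ R) (h : excess R x = 0) : |x| ≤ R := by
  rw [excess] at h
  by_contra! hx
  rcases lt_abs.1 hx with hx | hx
  · rw [max_eq_left (by linarith), max_eq_right (by linarith)] at h; linarith
  · rw [max_eq_right (by linarith), max_eq_left (by linarith)] at h; linarith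

theorem excess_mul_nonpos {R x r : ℝ} (hR : 0 ≤ R) (h1 : R < x → r ≤ 0) (h2 : x < -R → 0 ≤ r) :
    excess R x * r ≤ 0 := by
  rcases le_or_gt (|x|) R with h | h
  · rw [excess_eq_zero h, zero_mul]
  rcases lt_abs.1 h with hx | hx
  · rw [excess, max_eq_left (by linarith), max_eq_right (by linarith)]
    nlinarith [h1 hx]
  · rw [excess, max_eq_right (by linarith), max_eq_left (by linarith)]
    nlinarith [h2 (by linarith)]

/-! ### Monotone truncation and `L²` norms of mesh functions. -/

namespace AdmissibleMesh

variable {Ω : Set E3} (M : AdmissibleMesh Ω)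

/-- Jumps of `h ∘ z` have the sign of the jumps of `z`; at boundary faces this uses `h 0 = 0`. -/
theorem form_comp_nonneg {h : ℝ → ℝ} (hm : Monotone h) (h0 : h 0 = 0) (z : M.MeshFun) :
    0 ≤ M.form (fun K => h (z K)) z := by
  have hmul : ∀ x y, 0 ≤ (h x - h y) * (x - y) := fun x y => by
    rcases le_total x y with hxy | hxy
    · exact mul_nonneg_of_nonpos_of_nonpos (sub_nonpos.2 (hm hxy)) (sub_nonpos.2 hxy)
    · exact mul_nonneg (sub_nonneg.2 (hm hxy)) (sub_nonneg.2 hxy)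
  refine Finset.sum_nonneg fun p hp => mul_nonneg (M.wt_nonneg _) ?_
  have hd := (M.dd_pos (M.mem_edges.1 hp)).le
  have ha := (M.face_pos p.2).le
  have hj : 0 ≤ M.jump (fun K => h (z K)) p.1 p.2 * M.jump z p.1 p.2 := by
    simp only [jump]
    split_ifs
    · simpa [h0] using hmul (z p.1) 0
    · exact hmul _ _
  have e : M.jump (fun K => h (z K)) p.1 p.2 * (area (M.face p.2) / M.dd p.1 p.2 * M.jump z p.1 p.2)
      = area (M.face p.2) / M.dd p.1 p.2 * (M.jump (fun K => h (z K)) p.1 p.2 * M.jump z p.1 p.2) := by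
    ring
  rw [e]
  exact mul_nonneg (div_nonneg ha hd) hj

theorem sum_mass_mul_le (hΩ : volume Ω ≠ ⊤) {f : M.MeshFun} {B : ℝ} (hB : 0 ≤ B)
    (hf : ∀ K, f K ≤ B) : ∑ K, M.mass K * f K ≤ B * volume.real Ω := by
  calc ∑ K, M.mass K * f K ≤ ∑ K, M.mass K * B :=
        Finset.sum_le_sum fun K _ => mul_le_mul_of_nonneg_left (hf K) (M.mass_pos K).le
    _ = B * ∑ K, M.mass K := by rw [← Finset.sum_mul, mul_comm]
    _ ≤ B * volume.real Ω := mul_le_mul_of_nonneg_left (M.sum_mass_le hΩ) hB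

theorem abs_sum_mass_mul_le (hΩ : volume Ω ≠ ⊤) {f : M.MeshFun} {B : ℝ} (hB : 0 ≤ B)
    (hf : ∀ K, |f K| ≤ B) : |∑ K, M.mass K * f K| ≤ B * volume.real Ω := by
  refine (Finset.abs_sum_le_sum_abs _ _).trans ?_
  simp_rw [abs_mul, abs_of_pos (M.mass_pos _)]
  exact M.sum_mass_mul_le hΩ hB hf

theorem normSq_le (hΩ : volume Ω ≠ ⊤) {z : M.MeshFun} {B : ℝ} (hz : ∀ K, |z K| ≤ B) :
    M.normSq z ≤ B ^ 2 * volume.real Ω :=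
  M.sum_mass_mul_le hΩ (sq_nonneg B) fun K => by
    rw [← sq_abs]
    exact pow_le_pow_left₀ (abs_nonneg _) (hz K) 2

theorem normSq_nonneg (z : M.MeshFun) : 0 ≤ M.normSq z :=
  Finset.sum_nonneg fun K _ => mul_nonneg (M.mass_pos K).le (sq_nonneg _)

theorem continuousOn_form {z w : ℝ → M.MeshFun} {s : Set ℝ}
    (hz : ∀ K, ContinuousOn (fun t => z t K) s) (hw : ∀ K, ContinuousOn (fun t => w t K) s) :
    ContinuousOn (fun t => M.form (z t) (w t)) s := by
  simp_rw [← sum_mul_flux]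
  exact continuousOn_finsetSum _ fun K _ => (hz K).mul (M.continuousOn_flux hw K)

theorem hasDerivAt_normSq {z : ℝ → M.MeshFun} {z' : M.MeshFun} {t : ℝ}
    (hz : ∀ K, HasDerivAt (fun t => z t K) (z' K) t) :
    HasDerivAt (fun t => M.normSq (z t)) (2 * ∑ K, M.mass K * (z t K * z' K)) t := by
  have h : HasDerivAt (fun t => ∑ K, M.mass K * z t K ^ 2)
      (∑ K, M.mass K * (2 * z t K * z' K)) t := by
    refine HasDerivAt.fun_sum fun K _ => HasDerivAt.const_mul _ ?_
    refine ((hz K).pow 2).congr_deriv ?_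
    simp
  refine h.congr_deriv ?_
  rw [Finset.mul_sum]
  exact Finset.sum_congr rfl fun K _ => by ring

end AdmissibleMesh

end

section

/-! ### A priori estimates for the semi-discrete scheme -/

theorem abs_le_half_add_of_sq_le {x a b : ℝ} (ha : 0 ≤ a) (hb : 0 ≤ b) (h : x ^ 2 ≤ a * b) :
    |x| ≤ (a + b) / 2 :=
  abs_le_of_sq_le_sq (by nlinarith [sq_nonneg (a - b)]) (by linarith)

/-- First `κ` is chosen with `κ * B ≤ ε / 2`; the constant `e` belonging to it then determines `δ`.
The free `κ` replaces uniform integrability of the energies in time, which is not available. -/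
theorem exists_forall_abs_sub_le {T B : ℝ} {a A A' : ℕ → ℝ → ℝ}
    (ha : ∀ n, ContinuousOn (a n) (Ico 0 T)) (ha0 : ∀ n t, 0 ≤ a n t)
    (hB : ∀ n, ∀ t ∈ Ico 0 T, ∫ s in (0 : ℝ)..t, a n s ≤ B)
    (hd : ∀ n, ∀ t ∈ Ioo 0 T, HasDerivAt (A n) (A' n t) t)
    (hle : ∀ κ > 0, ∃ e, 0 ≤ e ∧ ∀ n, ∀ t ∈ Ioo 0 T, |A' n t| ≤ κ * a n t + e)
    {ε : ℝ} (hε : 0 < ε) :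
    ∃ δ > 0, ∀ n, ∀ s ∈ Ioo 0 T, ∀ t ∈ Ioo 0 T, |t - s| < δ → |A n t - A n s| ≤ ε := by
  obtain ⟨e, he, hle⟩ := hle (ε / (2 * (|B| + 1))) (by positivity)
  refine ⟨ε / (2 * (e + 1)), by positivity, fun n s hs t ht hst => ?_⟩
  refine (abs_sub_le_of_abs_deriv_le_primitive (by positivity) (ha n) (ha0 n) (hB n) (hd n)
    (hle n) hs ht).trans ?_
  have h1 : ε / (2 * (|B| + 1)) * B ≤ ε / 2 := by
    rw [div_mul_eq_mul_div, div_le_div_iff₀ (by positivity) (by norm_num)]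
    nlinarith [le_abs_self B]
  have h2 : e * |t - s| ≤ ε / 2 := by
    refine (mul_le_mul_of_nonneg_left hst.le he).trans ?_
    rw [mul_div_assoc', div_le_div_iff₀ (by positivity) (by norm_num)]
    nlinarith
  linarith

/-- The reaction term of the phase equation. -/
def reaction (b β ξ : ℝ) (Λ : ℝ → ℝ) (g : ℝ → ℝ → ℝ) (x y : ℝ) : ℝ :=
  1 / ξ ^ 2 * f₀ y - b * β / ξ * Λ (g x y)

/-- A bound for the reaction term on `[-R, R]`. -/
def reactionBound (b β ξ H R : ℝ) : ℝ :=
  1 / ξ ^ 2 * (R * (1 + R) * (R + 1 / 2)) + b * β / ξ * H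

theorem reactionBound_nonneg {b β ξ H R : ℝ} (hb : 0 < b) (hβ : 0 < β) (hξ : 0 < ξ) (hH : 0 ≤ H)
    (hR : 0 ≤ R) : 0 ≤ reactionBound b β ξ H R := by
  rw [reactionBound]; positivity

theorem abs_reaction_le {b β ξ H R : ℝ} (hb : 0 < b) (hβ : 0 < β) (hξ : 0 < ξ) {Λ : ℝ → ℝ}
    (hH : ∀ x, |Λ x| ≤ H) (g : ℝ → ℝ → ℝ) (x : ℝ) {y : ℝ} (hy : |y| ≤ R) :
    |reaction b β ξ Λ g x y| ≤ reactionBound b β ξ H R := by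
  have hf : |f₀ y| ≤ R * (1 + R) * (R + 1 / 2) := by
    rw [f₀, abs_mul, abs_mul]
    have h1 := abs_le.1 hy
    have hR : 0 ≤ R := (abs_nonneg y).trans hy
    have h2 : |1 - y| ≤ 1 + R := abs_le.2 ⟨by linarith, by linarith⟩
    have h3 : |y - 1 / 2| ≤ R + 1 / 2 := abs_le.2 ⟨by linarith, by linarith⟩
    gcongr
  refine (abs_sub _ _).trans ?_
  rw [abs_mul, abs_mul, abs_of_pos (show 0 < 1 / ξ ^ 2 by positivity),
    abs_of_pos (show 0 < b * β / ξ by positivity), reactionBound]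
  have := hH (g x y)
  gcongr

/-- Outside `[-R, R]` with `R ≥ 2` the cubic `f₀` has the opposite sign of `y` and size at least
`R`, while `hRH` keeps the coupling term below `R / ξ ^ 2`. -/
theorem excess_mul_reaction_nonpos {b β ξ H R : ℝ} (hb : 0 < b) (hβ : 0 < β) (hξ : 0 < ξ)
    {Λ : ℝ → ℝ} (hH : ∀ x, |Λ x| ≤ H) (g : ℝ → ℝ → ℝ) (hR : 2 ≤ R)
    (hRH : b * β / ξ * H ≤ 1 / ξ ^ 2 * R) (x y : ℝ) :
    excess R y * reaction b β ξ Λ g x y ≤ 0 := by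
  have hξ2 : 0 < 1 / ξ ^ 2 := by positivity
  have hc : 0 < b * β / ξ := by positivity
  have hΛ := abs_le.1 (hH (g x y))
  have h1 := mul_le_mul_of_nonneg_left hΛ.1 hc.le
  have h2 := mul_le_mul_of_nonneg_left hΛ.2 hc.le
  refine excess_mul_nonpos (by linarith) (fun hy => ?_) (fun hy => ?_)
  · have h3 : f₀ y ≤ -R := by
      rw [f₀]
      nlinarith [mul_nonneg (show 0 ≤ y - 2 by linarith) (show 0 ≤ y - 1 by linarith),
        mul_nonneg (mul_nonneg (show 0 ≤ y by linarith) (show 0 ≤ y - 2 by linarith))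
          (show 0 ≤ y - 1 by linarith)]
    have h4 := mul_le_mul_of_nonneg_left h3 hξ2.le
    rw [reaction]; linarith
  · have h3 : R ≤ f₀ y := by
      rw [f₀]
      nlinarith [mul_nonneg (show 0 ≤ -y - 2 by linarith) (show 0 ≤ -y by linarith),
        mul_nonneg (mul_nonneg (show 0 ≤ -y by linarith) (show 0 ≤ -y - 2 by linarith))
          (show 0 ≤ -y by linarith)]
    have h4 := mul_le_mul_of_nonneg_left h3 hξ2.le
    rw [reaction]; linarith

/-- Uniform bounds on the data: `|Λ| ≤ H`, `|uIni| ≤ U` and `|pIni| ≤ R` on the closure of `Ω`, and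
the reaction term points into `[-R, R]`. -/
structure DataBounds (Ω : Set E3) (b β ξ : ℝ) (Λ : ℝ → ℝ) (uIni pIni : E3 → ℝ) (H U R : ℝ) :
    Prop where
  volume_ne_top : volume Ω ≠ ⊤
  abs_le_H : ∀ x, |Λ x| ≤ H
  abs_uIni_le : ∀ x ∈ closure Ω, |uIni x| ≤ U
  abs_pIni_le : ∀ x ∈ closure Ω, |pIni x| ≤ R
  two_le : 2 ≤ R
  mul_le : b * β / ξ * H ≤ 1 / ξ ^ 2 * R

theorem exists_dataBounds {Ω : Set E3} (hΩ : IsPolyhedralDomain Ω) {b β ξ : ℝ} (hξ : 0 < ξ)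
    {Λ : ℝ → ℝ} {Hinf Hsup : ℝ} (hΛ : ∀ x, Λ x ∈ Ioo Hinf Hsup) {uIni pIni : E3 → ℝ}
    (hu : ContinuousOn uIni (closure Ω)) (hp : ContinuousOn pIni (closure Ω)) :
    ∃ H U R : ℝ, DataBounds Ω b β ξ Λ uIni pIni H U R := by
  have hcomp : IsCompact (closure Ω) := hΩ.isBounded.isCompact_closure
  obtain ⟨U, hU⟩ := hcomp.exists_bound_of_continuousOn hu
  obtain ⟨R, hR⟩ := hcomp.exists_bound_of_continuousOn hp
  -- The threshold for `p` combines the size of the initial value, the bound `2` from which the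
  -- cubic dominates, and the size of the coupling term relative to `1 / ξ ^ 2`.
  refine ⟨max |Hinf| |Hsup|, U, max (max 2 R) (ξ ^ 2 * (b * β / ξ * max |Hinf| |Hsup|)),
    hΩ.isBounded.measure_lt_top.ne, fun x => abs_le_max_abs_abs (hΛ x).1.le (hΛ x).2.le, hU,
    fun x hx => (hR x hx).trans ((le_max_right _ _).trans (le_max_left _ _)),
    (le_max_left _ _).trans (le_max_left _ _), ?_⟩
  rw [one_div, ← div_eq_inv_mul, le_div_iff₀ (by positivity), mul_comm]
  exact le_max_right _ _

namespace IsSchemeSolution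

variable {Ω : Set E3} {M : AdmissibleMesh Ω} {T L α β b ξ : ℝ} {Λ : ℝ → ℝ} {g : ℝ → ℝ → ℝ}
  {uIni pIni : E3 → ℝ} {u p : ℝ → M.MeshFun}

theorem hasDerivAt_u (h : IsSchemeSolution M T L α β b ξ Λ g uIni pIni u p) {t : ℝ}
    (ht : t ∈ Ioo 0 T) (K : Fin M.numCells) :
    HasDerivAt (fun s => u s K) (deriv (fun s => u s K) t) t :=
  (h.differentiable_u K t ht).hasDerivAt

theorem hasDerivAt_p (h : IsSchemeSolution M T L α β b ξ Λ g uIni pIni u p) {t : ℝ}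
    (ht : t ∈ Ioo 0 T) (K : Fin M.numCells) :
    HasDerivAt (fun s => p s K) (deriv (fun s => p s K) t) t :=
  (h.differentiable_p K t ht).hasDerivAt

theorem sum_mul_deriv_u (h : IsSchemeSolution M T L α β b ξ Λ g uIni pIni u p) {t : ℝ}
    (ht : t ∈ Ioo 0 T) (w : M.MeshFun) :
    ∑ K, M.mass K * (w K * deriv (fun s => u s K) t)
      = -M.form w (u t) + L * ∑ K, M.mass K * (w K * deriv (fun s => p s K) t) := by
  rw [← M.sum_mul_flux, Finset.mul_sum, ← Finset.sum_neg_distrib, ← Finset.sum_add_distrib]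
  refine Finset.sum_congr rfl fun K _ => ?_
  have := h.heat K t ht
  rw [AdmissibleMesh.mass]
  linear_combination w K * this

theorem mul_sum_mul_deriv_p (h : IsSchemeSolution M T L α β b ξ Λ g uIni pIni u p) {t : ℝ}
    (ht : t ∈ Ioo 0 T) (w : M.MeshFun) :
    α * ∑ K, M.mass K * (w K * deriv (fun s => p s K) t)
      = -M.form w (p t) + ∑ K, M.mass K * (w K * reaction b β ξ Λ g (u t K) (p t K)) := by
  rw [← M.sum_mul_flux, Finset.mul_sum, ← Finset.sum_neg_distrib, ← Finset.sum_add_distrib]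
  refine Finset.sum_congr rfl fun K _ => ?_
  have := h.phase K t ht
  rw [AdmissibleMesh.mass, reaction]
  linear_combination w K * this

variable {H U R : ℝ}

/-- The maximum principle for the phase variable. -/
theorem abs_p_le (h : IsSchemeSolution M T L α β b ξ Λ g uIni pIni u p)
    (hD : DataBounds Ω b β ξ Λ uIni pIni H U R) (hα : 0 < α) (hβ : 0 < β) (hb : 0 < b)
    (hξ : 0 < ξ) {t : ℝ} (ht : t ∈ Ico 0 T) (K : Fin M.numCells) : |p t K| ≤ R := by
  have hR0 : 0 ≤ R := zero_le_two.trans hD.two_le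
  have hder : ∀ s ∈ Ioo 0 T, HasDerivAt (fun s => ∑ K, M.mass K * excess R (p s K) ^ 2)
      (2 * ∑ K, M.mass K * (excess R (p s K) * deriv (fun s => p s K) s)) s := fun s hs => by
    have h1 : HasDerivAt (fun s => ∑ K, M.mass K * excess R (p s K) ^ 2)
        (∑ K, M.mass K * (2 * excess R (p s K) * deriv (fun s => p s K) s)) s :=
      HasDerivAt.fun_sum fun K _ => HasDerivAt.const_mul _
        ((hasDerivAt_excess_sq hR0 (p s K)).comp (h₂ := fun y => excess R y ^ 2)
          (h := fun s => p s K) s (h.hasDerivAt_p hs K))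
    refine h1.congr_deriv ?_
    rw [Finset.mul_sum]
    exact Finset.sum_congr rfl fun K _ => by ring
  have hcont : Continuous (excess R) := by unfold excess; fun_prop
  -- The phase equation is tested with the excess of `p`: the form is nonnegative by monotonicity
  -- and the reaction points back into `[-R, R]`. The squared norm of the excess is thus
  -- nonincreasing, and it starts at zero.
  have hanti := antitoneOn_of_hasDerivAt_nonpos (convex_Ico 0 T)
    (f := fun s => ∑ K, M.mass K * excess R (p s K) ^ 2)
    (f' := fun s => 2 * ∑ K, M.mass K * (excess R (p s K) * deriv (fun s => p s K) s))
    (continuousOn_finsetSum _ fun K _ => continuousOn_const.mul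
      ((hcont.comp_continuousOn (h.continuousOn_p K)).pow 2))
    (fun s hs => hder s (by rwa [interior_Ico] at hs))
    (fun s hs => by
      rw [interior_Ico] at hs
      have h1 := h.mul_sum_mul_deriv_p hs fun K => excess R (p s K)
      have h2 := M.form_comp_nonneg (monotone_excess R) (excess_eq_zero (by simpa using hR0)) (p s)
      have h3 : ∑ K, M.mass K * (excess R (p s K) * reaction b β ξ Λ g (u s K) (p s K)) ≤ 0 :=
        Finset.sum_nonpos fun K _ => mul_nonpos_of_nonneg_of_nonpos (M.mass_pos K).le
          (excess_mul_reaction_nonpos hb hβ hξ hD.abs_le_H g hD.two_le hD.mul_le _ _)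
      have h4 : α * ∑ K, M.mass K * (excess R (p s K) * deriv (fun s => p s K) s) ≤ 0 := by
        rw [h1]; linarith
      have h5 := nonpos_of_mul_nonpos_right h4 hα
      linarith)
  have h0 : ∑ K, M.mass K * excess R (p 0 K) ^ 2 = 0 := by
    refine Finset.sum_eq_zero fun K _ => ?_
    rw [h.init_p, excess_eq_zero (hD.abs_pIni_le _
      (closure_mono (M.cell_subset K) (M.center_mem K)))]
    norm_num
  have h1 := hanti (left_mem_Ico.2 (ht.1.trans_lt ht.2)) ht ht.1
  simp only [h0] at h1
  have h2 := (Finset.sum_eq_zero_iff_of_nonneg fun K _ =>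
    mul_nonneg (M.mass_pos K).le (sq_nonneg (excess R (p t K)))).1
    (le_antisymm h1 (Finset.sum_nonneg fun K _ => mul_nonneg (M.mass_pos K).le (sq_nonneg _)))
    K (Finset.mem_univ K)
  exact abs_le_of_excess_eq_zero hR0
    (pow_eq_zero_iff two_ne_zero |>.1 ((mul_eq_zero.1 h2).resolve_left (M.mass_pos K).ne'))

/-- The discrete energy density in time. -/
def energy (M : AdmissibleMesh Ω) (u p : ℝ → M.MeshFun) (t : ℝ) : ℝ :=
  (M.form (u t) (u t) + M.form (p t) (p t)) / 2

theorem energy_nonneg (t : ℝ) : 0 ≤ energy M u p t :=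
  div_nonneg (add_nonneg (M.form_self_nonneg _) (M.form_self_nonneg _)) zero_le_two

theorem form_u_le (t : ℝ) : M.form (u t) (u t) ≤ 2 * energy M u p t := by
  rw [energy]
  linarith [M.form_self_nonneg (p t)]

theorem form_p_le (t : ℝ) : M.form (p t) (p t) ≤ 2 * energy M u p t := by
  rw [energy]
  linarith [M.form_self_nonneg (u t)]

theorem continuousOn_energy (h : IsSchemeSolution M T L α β b ξ Λ g uIni pIni u p) :
    ContinuousOn (energy M u p) (Ico 0 T) :=
  ((M.continuousOn_form h.continuousOn_u h.continuousOn_u).add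
    (M.continuousOn_form h.continuousOn_p h.continuousOn_p)).div_const 2

theorem abs_reaction_p_le (h : IsSchemeSolution M T L α β b ξ Λ g uIni pIni u p)
    (hD : DataBounds Ω b β ξ Λ uIni pIni H U R) (hα : 0 < α) (hβ : 0 < β) (hb : 0 < b)
    (hξ : 0 < ξ) {t : ℝ} (ht : t ∈ Ico 0 T) (K : Fin M.numCells) :
    |reaction b β ξ Λ g (u t K) (p t K)| ≤ reactionBound b β ξ H R :=
  abs_reaction_le hb hβ hξ hD.abs_le_H g _ (h.abs_p_le hD hα hβ hb hξ ht K)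

/-- The constant in the energy estimate. -/
def energyBound (Ω : Set E3) (T L α β b ξ H U R : ℝ) : ℝ :=
  ((U + L * R) ^ 2 * volume.real Ω / 2 + (L ^ 2 + 1) / 2 * α * (R ^ 2 * volume.real Ω) / 2)
    + (L ^ 2 + 1) / 2 * (R * reactionBound b β ξ H R * volume.real Ω) * T

/-- The heat equation is tested with `u - L p`, which absorbs the latent heat into a time
derivative, and the phase equation with `μ p`, where `μ = (L² + 1) / 2`. The cross term of `p` and
`u` costs half of the form of `u` and `L² / 2` times the form of `p`; with this `μ` exactly half of
each form remains. -/
theorem energy_estimate (h : IsSchemeSolution M T L α β b ξ Λ g uIni pIni u p)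
    (hD : DataBounds Ω b β ξ Λ uIni pIni H U R) (hL : 0 < L) (hα : 0 < α) (hβ : 0 < β)
    (hb : 0 < b) (hξ : 0 < ξ) {t : ℝ} (ht : t ∈ Ico 0 T) :
    M.normSq (fun K => u t K - L * p t K) / 2 + ∫ s in (0 : ℝ)..t, energy M u p s
      ≤ energyBound Ω T L α β b ξ H U R := by
  have hR0 : 0 ≤ R := zero_le_two.trans hD.two_le
  have hH0 : 0 ≤ H := (abs_nonneg _).trans (hD.abs_le_H 0)
  have hr0 := reactionBound_nonneg hb hβ hξ hH0 hR0
  set μ := (L ^ 2 + 1) / 2 with hμ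
  have hμ0 : 0 < μ := by positivity
  have hc : 0 ≤ μ * (R * reactionBound b β ξ H R * volume.real Ω) := by positivity
  have hcn : ∀ {z : ℝ → M.MeshFun}, (∀ K, ContinuousOn (fun t => z t K) (Ico 0 T)) →
      ContinuousOn (fun t => M.normSq (z t)) (Ico 0 T) := fun hz =>
    continuousOn_finsetSum _ fun K _ => continuousOn_const.mul ((hz K).pow 2)
  have key := add_integral_le_of_deriv_le hc h.continuousOn_energy
    (Z := fun t => M.normSq (fun K => u t K - L * p t K) / 2 + μ * α * M.normSq (p t) / 2)
    (Z' := fun t => (2 * ∑ K, M.mass K * ((u t K - L * p t K)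
        * (deriv (fun s => u s K) t - L * deriv (fun s => p s K) t))) / 2
      + μ * α * (2 * ∑ K, M.mass K * (p t K * deriv (fun s => p s K) t)) / 2)
    (((hcn fun K => (h.continuousOn_u K).sub (continuousOn_const.mul
      (h.continuousOn_p K))).div_const 2).add
        ((continuousOn_const.mul (hcn h.continuousOn_p)).div_const 2))
    (fun s hs => ((M.hasDerivAt_normSq (z := fun t K => u t K - L * p t K) fun K =>
      (h.hasDerivAt_u hs K).sub ((h.hasDerivAt_p hs K).const_mul L)).div_const 2).add
        (((M.hasDerivAt_normSq fun K => h.hasDerivAt_p hs K).const_mul (μ * α)).div_const 2))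
    (fun s hs => ?_) ht
  · have e0 : M.normSq (fun K => u 0 K - L * p 0 K) ≤ (U + L * R) ^ 2 * volume.real Ω := by
      refine M.normSq_le hD.volume_ne_top fun K => ?_
      have hK := closure_mono (M.cell_subset K) (M.center_mem K)
      rw [h.init_u, h.init_p]
      refine (abs_sub _ _).trans ?_
      rw [abs_mul, abs_of_pos hL]
      exact add_le_add (hD.abs_uIni_le _ hK)
        (mul_le_mul_of_nonneg_left (hD.abs_pIni_le _ hK) hL.le)
    have e1 : M.normSq (p 0) ≤ R ^ 2 * volume.real Ω := M.normSq_le hD.volume_ne_top fun K => by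
      rw [h.init_p]
      exact hD.abs_pIni_le _ (closure_mono (M.cell_subset K) (M.center_mem K))
    have e2 := mul_le_mul_of_nonneg_left e1 (mul_nonneg hμ0.le hα.le)
    have e3 := mul_nonneg (mul_nonneg hμ0.le hα.le) (M.normSq_nonneg (p t))
    rw [energyBound, ← hμ]
    linarith
  · have hs' : s ∈ Ico 0 T := ⟨hs.1.le, hs.2⟩
    have h1 := h.sum_mul_deriv_u hs fun K => u s K - L * p s K
    have h2 := h.mul_sum_mul_deriv_p hs (p s)
    have h3 : ∑ K, M.mass K * ((u s K - L * p s K)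
        * (deriv (fun s => u s K) s - L * deriv (fun s => p s K) s))
        = -M.form (fun K => u s K - L * p s K) (u s) := by
      rw [← sub_eq_iff_eq_add] at h1
      rw [← h1, Finset.mul_sum, ← Finset.sum_sub_distrib]
      exact Finset.sum_congr rfl fun K _ => by ring
    have h4 : M.form (fun K => u s K - L * p s K) (u s)
        = M.form (u s) (u s) - L * M.form (p s) (u s) := by
      simp_rw [← M.sum_mul_flux, sub_mul, Finset.sum_sub_distrib, Finset.mul_sum, mul_assoc]
    have h5 : |L * M.form (p s) (u s)| ≤ (L ^ 2 * M.form (p s) (p s) + M.form (u s) (u s)) / 2 := by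
      refine abs_le_half_add_of_sq_le (mul_nonneg (sq_nonneg L) (M.form_self_nonneg _))
        (M.form_self_nonneg _) ?_
      rw [mul_pow, mul_assoc]
      exact mul_le_mul_of_nonneg_left (M.form_sq_le _ _) (sq_nonneg L)
    have h6 : ∑ K, M.mass K * (p s K * reaction b β ξ Λ g (u s K) (p s K))
        ≤ R * reactionBound b β ξ H R * volume.real Ω := by
      refine M.sum_mass_mul_le hD.volume_ne_top (mul_nonneg hR0 hr0) fun K => ?_
      refine (le_abs_self _).trans ?_
      rw [abs_mul]
      exact mul_le_mul (h.abs_p_le hD hα hβ hb hξ hs' K)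
        (h.abs_reaction_p_le hD hα hβ hb hξ hs' K) (abs_nonneg _) hR0
    have h7 := mul_le_mul_of_nonneg_left h6 hμ0.le
    have h8 := le_of_abs_le h5
    have h9 : μ * α * (2 * ∑ K, M.mass K * (p s K * deriv (fun s => p s K) s)) / 2
        = μ * (-M.form (p s) (p s)
          + ∑ K, M.mass K * (p s K * reaction b β ξ Λ g (u s K) (p s K))) := by
      rw [← h2]; ring
    rw [h9, h3, h4, energy]
    have h10 : μ * M.form (p s) (p s) = L ^ 2 * M.form (p s) (p s) / 2 + M.form (p s) (p s) / 2 := by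
      rw [hμ]; ring
    linarith

theorem normSq_p_le (h : IsSchemeSolution M T L α β b ξ Λ g uIni pIni u p)
    (hD : DataBounds Ω b β ξ Λ uIni pIni H U R) (hα : 0 < α) (hβ : 0 < β) (hb : 0 < b)
    (hξ : 0 < ξ) {t : ℝ} (ht : t ∈ Ico 0 T) : M.normSq (p t) ≤ R ^ 2 * volume.real Ω :=
  M.normSq_le hD.volume_ne_top (h.abs_p_le hD hα hβ hb hξ ht)

theorem integral_energy_le (h : IsSchemeSolution M T L α β b ξ Λ g uIni pIni u p)
    (hD : DataBounds Ω b β ξ Λ uIni pIni H U R) (hL : 0 < L) (hα : 0 < α) (hβ : 0 < β)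
    (hb : 0 < b) (hξ : 0 < ξ) {t : ℝ} (ht : t ∈ Ico 0 T) :
    ∫ s in (0 : ℝ)..t, energy M u p s ≤ energyBound Ω T L α β b ξ H U R := by
  have := h.energy_estimate hD hL hα hβ hb hξ ht
  have := M.normSq_nonneg fun K => u t K - L * p t K
  linarith

theorem normSq_u_le (h : IsSchemeSolution M T L α β b ξ Λ g uIni pIni u p)
    (hD : DataBounds Ω b β ξ Λ uIni pIni H U R) (hL : 0 < L) (hα : 0 < α) (hβ : 0 < β)
    (hb : 0 < b) (hξ : 0 < ξ) {t : ℝ} (ht : t ∈ Ico 0 T) :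
    M.normSq (u t)
      ≤ 4 * energyBound Ω T L α β b ξ H U R + 2 * L ^ 2 * (R ^ 2 * volume.real Ω) := by
  have h1 := h.energy_estimate hD hL hα hβ hb hξ ht
  have h2 := h.normSq_p_le hD hα hβ hb hξ ht
  have h3 : 0 ≤ ∫ s in (0 : ℝ)..t, energy M u p s :=
    intervalIntegral.integral_nonneg ht.1 fun s _ => energy_nonneg s
  have h4 : M.normSq (u t) ≤ 2 * M.normSq (fun K => u t K - L * p t K)
      + 2 * L ^ 2 * M.normSq (p t) := by
    simp only [AdmissibleMesh.normSq, Finset.mul_sum, ← Finset.sum_add_distrib]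
    refine Finset.sum_le_sum fun K _ => ?_
    nlinarith [mul_nonneg (M.mass_pos K).le (sq_nonneg (u t K - 2 * (L * p t K)))]
  have h5 := mul_le_mul_of_nonneg_left h2 (show 0 ≤ 2 * L ^ 2 by positivity)
  linarith

theorem integrable_form (h : IsSchemeSolution M T L α β b ξ Λ g uIni pIni u p)
    (hD : DataBounds Ω b β ξ Λ uIni pIni H U R) (hT : 0 < T) (hL : 0 < L) (hα : 0 < α)
    (hβ : 0 < β) (hb : 0 < b) (hξ : 0 < ξ) {z : ℝ → M.MeshFun}
    (hz : ∀ K, ContinuousOn (fun t => z t K) (Ico 0 T))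
    (hle : ∀ t, M.form (z t) (z t) ≤ 2 * energy M u p t) :
    Integrable (fun t => M.form (z t) (z t)) (timeMeasure T) ∧
      ∫ t, M.form (z t) (z t) ∂timeMeasure T ≤ 2 * energyBound Ω T L α β b ξ H U R := by
  obtain ⟨h1, h2⟩ := integrable_of_integral_le hT h.continuousOn_energy energy_nonneg
    fun t ht => h.integral_energy_le hD hL hα hβ hb hξ ht
  have h3 : Integrable (fun t => M.form (z t) (z t)) (timeMeasure T) := by
    refine (h1.const_mul 2).mono' (((M.continuousOn_form hz hz).mono
      Ioo_subset_Ico_self).aestronglyMeasurable measurableSet_Ioo) (Eventually.of_forall fun t => ?_)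
    rw [Real.norm_of_nonneg (M.form_self_nonneg _)]
    exact hle t
  refine ⟨h3, (integral_mono h3 (h1.const_mul 2) hle).trans ?_⟩
  rw [integral_const_mul]
  linarith

/-- Young's inequality with a parameter: the coefficient of the energy can be made small at the
expense of the constant term. -/
theorem abs_form_le {w z : M.MeshFun} {D κ E : ℝ} (hw : M.form w w ≤ D) (hz : M.form z z ≤ 2 * E)
    (hκ : 0 < κ) : |M.form w z| ≤ κ * E + D / κ := by
  have hw0 := M.form_self_nonneg w
  have hz0 := M.form_self_nonneg z
  have hD0 : 0 ≤ D := hw0.trans hw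
  have hE0 : 0 ≤ E := by linarith
  have h := abs_le_half_add_of_sq_le (x := M.form w z) (a := 2 * (D / κ)) (b := 2 * (κ * E))
    (by positivity) (by positivity) ?_
  · linarith
  · have e : 2 * (D / κ) * (2 * (κ * E)) = D * (2 * E) + D * (2 * E) := by field_simp; ring
    rw [e]
    have h1 := (M.form_sq_le w z).trans (mul_le_mul hw hz hz0 hD0)
    have : 0 ≤ D * (2 * E) := by positivity
    linarith

theorem abs_mul_sum_deriv_p_le (h : IsSchemeSolution M T L α β b ξ Λ g uIni pIni u p)
    (hD : DataBounds Ω b β ξ Λ uIni pIni H U R) (hα : 0 < α) (hβ : 0 < β)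
    (hb : 0 < b) (hξ : 0 < ξ) {w : M.MeshFun} {Q D κ : ℝ} (hQ : ∀ K, |w K| ≤ Q)
    (hQ0 : 0 ≤ Q) (hw : M.form w w ≤ D) (hκ : 0 < κ) {t : ℝ} (ht : t ∈ Ioo 0 T) :
    |α * ∑ K, M.mass K * (w K * deriv (fun s => p s K) t)|
      ≤ κ * energy M u p t + (D / κ + Q * reactionBound b β ξ H R * volume.real Ω) := by
  have ht' : t ∈ Ico 0 T := ⟨ht.1.le, ht.2⟩
  have hR0 : 0 ≤ R := zero_le_two.trans hD.two_le
  have hH0 : 0 ≤ H := (abs_nonneg _).trans (hD.abs_le_H 0)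
  rw [h.mul_sum_mul_deriv_p ht]
  refine (abs_add_le _ _).trans ?_
  rw [abs_neg, ← add_assoc]
  refine add_le_add ?_ ?_
  · exact abs_form_le hw (form_p_le t) hκ
  · refine M.abs_sum_mass_mul_le hD.volume_ne_top
      (mul_nonneg hQ0 (reactionBound_nonneg hb hβ hξ hH0 hR0)) fun K => ?_
    rw [abs_mul]
    exact mul_le_mul (hQ K) (h.abs_reaction_p_le hD hα hβ hb hξ ht' K) (abs_nonneg _) hQ0

theorem abs_sum_deriv_p_le (h : IsSchemeSolution M T L α β b ξ Λ g uIni pIni u p)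
    (hD : DataBounds Ω b β ξ Λ uIni pIni H U R) (hα : 0 < α) (hβ : 0 < β)
    (hb : 0 < b) (hξ : 0 < ξ) {w : M.MeshFun} {Q D κ : ℝ} (hQ : ∀ K, |w K| ≤ Q)
    (hQ0 : 0 ≤ Q) (hw : M.form w w ≤ D) (hκ : 0 < κ) {t : ℝ} (ht : t ∈ Ioo 0 T) :
    |∑ K, M.mass K * (w K * deriv (fun s => p s K) t)|
      ≤ (κ * energy M u p t + (D / κ + Q * reactionBound b β ξ H R * volume.real Ω)) / α := by
  have h1 := h.abs_mul_sum_deriv_p_le hD hα hβ hb hξ hQ hQ0 hw hκ ht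
  rwa [abs_mul, abs_of_pos hα, mul_comm, ← le_div_iff₀ hα] at h1

theorem abs_sum_deriv_u_le (h : IsSchemeSolution M T L α β b ξ Λ g uIni pIni u p)
    (hD : DataBounds Ω b β ξ Λ uIni pIni H U R) (hL : 0 < L) (hα : 0 < α) (hβ : 0 < β)
    (hb : 0 < b) (hξ : 0 < ξ) {w : M.MeshFun} {Q D κ : ℝ} (hQ : ∀ K, |w K| ≤ Q)
    (hQ0 : 0 ≤ Q) (hw : M.form w w ≤ D) (hκ : 0 < κ) {t : ℝ} (ht : t ∈ Ioo 0 T) :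
    |∑ K, M.mass K * (w K * deriv (fun s => u s K) t)|
      ≤ κ * energy M u p t + D / κ + L * ((κ * energy M u p t
        + (D / κ + Q * reactionBound b β ξ H R * volume.real Ω)) / α) := by
  rw [h.sum_mul_deriv_u ht]
  refine (abs_add_le _ _).trans (add_le_add ?_ ?_)
  · rw [abs_neg]
    exact abs_form_le hw (form_u_le t) hκ
  · rw [abs_mul, abs_of_pos hL]
    exact mul_le_mul_of_nonneg_left (h.abs_sum_deriv_p_le hD hα hβ hb hξ hQ hQ0 hw hκ ht) hL.le

theorem hasDerivAt_sum_mass_mul {z : ℝ → M.MeshFun} {z' : M.MeshFun} {t : ℝ}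
    (hz : ∀ K, HasDerivAt (fun s => z s K) (z' K) t) (w : M.MeshFun) :
    HasDerivAt (fun s => ∑ K, M.mass K * z s K * w K) (∑ K, M.mass K * (w K * z' K)) t := by
  refine (HasDerivAt.fun_sum fun K _ => ((hz K).const_mul (M.mass K)).mul_const (w K)).congr_deriv ?_
  exact Finset.sum_congr rfl fun K _ => by ring

end IsSchemeSolution

/-! ### Equicontinuity in time, uniformly in the mesh. -/

section Family

variable {Ω : Set E3} {T L α β b ξ : ℝ} {Λ : ℝ → ℝ} {g : ℝ → ℝ → ℝ} {uIni pIni : E3 → ℝ}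
  {H U R : ℝ} {M : ℕ → AdmissibleMesh Ω} {u p : ∀ n, ℝ → (M n).MeshFun}

theorem IsTestFunction.exists_bounds {q : E3 → ℝ} (hΩ : IsPolyhedralDomain Ω)
    (hq : IsTestFunction Ω q) : ∃ Q D : ℝ, 0 ≤ Q ∧ 0 ≤ D ∧ (∀ x, |q x| ≤ Q) ∧
      ∀ M : AdmissibleMesh Ω, M.form (fun K => q (M.center K)) (fun K => q (M.center K)) ≤ D := by
  obtain ⟨Q, hQ⟩ := hq.2.1.exists_bound_of_continuous hq.1.continuous
  obtain ⟨B, -, hB⟩ := hq.exists_lipschitz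
  refine ⟨Q, B ^ 2 * (3 * volume.real Ω), (norm_nonneg _).trans (hQ 0), by positivity, hQ,
    fun M => M.form_comp_center_le hΩ.isBounded.measure_lt_top.ne (fun x hx => hq.eq_zero ?_) hB⟩
  rw [hΩ.isOpen.frontier_eq] at hx
  exact hx.2

/-- The scheme expresses the time derivative of the mean against `q` by the form and the reaction.
The form of the sampled `q` is bounded independently of the mesh, so Young's inequality gives an
arbitrarily small multiple of the energy plus a constant; `κ * α` is used because the equation is
divided by `α`. -/
theorem equicontinuous_p (hΩ : IsPolyhedralDomain Ω)
    (h : ∀ n, IsSchemeSolution (M n) T L α β b ξ Λ g uIni pIni (u n) (p n))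
    (hD : DataBounds Ω b β ξ Λ uIni pIni H U R) (hL : 0 < L) (hα : 0 < α) (hβ : 0 < β)
    (hb : 0 < b) (hξ : 0 < ξ) {q : E3 → ℝ} (hq : IsTestFunction Ω q) {ε : ℝ} (hε : 0 < ε) :
    ∃ δ > 0, ∀ n, ∀ s ∈ Ioo 0 T, ∀ t ∈ Ioo 0 T, |t - s| < δ →
      |(∑ K, (M n).mass K * p n t K * q ((M n).center K))
        - ∑ K, (M n).mass K * p n s K * q ((M n).center K)| ≤ ε := by
  obtain ⟨Q, D, hQ0, hD0, hQ, hform⟩ := hq.exists_bounds hΩ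
  have hr := reactionBound_nonneg hb hβ hξ ((abs_nonneg _).trans (hD.abs_le_H 0))
    (zero_le_two.trans hD.two_le)
  refine exists_forall_abs_sub_le (a := fun n => IsSchemeSolution.energy (M n) (u n) (p n))
    (A := fun n t => ∑ K, (M n).mass K * p n t K * q ((M n).center K))
    (fun n => (h n).continuousOn_energy) (fun n => IsSchemeSolution.energy_nonneg)
    (fun n t ht => (h n).integral_energy_le hD hL hα hβ hb hξ ht)
    (fun n t ht => IsSchemeSolution.hasDerivAt_sum_mass_mul
      (fun K => (h n).hasDerivAt_p ht K) fun K => q ((M n).center K)) (fun κ hκ => ?_) hε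
  refine ⟨(D / (κ * α) + Q * reactionBound b β ξ H R * volume.real Ω) / α, by positivity,
    fun n t ht => ?_⟩
  refine ((h n).abs_sum_deriv_p_le hD hα hβ hb hξ (fun K => hQ _) hQ0 (hform (M n))
    (mul_pos hκ hα) ht).trans (le_of_eq ?_)
  field_simp

theorem equicontinuous_u (hΩ : IsPolyhedralDomain Ω)
    (h : ∀ n, IsSchemeSolution (M n) T L α β b ξ Λ g uIni pIni (u n) (p n))
    (hD : DataBounds Ω b β ξ Λ uIni pIni H U R) (hL : 0 < L) (hα : 0 < α) (hβ : 0 < β)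
    (hb : 0 < b) (hξ : 0 < ξ) {q : E3 → ℝ} (hq : IsTestFunction Ω q) {ε : ℝ} (hε : 0 < ε) :
    ∃ δ > 0, ∀ n, ∀ s ∈ Ioo 0 T, ∀ t ∈ Ioo 0 T, |t - s| < δ →
      |(∑ K, (M n).mass K * u n t K * q ((M n).center K))
        - ∑ K, (M n).mass K * u n s K * q ((M n).center K)| ≤ ε := by
  obtain ⟨Q, D, hQ0, hD0, hQ, hform⟩ := hq.exists_bounds hΩ
  have hr := reactionBound_nonneg hb hβ hξ ((abs_nonneg _).trans (hD.abs_le_H 0))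
    (zero_le_two.trans hD.two_le)
  refine exists_forall_abs_sub_le (a := fun n => IsSchemeSolution.energy (M n) (u n) (p n))
    (A := fun n t => ∑ K, (M n).mass K * u n t K * q ((M n).center K))
    (fun n => (h n).continuousOn_energy) (fun n => IsSchemeSolution.energy_nonneg)
    (fun n t ht => (h n).integral_energy_le hD hL hα hβ hb hξ ht)
    (fun n t ht => IsSchemeSolution.hasDerivAt_sum_mass_mul
      (fun K => (h n).hasDerivAt_u ht K) fun K => q ((M n).center K)) (fun κ hκ => ?_) hε
  -- The energy enters directly and, through the latent heat, a second time with factor `L / α`.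
  have hκ' : 0 < κ / (1 + L / α) := by positivity
  refine ⟨D / (κ / (1 + L / α)) + L * ((D / (κ / (1 + L / α))
    + Q * reactionBound b β ξ H R * volume.real Ω) / α), by positivity, fun n t ht => ?_⟩
  refine ((h n).abs_sum_deriv_u_le hD hL hα hβ hb hξ (fun K => hQ _) hQ0 (hform (M n))
    hκ' ht).trans (le_of_eq ?_)
  have e : κ = κ / (1 + L / α) * (1 + L / α) := by field_simp
  rw [show κ * IsSchemeSolution.energy (M n) (u n) (p n) t
    = κ / (1 + L / α) * (1 + L / α) * IsSchemeSolution.energy (M n) (u n) (p n) t by rw [← e]]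
  ring

end Family

end
end PhaseFieldFVM

end

/-! ### The common subsequence for both variables. -/

set_option maxHeartbeats 3000000 in
theorem mainTheorem4
    (Ω : Set PhaseFieldFVM.E3) (hΩ : PhaseFieldFVM.IsPolyhedralDomain Ω)
    (T : ℝ) (hT : 0 < T)
    (L α β b ξ : ℝ) (hL : 0 < L) (hα : 0 < α) (hβ : 0 < β) (hb : 0 < b) (hξ : 0 < ξ)
    (Λ : ℝ → ℝ) (hΛ : ContDiff ℝ 1 Λ)
    (Hinf Hsup : ℝ) (hΛ_range : ∀ x, Λ x ∈ Set.Ioo Hinf Hsup)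
    (g : ℝ → ℝ → ℝ)
    (uIni pIni : PhaseFieldFVM.E3 → ℝ)
    (huIni : ContDiffOn ℝ 2 uIni (closure Ω)) (hpIni : ContDiffOn ℝ 2 pIni (closure Ω))
    (M : ℕ → PhaseFieldFVM.AdmissibleMesh Ω) (hM : PhaseFieldFVM.IsNormalSeq M)
    (uM pM : (n : ℕ) → ℝ → (M n).MeshFun)
    (hsol : ∀ n, PhaseFieldFVM.IsSchemeSolution (M n) T L α β b ξ Λ g uIni pIni (uM n) (pM n)) :
    ∃ k : ℕ → ℕ, StrictMono k ∧
      ∃ u p : MeasureTheory.Lp (PhaseFieldFVM.H10 Ω) 2 (PhaseFieldFVM.timeMeasure T),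
        -- `u` and `p` are the limits of the numerical solutions along the subsequence
        PhaseFieldFVM.TendstoL2 T (fun n t => (M (k n)).interp (pM (k n) t))
          (fun t => PhaseFieldFVM.H10.val (p t)) ∧
        PhaseFieldFVM.TendstoL2 T (fun n t => (M (k n)).interp (uM (k n) t))
          (fun t => PhaseFieldFVM.H10.val (u t)) ∧
        -- convergence of the flux terms
        ∀ q : PhaseFieldFVM.E3 → ℝ, PhaseFieldFVM.IsTestFunction Ω q →
          PhaseFieldFVM.TendstoL2 T
            (fun n t => ∑ K, q ((M (k n)).center K) * (M (k n)).flux (pM (k n) t) K)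
            (fun t => ∫ x in Ω, inner ℝ (PhaseFieldFVM.H10.grad (p t) x) (gradient q x)) ∧
          PhaseFieldFVM.TendstoL2 T
            (fun n t => ∑ K, q ((M (k n)).center K) * (M (k n)).flux (uM (k n) t) K)
            (fun t => ∫ x in Ω, inner ℝ (PhaseFieldFVM.H10.grad (u t) x) (gradient q x)) := by
  obtain ⟨H, U, R, hD⟩ := PhaseFieldFVM.exists_dataBounds (b := b) (β := β) hΩ hξ hΛ_range
    huIni.continuousOn hpIni.continuousOn
  have hcont : ∀ n, (∀ K, ContinuousOn (fun t => uM n t K) (Ioo 0 T)) ∧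
      ∀ K, ContinuousOn (fun t => pM n t K) (Ioo 0 T) := fun n =>
    ⟨fun K => ((hsol n).continuousOn_u K).mono Ioo_subset_Ico_self,
      fun K => ((hsol n).continuousOn_p K).mono Ioo_subset_Ico_self⟩
  have hu := fun n => (hsol n).integrable_form hD hT hL hα hβ hb hξ (hsol n).continuousOn_u
    PhaseFieldFVM.IsSchemeSolution.form_u_le
  have hp := fun n => (hsol n).integrable_form hD hT hL hα hβ hb hξ (hsol n).continuousOn_p
    PhaseFieldFVM.IsSchemeSolution.form_p_le
  set E := PhaseFieldFVM.IsSchemeSolution.energyBound Ω T L α β b ξ H U R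
  set N := R ^ 2 * volume.real Ω
  obtain ⟨k₁, hk₁, v, hv, hvq⟩ := PhaseFieldFVM.exists_subseq_tendstoL2 hΩ hT M hM uM
    (fun n => (hcont n).1) (C := max (4 * E + 2 * L ^ 2 * N) (2 * E))
    (fun n t ht => ((hsol n).normSq_u_le hD hL hα hβ hb hξ ⟨ht.1.le, ht.2⟩).trans
      (le_max_left _ _)) (fun n => (hu n).1) (fun n => (hu n).2.trans (le_max_right _ _))
    (fun q hq ε hε => PhaseFieldFVM.equicontinuous_u hΩ hsol hD hL hα hβ hb hξ hq hε)
  -- The second extraction takes place along the first subsequence, so that the convergence already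
  -- obtained for `u` is inherited.
  obtain ⟨k₂, hk₂, w, hw, hwq⟩ := PhaseFieldFVM.exists_subseq_tendstoL2 hΩ hT (fun n => M (k₁ n))
    (hM.comp_strictMono hk₁) (fun n => pM (k₁ n))
    (fun n => (hcont (k₁ n)).2) (C := max N (2 * E))
    (fun n t ht => ((hsol (k₁ n)).normSq_p_le hD hα hβ hb hξ ⟨ht.1.le, ht.2⟩).trans
      (le_max_left _ _)) (fun n => (hp (k₁ n)).1)
    (fun n => (hp (k₁ n)).2.trans (le_max_right _ _))
    (fun q hq ε hε => PhaseFieldFVM.equicontinuous_p hΩ (fun n => hsol (k₁ n)) hD hL hα hβ hb hξ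
      hq hε)
  exact ⟨fun n => k₁ (k₂ n), hk₁.comp hk₂, v, w, hw, hv.comp_strictMono hk₂,
    fun q hq => ⟨hwq q hq, (hvq q hq).comp_strictMono hk₂⟩⟩
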